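/- Let $\mathbb F\in\{\mathbb R,\mathbb C\}$. A \emph{representation} of a Banach algebra $A$ in a Banach algebra $B$ is a contractive algebra homomorphism $A\to B$; approximate units are contractive. $B'$ is the dual space of $B$, and $B''$ carries the second Arens product (weak$^*$ continuous in the second variable); $B\subseteq B''$. \textbf{Twisted actions.} Let $S$ be an inverse semigroup with idempotents $E(S)$ and natural order $\le$, $X$ a locally compact Hausdorff space, and $(\alpha,u)$ a twisted action of $S$ on $C_0(X)$. Explicitly: $\alpha_t(a)=a\circ h_t^{-1}$, $\alpha_t:I_{t^*}=C_0(X_{t^*})\to I_t=C_0(X_t)$, for partial homeomorphisms $h_t:X_{t^*}\to X_t$ between open subsets of $X$ with $h_s\circ h_t=h_{st}$ and $\bigcup_t X_t=X$, and $u(s,t)$ are continuous unitary ($|u(s,t)|=1$) functions on $X_{st}$ with $\alpha_r(au(s,t))u(r,st)=\alpha_r(a)u(r,s)u(rs,t)$ for $a\in I_{r^*}\cap I_{st}$; $u(e,f)=1$, $u(t,t^*t)=u(tt^*,t)=1$; $u(t^*,e)u(t^*e,t)=u(t^*,t)$ on $X_{t^*et}$, for $r,s,t\in S$, $e,f\in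 E(S)$. Assume that every compact subset of $X$ is contained in $X_e$ for some $e\in E(S)$ (for instance, that $S$ has a unit $1$ with $X_1=X$). \textbf{The twisted groupoid.} Let $(\mathcal G,\mathcal L)$ be a twisted étale groupoid modeled by $(\alpha,u)$: $\mathcal G$ is an étale groupoid, not necessarily Hausdorff, with locally compact Hausdorff unit space, $\mathcal L$ is a Fell line bundle over $\mathcal G$, and $(\mathcal G,\mathcal L)$ is isomorphic to the following twisted groupoid. The groupoid is the transformation groupoid of germs $[t,x]$, $x\in X_{t^*}$, of $h$ (where $[t,x]=[t',x]$ iff $x\in X_{v^*}$ for some $v\le t,t'$). The bundle consists of the classes $[a,t,x]$, $a\in C_0(X_t)$, $x\in X_{t^*}$, where $[a,t,x]=[a',t',x]$ iff there is $v\le t,t'$ with $x\in X_{v^*}$ and $(a\,u(vv^*,t))(h_v(x))=(a'u(vv^*,t'))(h_v(x))$, with the topology for which the sections $[t,x]\mapsto[a,t,x]$ are continuous, $|[a,t,x]|=|a(h_t(x))|$, $[a,s,h_t(x)]\cdot[b,t,x]=[\alpha_s(\alpha_s^{-1}(a)b)u(s,t),st,x]$ and $[b,t,x]^*=[\overline{(b\,u(t,t^*))\circ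 h_t},t^*,h_t(x)]$. Put $U_t=\{[t,x]:x\in X_{t^*}\}$, and for $a\in C_c(X_t)$ let $a\delta_t\in C_c(U_t,\mathcal L)$ be the section $a\delta_t[t,x]=[a,t,x]$. Let $\mathfrak C_c(\mathcal G,\mathcal L)$ be the span of the spaces $C_c(U,\mathcal L)$ over all open bisections $U$ (sections extended by $0$), with convolution. $F^S(\mathcal G,\mathcal L)$ is its completion in the norm $\inf\{\sum_k\|f_k\|_\infty: f=\sum_k f_k\text{ a finite sum},\ f_k\in C_c(U_{t_k},\mathcal L),\ t_k\in S\}$. \textbf{Covariant representations.} A covariant representation of $(\alpha,u)$ in a Banach algebra $B$ is a pair $(\pi,v)$ of a representation $\pi:C_0(X)\to B$ and a map $v$ from $S$ to the closed unit ball of $B''$ with $v_t\pi(a)=\pi(\alpha_t(a))v_t\in B$ for $a\in I_{t^*}$, $\pi(a)v_sv_t=\pi(au(s,t))v_{st}$ for $a\in I_{st}$, and $\pi(a)v_e=\pi(a)$ for $a\in I_e$, $e\in E(S)$. It is $B'$-normalized if for every $t$ there is an approximate unit $(\mu_i)$ of $I_t$ with $\pi(\mu_i)v_t\to v_t$ in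 the $B'$-topology; if $B$ is the dual of a Banach space $B_*$, it is $B_*$-normalized if for every $t$ we have $v_t\in B$ and $\pi(\mu_i)v_t\to v_t$ in the $B_*$-topology for an approximate unit $(\mu_i)$ of $I_t$. $(B,B_*)$ is a dual Banach algebra if multiplication in $B=(B_*)'$ is separately $B_*$-continuous. A covariant representation of $(\alpha,u)$ on a Banach space $E$ is a pair $(\pi,v)$ of a representation $\pi:C_0(X)\to B(E)$ and a map $v$ from $S$ to the contractions in $B(E)$ such that every $v_t$ has a contractive generalised inverse $v_t^*$ with $v_t\pi(a)v_t^*=\pi(\alpha_t(a))$ for $a\in I_{t^*}$; the ranges of $v_t$ and $v_t^*$ are $\overline{\pi(I_t)E}$ and $\overline{\pi(I_{t^*})E}$; $v_sv_t=\overline\pi_{st}(u(s,t))v_{st}$, where $\overline\pi_{st}(u(s,t))$ is the bounded operator on $\overline{\pi(I_{st})E}$ with $\pi(a)x\mapsto\pi(au(s,t))x$; and $\pi(a)v_e=\pi(a)$ for $a\in I_e$, $e\in E(S)$. \textbf{Theorem.} For every covariant representation $(\pi,v)$ in a Banach algebra $B$ there is a unique representation $\pi\rtimes v:F^S(\mathcal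 G,\mathcal L)\to B$ with $\pi\rtimes v(a\delta_t)=\pi(a)v_t$ for $a\in C_c(X_t)$, $t\in S$, and every covariant representation on a Banach space $E$ is a covariant representation in $B(E)$. The map $(\pi,v)\mapsto\pi\rtimes v$ is a bijection onto the set of all representations of $F^S(\mathcal G,\mathcal L)$ in $B$ from each of the following sets: (1) the $B'$-normalized covariant representations in $B$; (2) the $B_*$-normalized covariant representations in $B$, if $(B,B_*)$ is a dual Banach algebra; (3) the covariant representations on $E$, if $B=B(E)$ and $E$ is a reflexive Banach space. If every $X_t$, $t\in S$, is compact, then the pairs in (1), in (2), and (for every Banach space $E$ and $B=B(E)$) the covariant representations on $E$ are exactly the covariant representations $(\pi,v)$ in $B$ with $v_t=\pi(1_{X_t})v_t\in B$ for all $t\in S$. \textbf{Corollary.} For a class $\mathcal R$ of covariant representations let $C_0(X)\rtimes_{(\alpha,u),\mathcal R}S$ be the Hausdorff completion of the Banach algebra $\ell^1(\alpha,u)=\{f\in\ell^1(S,C_0(X)):f(t)\in I_t\}$, with $(f*g)(r)=\sum_{st=r}\alpha_s(\alpha_s^{-1}(f(s))g(t))u(s,t)$, in the seminorm $\sup\{\|\sum_t\pi(f(t))v_t\|:(\pi,v)\in\mathcal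 R\}$; write $C_0(X)\rtimes_{(\alpha,u)}S$ if $\mathcal R$ consists of all covariant representations in Banach algebras. Then $a\delta_t\mapsto a\delta_t$, $a\in C_c(X_t)$, extends to an isometric isomorphism $F^S(\mathcal G,\mathcal L)\cong C_0(X)\rtimes_{(\alpha,u)}S$. For a class $\mathcal E$ of Banach spaces let $\mathcal E_{\rm alg}$ and $\mathcal E_{\rm spa}$ be the classes of all covariant representations in $B(E)$ and on $E$, respectively, for $E\in\mathcal E$, and let $F^S_{\mathcal E}(\mathcal G,\mathcal L)$ be the Hausdorff completion of $\mathfrak C_c(\mathcal G,\mathcal L)$ in the seminorm $\sup\|\psi(f)\|$ over all representations $\psi$ of $F^S(\mathcal G,\mathcal L)$ on spaces $E\in\mathcal E$. Then $a\delta_t\mapsto a\delta_t$ extends to an isometric isomorphism $F^S_{\mathcal E}(\mathcal G,\mathcal L)\cong C_0(X)\rtimes_{(\alpha,u),\mathcal E_{\rm alg}}S$, and the identity of $\ell^1(\alpha,u)$ extends to a representation of $C_0(X)\rtimes_{(\alpha,u),\mathcal E_{\rm alg}}S$ in $C_0(X)\rtimes_{(\alpha,u),\mathcal E_{\rm spa}}S$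 with dense range, which is isometric if all $E\in\mathcal E$ are reflexive or if all $X_t$ are compact. -/

import Mathlib

noncomputable section

namespace TwistedGroupoid

open Topology
open scoped ZeroAtInfty

/-! ### Extension of ring laws from a dense subalgebra -/

section Dense

variable {A C : Type*} [NonUnitalRing A] [NormedAddCommGroup C] [Mul C] [ContinuousMul C]

/-- If the image of an additive and multiplicative map `j` is dense and the norm is submultiplicative
on it, then all laws of a normed ring extend by continuity. -/
@[reducible]
def normedRingOfDense (j : A →+ C) (hd : DenseRange j) (hm : ∀ a b, j (a * b) = j a * j b)
    (hn : ∀ a b, ‖j a * j b‖ ≤ ‖j a‖ * ‖j b‖) : NonUnitalNormedRing C :=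
  { (inferInstance : NormedAddCommGroup C), (inferInstance : Mul C) with
    zero_mul := fun x => hd.induction_on x (isClosed_eq (by fun_prop) (by fun_prop)) fun a => by
      rw [← map_zero j, ← hm, zero_mul]
    mul_zero := fun x => hd.induction_on x (isClosed_eq (by fun_prop) (by fun_prop)) fun a => by
      rw [← map_zero j, ← hm, mul_zero]
    mul_assoc := fun x y z => hd.induction_on₃ (p := fun x y z => x * y * z = x * (y * z))
      (isClosed_eq (by fun_prop) (by fun_prop)) (fun a b c => by simp only [← hm, mul_assoc]) x y z
    left_distrib := fun x y z => hd.induction_on₃ (p := fun x y z => x * (y + z) = x * y + x * z)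
      (isClosed_eq (by fun_prop) (by fun_prop))
      (fun a b c => by simp only [← hm, ← map_add, mul_add]) x y z
    right_distrib := fun x y z => hd.induction_on₃ (p := fun x y z => (x + y) * z = x * z + y * z)
      (isClosed_eq (by fun_prop) (by fun_prop))
      (fun a b c => by simp only [← hm, ← map_add, add_mul]) x y z
    norm_mul_le := fun x y => hd.induction_on₂ (p := fun x y => ‖x * y‖ ≤ ‖x‖ * ‖y‖)
      (isClosed_le (by fun_prop) (by fun_prop)) hn x y }

variable {𝕜 : Type*} [RCLike 𝕜] [Module 𝕜 A] [NormedSpace 𝕜 C]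

theorem smul_mul_of_dense [IsScalarTower 𝕜 A A] (j : A →ₗ[𝕜] C) (hd : DenseRange j)
    (hm : ∀ a b, j (a * b) = j a * j b) (c : 𝕜) (x y : C) : c • x * y = c • (x * y) :=
  hd.induction_on₂ (p := fun x y => c • x * y = c • (x * y))
    (isClosed_eq (by fun_prop) (by fun_prop))
    (fun a b => by simp only [← hm, ← map_smul, smul_mul_assoc]) x y

theorem mul_smul_of_dense [SMulCommClass 𝕜 A A] (j : A →ₗ[𝕜] C) (hd : DenseRange j)
    (hm : ∀ a b, j (a * b) = j a * j b) (c : 𝕜) (x y : C) : x * (c • y) = c • (x * y) :=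
  hd.induction_on₂ (p := fun x y => x * (c • y) = c • (x * y))
    (isClosed_eq (by fun_prop) (by fun_prop))
    (fun a b => by simp only [← hm, ← map_smul, mul_smul_comm]) x y

end Dense

/-! ### Hausdorff completions of algebras in submultiplicative seminorms -/

section Completion

variable {𝕜 : Type*} [RCLike 𝕜] {A : Type*} [NonUnitalRing A] [Module 𝕜 A]

/-- A submultiplicative seminorm on a (non-unital) algebra. -/
structure AlgSeminorm (𝕜 : Type*) [RCLike 𝕜] (A : Type*) [NonUnitalRing A] [Module 𝕜 A]
    extends Seminorm 𝕜 A where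
  mul_le' : ∀ x y, toFun (x * y) ≤ toFun x * toFun y

/-- The algebra `A`, regarded as a seminormed algebra with the seminorm `p`. -/
def AlgSeminorm.Space (_ : AlgSeminorm 𝕜 A) : Type _ := A

variable (p : AlgSeminorm 𝕜 A)

instance : NonUnitalRing p.Space := inferInstanceAs (NonUnitalRing A)
instance : Module 𝕜 p.Space := inferInstanceAs (Module 𝕜 A)
instance [IsScalarTower 𝕜 A A] : IsScalarTower 𝕜 p.Space p.Space :=
  inferInstanceAs (IsScalarTower 𝕜 A A)
instance [SMulCommClass 𝕜 A A] : SMulCommClass 𝕜 p.Space p.Space :=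
  inferInstanceAs (SMulCommClass 𝕜 A A)

instance : SeminormedAddCommGroup p.Space :=
  { p.toSeminorm.toAddGroupSeminorm.toSeminormedAddCommGroup with
    toAddCommGroup := (inferInstance : NonUnitalRing p.Space).toAddCommGroup }

theorem AlgSeminorm.norm_def (x : p.Space) : ‖x‖ = p.toSeminorm x := rfl

instance : NonUnitalSeminormedRing p.Space :=
  { (inferInstance : SeminormedAddCommGroup p.Space), (inferInstance : NonUnitalRing p.Space) with
    norm_mul_le := p.mul_le' }

instance : NormedSpace 𝕜 p.Space where
  norm_smul_le c x := le_of_eq (p.toSeminorm.smul' c x)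

/-- The Hausdorff completion of the algebra `A` in the submultiplicative seminorm `p`. -/
def AlgSeminorm.Compl : Type _ := UniformSpace.Completion p.Space

instance : NormedAddCommGroup p.Compl :=
  inferInstanceAs (NormedAddCommGroup (UniformSpace.Completion p.Space))
instance : NormedSpace 𝕜 p.Compl :=
  inferInstanceAs (NormedSpace 𝕜 (UniformSpace.Completion p.Space))
instance : CompleteSpace p.Compl :=
  inferInstanceAs (CompleteSpace (UniformSpace.Completion p.Space))

/-- The canonical linear map into the Hausdorff completion. -/
def AlgSeminorm.toCompl : A →ₗ[𝕜] p.Compl where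
  toFun a := ((show p.Space from a) : UniformSpace.Completion p.Space)
  map_add' a b := UniformSpace.Completion.coe_add (α := p.Space) a b
  map_smul' c a := UniformSpace.Completion.coe_smul (X := p.Space) c a

theorem AlgSeminorm.norm_toCompl (a : A) : ‖p.toCompl a‖ = p.toSeminorm a :=
  UniformSpace.Completion.norm_coe (E := p.Space) a

theorem AlgSeminorm.isDenseInducing_toCompl :
    IsDenseInducing (fun a : p.Space => (p.toCompl a : p.Compl)) :=
  UniformSpace.Completion.isDenseInducing_coe (α := p.Space)

/-- The multiplication of the completion: the continuous extension of that of `A`. -/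
instance : Mul p.Compl :=
  ⟨Function.curry <| (p.isDenseInducing_toCompl.prodMap p.isDenseInducing_toCompl).extend
    (fun q : p.Space × p.Space => p.toCompl (q.1 * q.2 : p.Space))⟩

theorem AlgSeminorm.continuous_toCompl : Continuous (fun a : p.Space => (p.toCompl a : p.Compl)) :=
  p.isDenseInducing_toCompl.continuous

theorem AlgSeminorm.toCompl_mul (a b : A) : p.toCompl (a * b) = p.toCompl a * p.toCompl b :=
  ((p.isDenseInducing_toCompl.prodMap p.isDenseInducing_toCompl).extend_eq
      (p.continuous_toCompl.comp (continuous_mul (M := p.Space))) (a, b)).symm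

instance : ContinuousMul p.Compl where
  continuous_mul := by
    let c : p.Space →+ p.Compl := p.toCompl.toAddMonoidHom
    let m := (AddMonoidHom.mul : p.Space →+ p.Space →+ p.Space).compr₂ c
    have : Continuous fun q : p.Space × p.Space => m q.1 q.2 :=
      p.continuous_toCompl.comp continuous_mul
    have di : IsDenseInducing (c : p.Space → p.Compl) := p.isDenseInducing_toCompl
    exact (di.extend_Z_bilin di this :)

theorem AlgSeminorm.denseRange_toCompl : DenseRange p.toCompl :=
  p.isDenseInducing_toCompl.dense

instance : NonUnitalNormedRing p.Compl :=
  normedRingOfDense p.toCompl.toAddMonoidHom p.denseRange_toCompl p.toCompl_mul fun a b => by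
    change ‖p.toCompl a * p.toCompl b‖ ≤ ‖p.toCompl a‖ * ‖p.toCompl b‖
    rw [← p.toCompl_mul, p.norm_toCompl, p.norm_toCompl, p.norm_toCompl]
    exact p.mul_le' a b

instance [IsScalarTower 𝕜 A A] : IsScalarTower 𝕜 p.Compl p.Compl where
  smul_assoc := smul_mul_of_dense p.toCompl p.denseRange_toCompl p.toCompl_mul

instance [SMulCommClass 𝕜 A A] : SMulCommClass 𝕜 p.Compl p.Compl where
  smul_comm c x y := (mul_smul_of_dense p.toCompl p.denseRange_toCompl p.toCompl_mul c x y).symm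

end Completion

/-! ### Representations of Banach algebras, biduals, dual Banach algebras -/

section Representations

/-- A representation of `A` in `B`: a contractive algebra homomorphism. -/
@[ext]
structure BanachRep (𝕜 : Type*) [RCLike 𝕜] (A B : Type*) [NonUnitalNormedRing A] [NormedSpace 𝕜 A]
    [NonUnitalNormedRing B] [NormedSpace 𝕜 B] where
  toHom : A →ₙₐ[𝕜] B
  contractive : ∀ a, ‖toHom a‖ ≤ ‖a‖

instance {𝕜 : Type*} [RCLike 𝕜] {A B : Type*} [NonUnitalNormedRing A] [NormedSpace 𝕜 A]
    [NonUnitalNormedRing B] [NormedSpace 𝕜 B] : CoeFun (BanachRep 𝕜 A B) (fun _ => A → B) :=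
  ⟨fun π => π.toHom⟩

/-- A Banach algebra (not necessarily unital). -/
structure BanachAlg (𝕜 : Type*) [RCLike 𝕜] where
  carrier : Type*
  [ring : NonUnitalNormedRing carrier]
  [space : NormedSpace 𝕜 carrier]
  [tower : IsScalarTower 𝕜 carrier carrier]
  [comm : SMulCommClass 𝕜 carrier carrier]
  [complete : CompleteSpace carrier]

attribute [instance] BanachAlg.ring BanachAlg.space BanachAlg.tower BanachAlg.comm
  BanachAlg.complete

/-- A Banach space. -/
structure BanachSp (𝕜 : Type*) [RCLike 𝕜] where
  carrier : Type*
  [group : NormedAddCommGroup carrier]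
  [space : NormedSpace 𝕜 carrier]
  [complete : CompleteSpace carrier]

attribute [instance] BanachSp.group BanachSp.space BanachSp.complete

/-- The Banach algebra `B(E)` of bounded operators on `E`. -/
def BanachSp.operators {𝕜 : Type*} [RCLike 𝕜] (E : BanachSp 𝕜) : BanachAlg 𝕜 where
  carrier := E.carrier →L[𝕜] E.carrier

/-- A Banach space is reflexive if it is mapped onto its double dual. -/
def IsReflexive (𝕜 : Type*) [RCLike 𝕜] (E : Type*) [NormedAddCommGroup E] [NormedSpace 𝕜 E] :
    Prop :=
  Function.Surjective (NormedSpace.inclusionInDoubleDual 𝕜 E)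

variable (𝕜 : Type*) [RCLike 𝕜] (B : Type*) [NonUnitalNormedRing B] [NormedSpace 𝕜 B]

/-- The double dual `B''` of `B`. -/
def Bidual : Type _ := StrongDual 𝕜 (StrongDual 𝕜 B)

instance : NormedAddCommGroup (Bidual 𝕜 B) :=
  inferInstanceAs (NormedAddCommGroup (StrongDual 𝕜 (StrongDual 𝕜 B)))
instance : NormedSpace 𝕜 (Bidual 𝕜 B) :=
  inferInstanceAs (NormedSpace 𝕜 (StrongDual 𝕜 (StrongDual 𝕜 B)))
instance : CompleteSpace (Bidual 𝕜 B) :=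
  inferInstanceAs (CompleteSpace (StrongDual 𝕜 (StrongDual 𝕜 B)))

variable {𝕜 B}

/-- The functional on `B'` that is an element of `B''`. -/
def Bidual.fn (a : Bidual 𝕜 B) : StrongDual 𝕜 (StrongDual 𝕜 B) := a

theorem Bidual.ext {a b : Bidual 𝕜 B} (h : ∀ f, a.fn f = b.fn f) : a = b :=
  ContinuousLinearMap.ext h

variable (𝕜) in
/-- The canonical isometric embedding of `B` into `B''`. -/
def toBidual : B →ₗ[𝕜] Bidual 𝕜 B := (NormedSpace.inclusionInDoubleDual 𝕜 B).toLinearMap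

theorem norm_toBidual_le (b : B) : ‖toBidual 𝕜 b‖ ≤ ‖b‖ := NormedSpace.double_dual_bound 𝕜 B b

variable [IsScalarTower 𝕜 B B] [SMulCommClass 𝕜 B B]

variable (𝕜 B) in
/-- `f ↦ c ↦ (x ↦ f (x c))`. -/
def translate : StrongDual 𝕜 B →L[𝕜] B →L[𝕜] StrongDual 𝕜 B :=
  ((ContinuousLinearMap.compL 𝕜 B (B →L[𝕜] B) (StrongDual 𝕜 B)).flip
    (ContinuousLinearMap.mul 𝕜 B).flip).comp (ContinuousLinearMap.compL 𝕜 B B 𝕜)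

/-- The second Arens product on `B''`, given by `(a ⬝ b)(f) = b (c ↦ a (x ↦ f (x c)))`. It is
weak-* continuous in the second variable, and in the first one if the second one is in `B`; hence
`a ⬝ b = lim_β lim_α a_α b_β` for all nets in `B` with weak-* limits `a` and `b`. -/
def arens (a b : Bidual 𝕜 B) : Bidual 𝕜 B :=
  b.fn.comp ((ContinuousLinearMap.compL 𝕜 B (StrongDual 𝕜 B) 𝕜 a.fn).comp (translate 𝕜 B))

theorem translate_apply (f : StrongDual 𝕜 B) (c x : B) : translate 𝕜 B f c x = f (x * c) := rfl

theorem arens_apply (a b : Bidual 𝕜 B) (f : StrongDual 𝕜 B) :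
    (arens a b).fn f = b.fn (a.fn.comp (translate 𝕜 B f)) := rfl

theorem arens_assoc (a b c : Bidual 𝕜 B) : arens (arens a b) c = arens a (arens b c) := by
  have key : ∀ (f : StrongDual 𝕜 B) (x y : B), translate 𝕜 B (translate 𝕜 B f x) y =
      translate 𝕜 B f (y * x) := fun f x y => by
    ext z; simp only [translate_apply, mul_assoc]
  refine Bidual.ext fun f => ?_
  refine congrArg c.fn
    (ContinuousLinearMap.ext fun x => congrArg b.fn (ContinuousLinearMap.ext fun y => ?_))
  exact congrArg a.fn (key f x y)

theorem arens_toBidual (a b : B) : arens (toBidual 𝕜 a) (toBidual 𝕜 b) = toBidual 𝕜 (a * b) := rfl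

theorem norm_arens_le (a b : Bidual 𝕜 B) : ‖arens a b‖ ≤ ‖a‖ * ‖b‖ := by
  have h1 : ∀ (f : StrongDual 𝕜 B) (c : B), ‖translate 𝕜 B f c‖ ≤ ‖f‖ * ‖c‖ := fun f c =>
    ContinuousLinearMap.opNorm_le_bound _ (by positivity) fun x => by
      rw [translate_apply]
      calc ‖f (x * c)‖ ≤ ‖f‖ * ‖x * c‖ := f.le_opNorm _
        _ ≤ ‖f‖ * (‖x‖ * ‖c‖) := by gcongr; exact norm_mul_le _ _
        _ = ‖f‖ * ‖c‖ * ‖x‖ := by ring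
  have h3 : ‖(arens a b).fn‖ ≤ ‖a.fn‖ * ‖b.fn‖ := by
    refine ContinuousLinearMap.opNorm_le_bound _ (by positivity) fun f => ?_
    have h2 : ‖a.fn.comp (translate 𝕜 B f)‖ ≤ ‖a.fn‖ * ‖f‖ :=
      ContinuousLinearMap.opNorm_le_bound _ (by positivity) fun c => by
        calc ‖a.fn (translate 𝕜 B f c)‖ ≤ ‖a.fn‖ * ‖translate 𝕜 B f c‖ := a.fn.le_opNorm _
          _ ≤ ‖a.fn‖ * (‖f‖ * ‖c‖) := by gcongr; exact h1 f c
          _ = ‖a.fn‖ * ‖f‖ * ‖c‖ := by ring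
    calc ‖(arens a b).fn f‖ = ‖b.fn (a.fn.comp (translate 𝕜 B f))‖ := rfl
      _ ≤ ‖b.fn‖ * ‖a.fn.comp (translate 𝕜 B f)‖ := b.fn.le_opNorm _
      _ ≤ ‖b.fn‖ * (‖a.fn‖ * ‖f‖) := by gcongr
      _ = ‖a.fn‖ * ‖b.fn‖ * ‖f‖ := by ring
  exact h3

theorem arens_add_left (a a' b : Bidual 𝕜 B) : arens (a + a') b = arens a b + arens a' b := by
  refine Bidual.ext fun f => ?_
  have h : (a + a').fn.comp (translate 𝕜 B f)
      = a.fn.comp (translate 𝕜 B f) + a'.fn.comp (translate 𝕜 B f) := rfl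
  rw [arens_apply, h, map_add]; rfl

theorem arens_smul_left (c : 𝕜) (a b : Bidual 𝕜 B) : arens (c • a) b = c • arens a b := by
  refine Bidual.ext fun f => ?_
  have h : (c • a).fn.comp (translate 𝕜 B f) = c • a.fn.comp (translate 𝕜 B f) := rfl
  rw [arens_apply, h, map_smul]; rfl

/-- Multiplication by a fixed element from the right. -/
def arensRight (b : Bidual 𝕜 B) : Bidual 𝕜 B →+ Bidual 𝕜 B :=
  AddMonoidHom.mk' (fun a => arens a b) fun a a' => arens_add_left a a' b

theorem continuous_arensRight (b : Bidual 𝕜 B) : Continuous (arensRight b) :=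
  AddMonoidHomClass.continuous_of_bound (arensRight b) ‖b‖ fun a => by
    rw [mul_comm]; exact norm_arens_le a b

/-- Multiplication by a fixed element from the left. -/
def arensLeft (a : Bidual 𝕜 B) : Bidual 𝕜 B →+ Bidual 𝕜 B :=
  AddMonoidHom.mk' (fun b => arens a b) fun _ _ => rfl

theorem continuous_arensLeft (a : Bidual 𝕜 B) : Continuous (arensLeft a) :=
  AddMonoidHomClass.continuous_of_bound (arensLeft a) ‖a‖ fun b => norm_arens_le a b

/-- `(B, P)` is a dual Banach algebra: `e` identifies `B` isometrically with the dual of the Banach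
space `P`, and the multiplication of `B` is separately weak-* continuous. -/
def IsDualBanachAlgebra {P : Type*} [NormedAddCommGroup P] [NormedSpace 𝕜 P]
    (e : StrongDual 𝕜 P ≃ₗᵢ[𝕜] B) : Prop :=
  ∀ b : B,
    Continuous (fun φ : WeakDual 𝕜 P =>
      StrongDual.toWeakDual (e.symm (b * e (WeakDual.toStrongDual φ)))) ∧
    Continuous (fun φ : WeakDual 𝕜 P =>
      StrongDual.toWeakDual (e.symm (e (WeakDual.toStrongDual φ) * b)))

end Representations

/-! ### Inverse semigroups -/

/-- An inverse semigroup: every `t` has a unique generalised inverse `t⁻¹`. -/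
class InverseSemigroup (S : Type*) extends Semigroup S, Inv S where
  mul_inv_mul : ∀ t : S, t * t⁻¹ * t = t
  inv_mul_inv : ∀ t : S, t⁻¹ * t * t⁻¹ = t⁻¹
  inv_unique : ∀ t s : S, t * s * t = t → s * t * s = s → s = t⁻¹

/-- The natural order: `s ≤ t` iff `s = t s⁻¹ s`. -/
def InverseSemigroup.LE {S : Type*} [InverseSemigroup S] (s t : S) : Prop := s = t * (s⁻¹ * s)

/-! ### `ℓ¹`-algebras of families of Banach spaces graded by a semigroup -/

section GradedL1

variable {𝕜 S M : Type*} [RCLike 𝕜] [Semigroup S] [NormedAddCommGroup M] [NormedSpace 𝕜 M]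

/-- A contractive and associative multiplication `V s × V t → V (s t)` on a family of subspaces of
a normed space. -/
structure GradedMul (V : S → Submodule 𝕜 M) where
  m : ∀ s t, V s →ₗ[𝕜] V t →ₗ[𝕜] V (s * t)
  norm_le : ∀ s t a b, ‖m s t a b‖ ≤ ‖a‖ * ‖b‖
  assoc : ∀ r s t a b c, (m (r * s) t (m r s a b) c : M) = m r (s * t) a (m s t b c)

variable {V : S → Submodule 𝕜 M}

/-- The space of absolutely summable families `f` with `f t ∈ V t`, with the multiplication
`(f * g)(r) = ∑_{s t = r} f(s) g(t)`. -/
def GradedMul.L1 (_ : GradedMul V) : Type _ := lp (fun t : S => V t) 1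

variable (μ : GradedMul V)

instance : NormedAddCommGroup μ.L1 := inferInstanceAs (NormedAddCommGroup (lp (fun t : S => V t) 1))
instance : NormedSpace 𝕜 μ.L1 := inferInstanceAs (NormedSpace 𝕜 (lp (fun t : S => V t) 1))

/-- The value of an element of `L1` at `t`. -/
def GradedMul.coeff (f : μ.L1) (t : S) : V t := (show lp (fun t : S => V t) 1 from f) t

open Classical in
/-- The element `a δ_t` of `L1`. -/
def GradedMul.single (t : S) : V t →ₗ[𝕜] μ.L1 := lp.lsingle (E := fun t : S => V t) 1 t

open Classical in
theorem GradedMul.norm_single (t : S) (a : V t) : ‖μ.single t a‖ = ‖a‖ :=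
  lp.norm_single (E := fun t : S => V t) one_pos t a

theorem GradedMul.single_congr {s t : S} (h : s = t) (a : V s) (b : V t) (hab : (a : M) = b) :
    μ.single s a = μ.single t b := by
  subst h; congr 1; exact Subtype.ext hab

theorem GradedMul.coeff_add (f g : μ.L1) (t : S) : μ.coeff (f + g) t = μ.coeff f t + μ.coeff g t :=
  rfl

theorem GradedMul.coeff_smul (c : 𝕜) (f : μ.L1) (t : S) : μ.coeff (c • f) t = c • μ.coeff f t := rfl

open Classical in
theorem GradedMul.coeff_single_self (t : S) (a : V t) : μ.coeff (μ.single t a) t = a :=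
  lp.single_apply_self (E := fun t : S => V t) 1 t a

open Classical in
theorem GradedMul.coeff_single_ne {s t : S} (h : s ≠ t) (a : V t) :
    μ.coeff (μ.single t a) s = 0 :=
  lp.single_apply_ne (E := fun t : S => V t) 1 t a h

theorem GradedMul.hasSum_norm (f : μ.L1) : HasSum (fun t => ‖μ.coeff f t‖) ‖f‖ := by
  have := lp.hasSum_norm (E := fun t : S => V t) (p := 1) (by simp) f
  simp only [ENNReal.toReal_one, Real.rpow_one] at this
  exact this

open Classical in
theorem GradedMul.hasSum_single (f : μ.L1) : HasSum (fun t => μ.single t (μ.coeff f t)) f :=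
  lp.hasSum_single (E := fun t : S => V t) (p := 1) (by simp) f

/-- Two continuous additive maps on `L1` that agree on all `a δ_t` are equal. -/
theorem GradedMul.hom_ext {F : Type*} [AddCommMonoid F] [TopologicalSpace F] [T2Space F]
    {φ ψ : μ.L1 →+ F} (hφ : Continuous φ) (hψ : Continuous ψ)
    (h : ∀ t a, φ (μ.single t a) = ψ (μ.single t a)) (f : μ.L1) : φ f = ψ f := by
  have h1 := (μ.hasSum_single f).map φ hφ
  have h2 := (μ.hasSum_single f).map ψ hψ
  refine h1.unique ?_
  convert h2 using 1
  funext t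
  exact h t _

/-- The term `f(s) g(t) δ_{s t}`. -/
def GradedMul.term (f g : μ.L1) (q : S × S) : μ.L1 :=
  μ.single (q.1 * q.2) (μ.m q.1 q.2 (μ.coeff f q.1) (μ.coeff g q.2))

theorem GradedMul.norm_term_le (f g : μ.L1) (q : S × S) :
    ‖μ.term f g q‖ ≤ ‖μ.coeff f q.1‖ * ‖μ.coeff g q.2‖ := by
  rw [GradedMul.term, μ.norm_single]; exact μ.norm_le _ _ _ _

theorem GradedMul.hasSum_norm_mul (f g : μ.L1) :
    HasSum (fun q : S × S => ‖μ.coeff f q.1‖ * ‖μ.coeff g q.2‖) (‖f‖ * ‖g‖) := by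
  have hf := μ.hasSum_norm f
  have hg := μ.hasSum_norm g
  generalize ‖f‖ = x at *
  generalize ‖g‖ = y at *
  generalize hF : (fun t => ‖μ.coeff f t‖) = F at *
  generalize hG : (fun t => ‖μ.coeff g t‖) = G at *
  have hF0 : 0 ≤ F := fun t => hF ▸ norm_nonneg _
  have hG0 : 0 ≤ G := fun t => hG ▸ norm_nonneg _
  have := hf.mul hg (hf.summable.mul_of_nonneg hg.summable hF0 hG0)
  subst hF hG
  exact this

/-- The product `f * g = ∑_{s, t} f(s) g(t) δ_{s t}`. -/
instance : Mul μ.L1 := ⟨fun f g => ∑' q : S × S, μ.term f g q⟩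

theorem GradedMul.mul_def (f g : μ.L1) : f * g = ∑' q : S × S, μ.term f g q := rfl

theorem GradedMul.norm_mul_le (f g : μ.L1) : ‖f * g‖ ≤ ‖f‖ * ‖g‖ :=
  tsum_of_norm_bounded (μ.hasSum_norm_mul f g) (μ.norm_term_le f g)

theorem GradedMul.single_mul_single (s t : S) (a : V s) (b : V t) :
    μ.single s a * μ.single t b = μ.single (s * t) (μ.m s t a b) := by
  rw [μ.mul_def, tsum_eq_single (s, t)]
  · simp only [GradedMul.term, μ.coeff_single_self]
  · rintro ⟨s', t'⟩ hq
    by_cases hs : s' = s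
    · have ht : t' ≠ t := fun ht => hq (by rw [hs, ht])
      simp [GradedMul.term, μ.coeff_single_ne ht]
    · simp [GradedMul.term, μ.coeff_single_ne hs]

variable [∀ t, CompleteSpace (V t)]

instance : CompleteSpace μ.L1 := inferInstanceAs (CompleteSpace (lp (fun t : S => V t) 1))

theorem GradedMul.summable_term (f g : μ.L1) : Summable (μ.term f g) :=
  Summable.of_norm_bounded (μ.hasSum_norm_mul f g).summable (μ.norm_term_le f g)

theorem GradedMul.add_mul' (f f' g : μ.L1) : (f + f') * g = f * g + f' * g := by
  rw [μ.mul_def, μ.mul_def, μ.mul_def, ← (μ.summable_term f g).tsum_add (μ.summable_term f' g)]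
  congr 1; funext q
  simp [GradedMul.term, μ.coeff_add]

theorem GradedMul.mul_add' (f g g' : μ.L1) : f * (g + g') = f * g + f * g' := by
  rw [μ.mul_def, μ.mul_def, μ.mul_def, ← (μ.summable_term f g).tsum_add (μ.summable_term f g')]
  congr 1; funext q
  simp [GradedMul.term, μ.coeff_add]

theorem GradedMul.smul_mul' (c : 𝕜) (f g : μ.L1) : (c • f) * g = c • (f * g) := by
  rw [μ.mul_def, μ.mul_def, ← (μ.summable_term f g).tsum_const_smul c]
  congr 1; funext q
  simp [GradedMul.term, μ.coeff_smul]

theorem GradedMul.mul_smul' (c : 𝕜) (f g : μ.L1) : f * (c • g) = c • (f * g) := by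
  rw [μ.mul_def, μ.mul_def, ← (μ.summable_term f g).tsum_const_smul c]
  congr 1; funext q
  simp [GradedMul.term, μ.coeff_smul]

/-- Left multiplication. -/
def GradedMul.mulLeft (f : μ.L1) : μ.L1 →+ μ.L1 := AddMonoidHom.mk' (f * ·) (μ.mul_add' f)

/-- Right multiplication. -/
def GradedMul.mulRight (g : μ.L1) : μ.L1 →+ μ.L1 :=
  AddMonoidHom.mk' (· * g) fun f f' => μ.add_mul' f f' g

theorem GradedMul.continuous_mulLeft (f : μ.L1) : Continuous (μ.mulLeft f) :=
  AddMonoidHomClass.continuous_of_bound (μ.mulLeft f) ‖f‖ fun g => μ.norm_mul_le f g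

theorem GradedMul.continuous_mulRight (g : μ.L1) : Continuous (μ.mulRight g) :=
  AddMonoidHomClass.continuous_of_bound (μ.mulRight g) ‖g‖ fun f => by
    rw [mul_comm]; exact μ.norm_mul_le f g

theorem GradedMul.mul_assoc' (f g k : μ.L1) : f * g * k = f * (g * k) := by
  have h1 : ∀ r s a b (k : μ.L1), μ.single r a * μ.single s b * k
      = μ.single r a * (μ.single s b * k) := fun r s a b k =>
    μ.hom_ext (φ := μ.mulLeft (μ.single r a * μ.single s b))
      (ψ := (μ.mulLeft (μ.single r a)).comp (μ.mulLeft (μ.single s b)))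
      (μ.continuous_mulLeft _) ((μ.continuous_mulLeft _).comp (μ.continuous_mulLeft _))
      (fun t c => by
        change μ.single r a * μ.single s b * μ.single t c
          = μ.single r a * (μ.single s b * μ.single t c)
        simp only [μ.single_mul_single]
        exact μ.single_congr (mul_assoc r s t) _ _ (μ.assoc r s t a b c)) k
  have h2 : ∀ r a (g k : μ.L1), μ.single r a * g * k = μ.single r a * (g * k) := fun r a g k =>
    μ.hom_ext (φ := (μ.mulRight k).comp (μ.mulLeft (μ.single r a)))
      (ψ := (μ.mulLeft (μ.single r a)).comp (μ.mulRight k))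
      ((μ.continuous_mulRight _).comp (μ.continuous_mulLeft _))
      ((μ.continuous_mulLeft _).comp (μ.continuous_mulRight _)) (fun s b => h1 r s a b k) g
  exact μ.hom_ext (φ := (μ.mulRight k).comp (μ.mulRight g)) (ψ := μ.mulRight (g * k))
      ((μ.continuous_mulRight _).comp (μ.continuous_mulRight _))
      (μ.continuous_mulRight _) (fun r a => h2 r a g k) f

instance : NonUnitalNormedRing μ.L1 :=
  { (inferInstance : NormedAddCommGroup μ.L1), (inferInstance : Mul μ.L1) with
    zero_mul := fun g => map_zero (μ.mulRight g)
    mul_zero := fun f => map_zero (μ.mulLeft f)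
    mul_assoc := μ.mul_assoc'
    left_distrib := μ.mul_add'
    right_distrib := μ.add_mul'
    norm_mul_le := μ.norm_mul_le }

instance : IsScalarTower 𝕜 μ.L1 μ.L1 := ⟨μ.smul_mul'⟩
instance : SMulCommClass 𝕜 μ.L1 μ.L1 := ⟨fun c f g => (μ.mul_smul' c f g).symm⟩

end GradedL1

/-! ### Ideals of `C₀(X)` -/

section Ideals

variable {𝕜 X : Type*} [RCLike 𝕜] [TopologicalSpace X]

variable (𝕜) in
/-- The ideal `C₀(U)` of `C₀(X)`: functions that vanish outside `U`. -/
def C0on (U : Set X) : Submodule 𝕜 C₀(X, 𝕜) where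
  carrier := {a | ∀ x, x ∉ U → a x = 0}
  add_mem' ha hb x hx := by simp [ha x hx, hb x hx]
  zero_mem' _ _ := rfl
  smul_mem' c a ha x hx := by simp [ha x hx]

theorem mem_C0on {U : Set X} {a : C₀(X, 𝕜)} : a ∈ C0on 𝕜 U ↔ ∀ x, x ∉ U → a x = 0 := Iff.rfl

theorem norm_apply_le (a : C₀(X, 𝕜)) (x : X) : ‖a x‖ ≤ ‖a‖ := a.toBCF.norm_coe_le_norm x

theorem continuous_eval (x : X) : Continuous (fun a : C₀(X, 𝕜) => a x) :=
  LipschitzWith.continuous (K := 1) <| LipschitzWith.of_dist_le_mul fun a b => by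
    rw [NNReal.coe_one, one_mul, dist_eq_norm, dist_eq_norm]
    exact norm_apply_le (a - b) x

instance (U : Set X) : CompleteSpace (C0on 𝕜 U) := by
  have hc : IsClosed (C0on 𝕜 U : Set C₀(X, 𝕜)) := by
    have : (C0on 𝕜 U : Set C₀(X, 𝕜)) = ⋂ x ∈ Uᶜ, {a : C₀(X, 𝕜) | a x = 0} := by
      ext a; simp [mem_C0on]
    rw [this]
    exact isClosed_biInter fun x _ => isClosed_eq (continuous_eval x) continuous_const
  exact hc.completeSpace_coe

theorem C0_norm_le {a : C₀(X, 𝕜)} {C : ℝ} (hC : 0 ≤ C) (h : ∀ x, ‖a x‖ ≤ C) : ‖a‖ ≤ C :=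
  (BoundedContinuousFunction.norm_le (f := a.toBCF) hC).2 h

/-- A function that is continuous on the open set `U` and dominated by an element of `C₀(U)` is an
element of `C₀(U)`. -/
def dominated {U : Set X} (hU : IsOpen U) (a : C0on 𝕜 U) (f : X → 𝕜) (C : ℝ)
    (hf : ContinuousOn f U) (hle : ∀ x, ‖f x‖ ≤ C * ‖(a : C₀(X, 𝕜)) x‖) : C0on 𝕜 U :=
  ⟨{  toFun := f
      continuous_toFun := by
        rw [continuous_iff_continuousAt]
        intro x
        by_cases hx : x ∈ U
        · exact hf.continuousAt (hU.mem_nhds hx)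
        · have ha : (a : C₀(X, 𝕜)) x = 0 := a.2 x hx
          have h0 : f x = 0 := by simpa [ha] using hle x
          rw [ContinuousAt, h0]
          refine squeeze_zero_norm hle ?_
          have h1 : ContinuousAt (fun x => C * ‖(a : C₀(X, 𝕜)) x‖) x := by fun_prop
          simpa [ContinuousAt, ha] using h1
      zero_at_infty' := by
        refine squeeze_zero_norm hle ?_
        have h1 := ((a : C₀(X, 𝕜)).zero_at_infty'.norm).const_mul C
        simpa using h1 },
    fun x hx => by
      have ha : (a : C₀(X, 𝕜)) x = 0 := a.2 x hx
      simpa [ha] using hle x⟩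

@[simp]
theorem dominated_apply {U : Set X} (hU : IsOpen U) (a : C0on 𝕜 U) (f : X → 𝕜) (C : ℝ)
    (hf : ContinuousOn f U) (hle : ∀ x, ‖f x‖ ≤ C * ‖(a : C₀(X, 𝕜)) x‖) (x : X) :
    (dominated hU a f C hf hle : C₀(X, 𝕜)) x = f x := rfl

open Classical in
/-- The map `C₀(U) → C₀(V)`, `a ↦ a ∘ e⁻¹`, defined by a partial homeomorphism `e : U → V`. -/
def transport [T2Space X] (e : OpenPartialHomeomorph X X) (a : C0on 𝕜 e.source) :
    C0on 𝕜 e.target :=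
  have key : ∀ ε > 0, ∃ K ⊆ e.target, IsCompact K ∧ ∀ y, y ∉ K →
      ‖(if y ∈ e.target then (a : C₀(X, 𝕜)) (e.symm y) else 0)‖ < ε := by
    intro ε hε
    have h0 : ∀ᶠ y in Filter.cocompact X, ‖(a : C₀(X, 𝕜)) y‖ < ε := by
      have := (a : C₀(X, 𝕜)).zero_at_infty'.norm
      simp only [norm_zero] at this
      exact this.eventually (gt_mem_nhds hε)
    obtain ⟨K, hK, hKa⟩ := Filter.mem_cocompact.1 h0
    have hc : IsClosed {y | ε ≤ ‖(a : C₀(X, 𝕜)) y‖} :=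
      isClosed_le continuous_const (a : C₀(X, 𝕜)).continuous.norm
    have hK' : IsCompact {y | ε ≤ ‖(a : C₀(X, 𝕜)) y‖} := by
      refine hK.of_isClosed_subset hc fun y hy => ?_
      by_contra hyK
      have h2 : ‖(a : C₀(X, 𝕜)) y‖ < ε := hKa hyK
      exact not_lt.2 hy h2
    have hs : {y | ε ≤ ‖(a : C₀(X, 𝕜)) y‖} ⊆ e.source := fun y hy => by
      by_contra hys
      have : (a : C₀(X, 𝕜)) y = 0 := a.2 y hys
      have h2 : ε ≤ ‖(a : C₀(X, 𝕜)) y‖ := hy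
      rw [this, norm_zero] at h2
      exact absurd h2 (not_le.2 hε)
    refine ⟨e '' {y | ε ≤ ‖(a : C₀(X, 𝕜)) y‖}, ?_,
      hK'.image_of_continuousOn (e.continuousOn.mono hs), fun y hy => ?_⟩
    · rintro _ ⟨x, hx, rfl⟩
      exact e.map_source (hs hx)
    · split_ifs with hyt
      · by_contra hlt
        exact hy ⟨e.symm y, not_lt.1 hlt, e.right_inv hyt⟩
      · simpa using hε
  ⟨{  toFun := fun x => if x ∈ e.target then (a : C₀(X, 𝕜)) (e.symm x) else 0
      continuous_toFun := by
        rw [continuous_iff_continuousAt]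
        intro x
        by_cases hx : x ∈ e.target
        · have h1 : ContinuousAt (fun y => (a : C₀(X, 𝕜)) (e.symm y)) x :=
            (a : C₀(X, 𝕜)).continuous.continuousAt.comp (e.continuousAt_symm hx)
          refine h1.congr ?_
          filter_upwards [e.open_target.mem_nhds hx] with y hy
          rw [if_pos hy]
        · rw [ContinuousAt, if_neg hx, Metric.tendsto_nhds]
          intro ε hε
          obtain ⟨K, hKt, hK, hKa⟩ := key ε hε
          filter_upwards [hK.isClosed.isOpen_compl.mem_nhds fun hxK => hx (hKt hxK)] with y hy
          simpa using hKa y hy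
      zero_at_infty' := by
        rw [Metric.tendsto_nhds]
        intro ε hε
        obtain ⟨K, hKt, hK, hKa⟩ := key ε hε
        filter_upwards [hK.compl_mem_cocompact] with y hy
        simpa using hKa y hy },
    fun x hx => if_neg hx⟩

theorem transport_apply [T2Space X] (e : OpenPartialHomeomorph X X) (a : C0on 𝕜 e.source) {x : X}
    (hx : x ∈ e.target) : (transport e a : C₀(X, 𝕜)) x = (a : C₀(X, 𝕜)) (e.symm x) := by
  classical exact if_pos hx

end Ideals

/-! ### Twisted actions of inverse semigroups on `C₀(X)` -/

/-- A twisted action `(α, u)` of the inverse semigroup `S` on `C₀(X)`. The ideals of `C₀(X)` are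
`C₀(U)` with `U` open, their isometric isomorphisms are `a ↦ a ∘ h⁻¹` for partial homeomorphisms
`h`, and the unitary multipliers of `C₀(U)` are the continuous functions `U → {z : |z| = 1}`.
So the action is given by `α_t(a) = a ∘ h_t⁻¹` from `C₀(X_{t⁻¹})` onto `C₀(X_t)`, where
`X_t` is the target and `X_{t⁻¹}` is the source of `h_t`, and `u(s, t)` is a unitary function on
`X_{s t}` (its values outside of `X_{s t}` play no role). -/
structure TwistedAction (𝕜 X S : Type*) [RCLike 𝕜] [TopologicalSpace X] [InverseSemigroup S] where
  h : S → OpenPartialHomeomorph X X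
  u : S → S → X → 𝕜
  /-- the ideals `C₀(X_t)` span a dense subspace of `C₀(X)` -/
  covers : ∀ x, ∃ t, x ∈ (h t).target
  continuousOn_u : ∀ s t, ContinuousOn (u s t) (h (s * t)).target
  norm_u : ∀ s t, ∀ x ∈ (h (s * t)).target, ‖u s t x‖ = 1
  /-- `α_s ∘ α_t = α_{s t}`, with equality of domains (`Ad_{u(s, t)}` is trivial as `C₀(X)` is
  commutative) -/
  comp : ∀ s t, (h t).trans (h s) ≈ h (s * t)
  /-- `α_r(a u(s, t)) u(r, s t) = α_r(a) u(r, s) u(r s, t)` for `a ∈ C₀(X_{r⁻¹} ∩ X_{s t})` -/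
  cocycle : ∀ r s t x, x ∈ (h r).target → (h r).symm x ∈ (h (s * t)).target →
    u s t ((h r).symm x) * u r (s * t) x = u r s x * u (r * s) t x
  u_idem : ∀ e f, e * e = e → f * f = f → ∀ x ∈ (h (e * f)).target, u e f x = 1
  u_right : ∀ t, ∀ x ∈ (h t).target, u t (t⁻¹ * t) x = 1
  u_left : ∀ t, ∀ x ∈ (h t).target, u (t * t⁻¹) t x = 1
  u_conj : ∀ t e, e * e = e → ∀ x ∈ (h (t⁻¹ * e * t)).target,
    u t⁻¹ e x * u (t⁻¹ * e) t x = u t⁻¹ t x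

namespace TwistedAction

variable {𝕜 X S : Type*} [RCLike 𝕜] [TopologicalSpace X] [InverseSemigroup S]
  (T : TwistedAction 𝕜 X S)

/-- Every compact subset of `X` is contained in `X_e` for some idempotent `e`. This holds if `S` has
a unit `1` that acts as the identity map of `X_1 = X`. -/
def AbsorbsCompacts : Prop := ∀ K : Set X, IsCompact K → ∃ e, e * e = e ∧ K ⊆ (T.h e).target

/-- The ideal `I_t = C₀(X_t)`. -/
abbrev I (t : S) : Submodule 𝕜 C₀(X, 𝕜) := C0on 𝕜 (T.h t).target

/-- The ideal `I_{t⁻¹} = C₀(X_{t⁻¹})`. -/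
abbrev I' (t : S) : Submodule 𝕜 C₀(X, 𝕜) := C0on 𝕜 (T.h t).source

/-- The partial automorphism `α_t`. -/
def α [T2Space X] (t : S) (a : T.I' t) : T.I t := transport (T.h t) a

theorem mem_source_mul {s t : S} {x : X} :
    x ∈ (T.h (s * t)).source ↔ x ∈ (T.h t).source ∧ T.h t x ∈ (T.h s).source := by
  rw [← (T.comp s t).source_eq, OpenPartialHomeomorph.trans_source]; rfl

theorem h_mul {s t : S} {x : X} (hx : x ∈ (T.h (s * t)).source) :
    T.h (s * t) x = T.h s (T.h t x) := by
  rw [← (T.comp s t).source_eq] at hx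
  exact ((T.comp s t).eqOn hx).symm

theorem mem_target_mul {s t : S} {x : X} :
    x ∈ (T.h (s * t)).target ↔ x ∈ (T.h s).target ∧ (T.h s).symm x ∈ (T.h t).target := by
  rw [← (T.comp s t).target_eq, OpenPartialHomeomorph.trans_target]; rfl

theorem symm_mul {s t : S} {x : X} (hx : x ∈ (T.h (s * t)).target) :
    (T.h (s * t)).symm x = (T.h t).symm ((T.h s).symm x) := by
  rw [← (T.comp s t).target_eq] at hx
  exact ((T.comp s t).symm_eqOn_target hx).symm

theorem h_idem {e : S} (he : e * e = e) {x : X} (hx : x ∈ (T.h e).source) : T.h e x = x := by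
  have h1 : x ∈ (T.h (e * e)).source := by rwa [he]
  have h2 := T.h_mul h1
  rw [he] at h2
  exact ((T.h e).injOn hx (T.mem_source_mul.1 h1).2 h2).symm

theorem inv_mul_idem (t : S) : (t⁻¹ * t) * (t⁻¹ * t) = t⁻¹ * t := by
  rw [← mul_assoc, InverseSemigroup.inv_mul_inv]

theorem mul_inv_idem (t : S) : (t * t⁻¹) * (t * t⁻¹) = t * t⁻¹ := by
  rw [← mul_assoc, InverseSemigroup.mul_inv_mul]

theorem h_inv_h {t : S} {x : X} (hx : x ∈ (T.h t).source) :
    T.h t x ∈ (T.h t⁻¹).source ∧ T.h t⁻¹ (T.h t x) = x := by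
  have h1 : x ∈ (T.h (t * (t⁻¹ * t))).source := by
    rwa [← mul_assoc, InverseSemigroup.mul_inv_mul]
  have h2 := (T.mem_source_mul.1 h1).1
  refine ⟨(T.mem_source_mul.1 h2).2, ?_⟩
  rw [← T.h_mul h2, T.h_idem (inv_mul_idem t) h2]

theorem h_h_inv {t : S} {x : X} (hx : x ∈ (T.h t⁻¹).source) :
    T.h t⁻¹ x ∈ (T.h t).source ∧ T.h t (T.h t⁻¹ x) = x := by
  have h1 : x ∈ (T.h (t⁻¹ * (t * t⁻¹))).source := by
    rwa [← mul_assoc, InverseSemigroup.inv_mul_inv]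
  have h2 := (T.mem_source_mul.1 h1).1
  refine ⟨(T.mem_source_mul.1 h2).2, ?_⟩
  rw [← T.h_mul h2, T.h_idem (mul_inv_idem t) h2]

theorem source_inv (t : S) : (T.h t⁻¹).source = (T.h t).target := by
  ext x
  constructor
  · intro hx
    rw [← (T.h_h_inv hx).2]
    exact (T.h t).map_source (T.h_h_inv hx).1
  · intro hx
    rw [← (T.h t).right_inv hx]
    exact (T.h_inv_h ((T.h t).map_target hx)).1

theorem target_inv (t : S) : (T.h t⁻¹).target = (T.h t).source := by
  ext x
  constructor
  · intro hx
    rw [← (T.h t⁻¹).right_inv hx]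
    exact (T.h_h_inv ((T.h t⁻¹).map_target hx)).1
  · intro hx
    rw [← (T.h_inv_h hx).2]
    exact (T.h t⁻¹).map_source (T.h_inv_h hx).1

theorem target_mul_inv (t : S) : (T.h (t * t⁻¹)).target = (T.h t).target := by
  ext x
  rw [T.mem_target_mul, T.target_inv]
  exact ⟨fun h => h.1, fun h => ⟨h, (T.h t).map_target h⟩⟩

/-- The product `a u(s, t)` for `a ∈ I_{s t}`. -/
def mulU (s t : S) (a : T.I (s * t)) : T.I (s * t) :=
  dominated (T.h (s * t)).open_target a (fun x => (a : C₀(X, 𝕜)) x * T.u s t x) 1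
    ((a : C₀(X, 𝕜)).continuous.continuousOn.mul (T.continuousOn_u s t)) fun x => by
      by_cases hx : x ∈ (T.h (s * t)).target
      · rw [norm_mul, T.norm_u s t x hx, mul_one, one_mul]
      · have : (a : C₀(X, 𝕜)) x = 0 := a.2 x hx
        simp [this]

theorem mulU_apply (s t : S) (a : T.I (s * t)) (x : X) :
    (T.mulU s t a : C₀(X, 𝕜)) x = (a : C₀(X, 𝕜)) x * T.u s t x := rfl

theorem I_ext {t : S} {a b : T.I t}
    (h : ∀ x ∈ (T.h t).target, (a : C₀(X, 𝕜)) x = (b : C₀(X, 𝕜)) x) : a = b := by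
  apply Subtype.ext
  ext x
  by_cases hx : x ∈ (T.h t).target
  · exact h x hx
  · rw [a.2 x hx, b.2 x hx]

variable [T2Space X]

/-- The inverse of the partial automorphism `α_t`. -/
def αinv (t : S) (a : T.I t) : T.I' t := transport (T.h t).symm a

theorem α_apply {t : S} (a : T.I' t) {x : X} (hx : x ∈ (T.h t).target) :
    (T.α t a : C₀(X, 𝕜)) x = (a : C₀(X, 𝕜)) ((T.h t).symm x) := transport_apply _ _ hx

theorem αinv_apply {t : S} (a : T.I t) {x : X} (hx : x ∈ (T.h t).source) :
    (T.αinv t a : C₀(X, 𝕜)) x = (a : C₀(X, 𝕜)) (T.h t x) :=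
  transport_apply (T.h t).symm _ hx

theorem α_αinv (t : S) (a : T.I t) : T.α t (T.αinv t a) = a := by
  apply Subtype.ext
  ext x
  by_cases hx : x ∈ (T.h t).target
  · rw [T.α_apply _ hx, T.αinv_apply _ ((T.h t).map_target hx), (T.h t).right_inv hx]
  · rw [(T.α t (T.αinv t a)).2 x hx, a.2 x hx]

/-- The product `α_t⁻¹(a) b ∈ I_{t⁻¹}`, for `a ∈ I_t` and `b ∈ C₀(X)`. -/
def αinvMul (t : S) (a : T.I t) (b : C₀(X, 𝕜)) : T.I' t :=
  ⟨(T.αinv t a : C₀(X, 𝕜)) * b, fun x hx => by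
    rw [ZeroAtInftyContinuousMap.mul_apply, (T.αinv t a).2 x hx, zero_mul]⟩

theorem α_αinvMul_apply {t : S} (a : T.I t) (b : C₀(X, 𝕜)) {x : X} (hx : x ∈ (T.h t).target) :
    (T.α t (T.αinvMul t a b) : C₀(X, 𝕜)) x = (a : C₀(X, 𝕜)) x * b ((T.h t).symm x) := by
  rw [T.α_apply _ hx]
  change (T.αinv t a : C₀(X, 𝕜)) _ * b _ = _
  rw [T.αinv_apply _ ((T.h t).map_target hx), (T.h t).right_inv hx]

theorem α_αinvMul_mem (s t : S) (a : T.I s) (b : T.I t) :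
    (T.α s (T.αinvMul s a b) : C₀(X, 𝕜)) ∈ T.I (s * t) := by
  intro x hx
  by_cases hxs : x ∈ (T.h s).target
  · have hxt : (T.h s).symm x ∉ (T.h t).target := fun h => hx (T.mem_target_mul.2 ⟨hxs, h⟩)
    rw [T.α_αinvMul_apply a _ hxs, b.2 _ hxt, mul_zero]
  · exact (T.α s (T.αinvMul s a b)).2 x hxs

/-- The element `α_s(α_s⁻¹(a) b) u(s, t)` of `I_{s t}`, for `a ∈ I_s` and `b ∈ I_t`. -/
def coeffMul (s t : S) (a : T.I s) (b : T.I t) : T.I (s * t) :=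
  T.mulU s t ⟨T.α s (T.αinvMul s a b), T.α_αinvMul_mem s t a b⟩

theorem coeffMul_apply {s t : S} (a : T.I s) (b : T.I t) {x : X} (hx : x ∈ (T.h (s * t)).target) :
    (T.coeffMul s t a b : C₀(X, 𝕜)) x
      = (a : C₀(X, 𝕜)) x * (b : C₀(X, 𝕜)) ((T.h s).symm x) * T.u s t x := by
  rw [coeffMul, mulU_apply, T.α_αinvMul_apply a _ (T.mem_target_mul.1 hx).1]

theorem norm_coeffMul_le (s t : S) (a : T.I s) (b : T.I t) : ‖T.coeffMul s t a b‖ ≤ ‖a‖ * ‖b‖ := by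
  refine C0_norm_le (a := (T.coeffMul s t a b : C₀(X, 𝕜))) (by positivity) fun x => ?_
  by_cases hx : x ∈ (T.h (s * t)).target
  · rw [T.coeffMul_apply a b hx, norm_mul, norm_mul, T.norm_u s t x hx, mul_one]
    exact mul_le_mul (norm_apply_le (a : C₀(X, 𝕜)) x) (norm_apply_le (b : C₀(X, 𝕜)) _)
      (norm_nonneg _) (norm_nonneg a)
  · rw [(T.coeffMul s t a b).2 x hx, norm_zero]; positivity

theorem coeffMul_assoc (r s t : S) (a : T.I r) (b : T.I s) (c : T.I t) :
    (T.coeffMul (r * s) t (T.coeffMul r s a b) c : C₀(X, 𝕜))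
      = T.coeffMul r (s * t) a (T.coeffMul s t b c) := by
  ext x
  by_cases hx : x ∈ (T.h (r * s * t)).target
  · have hx' : x ∈ (T.h (r * (s * t))).target := by rwa [← mul_assoc]
    have h1 := (T.mem_target_mul.1 hx).1
    obtain ⟨h2, h3⟩ := T.mem_target_mul.1 hx'
    rw [T.coeffMul_apply _ _ hx, T.coeffMul_apply _ _ h1, T.coeffMul_apply _ _ hx',
      T.coeffMul_apply _ _ h3, T.symm_mul h1]
    linear_combination (-1) * (a : C₀(X, 𝕜)) x * (b : C₀(X, 𝕜)) ((T.h r).symm x) *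
      (c : C₀(X, 𝕜)) ((T.h s).symm ((T.h r).symm x)) * T.cocycle r s t x h2 h3
  · have hx' : x ∉ (T.h (r * (s * t))).target := by rwa [← mul_assoc]
    rw [(T.coeffMul (r * s) t (T.coeffMul r s a b) c).2 x hx,
      (T.coeffMul r (s * t) a (T.coeffMul s t b c)).2 x hx']

/-- The multiplication `(a δ_s) (b δ_t) = α_s(α_s⁻¹(a) b) u(s, t) δ_{s t}`. -/
def gradedMul : GradedMul T.I where
  m s t := LinearMap.mk₂ 𝕜 (T.coeffMul s t)
    (fun a a' b => T.I_ext fun x hx => by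
      simp only [T.coeffMul_apply _ _ hx, Submodule.coe_add, ZeroAtInftyContinuousMap.add_apply]
      ring)
    (fun c a b => T.I_ext fun x hx => by
      simp only [T.coeffMul_apply _ _ hx, Submodule.coe_smul, ZeroAtInftyContinuousMap.smul_apply,
        smul_eq_mul]
      ring)
    (fun a b b' => T.I_ext fun x hx => by
      simp only [T.coeffMul_apply _ _ hx, Submodule.coe_add, ZeroAtInftyContinuousMap.add_apply]
      ring)
    (fun c a b => T.I_ext fun x hx => by
      simp only [T.coeffMul_apply _ _ hx, Submodule.coe_smul, ZeroAtInftyContinuousMap.smul_apply,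
        smul_eq_mul]
      ring)
  norm_le s t a b := T.norm_coeffMul_le s t a b
  assoc r s t a b c := T.coeffMul_assoc r s t a b c

/-- The Banach algebra `ℓ¹(α, u)` of all `f ∈ ℓ¹(S, C₀(X))` with `f(t) ∈ I_t`, with the
multiplication `(f * g)(r) = ∑_{s t = r} α_s(α_s⁻¹(f(s)) g(t)) u(s, t)`. -/
abbrev ell1 : Type _ := T.gradedMul.L1

end TwistedAction

/-! ### Covariant representations and crossed products -/

section Covariant

variable {𝕜 X S : Type*} [RCLike 𝕜] [TopologicalSpace X] [T2Space X] [InverseSemigroup S]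

/-- A covariant representation `(π, v)` of the twisted action `(α, u)` in the Banach algebra `B`.
All products are formed in `B''`. -/
@[ext]
structure CovRep (T : TwistedAction 𝕜 X S) (B : Type*) [NonUnitalNormedRing B] [NormedSpace 𝕜 B]
    [IsScalarTower 𝕜 B B] [SMulCommClass 𝕜 B B] where
  π : BanachRep 𝕜 C₀(X, 𝕜) B
  v : S → Bidual 𝕜 B
  norm_v : ∀ t, ‖v t‖ ≤ 1
  /-- `v_t π(a) = π(α_t(a)) v_t ∈ B` for `a ∈ I_{t⁻¹}` -/
  cov : ∀ t (a : T.I' t),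
    arens (v t) (toBidual 𝕜 (π a)) = arens (toBidual 𝕜 (π (T.α t a))) (v t) ∧
      ∃ b : B, arens (v t) (toBidual 𝕜 (π a)) = toBidual 𝕜 b
  /-- `π(a) v_s v_t = π(a u(s, t)) v_{s t}` for `a ∈ I_{s t}` -/
  mul : ∀ s t (a : T.I (s * t)),
    arens (arens (toBidual 𝕜 (π a)) (v s)) (v t)
      = arens (toBidual 𝕜 (π (T.mulU s t a))) (v (s * t))
  /-- `π(a) v_e = π(a)` for `a ∈ I_e` -/
  idem : ∀ e, e * e = e → ∀ a : T.I e,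
    arens (toBidual 𝕜 (π a)) (v e) = toBidual 𝕜 (π a)

namespace CovRep

variable {T : TwistedAction 𝕜 X S} {B : Type*} [NonUnitalNormedRing B] [NormedSpace 𝕜 B]
  [IsScalarTower 𝕜 B B] [SMulCommClass 𝕜 B B] (p : CovRep T B)

/-- The element `π(a) v_t` (it lies in `B` for `a ∈ I_t`). -/
def elt (t : S) (a : C₀(X, 𝕜)) : Bidual 𝕜 B := arens (toBidual 𝕜 (p.π a)) (p.v t)

/-- The integrated form `π × v : ℓ¹(α, u) → B ⊆ B''`, `f ↦ ∑_t π(f(t)) v_t`. -/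
def integrate (f : T.ell1) : Bidual 𝕜 B := ∑' t, p.elt t (T.gradedMul.coeff f t)

theorem norm_elt_le (t : S) (a : C₀(X, 𝕜)) : ‖p.elt t a‖ ≤ ‖a‖ := by
  have h1 : ‖toBidual 𝕜 (p.π a)‖ ≤ ‖a‖ :=
    (norm_toBidual_le (p.π a)).trans (p.π.contractive a)
  calc ‖p.elt t a‖ ≤ ‖toBidual 𝕜 (p.π a)‖ * ‖p.v t‖ := norm_arens_le _ _
    _ ≤ ‖a‖ * 1 := mul_le_mul h1 (p.norm_v t) (norm_nonneg _) (norm_nonneg _)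
    _ = ‖a‖ := mul_one _

theorem elt_add (t : S) (a b : C₀(X, 𝕜)) : p.elt t (a + b) = p.elt t a + p.elt t b := by
  rw [elt, map_add, map_add, arens_add_left]; rfl

theorem elt_smul (t : S) (c : 𝕜) (a : C₀(X, 𝕜)) : p.elt t (c • a) = c • p.elt t a := by
  rw [elt, map_smul, map_smul, arens_smul_left]; rfl

theorem elt_zero (t : S) : p.elt t 0 = 0 := by
  have := p.elt_smul t 0 0
  rwa [zero_smul, zero_smul] at this

theorem summable_elt (f : T.ell1) : Summable fun t => p.elt t (T.gradedMul.coeff f t) :=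
  Summable.of_norm_bounded (T.gradedMul.hasSum_norm f).summable fun t => p.norm_elt_le t _

theorem norm_integrate_le (f : T.ell1) : ‖p.integrate f‖ ≤ ‖f‖ :=
  tsum_of_norm_bounded (T.gradedMul.hasSum_norm f) fun t => p.norm_elt_le t _

theorem integrate_add (f g : T.ell1) : p.integrate (f + g) = p.integrate f + p.integrate g := by
  rw [integrate, integrate, integrate, ← (p.summable_elt f).tsum_add (p.summable_elt g)]
  congr 1; funext t
  exact p.elt_add t _ _

theorem integrate_smul (c : 𝕜) (f : T.ell1) : p.integrate (c • f) = c • p.integrate f := by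
  rw [integrate, integrate, ← (p.summable_elt f).tsum_const_smul c]
  congr 1; funext t
  exact p.elt_smul t c _

theorem integrate_single (t : S) (a : T.I t) :
    p.integrate (T.gradedMul.single t a) = p.elt t a := by
  rw [integrate, tsum_eq_single t]
  · rw [T.gradedMul.coeff_single_self]
  · intro s hs
    rw [T.gradedMul.coeff_single_ne hs]
    exact p.elt_zero s

theorem elt_mul (s t : S) (a : T.I s) (b : T.I t) :
    arens (p.elt s a) (p.elt t b) = p.elt (s * t) (T.coeffMul s t a b) := by
  have h1 : p.elt s a = arens (p.v s) (toBidual 𝕜 (p.π (T.αinv s a))) := by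
    rw [(p.cov s (T.αinv s a)).1, T.α_αinv]; rfl
  have h2 := (p.cov s (T.αinvMul s a b)).1
  have h3 : p.π (T.αinvMul s a b) = p.π (T.αinv s a) * p.π b := map_mul p.π.toHom _ _
  have h4 := p.mul s t ⟨T.α s (T.αinvMul s a b), T.α_αinvMul_mem s t a b⟩
  calc arens (p.elt s a) (p.elt t b)
      = arens (arens (p.v s) (toBidual 𝕜 (p.π (T.αinvMul s a b)))) (p.v t) := by
        rw [h1, elt, ← arens_assoc, arens_assoc (p.v s), arens_toBidual, h3]
    _ = p.elt (s * t) (T.coeffMul s t a b) := by rw [h2]; exact h4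

/-- The integrated form as an additive map. -/
def integrateHom : T.ell1 →+ Bidual 𝕜 B := AddMonoidHom.mk' p.integrate p.integrate_add

theorem continuous_integrateHom : Continuous p.integrateHom :=
  AddMonoidHomClass.continuous_of_bound p.integrateHom 1 fun f => by
    rw [one_mul]; exact p.norm_integrate_le f

theorem integrate_mul (f g : T.ell1) :
    p.integrate (f * g) = arens (p.integrate f) (p.integrate g) := by
  have h1 : ∀ s a (g : T.ell1), p.integrate (T.gradedMul.single s a * g)
      = arens (p.integrate (T.gradedMul.single s a)) (p.integrate g) := fun s a g =>
    T.gradedMul.hom_ext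
      (φ := p.integrateHom.comp (T.gradedMul.mulLeft (T.gradedMul.single s a)))
      (ψ := (arensLeft (p.integrate (T.gradedMul.single s a))).comp p.integrateHom)
      (p.continuous_integrateHom.comp (T.gradedMul.continuous_mulLeft _))
      ((continuous_arensLeft _).comp p.continuous_integrateHom)
      (fun t b => by
        change p.integrate (T.gradedMul.single s a * T.gradedMul.single t b)
          = arens (p.integrate (T.gradedMul.single s a)) (p.integrate (T.gradedMul.single t b))
        rw [T.gradedMul.single_mul_single, p.integrate_single, p.integrate_single,
          p.integrate_single, p.elt_mul]
        rfl) g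
  exact T.gradedMul.hom_ext
      (φ := p.integrateHom.comp (T.gradedMul.mulRight g))
      (ψ := (arensRight (p.integrate g)).comp p.integrateHom)
      (p.continuous_integrateHom.comp (T.gradedMul.continuous_mulRight _))
      ((continuous_arensRight _).comp p.continuous_integrateHom)
      (fun s a => h1 s a g) f

end CovRep

end Covariant

section Normalized

variable {𝕜 X S : Type*} [RCLike 𝕜] [TopologicalSpace X] [T2Space X] [InverseSemigroup S]

/-- Covariant representations of `T` in Banach algebras. -/
abbrev SomeCovRep.{w, a, b, c} {𝕜 : Type a} {X : Type b} {S : Type c} [RCLike 𝕜]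
    [TopologicalSpace X] [T2Space X] [InverseSemigroup S] (T : TwistedAction 𝕜 X S) :
    Type (max a b c (w + 1)) :=
  Σ B : BanachAlg.{a, w} 𝕜, CovRep T B.carrier

/-- The seminorm `‖f‖ = sup {‖(π × v)(f)‖ : (π, v) ∈ R}` on `ℓ¹(α, u)`. -/
def crossedSeminorm {T : TwistedAction 𝕜 X S} (R : Set (SomeCovRep T)) : AlgSeminorm 𝕜 T.ell1 where
  toSeminorm := Seminorm.ofSMulLE (fun f => sSup ((fun q => ‖q.2.integrate f‖) '' R))
    (le_antisymm (Real.sSup_le (by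
        rintro _ ⟨q, -, rfl⟩
        exact (q.2.norm_integrate_le 0).trans_eq norm_zero) le_rfl)
      (Real.sSup_nonneg (by rintro _ ⟨q, -, rfl⟩; exact norm_nonneg _)))
    (fun f g => Real.sSup_le (by
        rintro _ ⟨q, hq, rfl⟩
        refine (congrArg norm (q.2.integrate_add f g)).trans_le ((norm_add_le _ _).trans ?_)
        exact add_le_add
          (le_csSup ⟨‖f‖, by rintro _ ⟨q, -, rfl⟩; exact q.2.norm_integrate_le f⟩ ⟨q, hq, rfl⟩)
          (le_csSup ⟨‖g‖, by rintro _ ⟨q, -, rfl⟩; exact q.2.norm_integrate_le g⟩ ⟨q, hq, rfl⟩))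
      (add_nonneg
        (Real.sSup_nonneg (by rintro _ ⟨q, -, rfl⟩; exact norm_nonneg _))
        (Real.sSup_nonneg (by rintro _ ⟨q, -, rfl⟩; exact norm_nonneg _))))
    (fun c f => Real.sSup_le (by
        rintro _ ⟨q, hq, rfl⟩
        refine (congrArg norm (q.2.integrate_smul c f)).trans_le ?_
        rw [norm_smul]
        exact mul_le_mul_of_nonneg_left
          (le_csSup ⟨‖f‖, by rintro _ ⟨q, -, rfl⟩; exact q.2.norm_integrate_le f⟩ ⟨q, hq, rfl⟩)
          (norm_nonneg c))
      (mul_nonneg (norm_nonneg c)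
        (Real.sSup_nonneg (by rintro _ ⟨q, -, rfl⟩; exact norm_nonneg _))))
  mul_le' f g := Real.sSup_le (by
        rintro _ ⟨q, hq, rfl⟩
        refine (congrArg norm (q.2.integrate_mul f g)).trans_le ((norm_arens_le _ _).trans ?_)
        exact mul_le_mul
          (le_csSup ⟨‖f‖, by rintro _ ⟨q, -, rfl⟩; exact q.2.norm_integrate_le f⟩ ⟨q, hq, rfl⟩)
          (le_csSup ⟨‖g‖, by rintro _ ⟨q, -, rfl⟩; exact q.2.norm_integrate_le g⟩ ⟨q, hq, rfl⟩)
          (norm_nonneg _) (Real.sSup_nonneg (by rintro _ ⟨q, -, rfl⟩; exact norm_nonneg _)))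
      (mul_nonneg
        (Real.sSup_nonneg (by rintro _ ⟨q, -, rfl⟩; exact norm_nonneg _))
        (Real.sSup_nonneg (by rintro _ ⟨q, -, rfl⟩; exact norm_nonneg _)))

theorem crossedSeminorm_apply {T : TwistedAction 𝕜 X S} (R : Set (SomeCovRep T)) (f : T.ell1) :
    (crossedSeminorm R).toSeminorm f = sSup ((fun q => ‖q.2.integrate f‖) '' R) := rfl

/-- The crossed product `C₀(X) ⋊_R S` for a class `R` of covariant representations: the Hausdorff
completion of `ℓ¹(α, u)` in the seminorm defined by `R`. -/
abbrev CrossedProduct {T : TwistedAction 𝕜 X S} (R : Set (SomeCovRep T)) : Type _ :=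
  (crossedSeminorm R).Compl

/-- The filter `l` on `C₀(X)` is a contractive approximate unit of the ideal `J`. -/
structure IsApproxUnit (J : Submodule 𝕜 C₀(X, 𝕜)) (l : Filter C₀(X, 𝕜)) : Prop where
  neBot : l.NeBot
  mem : ∀ᶠ a in l, a ∈ J ∧ ‖a‖ ≤ 1
  tendsto : ∀ b ∈ J, Filter.Tendsto (fun a => a * b) l (𝓝 b)

namespace CovRep

variable {T : TwistedAction 𝕜 X S} {B : Type*} [NonUnitalNormedRing B] [NormedSpace 𝕜 B]
  [IsScalarTower 𝕜 B B] [SMulCommClass 𝕜 B B]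

/-- `(π, v)` is `B'`-normalized: `v_t = B'-lim π(μ_i) v_t` for an approximate unit `(μ_i)` of
`I_t`. -/
def IsNormalized (p : CovRep T B) : Prop :=
  ∀ t, ∃ l, IsApproxUnit (T.I t) l ∧
    ∀ f : StrongDual 𝕜 B, Filter.Tendsto (fun a => (p.elt t a).fn f) l (𝓝 ((p.v t).fn f))

/-- `(π, v)` is `P`-normalized, where `P` is a predual of `B`: each `v_t` is in `B`, and
`v_t = P-lim π(μ_i) v_t` for an approximate unit `(μ_i)` of `I_t`. -/
def IsPredualNormalized {P : Type*} [NormedAddCommGroup P] [NormedSpace 𝕜 P]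
    (e : StrongDual 𝕜 P ≃ₗᵢ[𝕜] B) (p : CovRep T B) : Prop :=
  ∀ t, ∃ w : B, p.v t = toBidual 𝕜 w ∧ ∃ l, IsApproxUnit (T.I t) l ∧
    ∀ x : P, Filter.Tendsto (fun a => e.symm (p.π a * w) x) l (𝓝 (e.symm w x))

/-- `v_t = π(1_{X_t}) v_t ∈ B` for all `t` (which presupposes that `1_{X_t} ∈ C₀(X)`). -/
def IsUnitNormalized (p : CovRep T B) : Prop :=
  ∀ t, ∃ q : T.I t, (∀ x ∈ (T.h t).target, (q : C₀(X, 𝕜)) x = 1) ∧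
    ∃ w : B, p.v t = toBidual 𝕜 w ∧ w = p.π q * w

end CovRep

/-- The closed subspace of `E` spanned by `π(J) E`. -/
def essSubspace {E : Type*} [NormedAddCommGroup E] [NormedSpace 𝕜 E]
    (π : BanachRep 𝕜 C₀(X, 𝕜) (E →L[𝕜] E)) (J : Submodule 𝕜 C₀(X, 𝕜)) : Submodule 𝕜 E :=
  (Submodule.span 𝕜 {y | ∃ a ∈ J, ∃ x, y = π a x}).topologicalClosure

theorem mem_essSubspace {E : Type*} [NormedAddCommGroup E] [NormedSpace 𝕜 E]
    (π : BanachRep 𝕜 C₀(X, 𝕜) (E →L[𝕜] E)) {J : Submodule 𝕜 C₀(X, 𝕜)} {a : C₀(X, 𝕜)} (ha : a ∈ J)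
    (x : E) : π a x ∈ essSubspace π J :=
  Submodule.le_topologicalClosure _ (Submodule.subset_span ⟨a, ha, x, rfl⟩)

/-- A covariant representation `(π, v)` of `(α, u)` on the Banach space `E`. -/
@[ext]
structure CovRepOn (T : TwistedAction 𝕜 X S) (E : Type*) [NormedAddCommGroup E]
    [NormedSpace 𝕜 E] where
  π : BanachRep 𝕜 C₀(X, 𝕜) (E →L[𝕜] E)
  v : S → E →L[𝕜] E
  norm_v : ∀ t, ‖v t‖ ≤ 1
  /-- `v_t` has a contractive generalised inverse `w`, with `v_t π(a) w = π(α_t(a))` for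
  `a ∈ I_{t⁻¹}`, such that `v_t` and `w` have the ranges `π(I_t) E` and `π(I_{t⁻¹}) E` -/
  cov : ∀ t, ∃ w : E →L[𝕜] E, ‖w‖ ≤ 1 ∧ v t * w * v t = v t ∧ w * v t * w = w ∧
    (∀ a : T.I' t, v t * π a * w = π (T.α t a)) ∧
    Set.range (v t) = essSubspace π (T.I t) ∧ Set.range w = essSubspace π (T.I' t)
  /-- `π(a) v_e = π(a)` for `a ∈ I_e`: the projection `v_e` onto the closed span of `π(I_e) E`
  commutes with `π(I_e)` -/
  idem : ∀ e, e * e = e → ∀ a : T.I e, π a * v e = π a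
  /-- `v_s v_t = M v_{s t}`, where `M` is the operator on the closed span of `π(I_{s t}) E` with
  `M (π(a) x) = π(a u(s, t)) x` for `a ∈ I_{s t}` -/
  mul : ∀ s t, ∃ M : essSubspace π (T.I (s * t)) →L[𝕜] essSubspace π (T.I (s * t)),
    (∀ (a : T.I (s * t)) (x : E),
      (M ⟨π a x, mem_essSubspace π a.2 x⟩ : E) = π (T.mulU s t a) x) ∧
    ∀ ξ, ∃ hξ : v (s * t) ξ ∈ essSubspace π (T.I (s * t)), v s (v t ξ) = M ⟨v (s * t) ξ, hξ⟩

/-- The covariant representation `q` on `E` is the covariant representation `p` in `B(E)`. -/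
def CovRepOn.IsCov {T : TwistedAction 𝕜 X S} {E : Type*} [NormedAddCommGroup E] [NormedSpace 𝕜 E]
    (q : CovRepOn T E) (p : CovRep T (E →L[𝕜] E)) : Prop :=
  p.π = q.π ∧ ∀ t, p.v t = toBidual 𝕜 (q.v t)

/-- The class of all covariant representations in the algebras `B(E)`, `E ∈ 𝓔`. -/
def algClass (T : TwistedAction 𝕜 X S) (𝓔 : Set (BanachSp 𝕜)) : Set (SomeCovRep T) :=
  {q | ∃ E ∈ 𝓔, ∃ p : CovRep T (E.operators).carrier, q = ⟨E.operators, p⟩}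

/-- The class of all covariant representations on the Banach spaces `E ∈ 𝓔`. -/
def spaClass (T : TwistedAction 𝕜 X S) (𝓔 : Set (BanachSp 𝕜)) : Set (SomeCovRep T) :=
  {q | ∃ E ∈ 𝓔, ∃ p : CovRep T (E.operators).carrier, q = ⟨E.operators, p⟩ ∧
    ∃ q' : CovRepOn T E.carrier, q'.IsCov p}

end Normalized

/-! ### Étale groupoids and their twists -/

/-- An étale groupoid `G` with unit space `Y`. The product `mul γ η` is only meaningful if
`d γ = r η`. The space `G` is not assumed to be Hausdorff. -/
structure EtaleGroupoid (Y G : Type*) [TopologicalSpace Y] [TopologicalSpace G] where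
  d : G → Y
  r : G → Y
  unit : Y → G
  mul : G → G → G
  inv : G → G
  d_unit : ∀ y, d (unit y) = y
  r_unit : ∀ y, r (unit y) = y
  d_mul : ∀ γ η, d γ = r η → d (mul γ η) = d η
  r_mul : ∀ γ η, d γ = r η → r (mul γ η) = r γ
  mul_assoc : ∀ γ η ζ, d γ = r η → d η = r ζ → mul (mul γ η) ζ = mul γ (mul η ζ)
  unit_mul : ∀ γ, mul (unit (r γ)) γ = γ
  mul_unit : ∀ γ, mul γ (unit (d γ)) = γ
  d_inv : ∀ γ, d (inv γ) = r γ
  r_inv : ∀ γ, r (inv γ) = d γ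
  inv_mul : ∀ γ, mul (inv γ) γ = unit (d γ)
  mul_inv : ∀ γ, mul γ (inv γ) = unit (r γ)
  continuous_unit : Continuous unit
  continuous_inv : Continuous inv
  continuousOn_mul : ContinuousOn (fun p : G × G => mul p.1 p.2) {p | d p.1 = r p.2}
  local_d : IsLocalHomeomorph d
  local_r : IsLocalHomeomorph r

namespace EtaleGroupoid

variable {Y G : Type*} [TopologicalSpace Y] [TopologicalSpace G] (𝓖 : EtaleGroupoid Y G)

/-- `γ` and `η` are composable with product `ζ`. -/
def IsProd (γ η ζ : G) : Prop := 𝓖.d γ = 𝓖.r η ∧ 𝓖.mul γ η = ζ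

variable {𝓖}

theorem IsProd.r_eq {γ η ζ : G} (h : 𝓖.IsProd γ η ζ) : 𝓖.r γ = 𝓖.r ζ := by
  rw [← h.2, 𝓖.r_mul _ _ h.1]

theorem IsProd.d_eq {γ η ζ : G} (h : 𝓖.IsProd γ η ζ) : 𝓖.d η = 𝓖.d ζ := by
  rw [← h.2, 𝓖.d_mul _ _ h.1]

theorem IsProd.inv_mul_eq {γ η ζ : G} (h : 𝓖.IsProd γ η ζ) : 𝓖.mul (𝓖.inv γ) ζ = η := by
  rw [← h.2, ← 𝓖.mul_assoc _ _ _ (𝓖.d_inv γ) h.1, 𝓖.inv_mul, h.1, 𝓖.unit_mul]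

variable (𝓖)

theorem isProd_inv_mul {γ ζ : G} (h : 𝓖.r γ = 𝓖.r ζ) :
    𝓖.IsProd γ (𝓖.mul (𝓖.inv γ) ζ) ζ := by
  have h1 : 𝓖.d (𝓖.inv γ) = 𝓖.r ζ := by rw [𝓖.d_inv, h]
  refine ⟨by rw [𝓖.r_mul _ _ h1, 𝓖.r_inv], ?_⟩
  rw [← 𝓖.mul_assoc _ _ _ (𝓖.r_inv γ).symm h1, 𝓖.mul_inv, h, 𝓖.unit_mul]

theorem isProd_unit_mul (γ : G) : 𝓖.IsProd (𝓖.unit (𝓖.r γ)) γ γ :=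
  ⟨𝓖.d_unit _, 𝓖.unit_mul γ⟩

theorem isProd_mul_unit (γ : G) : 𝓖.IsProd γ (𝓖.unit (𝓖.d γ)) γ :=
  ⟨(𝓖.r_unit _).symm, 𝓖.mul_unit γ⟩

theorem isProd_mul_inv (γ : G) : 𝓖.IsProd γ (𝓖.inv γ) (𝓖.unit (𝓖.r γ)) :=
  ⟨(𝓖.r_inv γ).symm, 𝓖.mul_inv γ⟩

theorem continuous_d : Continuous 𝓖.d := 𝓖.local_d.continuous
theorem continuous_r : Continuous 𝓖.r := 𝓖.local_r.continuous

/-- A bisection: an open set on which `d` and `r` are injective (hence homeomorphisms onto open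
sets, since `d` and `r` are local homeomorphisms). -/
structure IsBisection (U : Set G) : Prop where
  isOpen : IsOpen U
  injOn_d : Set.InjOn 𝓖.d U
  injOn_r : Set.InjOn 𝓖.r U

/-- The product of sets in a groupoid. -/
def setMul (U V : Set G) : Set G := {ζ | ∃ γ ∈ U, ∃ η ∈ V, 𝓖.IsProd γ η ζ}

variable {𝓖}

theorem continuousOn_lift {Z : Type*} [TopologicalSpace Z] {U : Set G} (hU : IsOpen U)
    {ρ : G → Y} (hρ : IsLocalHomeomorph ρ) (hi : Set.InjOn ρ U) {D : Set Z} {g : Z → Y}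
    (hg : ContinuousOn g D) {α : Z → G} (hα : ∀ z ∈ D, α z ∈ U ∧ ρ (α z) = g z) :
    ContinuousOn α D := by
  intro z hz
  rw [ContinuousWithinAt, tendsto_nhds]
  intro W hW hzW
  have h1 : ρ '' (U ∩ W) ∈ 𝓝 (g z) :=
    (hρ.isOpenMap _ (hU.inter hW)).mem_nhds ⟨α z, ⟨(hα z hz).1, hzW⟩, (hα z hz).2⟩
  filter_upwards [hg z hz h1, self_mem_nhdsWithin] with z' h2 hz'
  obtain ⟨ω, ⟨hωU, hωW⟩, hω⟩ := h2
  have : α z' = ω := hi (hα z' hz').1 hωU (by rw [(hα z' hz').2, hω])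
  rw [Set.mem_preimage, this]
  exact hωW

theorem IsBisection.injOn_r_setMul {U V : Set G} (hU : 𝓖.IsBisection U) (hV : 𝓖.IsBisection V) :
    Set.InjOn 𝓖.r (𝓖.setMul U V) := by
  rintro ζ ⟨γ, hγ, η, hη, h⟩ ζ' ⟨γ', hγ', η', hη', h'⟩ e
  have h1 : γ = γ' := hU.injOn_r hγ hγ' (by rw [h.r_eq, h'.r_eq, e])
  subst h1
  have h2 : η = η' := hV.injOn_r hη hη' (by rw [← h.1, ← h'.1])
  subst h2
  rw [← h.2, ← h'.2]

/-- For `ζ ∈ U V`, the factor in `U`; it depends continuously on `ζ`. -/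
theorem IsBisection.exists_factor {U V : Set G} (hU : 𝓖.IsBisection U) :
    ∃ α : G → G, ContinuousOn α {ζ | 𝓖.r ζ ∈ 𝓖.r '' U} ∧
      ContinuousOn (fun ζ => 𝓖.mul (𝓖.inv (α ζ)) ζ) {ζ | 𝓖.r ζ ∈ 𝓖.r '' U} ∧
      (∀ ζ, 𝓖.r ζ ∈ 𝓖.r '' U → α ζ ∈ U ∧ 𝓖.r (α ζ) = 𝓖.r ζ) ∧
      𝓖.setMul U V = {ζ | 𝓖.r ζ ∈ 𝓖.r '' U ∧ 𝓖.mul (𝓖.inv (α ζ)) ζ ∈ V} := by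
  classical
  let α : G → G := fun ζ => if h : 𝓖.r ζ ∈ 𝓖.r '' U then h.choose else ζ
  have hα : ∀ ζ, 𝓖.r ζ ∈ 𝓖.r '' U → α ζ ∈ U ∧ 𝓖.r (α ζ) = 𝓖.r ζ := fun ζ h => by
    simp only [α, dif_pos h]
    exact h.choose_spec
  have hc : ContinuousOn α {ζ | 𝓖.r ζ ∈ 𝓖.r '' U} :=
    continuousOn_lift hU.isOpen 𝓖.local_r hU.injOn_r 𝓖.continuous_r.continuousOn fun ζ h => hα ζ h
  refine ⟨α, hc, ?_, hα, ?_⟩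
  · refine 𝓖.continuousOn_mul.comp
      ((𝓖.continuous_inv.comp_continuousOn hc).prodMk continuousOn_id) fun ζ hζ => ?_
    change 𝓖.d (𝓖.inv (α ζ)) = 𝓖.r ζ
    rw [𝓖.d_inv, (hα ζ hζ).2]
  · ext ζ
    constructor
    · rintro ⟨γ, hγ, η, hη, h⟩
      have h1 : 𝓖.r ζ ∈ 𝓖.r '' U := ⟨γ, hγ, h.r_eq⟩
      have h2 : α ζ = γ := hU.injOn_r (hα ζ h1).1 hγ (by rw [(hα ζ h1).2, h.r_eq])
      refine ⟨h1, ?_⟩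
      rw [h2, h.inv_mul_eq]
      exact hη
    · rintro ⟨h1, h2⟩
      exact ⟨α ζ, (hα ζ h1).1, _, h2, 𝓖.isProd_inv_mul (hα ζ h1).2⟩

theorem IsBisection.setMul {U V : Set G} (hU : 𝓖.IsBisection U) (hV : 𝓖.IsBisection V) :
    𝓖.IsBisection (𝓖.setMul U V) where
  isOpen := by
    obtain ⟨α, -, hc, -, he⟩ := hU.exists_factor (V := V)
    rw [he]
    exact hc.isOpen_inter_preimage
      ((𝓖.local_r.isOpenMap _ hU.isOpen).preimage 𝓖.continuous_r) hV.isOpen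
  injOn_r := hU.injOn_r_setMul hV
  injOn_d := by
    rintro ζ ⟨γ, hγ, η, hη, h⟩ ζ' ⟨γ', hγ', η', hη', h'⟩ e
    have h1 : η = η' := hV.injOn_d hη hη' (by rw [h.d_eq, h'.d_eq, e])
    subst h1
    have h2 : γ = γ' := hU.injOn_d hγ hγ' (by rw [h.1, h'.1])
    subst h2
    rw [← h.2, ← h'.2]

variable (𝓖)

/-- A semigroup of bisections that covers the groupoid. -/
structure CoveringSemigroup where
  sets : Set (Set G)
  bis : ∀ U ∈ sets, 𝓖.IsBisection U
  mul_mem : ∀ U ∈ sets, ∀ V ∈ sets, 𝓖.setMul U V ∈ sets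
  covers : ∀ γ, ∃ U ∈ sets, γ ∈ U

end EtaleGroupoid

open Bundle (TotalSpace) in
/-- A twist over the étale groupoid: a Fell line bundle `L` (over `𝕜`, that is `ℝ` or `ℂ`). -/
structure Twist (𝕜 : Type*) [RCLike 𝕜] {Y G : Type*} [TopologicalSpace Y] [TopologicalSpace G]
    (𝓖 : EtaleGroupoid Y G) (L : G → Type*) [∀ γ, NormedAddCommGroup (L γ)]
    [∀ γ, NormedSpace 𝕜 (L γ)] [TopologicalSpace (TotalSpace 𝕜 L)] where
  continuous_proj : Continuous (TotalSpace.proj : TotalSpace 𝕜 L → G)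
  isOpenMap_proj : IsOpenMap (TotalSpace.proj : TotalSpace 𝕜 L → G)
  finrank : ∀ γ, Module.finrank 𝕜 (L γ) = 1
  continuous_add : Continuous fun p : {p : TotalSpace 𝕜 L × TotalSpace 𝕜 L // p.2.1 = p.1.1} =>
    (⟨p.1.1.1, p.1.1.2 + p.2 ▸ p.1.2.2⟩ : TotalSpace 𝕜 L)
  continuous_smul : Continuous fun p : 𝕜 × TotalSpace 𝕜 L =>
    (⟨p.2.1, p.1 • p.2.2⟩ : TotalSpace 𝕜 L)
  continuous_norm : Continuous fun z : TotalSpace 𝕜 L => ‖z.2‖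
  mul : ∀ {γ η ζ}, 𝓖.IsProd γ η ζ → L γ →ₗ[𝕜] L η →ₗ[𝕜] L ζ
  mul_assoc : ∀ {α β γ αβ βγ ζ} (h₁ : 𝓖.IsProd α β αβ) (h₂ : 𝓖.IsProd αβ γ ζ)
    (h₃ : 𝓖.IsProd β γ βγ) (h₄ : 𝓖.IsProd α βγ ζ) (x : L α) (y : L β) (z : L γ),
    mul h₂ (mul h₁ x y) z = mul h₄ x (mul h₃ y z)
  norm_mul : ∀ {γ η ζ} (h : 𝓖.IsProd γ η ζ) (x : L γ) (y : L η), ‖mul h x y‖ = ‖x‖ * ‖y‖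
  continuous_mul : Continuous
    fun p : {p : TotalSpace 𝕜 L × TotalSpace 𝕜 L // 𝓖.d p.1.1 = 𝓖.r p.2.1} =>
      (⟨𝓖.mul p.1.1.1 p.1.2.1, mul ⟨p.2, rfl⟩ p.1.1.2 p.1.2.2⟩ : TotalSpace 𝕜 L)
  /-- the unit of the algebra `L_y`, which is isomorphic to `𝕜`, for a unit `y` -/
  one : ∀ y, L (𝓖.unit y)
  one_mul : ∀ γ (z : L γ), mul (𝓖.isProd_unit_mul γ) (one (𝓖.r γ)) z = z
  mul_one : ∀ γ (z : L γ), mul (𝓖.isProd_mul_unit γ) z (one (𝓖.d γ)) = z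
  star : ∀ γ, L γ →ₛₗ[starRingEnd 𝕜] L (𝓖.inv γ)
  norm_star : ∀ γ (z : L γ), ‖star γ z‖ = ‖z‖
  star_star : ∀ γ (z : L γ),
    (⟨𝓖.inv (𝓖.inv γ), star _ (star γ z)⟩ : TotalSpace 𝕜 L) = ⟨γ, z⟩
  star_mul : ∀ {γ η ζ} (h : 𝓖.IsProd γ η ζ) (h' : 𝓖.IsProd (𝓖.inv η) (𝓖.inv γ) (𝓖.inv ζ))
    (x : L γ) (y : L η), star ζ (mul h x y) = mul h' (star η y) (star γ x)
  mul_star : ∀ γ (z : L γ),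
    mul (𝓖.isProd_mul_inv γ) z (star γ z) = ((‖z‖ ^ 2 : ℝ) : 𝕜) • one (𝓖.r γ)
  continuous_star : Continuous fun z : TotalSpace 𝕜 L =>
    (⟨𝓖.inv z.1, star z.1 z.2⟩ : TotalSpace 𝕜 L)

/-! ### The convolution algebra of a twisted groupoid -/

namespace Twist

open Bundle (TotalSpace)

variable {𝕜 : Type*} [RCLike 𝕜] {Y G : Type*} [TopologicalSpace Y] [TopologicalSpace G]
  {𝓖 : EtaleGroupoid Y G} {L : G → Type*} [∀ γ, NormedAddCommGroup (L γ)]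
  [∀ γ, NormedSpace 𝕜 (L γ)] [TopologicalSpace (TotalSpace 𝕜 L)]

section Continuity

variable {Z : Type*} [TopologicalSpace Z] {D : Set Z}

theorem continuousOn_add (𝓛 : Twist 𝕜 𝓖 L) {g : Z → G} {f f' : ∀ z, L (g z)}
    (hf : ContinuousOn (fun z => (⟨g z, f z⟩ : TotalSpace 𝕜 L)) D)
    (hf' : ContinuousOn (fun z => (⟨g z, f' z⟩ : TotalSpace 𝕜 L)) D) :
    ContinuousOn (fun z => (⟨g z, f z + f' z⟩ : TotalSpace 𝕜 L)) D := by
  rw [continuousOn_iff_continuous_domRestrict] at *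
  exact 𝓛.continuous_add.comp
    (Continuous.subtype_mk (hf.prodMk hf') (fun z => (rfl : g z.1 = g z.1)))

theorem continuousOn_smul (𝓛 : Twist 𝕜 𝓖 L) {g : Z → G} {c : Z → 𝕜} {f : ∀ z, L (g z)}
    (hc : ContinuousOn c D) (hf : ContinuousOn (fun z => (⟨g z, f z⟩ : TotalSpace 𝕜 L)) D) :
    ContinuousOn (fun z => (⟨g z, c z • f z⟩ : TotalSpace 𝕜 L)) D :=
  𝓛.continuous_smul.comp_continuousOn (hc.prodMk hf)

theorem continuousOn_mul (𝓛 : Twist 𝕜 𝓖 L) {g g' k : Z → G} {f : ∀ z, L (g z)}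
    {f' : ∀ z, L (g' z)} (h : ∀ z ∈ D, 𝓖.IsProd (g z) (g' z) (k z)) {F : ∀ z, L (k z)}
    (hF : ∀ z (hz : z ∈ D), F z = 𝓛.mul (h z hz) (f z) (f' z))
    (hf : ContinuousOn (fun z => (⟨g z, f z⟩ : TotalSpace 𝕜 L)) D)
    (hf' : ContinuousOn (fun z => (⟨g' z, f' z⟩ : TotalSpace 𝕜 L)) D) :
    ContinuousOn (fun z => (⟨k z, F z⟩ : TotalSpace 𝕜 L)) D := by
  rw [continuousOn_iff_continuous_domRestrict] at *
  have h1 := 𝓛.continuous_mul.comp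
    (Continuous.subtype_mk (hf.prodMk hf') (fun z => (h z.1 z.2).1))
  refine h1.congr fun z => ?_
  have key : ∀ (ζ : G) (hp : 𝓖.IsProd (g z.1) (g' z.1) ζ),
      (⟨𝓖.mul (g z.1) (g' z.1), 𝓛.mul ⟨hp.1, rfl⟩ (f z.1) (f' z.1)⟩ : TotalSpace 𝕜 L)
        = ⟨ζ, 𝓛.mul hp (f z.1) (f' z.1)⟩ := by
    rintro _ ⟨hp, rfl⟩
    rfl
  change _ = (⟨k z.1, F z.1⟩ : TotalSpace 𝕜 L)
  rw [hF z.1 z.2]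
  exact key _ _

theorem continuous_zero (𝓛 : Twist 𝕜 𝓖 L) : Continuous fun γ : G => (⟨γ, 0⟩ : TotalSpace 𝕜 L) := by
  rw [continuous_iff_continuousAt]
  intro γ
  rw [ContinuousAt, tendsto_nhds]
  intro W hW hγ
  have h1 : (fun p : 𝕜 × TotalSpace 𝕜 L => (⟨p.2.1, p.1 • p.2.2⟩ : TotalSpace 𝕜 L)) ⁻¹' W
      ∈ 𝓝 ((0 : 𝕜), (⟨γ, 0⟩ : TotalSpace 𝕜 L)) := by
    refine (hW.preimage 𝓛.continuous_smul).mem_nhds ?_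
    simpa using hγ
  obtain ⟨V, hV, W', hW', hsub⟩ := mem_nhds_prod_iff.1 h1
  filter_upwards [𝓛.isOpenMap_proj.image_mem_nhds hW']
  rintro _ ⟨z, hz, rfl⟩
  have := hsub (Set.mk_mem_prod (mem_of_mem_nhds hV) hz)
  simpa using this

end Continuity

/-- `C_c(U, L)`: the sections of the bundle that are continuous on the open set `U` and vanish
outside of a compact subset of `U`. -/
def Cc (𝓛 : Twist 𝕜 𝓖 L) (U : Set G) : Submodule 𝕜 (∀ γ, L γ) where
  carrier := {f | ContinuousOn (fun γ => (⟨γ, f γ⟩ : TotalSpace 𝕜 L)) U ∧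
    ∃ K ⊆ U, IsCompact K ∧ ∀ γ, γ ∉ K → f γ = 0}
  add_mem' := by
    rintro f f' ⟨hf, K, hKU, hK, hfK⟩ ⟨hf', K', hKU', hK', hfK'⟩
    refine ⟨𝓛.continuousOn_add hf hf', K ∪ K', Set.union_subset hKU hKU', hK.union hK',
      fun γ hγ => ?_⟩
    rw [Pi.add_apply, hfK γ fun h => hγ (Or.inl h), hfK' γ fun h => hγ (Or.inr h), add_zero]
  zero_mem' := ⟨𝓛.continuous_zero.continuousOn, ∅, Set.empty_subset _, isCompact_empty,
    fun _ _ => rfl⟩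
  smul_mem' := by
    rintro c f ⟨hf, K, hKU, hK, hfK⟩
    refine ⟨𝓛.continuousOn_smul continuousOn_const hf, K, hKU, hK, fun γ hγ => ?_⟩
    rw [Pi.smul_apply, hfK γ hγ, smul_zero]

theorem eq_zero_of_mem_Cc {𝓛 : Twist 𝕜 𝓖 L} {U : Set G} {f : ∀ γ, L γ} (hf : f ∈ 𝓛.Cc U) {γ : G}
    (hγ : γ ∉ U) : f γ = 0 := by
  obtain ⟨-, K, hKU, -, hK⟩ := hf
  exact hK γ fun h => hγ (hKU h)

/-- The space of quasi-continuous compactly supported sections: the span of the spaces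
`C_c(U, L)` for all bisections `U`. -/
def sections (𝓛 : Twist 𝕜 𝓖 L) : Submodule 𝕜 (∀ γ, L γ) :=
  ⨆ U : {U : Set G // 𝓖.IsBisection U}, 𝓛.Cc U.1

/-- The convolution `(f * g)(ζ) = ∑_{r(η) = r(ζ)} f(η) g(η⁻¹ ζ)`. -/
def conv (𝓛 : Twist 𝕜 𝓖 L) (f g : ∀ γ, L γ) (ζ : G) : L ζ :=
  ∑ᶠ η : {η : G // 𝓖.r η = 𝓖.r ζ},
    𝓛.mul (𝓖.isProd_inv_mul η.2) (f η.1) (g (𝓖.mul (𝓖.inv η.1) ζ))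

theorem mul_congr (𝓛 : Twist 𝕜 𝓖 L) (f g : ∀ γ, L γ) {γ η η' ζ : G} (h : 𝓖.IsProd γ η ζ)
    (h' : 𝓖.IsProd γ η' ζ) : 𝓛.mul h (f γ) (g η) = 𝓛.mul h' (f γ) (g η') := by
  obtain rfl : η = η' := by rw [← h.inv_mul_eq, ← h'.inv_mul_eq]
  rfl

theorem conv_apply (𝓛 : Twist 𝕜 𝓖 L) {U : Set G} (hU : Set.InjOn 𝓖.r U) {f : ∀ γ, L γ}
    (hf : ∀ γ, γ ∉ U → f γ = 0) (g : ∀ γ, L γ) {γ η ζ : G} (hγ : γ ∈ U) (h : 𝓖.IsProd γ η ζ) :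
    𝓛.conv f g ζ = 𝓛.mul h (f γ) (g η) := by
  rw [conv, finsum_eq_single _ ⟨γ, h.r_eq⟩]
  · exact 𝓛.mul_congr f g _ _
  · rintro ⟨γ', hγ'⟩ hne
    have : γ' ∉ U := fun h' => hne (Subtype.ext (hU h' hγ (by rw [hγ', h.r_eq])))
    rw [hf γ' this, map_zero, LinearMap.zero_apply]

theorem conv_eq_zero (𝓛 : Twist 𝕜 𝓖 L) {U : Set G} {f : ∀ γ, L γ}
    (hf : ∀ γ, γ ∉ U → f γ = 0) (g : ∀ γ, L γ) {ζ : G} (hζ : 𝓖.r ζ ∉ 𝓖.r '' U) :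
    𝓛.conv f g ζ = 0 := by
  rw [conv]
  refine finsum_eq_zero_of_forall_eq_zero ?_
  rintro ⟨γ', hγ'⟩
  have : γ' ∉ U := fun h' => hζ ⟨γ', h', hγ'⟩
  rw [hf γ' this, map_zero, LinearMap.zero_apply]

theorem finite_fibre {𝓛 : Twist 𝕜 𝓖 L} {f : ∀ γ, L γ} (hf : f ∈ 𝓛.sections) (y : Y) :
    {η : G | 𝓖.r η = y ∧ f η ≠ 0}.Finite := by
  refine Submodule.iSup_induction (p := fun U : {U : Set G // 𝓖.IsBisection U} => 𝓛.Cc U.1)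
    (motive := fun f => {η : G | 𝓖.r η = y ∧ f η ≠ 0}.Finite) hf ?_ ?_ ?_
  · rintro ⟨U, hU⟩ f hf
    refine Set.Subsingleton.finite ?_
    rintro η ⟨h1, h2⟩ η' ⟨h1', h2'⟩
    have h3 : η ∈ U := by by_contra h; exact h2 (eq_zero_of_mem_Cc hf h)
    have h3' : η' ∈ U := by by_contra h; exact h2' (eq_zero_of_mem_Cc hf h)
    exact hU.injOn_r h3 h3' (h1.trans h1'.symm)
  · simp
  · intro f g hf hg
    refine (hf.union hg).subset ?_
    rintro η ⟨h1, h2⟩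
    by_cases h3 : f η = 0
    · exact Or.inr ⟨h1, fun h4 => h2 (by rw [Pi.add_apply, h3, h4, add_zero])⟩
    · exact Or.inl ⟨h1, h3⟩

theorem finite_support {𝓛 : Twist 𝕜 𝓖 L} {f : ∀ γ, L γ} (hf : f ∈ 𝓛.sections) (g : ∀ γ, L γ)
    (ζ : G) : (Function.support fun η : {η : G // 𝓖.r η = 𝓖.r ζ} =>
      𝓛.mul (𝓖.isProd_inv_mul η.2) (f η.1) (g (𝓖.mul (𝓖.inv η.1) ζ))).Finite := by
  refine ((finite_fibre hf (𝓖.r ζ)).preimage (Subtype.val_injective.injOn)).subset ?_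
  rintro ⟨η, hη⟩ h
  refine ⟨hη, fun h0 => h ?_⟩
  simp only [h0, map_zero, LinearMap.zero_apply]

theorem conv_add_left {𝓛 : Twist 𝕜 𝓖 L} {f f' : ∀ γ, L γ} (hf : f ∈ 𝓛.sections)
    (hf' : f' ∈ 𝓛.sections) (g : ∀ γ, L γ) : 𝓛.conv (f + f') g = 𝓛.conv f g + 𝓛.conv f' g := by
  funext ζ
  rw [Pi.add_apply, conv, conv, conv,
    ← finsum_add_distrib (finite_support hf g ζ) (finite_support hf' g ζ)]
  simp only [Pi.add_apply, map_add, LinearMap.add_apply]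

theorem conv_add_right {𝓛 : Twist 𝕜 𝓖 L} {f : ∀ γ, L γ} (hf : f ∈ 𝓛.sections)
    (g g' : ∀ γ, L γ) : 𝓛.conv f (g + g') = 𝓛.conv f g + 𝓛.conv f g' := by
  funext ζ
  rw [Pi.add_apply, conv, conv, conv,
    ← finsum_add_distrib (finite_support hf g ζ) (finite_support hf g' ζ)]
  simp only [Pi.add_apply, map_add]

theorem conv_smul_left (𝓛 : Twist 𝕜 𝓖 L) (c : 𝕜) (f g : ∀ γ, L γ) :
    𝓛.conv (c • f) g = c • 𝓛.conv f g := by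
  funext ζ
  rw [Pi.smul_apply, conv, conv, smul_finsum]
  simp only [Pi.smul_apply, map_smul, LinearMap.smul_apply]

theorem conv_smul_right (𝓛 : Twist 𝕜 𝓖 L) (c : 𝕜) (f g : ∀ γ, L γ) :
    𝓛.conv f (c • g) = c • 𝓛.conv f g := by
  funext ζ
  rw [Pi.smul_apply, conv, conv, smul_finsum]
  simp only [Pi.smul_apply, map_smul]

theorem conv_zero_left (𝓛 : Twist 𝕜 𝓖 L) (g : ∀ γ, L γ) : 𝓛.conv 0 g = 0 := by
  have := 𝓛.conv_smul_left 0 0 g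
  rwa [zero_smul, zero_smul] at this

theorem conv_zero_right (𝓛 : Twist 𝕜 𝓖 L) (f : ∀ γ, L γ) : 𝓛.conv f 0 = 0 := by
  have := 𝓛.conv_smul_right 0 f 0
  rwa [zero_smul, zero_smul] at this

theorem conv_mem_Cc [T2Space Y] {𝓛 : Twist 𝕜 𝓖 L} {U V : Set G} (hU : 𝓖.IsBisection U)
    {f g : ∀ γ, L γ} (hf : f ∈ 𝓛.Cc U) (hg : g ∈ 𝓛.Cc V) :
    𝓛.conv f g ∈ 𝓛.Cc (𝓖.setMul U V) := by
  obtain ⟨α, hα, hβ, hm, he⟩ := hU.exists_factor (V := V)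
  have hf0 : ∀ γ, γ ∉ U → f γ = 0 := fun γ => eq_zero_of_mem_Cc hf
  have hsub : 𝓖.setMul U V ⊆ {ζ | 𝓖.r ζ ∈ 𝓖.r '' U} := by rw [he]; exact fun ζ h => h.1
  obtain ⟨hfc, K, hKU, hK, hfK⟩ := hf
  obtain ⟨hgc, K', hKV, hK', hgK⟩ := hg
  refine ⟨?_, (fun p : G × G => 𝓖.mul p.1 p.2) '' ((K ×ˢ K') ∩ {p | 𝓖.d p.1 = 𝓖.r p.2}), ?_, ?_, ?_⟩
  · refine 𝓛.continuousOn_mul (g := α) (g' := fun ζ => 𝓖.mul (𝓖.inv (α ζ)) ζ)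
      (f := fun ζ => f (α ζ)) (f' := fun ζ => g (𝓖.mul (𝓖.inv (α ζ)) ζ))
      (fun ζ hζ => 𝓖.isProd_inv_mul (hm ζ (hsub hζ)).2) (fun ζ hζ => ?_) ?_ ?_
    · exact 𝓛.conv_apply hU.injOn_r hf0 g (hm ζ (hsub hζ)).1 _
    · exact hfc.comp (hα.mono hsub) fun ζ hζ => (hm ζ (hsub hζ)).1
    · refine hgc.comp (hβ.mono hsub) fun ζ hζ => ?_
      rw [he] at hζ
      exact hζ.2
  · rintro _ ⟨⟨γ, η⟩, ⟨⟨h1, h2⟩, h3⟩, rfl⟩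
    exact ⟨γ, hKU h1, η, hKV h2, h3, rfl⟩
  · refine IsCompact.image_of_continuousOn ?_ (𝓖.continuousOn_mul.mono Set.inter_subset_right)
    exact (hK.prod hK').inter_right
      (isClosed_eq (𝓖.continuous_d.comp continuous_fst) (𝓖.continuous_r.comp continuous_snd))
  · intro ζ hζ
    by_cases h1 : 𝓖.r ζ ∈ 𝓖.r '' U
    · have hp := 𝓖.isProd_inv_mul (hm ζ h1).2
      rw [𝓛.conv_apply hU.injOn_r hf0 g (hm ζ h1).1 hp]
      by_cases h2 : α ζ ∈ K
      · by_cases h3 : 𝓖.mul (𝓖.inv (α ζ)) ζ ∈ K'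
        · exact absurd ⟨(α ζ, _), ⟨⟨h2, h3⟩, hp.1⟩, hp.2⟩ hζ
        · rw [hgK _ h3, map_zero]
      · rw [hfK _ h2, map_zero, LinearMap.zero_apply]
    · exact 𝓛.conv_eq_zero hf0 g h1

theorem Cc_le_sections (𝓛 : Twist 𝕜 𝓖 L) {U : Set G} (hU : 𝓖.IsBisection U) :
    𝓛.Cc U ≤ 𝓛.sections :=
  le_iSup (fun U : {U : Set G // 𝓖.IsBisection U} => 𝓛.Cc U.1) ⟨U, hU⟩

theorem sections_induction {𝓛 : Twist 𝕜 𝓖 L} {P : (∀ γ, L γ) → Prop} {f : ∀ γ, L γ}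
    (hf : f ∈ 𝓛.sections) (h : ∀ U, 𝓖.IsBisection U → ∀ f ∈ 𝓛.Cc U, P f) (h0 : P 0)
    (hadd : ∀ f g, f ∈ 𝓛.sections → g ∈ 𝓛.sections → P f → P g → P (f + g)) : P f := by
  refine (Submodule.iSup_induction
    (p := fun U : {U : Set G // 𝓖.IsBisection U} => 𝓛.Cc U.1)
    (motive := fun f => f ∈ 𝓛.sections ∧ P f) hf ?_ ?_ ?_).2
  · rintro ⟨U, hU⟩ f hf
    exact ⟨𝓛.Cc_le_sections hU hf, h U hU f hf⟩
  · exact ⟨zero_mem _, h0⟩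
  · rintro f g ⟨hf, hf'⟩ ⟨hg, hg'⟩
    exact ⟨add_mem hf hg, hadd f g hf hg hf' hg'⟩

theorem conv_mem [T2Space Y] {𝓛 : Twist 𝕜 𝓖 L} {f g : ∀ γ, L γ} (hf : f ∈ 𝓛.sections)
    (hg : g ∈ 𝓛.sections) : 𝓛.conv f g ∈ 𝓛.sections := by
  refine sections_induction (P := fun f => 𝓛.conv f g ∈ 𝓛.sections) hf (fun U hU f hfU => ?_) ?_ fun f f' hf hf' h h' => ?_
  · refine sections_induction (P := fun g => 𝓛.conv f g ∈ 𝓛.sections) hg (fun V hV g hgV => ?_) ?_ fun g g' hg hg' h h' => ?_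
    · exact 𝓛.Cc_le_sections (hU.setMul hV) (conv_mem_Cc hU hfU hgV)
    · rw [conv_zero_right]; exact zero_mem _
    · rw [conv_add_right (𝓛.Cc_le_sections hU hfU)]; exact add_mem h h'
  · rw [conv_zero_left]; exact zero_mem _
  · rw [conv_add_left hf hf']; exact add_mem h h'

theorem conv_assoc [T2Space Y] {𝓛 : Twist 𝕜 𝓖 L} {f g : ∀ γ, L γ} (k : ∀ γ, L γ)
    (hf : f ∈ 𝓛.sections) (hg : g ∈ 𝓛.sections) :
    𝓛.conv (𝓛.conv f g) k = 𝓛.conv f (𝓛.conv g k) := by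
  refine sections_induction
    (P := fun f => 𝓛.conv (𝓛.conv f g) k = 𝓛.conv f (𝓛.conv g k)) hf (fun U hU f hfU => ?_) ?_ fun f f' hf hf' h h' => ?_
  · have hfs := 𝓛.Cc_le_sections hU hfU
    refine sections_induction
      (P := fun g => 𝓛.conv (𝓛.conv f g) k = 𝓛.conv f (𝓛.conv g k)) hg (fun V hV g hgV => ?_) ?_ fun g g' hg hg' h h' => ?_
    · have hf0 : ∀ γ, γ ∉ U → f γ = 0 := fun γ => eq_zero_of_mem_Cc hfU
      have hg0 : ∀ γ, γ ∉ V → g γ = 0 := fun γ => eq_zero_of_mem_Cc hgV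
      have hfg0 : ∀ γ, γ ∉ 𝓖.setMul U V → 𝓛.conv f g γ = 0 :=
        fun γ => eq_zero_of_mem_Cc (conv_mem_Cc hU hfU hgV)
      funext ζ
      by_cases h1 : 𝓖.r ζ ∈ 𝓖.r '' U
      · obtain ⟨α, hα, hαζ⟩ := h1
        have hp := 𝓖.isProd_inv_mul hαζ
        rw [𝓛.conv_apply hU.injOn_r hf0 _ hα hp]
        set δ := 𝓖.mul (𝓖.inv α) ζ with hδ
        by_cases h2 : 𝓖.r δ ∈ 𝓖.r '' V
        · obtain ⟨β, hβ, hβδ⟩ := h2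
          have hq := 𝓖.isProd_inv_mul hβδ
          rw [𝓛.conv_apply hV.injOn_r hg0 _ hβ hq]
          have hab : 𝓖.IsProd α β (𝓖.mul α β) := ⟨by rw [hp.1, hβδ], rfl⟩
          have habc : 𝓖.IsProd (𝓖.mul α β) (𝓖.mul (𝓖.inv β) δ) ζ :=
            ⟨by rw [hab.d_eq.symm, hq.1], by rw [𝓖.mul_assoc _ _ _ hab.1 hq.1, hq.2, hp.2]⟩
          rw [𝓛.conv_apply (hU.injOn_r_setMul hV) hfg0 _ ⟨α, hα, β, hβ, hab⟩ habc,
            𝓛.conv_apply hU.injOn_r hf0 _ hα hab]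
          exact 𝓛.mul_assoc hab habc hq hp _ _ _
        · rw [𝓛.conv_eq_zero hg0 k h2, map_zero]
          refine 𝓛.conv_eq_zero hfg0 k ?_
          rintro ⟨_, ⟨α', hα', β, hβ, hab⟩, hr⟩
          have : α' = α := hU.injOn_r hα' hα (by rw [hab.r_eq, hr, hαζ])
          subst this
          exact h2 ⟨β, hβ, by rw [← hab.1, hp.1]⟩
      · rw [𝓛.conv_eq_zero hf0 _ h1]
        refine 𝓛.conv_eq_zero hfg0 k ?_
        rintro ⟨_, ⟨α', hα', β, hβ, hab⟩, hr⟩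
        exact h1 ⟨α', hα', by rw [hab.r_eq, hr]⟩
    · rw [conv_zero_right, conv_zero_left, conv_zero_right]
    · rw [conv_add_right hfs, conv_add_left (conv_mem hfs hg) (conv_mem hfs hg'),
        conv_add_left hg hg', conv_add_right hfs, h, h']
  · rw [conv_zero_left, conv_zero_left, conv_zero_left]
  · rw [conv_add_left hf hf', conv_add_left (conv_mem hf hg) (conv_mem hf' hg),
      conv_add_left hf hf', h, h']

/-- The algebra of quasi-continuous compactly supported sections, with the convolution. -/
def Alg (𝓛 : Twist 𝕜 𝓖 L) : Type _ := 𝓛.sections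

instance (𝓛 : Twist 𝕜 𝓖 L) : AddCommGroup 𝓛.Alg := inferInstanceAs (AddCommGroup 𝓛.sections)
instance (𝓛 : Twist 𝕜 𝓖 L) : Module 𝕜 𝓛.Alg := inferInstanceAs (Module 𝕜 𝓛.sections)

/-- The section underlying an element of the algebra. -/
def Alg.val {𝓛 : Twist 𝕜 𝓖 L} (f : 𝓛.Alg) : ∀ γ, L γ := (show 𝓛.sections from f).1

theorem Alg.mem {𝓛 : Twist 𝕜 𝓖 L} (f : 𝓛.Alg) : f.val ∈ 𝓛.sections :=
  (show 𝓛.sections from f).2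

theorem Alg.ext {𝓛 : Twist 𝕜 𝓖 L} {f g : 𝓛.Alg} (h : f.val = g.val) : f = g := Subtype.ext h

theorem Alg.val_add {𝓛 : Twist 𝕜 𝓖 L} (f g : 𝓛.Alg) : (f + g).val = f.val + g.val := rfl

theorem Alg.val_smul {𝓛 : Twist 𝕜 𝓖 L} (c : 𝕜) (f : 𝓛.Alg) : (c • f).val = c • f.val := rfl

variable [T2Space Y]

instance (𝓛 : Twist 𝕜 𝓖 L) : Mul 𝓛.Alg :=
  ⟨fun f g => (⟨𝓛.conv f.val g.val, conv_mem f.mem g.mem⟩ : 𝓛.sections)⟩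

theorem Alg.val_mul {𝓛 : Twist 𝕜 𝓖 L} (f g : 𝓛.Alg) : (f * g).val = 𝓛.conv f.val g.val := rfl

instance (𝓛 : Twist 𝕜 𝓖 L) : NonUnitalRing 𝓛.Alg :=
  { (inferInstance : AddCommGroup 𝓛.Alg), (inferInstance : Mul 𝓛.Alg) with
    left_distrib := fun f g k => Alg.ext (conv_add_right f.mem g.val k.val)
    right_distrib := fun f g k => Alg.ext (conv_add_left f.mem g.mem k.val)
    zero_mul := fun f => Alg.ext (𝓛.conv_zero_left f.val)
    mul_zero := fun f => Alg.ext (𝓛.conv_zero_right f.val)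
    mul_assoc := fun f g k => Alg.ext (conv_assoc k.val f.mem g.mem) }

instance (𝓛 : Twist 𝕜 𝓖 L) : IsScalarTower 𝕜 𝓛.Alg 𝓛.Alg :=
  ⟨fun c f g => Alg.ext (𝓛.conv_smul_left c f.val g.val)⟩

instance (𝓛 : Twist 𝕜 𝓖 L) : SMulCommClass 𝕜 𝓛.Alg 𝓛.Alg :=
  ⟨fun c f g => Alg.ext (𝓛.conv_smul_right c f.val g.val).symm⟩

end Twist

/-! ### The groupoid Banach algebras -/

namespace Twist

open Bundle (TotalSpace)

variable {𝕜 : Type*} [RCLike 𝕜] {Y G : Type*} [TopologicalSpace Y] [TopologicalSpace G]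
  {𝓖 : EtaleGroupoid Y G} {L : G → Type*} [∀ γ, NormedAddCommGroup (L γ)]
  [∀ γ, NormedSpace 𝕜 (L γ)] [TopologicalSpace (TotalSpace 𝕜 L)]

/-- The supremum norm of a section. -/
def supNorm (f : ∀ γ, L γ) : ℝ := ⨆ γ, ‖f γ‖

theorem supNorm_nonneg (f : ∀ γ, L γ) : 0 ≤ supNorm f := Real.iSup_nonneg fun _ => norm_nonneg _

theorem norm_le_supNorm {𝓛 : Twist 𝕜 𝓖 L} {U : Set G} {f : ∀ γ, L γ} (hf : f ∈ 𝓛.Cc U) (γ : G) :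
    ‖f γ‖ ≤ supNorm f := by
  obtain ⟨hc, K, hKU, hK, hfK⟩ := hf
  have h1 : ContinuousOn (fun γ => ‖f γ‖) K :=
    𝓛.continuous_norm.comp_continuousOn (hc.mono hKU)
  obtain ⟨C, hC⟩ := hK.bddAbove_image h1
  refine le_ciSup (f := fun γ => ‖f γ‖) ⟨max C 0, ?_⟩ γ
  rintro _ ⟨γ, rfl⟩
  by_cases hγ : γ ∈ K
  · exact (hC ⟨γ, hγ, rfl⟩).trans (le_max_left _ _)
  · simp only [hfK γ hγ, norm_zero]
    exact le_max_right _ _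

theorem supNorm_smul (c : 𝕜) (f : ∀ γ, L γ) : supNorm (c • f) = ‖c‖ * supNorm f := by
  rw [supNorm, supNorm, Real.mul_iSup_of_nonneg (norm_nonneg c)]
  simp only [Pi.smul_apply, norm_smul]

theorem supNorm_conv_le {𝓛 : Twist 𝕜 𝓖 L} {U V : Set G} (hU : 𝓖.IsBisection U) {f g : ∀ γ, L γ}
    (hf : f ∈ 𝓛.Cc U) (hg : g ∈ 𝓛.Cc V) :
    supNorm (𝓛.conv f g) ≤ supNorm f * supNorm g := by
  refine Real.iSup_le (fun ζ => ?_) (mul_nonneg (supNorm_nonneg f) (supNorm_nonneg g))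
  by_cases h1 : 𝓖.r ζ ∈ 𝓖.r '' U
  · obtain ⟨γ, hγ, h2⟩ := h1
    rw [𝓛.conv_apply hU.injOn_r (fun _ => eq_zero_of_mem_Cc hf) g hγ (𝓖.isProd_inv_mul h2),
      𝓛.norm_mul]
    exact mul_le_mul (norm_le_supNorm hf _) (norm_le_supNorm hg _) (norm_nonneg _)
      (supNorm_nonneg f)
  · rw [𝓛.conv_eq_zero (fun _ => eq_zero_of_mem_Cc hf) g h1, norm_zero]
    exact mul_nonneg (supNorm_nonneg f) (supNorm_nonneg g)

/-- The set of all numbers `∑ ‖f_k‖_∞`, where `f = ∑ f_k` is a finite sum with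
`f_k ∈ C_c(U_k, L)`, `U_k ∈ 𝒮`. -/
def costs (𝓛 : Twist 𝕜 𝓖 L) (𝒮 : 𝓖.CoveringSemigroup) (f : ∀ γ, L γ) : Set ℝ :=
  {c | ∃ (ι : Type) (_ : Fintype ι) (F : ι → ∀ γ, L γ) (U : ι → Set G),
    (∀ k, U k ∈ 𝒮.sets ∧ F k ∈ 𝓛.Cc (U k)) ∧ f = ∑ k, F k ∧ c = ∑ k, supNorm (F k)}

variable {𝓛 : Twist 𝕜 𝓖 L} {𝒮 : 𝓖.CoveringSemigroup}

theorem zero_mem_costs : 0 ∈ 𝓛.costs 𝒮 0 :=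
  ⟨Empty, inferInstance, fun e => e.elim, fun e => e.elim, fun e => e.elim, by simp, by simp⟩

theorem nonneg_of_mem_costs {f : ∀ γ, L γ} {c : ℝ} (hc : c ∈ 𝓛.costs 𝒮 f) : 0 ≤ c := by
  obtain ⟨ι, _, F, U, -, -, rfl⟩ := hc
  exact Finset.sum_nonneg fun k _ => supNorm_nonneg _

theorem add_mem_costs {f g : ∀ γ, L γ} {c c' : ℝ} (hc : c ∈ 𝓛.costs 𝒮 f)
    (hc' : c' ∈ 𝓛.costs 𝒮 g) : c + c' ∈ 𝓛.costs 𝒮 (f + g) := by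
  obtain ⟨ι, _, F, U, h, rfl, rfl⟩ := hc
  obtain ⟨κ, _, F', U', h', rfl, rfl⟩ := hc'
  refine ⟨ι ⊕ κ, inferInstance, Sum.elim F F', Sum.elim U U', ?_, ?_, ?_⟩
  · rintro (k | k)
    · exact h k
    · exact h' k
  · simp
  · simp

theorem smul_mem_costs (a : 𝕜) {f : ∀ γ, L γ} {c : ℝ} (hc : c ∈ 𝓛.costs 𝒮 f) :
    ‖a‖ * c ∈ 𝓛.costs 𝒮 (a • f) := by
  obtain ⟨ι, _, F, U, h, rfl, rfl⟩ := hc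
  exact ⟨ι, inferInstance, fun k => a • F k, U,
    fun k => ⟨(h k).1, Submodule.smul_mem _ a (h k).2⟩, Finset.smul_sum, by
      simp only [supNorm_smul, Finset.mul_sum]⟩

theorem sum_mem_sections {ι : Type} (s : Finset ι) {F : ι → ∀ γ, L γ} {U : ι → Set G}
    (h : ∀ k, U k ∈ 𝒮.sets ∧ F k ∈ 𝓛.Cc (U k)) : ∑ k ∈ s, F k ∈ 𝓛.sections :=
  Submodule.sum_mem _ fun k _ => 𝓛.Cc_le_sections (𝒮.bis _ (h k).1) (h k).2

theorem conv_sum_right {f : ∀ γ, L γ} (hf : f ∈ 𝓛.sections) {ι : Type} (s : Finset ι)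
    (F : ι → ∀ γ, L γ) : 𝓛.conv f (∑ k ∈ s, F k) = ∑ k ∈ s, 𝓛.conv f (F k) := by
  classical
  induction s using Finset.induction_on with
  | empty => simp [conv_zero_right]
  | insert k s hk ih => rw [Finset.sum_insert hk, Finset.sum_insert hk, conv_add_right hf, ih]

theorem conv_sum_left {ι : Type} (s : Finset ι) {F : ι → ∀ γ, L γ} {U : ι → Set G}
    (h : ∀ k, U k ∈ 𝒮.sets ∧ F k ∈ 𝓛.Cc (U k)) (g : ∀ γ, L γ) :
    𝓛.conv (∑ k ∈ s, F k) g = ∑ k ∈ s, 𝓛.conv (F k) g := by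
  classical
  induction s using Finset.induction_on with
  | empty => simp [conv_zero_left]
  | insert k s hk ih =>
    rw [Finset.sum_insert hk, Finset.sum_insert hk,
      conv_add_left (𝓛.Cc_le_sections (𝒮.bis _ (h k).1) (h k).2) (sum_mem_sections s h), ih]

theorem mul_mem_costs [T2Space Y] {f g : ∀ γ, L γ} {c c' : ℝ} (hc : c ∈ 𝓛.costs 𝒮 f)
    (hc' : c' ∈ 𝓛.costs 𝒮 g) : ∃ c'' ∈ 𝓛.costs 𝒮 (𝓛.conv f g), c'' ≤ c * c' := by
  obtain ⟨ι, _, F, U, h, rfl, rfl⟩ := hc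
  obtain ⟨κ, _, F', U', h', rfl, rfl⟩ := hc'
  refine ⟨∑ q : ι × κ, supNorm (𝓛.conv (F q.1) (F' q.2)), ⟨ι × κ, inferInstance,
    fun q => 𝓛.conv (F q.1) (F' q.2), fun q => 𝓖.setMul (U q.1) (U' q.2), fun q => ⟨?_, ?_⟩, ?_,
    rfl⟩, ?_⟩
  · exact 𝒮.mul_mem _ (h _).1 _ (h' _).1
  · exact conv_mem_Cc (𝒮.bis _ (h _).1) (h _).2 (h' _).2
  · rw [conv_sum_left _ h, Fintype.sum_prod_type]
    exact Finset.sum_congr rfl fun k _ =>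
      conv_sum_right (𝓛.Cc_le_sections (𝒮.bis _ (h k).1) (h k).2) _ _
  · rw [Finset.sum_mul_sum, Fintype.sum_prod_type]
    exact Finset.sum_le_sum fun k _ => Finset.sum_le_sum fun l _ =>
      supNorm_conv_le (𝒮.bis _ (h _).1) (h _).2 (h' _).2

theorem costs_nonempty_of_mem_Cc [T2Space Y] [LocallyCompactSpace Y] {U : Set G}
    (hU : 𝓖.IsBisection U) {f : ∀ γ, L γ} (hf : f ∈ 𝓛.Cc U) : (𝓛.costs 𝒮 f).Nonempty := by
  obtain ⟨hc, K, hKU, hK, hfK⟩ := hf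
  obtain ⟨t, ht⟩ := hK.elim_finite_subcover (fun V : 𝒮.sets => U ∩ V.1)
    (fun V => hU.isOpen.inter (𝒮.bis _ V.2).isOpen) fun γ hγ => by
      obtain ⟨V, hV, hγV⟩ := 𝒮.covers γ
      exact Set.mem_iUnion.2 ⟨⟨V, hV⟩, hKU hγ, hγV⟩
  let V : Fin t.card → Set G := fun i => (t.equivFin.symm i).1.1
  have hV : ∀ i, V i ∈ 𝒮.sets := fun i => (t.equivFin.symm i).1.2
  obtain ⟨ρ, hρs, hρ1, -, -⟩ := exists_continuous_sum_one_of_isOpen_isCompact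
    (t := 𝓖.d '' K) (s := fun i => 𝓖.d '' (U ∩ V i))
    (fun i => 𝓖.local_d.isOpenMap _ (hU.isOpen.inter (𝒮.bis _ (hV i)).isOpen))
    (hK.image 𝓖.continuous_d) (by
      rintro _ ⟨γ, hγ, rfl⟩
      obtain ⟨W, hW⟩ := Set.mem_iUnion.1 (ht hγ)
      obtain ⟨hWt, hγW⟩ := Set.mem_iUnion.1 hW
      refine Set.mem_iUnion.2 ⟨t.equivFin ⟨W, hWt⟩, γ, ⟨hγW.1, ?_⟩, rfl⟩
      simp only [V, Equiv.symm_apply_apply]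
      exact hγW.2)
  let F : Fin t.card → ∀ γ, L γ := fun i γ => ((ρ i (𝓖.d γ) : ℝ) : 𝕜) • f γ
  have hFc : ∀ i, ContinuousOn (fun γ => ((ρ i (𝓖.d γ) : ℝ) : 𝕜)) U := fun i =>
    (RCLike.continuous_ofReal.comp ((ρ i).continuous.comp 𝓖.continuous_d)).continuousOn
  refine ⟨_, Fin t.card, inferInstance, F, V, fun i => ⟨hV i, ?_, ?_⟩, ?_, rfl⟩
  · have hKi : K ∩ 𝓖.d ⁻¹' (tsupport (ρ i)) ⊆ U ∩ V i := by
      rintro γ ⟨hγ, hγ'⟩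
      obtain ⟨γ', h1, h2⟩ := hρs i hγ'
      rwa [← hU.injOn_d h1.1 (hKU hγ) h2]
    have hF0 : ∀ γ, γ ∉ K ∩ 𝓖.d ⁻¹' (tsupport (ρ i)) → F i γ = 0 := by
      intro γ hγ
      by_cases h1 : γ ∈ K
      · have h2 : ρ i (𝓖.d γ) = 0 := image_eq_zero_of_notMem_tsupport fun h => hγ ⟨h1, h⟩
        simp [F, h2]
      · simp only [F, hfK γ h1, smul_zero]
    have hKc : IsCompact (K ∩ 𝓖.d ⁻¹' (tsupport (ρ i))) :=
      hK.inter_right ((isClosed_tsupport _).preimage 𝓖.continuous_d)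
    intro γ hγ
    refine ContinuousAt.continuousWithinAt ?_
    by_cases h1 : γ ∈ U
    · exact (𝓛.continuousOn_smul (hFc i) hc).continuousAt (hU.isOpen.mem_nhds h1)
    · refine 𝓛.continuous_zero.continuousAt.congr ?_
      have h2 : 𝓖.d γ ∉ 𝓖.d '' (K ∩ 𝓖.d ⁻¹' (tsupport (ρ i))) := by
        rintro ⟨γ', h3, h4⟩
        rw [(𝒮.bis _ (hV i)).injOn_d (hKi h3).2 hγ h4] at h3
        exact h1 (hKi h3).1
      filter_upwards [((hKc.image 𝓖.continuous_d).isClosed.isOpen_compl.preimage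
        𝓖.continuous_d).mem_nhds h2] with γ' h3
      rw [hF0 γ' fun h => h3 ⟨γ', h, rfl⟩]
  · refine ⟨K ∩ 𝓖.d ⁻¹' (tsupport (ρ i)), ?_,
      hK.inter_right ((isClosed_tsupport _).preimage 𝓖.continuous_d), ?_⟩
    · rintro γ ⟨hγ, hγ'⟩
      obtain ⟨γ', h1, h2⟩ := hρs i hγ'
      rw [← hU.injOn_d h1.1 (hKU hγ) h2]
      exact h1.2
    · intro γ hγ
      by_cases h1 : γ ∈ K
      · have h2 : ρ i (𝓖.d γ) = 0 := image_eq_zero_of_notMem_tsupport fun h => hγ ⟨h1, h⟩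
        simp [F, h2]
      · simp only [F, hfK γ h1, smul_zero]
  · funext γ
    rw [Finset.sum_apply]
    by_cases h1 : γ ∈ K
    · have h2 := hρ1 ⟨γ, h1, rfl⟩
      simp only [Finset.sum_apply, Pi.one_apply] at h2
      simp only [F]
      rw [← Finset.sum_smul, ← RCLike.ofReal_sum, h2, RCLike.ofReal_one, one_smul]
    · simp only [F, hfK γ h1, smul_zero, Finset.sum_const_zero]

theorem costs_nonempty [T2Space Y] [LocallyCompactSpace Y] {f : ∀ γ, L γ} (hf : f ∈ 𝓛.sections) :
    (𝓛.costs 𝒮 f).Nonempty :=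
  sections_induction (P := fun f => (𝓛.costs 𝒮 f).Nonempty) hf
    (fun _ hU _ hf => costs_nonempty_of_mem_Cc hU hf) ⟨0, zero_mem_costs⟩
    fun _ _ _ _ ⟨c, hc⟩ ⟨c', hc'⟩ => ⟨c + c', add_mem_costs hc hc'⟩

theorem bddBelow_costs (f : ∀ γ, L γ) : BddBelow (𝓛.costs 𝒮 f) :=
  ⟨0, fun _ hc => nonneg_of_mem_costs hc⟩

theorem le_sInf_mul_sInf {A B : Set ℝ} (hA : A.Nonempty) (hB : B.Nonempty) (hA0 : ∀ a ∈ A, 0 ≤ a)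
    (hB0 : ∀ b ∈ B, 0 ≤ b) {x : ℝ} (h : ∀ a ∈ A, ∀ b ∈ B, x ≤ a * b) : x ≤ sInf A * sInf B := by
  have key : ∀ (A : Set ℝ), A.Nonempty → (∀ a ∈ A, 0 ≤ a) → ∀ y : ℝ, 0 ≤ y →
      (∀ a ∈ A, x ≤ a * y) → x ≤ sInf A * y := by
    intro A hA hA0 y hy h
    rcases hy.eq_or_lt with rfl | hy
    · obtain ⟨a, ha⟩ := hA
      simpa using h a ha
    · rw [← div_le_iff₀ hy]
      exact le_csInf hA fun a ha => (div_le_iff₀ hy).2 (h a ha)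
  refine key A hA hA0 _ (Real.sInf_nonneg hB0) fun a ha => ?_
  rw [mul_comm]
  exact key B hB hB0 a (hA0 a ha) fun b hb => by rw [mul_comm]; exact h a ha b hb

variable [T2Space Y] [LocallyCompactSpace Y]

/-- The norm `‖f‖ = inf {∑ ‖f_k‖_∞ : f = ∑ f_k, f_k ∈ C_c(U_k, L), U_k ∈ 𝒮}` on the algebra of
quasi-continuous compactly supported sections. -/
def maxNorm (𝓛 : Twist 𝕜 𝓖 L) (𝒮 : 𝓖.CoveringSemigroup) : AlgSeminorm 𝕜 𝓛.Alg where
  toSeminorm := Seminorm.ofSMulLE (fun f => sInf (𝓛.costs 𝒮 f.val))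
    (le_antisymm (csInf_le (bddBelow_costs _) zero_mem_costs)
      (Real.sInf_nonneg fun _ hc => nonneg_of_mem_costs hc))
    (fun f g => by
      rw [← csInf_add (costs_nonempty f.mem) (bddBelow_costs _) (costs_nonempty g.mem)
        (bddBelow_costs _)]
      refine le_csInf ((costs_nonempty f.mem).add (costs_nonempty g.mem)) ?_
      rintro _ ⟨c, hc, c', hc', rfl⟩
      exact csInf_le (bddBelow_costs _) (add_mem_costs hc hc'))
    (fun a f => by
      have h := le_sInf_mul_sInf (A := {‖a‖}) (Set.singleton_nonempty _)
        (costs_nonempty (𝒮 := 𝒮) f.mem) (by rintro _ rfl; exact norm_nonneg a)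
        (fun _ hc => nonneg_of_mem_costs hc) (x := sInf (𝓛.costs 𝒮 (a • f).val)) (by
          rintro _ rfl c hc
          exact csInf_le (bddBelow_costs _) (smul_mem_costs a hc))
      rwa [csInf_singleton] at h)
  mul_le' f g := le_sInf_mul_sInf (costs_nonempty f.mem) (costs_nonempty g.mem)
    (fun _ hc => nonneg_of_mem_costs hc) (fun _ hc => nonneg_of_mem_costs hc) fun c hc c' hc' => by
      obtain ⟨c'', h1, h2⟩ := mul_mem_costs hc hc'
      exact (csInf_le (bddBelow_costs _) h1).trans h2

/-- The groupoid Banach algebra `F^𝒮(G, L)`: the completion in the norm `maxNorm`. -/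
abbrev F (𝓛 : Twist 𝕜 𝓖 L) (𝒮 : 𝓖.CoveringSemigroup) : Type _ := (𝓛.maxNorm 𝒮).Compl

/-- The seminorm `‖f‖ = sup {‖ψ(f)‖ : ψ ∈ R}` on the algebra of quasi-continuous compactly supported
sections, for a class `R` of representations of `F^𝒮(G, L)`. -/
def repSeminorm (R : Set (Σ B : BanachAlg 𝕜, BanachRep 𝕜 (𝓛.F 𝒮) B.carrier)) :
    AlgSeminorm 𝕜 𝓛.Alg where
  toSeminorm := Seminorm.ofSMulLE
    (fun f => sSup ((fun q => ‖q.2 ((𝓛.maxNorm 𝒮).toCompl f)‖) '' R))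
    (le_antisymm (Real.sSup_le (by
        rintro _ ⟨q, -, rfl⟩
        simp only [map_zero, norm_zero, le_refl]) le_rfl)
      (Real.sSup_nonneg (by rintro _ ⟨q, -, rfl⟩; exact norm_nonneg _)))
    (fun f g => Real.sSup_le (by
        rintro _ ⟨q, hq, rfl⟩
        simp only [map_add]
        refine (norm_add_le _ _).trans ?_
        exact add_le_add
          (le_csSup ⟨_, by rintro _ ⟨q, -, rfl⟩; exact q.2.contractive _⟩ ⟨q, hq, rfl⟩)
          (le_csSup ⟨_, by rintro _ ⟨q, -, rfl⟩; exact q.2.contractive _⟩ ⟨q, hq, rfl⟩))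
      (add_nonneg
        (Real.sSup_nonneg (by rintro _ ⟨q, -, rfl⟩; exact norm_nonneg _))
        (Real.sSup_nonneg (by rintro _ ⟨q, -, rfl⟩; exact norm_nonneg _))))
    (fun c f => Real.sSup_le (by
        rintro _ ⟨q, hq, rfl⟩
        simp only [map_smul, norm_smul]
        exact mul_le_mul_of_nonneg_left
          (le_csSup ⟨_, by rintro _ ⟨q, -, rfl⟩; exact q.2.contractive _⟩ ⟨q, hq, rfl⟩)
          (norm_nonneg c))
      (mul_nonneg (norm_nonneg c)
        (Real.sSup_nonneg (by rintro _ ⟨q, -, rfl⟩; exact norm_nonneg _))))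
  mul_le' f g := Real.sSup_le (by
        rintro _ ⟨q, hq, rfl⟩
        simp only [AlgSeminorm.toCompl_mul, map_mul]
        refine (norm_mul_le _ _).trans ?_
        exact mul_le_mul
          (le_csSup ⟨_, by rintro _ ⟨q, -, rfl⟩; exact q.2.contractive _⟩ ⟨q, hq, rfl⟩)
          (le_csSup ⟨_, by rintro _ ⟨q, -, rfl⟩; exact q.2.contractive _⟩ ⟨q, hq, rfl⟩)
          (norm_nonneg _) (Real.sSup_nonneg (by rintro _ ⟨q, -, rfl⟩; exact norm_nonneg _)))
      (mul_nonneg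
        (Real.sSup_nonneg (by rintro _ ⟨q, -, rfl⟩; exact norm_nonneg _))
        (Real.sSup_nonneg (by rintro _ ⟨q, -, rfl⟩; exact norm_nonneg _)))

/-- The class of all representations of `F^𝒮(G, L)` on the Banach spaces `E ∈ 𝓔`. -/
def onClass (𝓛 : Twist 𝕜 𝓖 L) (𝒮 : 𝓖.CoveringSemigroup) (𝓔 : Set (BanachSp 𝕜)) :
    Set (Σ B : BanachAlg 𝕜, BanachRep 𝕜 (𝓛.F 𝒮) B.carrier) :=
  {q | ∃ E ∈ 𝓔, ∃ ψ : BanachRep 𝕜 (𝓛.F 𝒮) (E.operators).carrier, q = ⟨E.operators, ψ⟩}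

/-- The Hausdorff completion `F^𝒮_𝓔(G, L)` in the seminorm defined by all representations of
`F^𝒮(G, L)` on the Banach spaces `E ∈ 𝓔`. -/
abbrev FClass (𝓛 : Twist 𝕜 𝓖 L) (𝒮 : 𝓖.CoveringSemigroup) (𝓔 : Set (BanachSp 𝕜)) : Type _ :=
  (repSeminorm (𝓛.onClass 𝒮 𝓔)).Compl

end Twist

/-! ### The twisted groupoid associated with a twisted action -/

namespace TwistedAction

variable {𝕜 X S : Type*} [RCLike 𝕜] [TopologicalSpace X] [InverseSemigroup S]
  (T : TwistedAction 𝕜 X S)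

/-- `(t, x)` and `(t', x')` define the same germ: `x = x'`, and there is `v ≤ t, t'` with
`x ∈ X_{v⁻¹}`. -/
def GermRel (p q : Σ t : S, (T.h t).source) : Prop :=
  (p.2 : X) = q.2 ∧ ∃ v, InverseSemigroup.LE v p.1 ∧ InverseSemigroup.LE v q.1 ∧
    (p.2 : X) ∈ (T.h v).source

/-- The space of germs `[t, x]`, `x ∈ X_{t⁻¹}`, with the quotient topology: the sets
`{[t, x] : x ∈ V}` with `V ⊆ X_{t⁻¹}` open form a basis. -/
def Germ : Type _ := Quot T.GermRel

instance : TopologicalSpace T.Germ := inferInstanceAs (TopologicalSpace (Quot T.GermRel))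

/-- The germ `[t, x]`. -/
def germ (t : S) (x : (T.h t).source) : T.Germ := Quot.mk _ ⟨t, x⟩

/-- `(a, t, x)` and `(a', t', x')` define the same point of the line bundle: `x = x'`, and there is
`v ≤ t, t'` with `x ∈ X_{v⁻¹}` and `(a u(v v⁻¹, t))(h_v(x)) = (a' u(v v⁻¹, t'))(h_v(x))`. -/
def LineRel (p q : Σ t : S, T.I t × (T.h t).source) : Prop :=
  (p.2.2 : X) = q.2.2 ∧ ∃ v, InverseSemigroup.LE v p.1 ∧ InverseSemigroup.LE v q.1 ∧
    (p.2.2 : X) ∈ (T.h v).source ∧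
    (p.2.1 : C₀(X, 𝕜)) (T.h v p.2.2) * T.u (v * v⁻¹) p.1 (T.h v p.2.2)
      = (q.2.1 : C₀(X, 𝕜)) (T.h v p.2.2) * T.u (v * v⁻¹) q.1 (T.h v p.2.2)

/-- The total space of the line bundle associated with the twisted action: the space of classes
`[a, t, x]`, where `a ∈ C₀(X_t)` and `x ∈ X_{t⁻¹}`. It has the quotient topology, where `C₀(X_t)`
has its norm topology. Since `(a, x) ↦ (a(h_t(x)), x)` is an open map, this is the topology that
makes it a line bundle over the space of germs with continuous local sections
`[t, x] ↦ [a, t, x]`. -/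
def LineGerm : Type _ := Quot T.LineRel

instance : TopologicalSpace T.LineGerm := inferInstanceAs (TopologicalSpace (Quot T.LineRel))

/-- The point `[a, t, x]` of the line bundle. -/
def lineGerm (t : S) (a : T.I t) (x : (T.h t).source) : T.LineGerm := Quot.mk _ ⟨t, a, x⟩

/-- The subspace `C_c(X_t)` of `I_t = C₀(X_t)`. -/
def Ic (t : S) : Set (T.I t) :=
  {a | ∃ K ⊆ (T.h t).target, IsCompact K ∧ ∀ x, x ∉ K → (a : C₀(X, 𝕜)) x = 0}

end TwistedAction

open Bundle (TotalSpace) in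
/-- `T` models the twisted groupoid `(G, L)`: an isomorphism between the twisted groupoid associated
with `T` and `(G, L)`. It consists of homeomorphisms `base`, `φ` and `Φ` of the unit spaces, the
groupoids and the total spaces of the line bundles, which intertwine all operations. The linear
map `vec t x` is `a ↦ Φ [a, t, x]`. -/
structure Models {𝕜 X S Y G : Type*} [RCLike 𝕜] [TopologicalSpace X] [T2Space X]
    [InverseSemigroup S] [TopologicalSpace Y] [TopologicalSpace G] (T : TwistedAction 𝕜 X S)
    {𝓖 : EtaleGroupoid Y G} {L : G → Type*} [∀ γ, NormedAddCommGroup (L γ)]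
    [∀ γ, NormedSpace 𝕜 (L γ)] [TopologicalSpace (TotalSpace 𝕜 L)] (𝓛 : Twist 𝕜 𝓖 L) where
  base : X ≃ₜ Y
  φ : T.Germ ≃ₜ G
  d_φ : ∀ t x, 𝓖.d (φ (T.germ t x)) = base x
  r_φ : ∀ t x, 𝓖.r (φ (T.germ t x)) = base (T.h t x)
  /-- `[s, h_t(x)] [t, x] = [s t, x]` -/
  mul_φ : ∀ s t (x : (T.h (s * t)).source),
    𝓖.IsProd (φ (T.germ s ⟨T.h t x, (T.mem_source_mul.1 x.2).2⟩))
      (φ (T.germ t ⟨x, (T.mem_source_mul.1 x.2).1⟩)) (φ (T.germ (s * t) x))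
  Φ : T.LineGerm ≃ₜ TotalSpace 𝕜 L
  vec : ∀ t (x : (T.h t).source), T.I t →ₗ[𝕜] L (φ (T.germ t x))
  Φ_apply : ∀ t a x, Φ (T.lineGerm t a x) = ⟨φ (T.germ t x), vec t x a⟩
  norm_vec : ∀ t x a, ‖vec t x a‖ = ‖(a : C₀(X, 𝕜)) (T.h t x)‖
  /-- `[a, s, h_t(x)] [b, t, x] = [α_s(α_s⁻¹(a) b) u(s, t), s t, x]` -/
  mul_vec : ∀ s t (x : (T.h (s * t)).source) (a : T.I s) (b : T.I t),
    𝓛.mul (mul_φ s t x) (vec s ⟨T.h t x, (T.mem_source_mul.1 x.2).2⟩ a)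
      (vec t ⟨x, (T.mem_source_mul.1 x.2).1⟩ b) = vec (s * t) x (T.coeffMul s t a b)
  /-- `[b, t, x]^* = [b', t⁻¹, h_t(x)]`, where `b'` is the complex conjugate of
  `(b u(t, t⁻¹)) ∘ h_t` -/
  star_vec : ∀ t (x : (T.h t).source) (b : T.I t) (b' : T.I t⁻¹),
    (∀ y ∈ (T.h t).source, (b' : C₀(X, 𝕜)) y
      = star ((b : C₀(X, 𝕜)) (T.h t y) * T.u t t⁻¹ (T.h t y))) →
    (⟨𝓖.inv (φ (T.germ t x)), 𝓛.star _ (vec t x b)⟩ : TotalSpace 𝕜 L)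
      = ⟨φ (T.germ t⁻¹ ⟨T.h t x, (T.h_inv_h x.2).1⟩), vec t⁻¹ ⟨T.h t x, (T.h_inv_h x.2).1⟩ b'⟩

theorem TwistedAction.source_mono {𝕜 X S : Type*} [RCLike 𝕜] [TopologicalSpace X]
    [InverseSemigroup S] (T : TwistedAction 𝕜 X S) {v t : S} (h : InverseSemigroup.LE v t) :
    (T.h v).source ⊆ (T.h t).source := by
  intro x hx
  rw [InverseSemigroup.LE] at h
  rw [h] at hx
  obtain ⟨h1, h2⟩ := T.mem_source_mul.1 hx
  rwa [T.h_idem (TwistedAction.inv_mul_idem v) h1] at h2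

theorem TwistedAction.germ_eq_near {𝕜 X S : Type*} [RCLike 𝕜] [TopologicalSpace X]
    [InverseSemigroup S] (T : TwistedAction 𝕜 X S) {p q : Σ t : S, (T.h t).source}
    (h : Relation.EqvGen T.GermRel p q) :
    (p.2 : X) = q.2 ∧ ∃ N : Set X, IsOpen N ∧ (p.2 : X) ∈ N ∧
      ∀ x ∈ N, ∃ hp : x ∈ (T.h p.1).source, ∃ hq : x ∈ (T.h q.1).source,
        T.germ p.1 ⟨x, hp⟩ = T.germ q.1 ⟨x, hq⟩ := by
  induction h with
  | rel p q h =>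
    obtain ⟨h1, v, hv, hv', hx⟩ := h
    exact ⟨h1, (T.h v).source, (T.h v).open_source, hx, fun x hx =>
      ⟨T.source_mono hv hx, T.source_mono hv' hx, Quot.sound ⟨rfl, v, hv, hv', hx⟩⟩⟩
  | refl p => exact ⟨rfl, (T.h p.1).source, (T.h p.1).open_source, p.2.2, fun x hx => ⟨hx, hx, rfl⟩⟩
  | symm p q _ ih =>
    obtain ⟨h1, N, hN, hpN, h⟩ := ih
    refine ⟨h1.symm, N, hN, h1 ▸ hpN, fun x hx => ?_⟩
    obtain ⟨h2, h3, h4⟩ := h x hx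
    exact ⟨h3, h2, h4.symm⟩
  | trans p q r _ _ ih ih' =>
    obtain ⟨h1, N, hN, hpN, h⟩ := ih
    obtain ⟨h1', N', hN', hpN', h'⟩ := ih'
    refine ⟨h1.trans h1', N ∩ N', hN.inter hN', ⟨hpN, h1 ▸ hpN'⟩, fun x hx => ?_⟩
    obtain ⟨h2, h3, h4⟩ := h x hx.1
    obtain ⟨h2', h3', h4'⟩ := h' x hx.2
    exact ⟨h2, h3', h4.trans h4'⟩

theorem TwistedAction.isOpen_range_germ {𝕜 X S : Type*} [RCLike 𝕜] [TopologicalSpace X]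
    [InverseSemigroup S] (T : TwistedAction 𝕜 X S) (t : S) : IsOpen (Set.range (T.germ t)) := by
  have h1 : IsOpen ((Quot.mk T.GermRel) ⁻¹' (Set.range (T.germ t))) := by
    rw [isOpen_sigma_iff]
    intro s
    rw [isOpen_iff_mem_nhds]
    rintro x ⟨y, hy⟩
    obtain ⟨h2, N, hN, hxN, h⟩ := T.germ_eq_near (Quot.eqvGen_exact hy)
    have hxN' : (x : X) ∈ N := by rw [← show (y : X) = x from h2]; exact hxN
    filter_upwards [(hN.preimage continuous_subtype_val).mem_nhds hxN'] with x' hx'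
    obtain ⟨h3, h4, h5⟩ := h x' hx'
    exact ⟨⟨x', h3⟩, h5⟩
  exact h1

namespace Models

open Bundle (TotalSpace)

variable {𝕜 X S Y G : Type*} [RCLike 𝕜] [TopologicalSpace X] [T2Space X]
  [InverseSemigroup S] [TopologicalSpace Y] [TopologicalSpace G] {T : TwistedAction 𝕜 X S}
  {𝓖 : EtaleGroupoid Y G} {L : G → Type*} [∀ γ, NormedAddCommGroup (L γ)]
  [∀ γ, NormedSpace 𝕜 (L γ)] [TopologicalSpace (TotalSpace 𝕜 L)] {𝓛 : Twist 𝕜 𝓖 L}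
  (M : Models T 𝓛)

/-- The bisection `U_t = {[t, x] : x ∈ X_{t⁻¹}}`. -/
def U (t : S) : Set G := Set.range fun x => M.φ (T.germ t x)

theorem isBisection_U (t : S) : 𝓖.IsBisection (M.U t) where
  isOpen := by
    have : M.U t = M.φ '' (Set.range (T.germ t)) := by rw [← Set.range_comp]; rfl
    rw [this]
    exact M.φ.isOpenMap _ (T.isOpen_range_germ t)
  injOn_d := by
    rintro _ ⟨x, rfl⟩ _ ⟨y, rfl⟩ h
    simp only [M.d_φ] at h
    rw [Subtype.ext (M.base.injective h)]
  injOn_r := by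
    rintro _ ⟨x, rfl⟩ _ ⟨y, rfl⟩ h
    simp only [M.r_φ] at h
    rw [Subtype.ext ((T.h t).injOn x.2 y.2 (M.base.injective h))]

theorem setMul_U (s t : S) : 𝓖.setMul (M.U s) (M.U t) = M.U (s * t) := by
  ext ζ
  constructor
  · rintro ⟨_, ⟨y, rfl⟩, _, ⟨x, rfl⟩, h⟩
    have h1 := h.1
    rw [M.d_φ, M.r_φ] at h1
    have h2 : (y : X) = T.h t x := M.base.injective h1
    have hx : (x : X) ∈ (T.h (s * t)).source := T.mem_source_mul.2 ⟨x.2, h2 ▸ y.2⟩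
    refine ⟨⟨x, hx⟩, ?_⟩
    have h3 := M.mul_φ s t ⟨x, hx⟩
    have h4 : y = ⟨T.h t x, (T.mem_source_mul.1 hx).2⟩ := Subtype.ext h2
    rw [h4] at h
    exact h3.2.symm.trans h.2
  · rintro ⟨x, rfl⟩
    exact ⟨_, ⟨_, rfl⟩, _, ⟨_, rfl⟩, M.mul_φ s t x⟩

/-- The semigroup of all bisections `U_t`, `t ∈ S`. -/
def bisections : 𝓖.CoveringSemigroup where
  sets := Set.range M.U
  bis := by rintro _ ⟨t, rfl⟩; exact M.isBisection_U t
  mul_mem := by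
    rintro _ ⟨s, rfl⟩ _ ⟨t, rfl⟩
    exact ⟨s * t, (M.setMul_U s t).symm⟩
  covers γ := by
    obtain ⟨g, rfl⟩ := M.φ.surjective γ
    induction g using Quot.ind with
    | mk p => exact ⟨M.U p.1, ⟨p.1, rfl⟩, p.2, rfl⟩

open Classical in
/-- The section `a δ_t` of `L`, with `a δ_t [t, x] = [a, t, x]`, that vanishes outside of `U_t`. -/
def deltaFun (t : S) (a : T.I t) (γ : G) : L γ :=
  if h : ∃ x, M.φ (T.germ t x) = γ then h.choose_spec ▸ M.vec t h.choose a else 0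

theorem deltaFun_apply (t : S) (a : T.I t) (x : (T.h t).source) :
    M.deltaFun t a (M.φ (T.germ t x)) = M.vec t x a := by
  have key : ∀ γ (y : (T.h t).source) (hy : M.φ (T.germ t y) = γ), γ = M.φ (T.germ t x) →
      ∀ w : L γ, (hy ▸ M.vec t y a) = w → (⟨γ, w⟩ : TotalSpace 𝕜 L) = ⟨_, M.vec t x a⟩ := by
    rintro _ y rfl h w rfl
    have h1 : y = x := by
      have := congrArg 𝓖.d h
      rw [M.d_φ, M.d_φ] at this
      exact Subtype.ext (M.base.injective this)
    rw [h1]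
  have h : ∃ y, M.φ (T.germ t y) = M.φ (T.germ t x) := ⟨x, rfl⟩
  have h2 := key _ h.choose h.choose_spec rfl _ rfl
  rw [deltaFun, dif_pos h]
  simpa using h2

theorem deltaFun_eq_zero (t : S) (a : T.I t) {γ : G} (h : γ ∉ M.U t) : M.deltaFun t a γ = 0 := by
  rw [deltaFun, dif_neg]
  exact h

theorem deltaFun_mem (t : S) {a : T.I t} (ha : a ∈ T.Ic t) : M.deltaFun t a ∈ 𝓛.Cc (M.U t) := by
  have hphi : Continuous fun x : (T.h t).source => M.φ (T.germ t x) :=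
    M.φ.continuous.comp (continuous_quot_mk.comp continuous_sigmaMk)
  have hPhi : Continuous fun x : (T.h t).source => M.Φ (T.lineGerm t a x) :=
    M.Φ.continuous.comp (continuous_quot_mk.comp
      (continuous_sigmaMk.comp (continuous_const.prodMk continuous_id)))
  constructor
  · rw [continuousOn_iff_continuous_domRestrict]
    have hx : ∀ γ : M.U t, M.base.symm (𝓖.d γ) ∈ (T.h t).source := by
      rintro ⟨_, x, rfl⟩
      rw [M.d_φ, Homeomorph.symm_apply_apply]
      exact x.2
    have hc : Continuous fun γ : M.U t => (⟨M.base.symm (𝓖.d γ), hx γ⟩ : (T.h t).source) :=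
      Continuous.subtype_mk
        (M.base.symm.continuous.comp (𝓖.continuous_d.comp continuous_subtype_val)) _
    refine (hPhi.comp hc).congr ?_
    rintro ⟨_, x, rfl⟩
    have h1 : (⟨M.base.symm (𝓖.d (M.φ (T.germ t x))), hx ⟨_, x, rfl⟩⟩ : (T.h t).source) = x := by
      apply Subtype.ext
      simp only [M.d_φ, Homeomorph.symm_apply_apply]
    change M.Φ (T.lineGerm t a ⟨M.base.symm (𝓖.d (M.φ (T.germ t x))), hx ⟨_, x, rfl⟩⟩)
      = (⟨M.φ (T.germ t x), M.deltaFun t a (M.φ (T.germ t x))⟩ : TotalSpace 𝕜 L)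
    rw [h1, M.Φ_apply, M.deltaFun_apply]
  · obtain ⟨K, hK, hKc, haK⟩ := ha
    have hK' : IsCompact ((T.h t).symm '' K) :=
      hKc.image_of_continuousOn ((T.h t).continuousOn_symm.mono hK)
    have hsub : (T.h t).symm '' K ⊆ (T.h t).source := by
      rintro _ ⟨y, hy, rfl⟩
      exact (T.h t).map_target (hK hy)
    have hK'' : IsCompact ((Subtype.val : (T.h t).source → X) ⁻¹' ((T.h t).symm '' K)) := by
      rw [Topology.IsInducing.subtypeVal.isCompact_preimage_iff]
      · exact hK'
      · rwa [Subtype.range_coe]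
    refine ⟨_, ?_, hK''.image hphi, ?_⟩
    · rintro _ ⟨x, -, rfl⟩
      exact ⟨x, rfl⟩
    · intro γ hγ
      by_cases h : γ ∈ M.U t
      · obtain ⟨x, rfl⟩ := h
        have hx : T.h t x ∉ K := fun hx =>
          hγ ⟨x, ⟨T.h t x, hx, (T.h t).left_inv x.2⟩, rfl⟩
        have h0 := M.norm_vec t x a
        rw [haK _ hx, norm_zero, norm_eq_zero] at h0
        change M.deltaFun t a (M.φ (T.germ t x)) = 0
        rw [M.deltaFun_apply, h0]
      · exact M.deltaFun_eq_zero t a h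

/-- The element `a δ_t` of the algebra of quasi-continuous compactly supported sections, for
`a ∈ C_c(X_t)`. -/
def delta (t : S) (a : T.Ic t) : 𝓛.Alg :=
  (⟨M.deltaFun t a, 𝓛.Cc_le_sections (M.isBisection_U t) (M.deltaFun_mem t a.2)⟩ : 𝓛.sections)

end Models

namespace Models

open Bundle (TotalSpace)

variable {𝕜 X S Y G : Type*} [RCLike 𝕜] [TopologicalSpace X] [T2Space X]
  [InverseSemigroup S] [TopologicalSpace Y] [T2Space Y] [LocallyCompactSpace Y]
  [TopologicalSpace G] {T : TwistedAction 𝕜 X S}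
  {𝓖 : EtaleGroupoid Y G} {L : G → Type*} [∀ γ, NormedAddCommGroup (L γ)]
  [∀ γ, NormedSpace 𝕜 (L γ)] [TopologicalSpace (TotalSpace 𝕜 L)] {𝓛 : Twist 𝕜 𝓖 L}
  (M : Models T 𝓛)

/-- The Banach algebra `F^S(G, L)`, where `S` stands for the semigroup of the bisections `U_t`. -/
abbrev FS : Type _ := 𝓛.F M.bisections

/-- The algebra of quasi-continuous compactly supported sections as a subalgebra of `F^S(G, L)`. -/
def toFS (f : 𝓛.Alg) : M.FS := (𝓛.maxNorm M.bisections).toCompl f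

/-- `ψ = π ⋊ v`, that is `ψ(a δ_t) = π(a) v_t` for all `t` and all `a ∈ C_c(X_t)`. -/
def Integrates {B : Type*} [NonUnitalNormedRing B] [NormedSpace 𝕜 B] [IsScalarTower 𝕜 B B]
    [SMulCommClass 𝕜 B B] (p : CovRep T B) (ψ : BanachRep 𝕜 M.FS B) : Prop :=
  ∀ t (a : T.Ic t), toBidual 𝕜 (ψ (M.toFS (M.delta t a))) = p.elt t (a.1 : C₀(X, 𝕜))

end Models

end TwistedGroupoid

end

universe u₁ u₂ u₃ u₄ u₅ u₆ w w'

open TwistedGroupoid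

set_option linter.unusedSectionVars false

noncomputable section

namespace TwistedGroupoid

open Topology
open scoped ZeroAtInfty
open InverseSemigroup

section

/-! ### Inverse semigroups: idempotents commute, properties of the natural order -/

namespace InverseSemigroup

variable {S : Type*} [InverseSemigroup S]

/-! Everything is compared with one intermediate object, `GradedRep`: contractions `Ψ_t : I_t → B`
with `Ψ_s(a) Ψ_t(b) = Ψ_{st}(α_s(α_s⁻¹(a) b) u(s, t))`, and with `Ψ_t(a) = Ψ_s(a u(s s⁻¹, t))`
whenever `s ≤ t` and `a` vanishes off `X_s`. A representation `ψ` of `F^S(G, L)` gives `Ψ_t(a) = ψ(a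
δ_t)`, extended from `C_c(X_t)` by continuity (`Models.exists_gradedRep`). A covariant
representation gives `Ψ_t(a) = π(a) v_t` (`CovRep.exists_gradedRep`). The equation `ψ = π ⋊ v` says
that both families are the same (`integrates_iff`). So it remains to pass back from `Ψ` to `ψ` and
to `(π, v)`.

From `Ψ` to `ψ`: the fibres of `L` are lines, so every section in `C_c(U_t, L)` is some `a δ_t` with
the norm of `a` at most its sup-norm (`exists_deltaFun_eq`), and contractivity is automatic once `∑
a_t δ_t ↦ ∑ Ψ_t(a_t)` is well defined. That is the real issue, as `G` may fail to be Hausdorff and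
the `U_t` overlap. It is settled by `exists_bound`: for a fixed finite set of bisections, `∑
Ψ_t(a_t)` is bounded by a multiple of the sup-norm of `∑ a_t δ_t`. The proof is by induction on the
set. Where `|a_n| ≥ 2ε` but the total is at most `ε`, another of the bisections must pass through
the same germ; so the large part of `a_n` can be moved to the other bisections by a partition of
unity and the compatibility of `Ψ` with the order, and a remainder of norm at most `2ε` is left.

From `Ψ` to `(π, v)`: for idempotents `e` the twist is trivial, the maps `Ψ_e` agree on overlaps,
and they glue to `π` because compact sets are absorbed by the `X_e` (`exists_pi`). The operator
`v_t` has to be a limit of `Ψ_t(μ_i)` for an approximate unit of `I_t`. Along an ultrafilter such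
limits exist by weak-* compactness in `B''` or in `B = P'`, and in the weak operator topology if `E`
is reflexive; if `X_t` is compact, the constant net `1_{X_t}` serves. After multiplication by `π(a)`
the nets converge in norm, and separate weak continuity of the product turns these norm limits into
the covariance relations. On `E`, the generalised inverse of `v_t` arises likewise as a limit of
`Ψ_{t⁻¹}(μ_i u(t⁻¹, t)^*)`.

Uniqueness under normalization requires that the limit does not depend on the approximate unit. This
is `limit_unique`, which rests on `exists_concentrated`: a bounded functional on `C₀(U)` is, up to
`ε`, carried by a compact subset of `U`. On `E`, uniqueness comes instead from the prescribed range
of `v_t`, on which `π(I_t)` separates points (`essSubspace_ext`).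

For the corollary, `a δ_t ↦ a δ_t` is itself a graded representation in the crossed product, so it
integrates to `F^S(G, L)`; the seminorms agree because both sides have the same integrated forms.
For the universal crossed product, the lower estimate comes from the isometric representation of
`F^S(G, L)` in a copy of itself. -/

theorem idem_mul_idem {e f : S} (he : e * e = e) (hf : f * f = f) :
    e * f * (e * f) = e * f := by
  set x := (e * f)⁻¹ with hx
  have h1 : e * f * x * (e * f) = e * f := mul_inv_mul _
  have h2 : x * (e * f) * x = x := inv_mul_inv _
  -- `f x e` is another generalised inverse of `e f`, so it equals `x` by uniqueness. This makes `x`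
  -- idempotent, hence its own inverse, so `e f = x⁻¹ = x` is idempotent.
  have h3 : f * x * e = x := by
    rw [hx]
    refine inv_unique _ _ ?_ ?_
    · calc e * f * (f * x * e) * (e * f) = e * (f * f) * x * (e * e) * f := by
            simp only [mul_assoc]
        _ = e * f * x * (e * f) := by rw [he, hf]; simp only [mul_assoc]
        _ = e * f := h1
    · calc f * x * e * (e * f) * (f * x * e) = f * (x * ((e * e) * (f * f)) * x) * e := by
            simp only [mul_assoc]
        _ = f * x * e := by rw [he, hf, h2]
  have h4 : x * x = x := by
    calc x * x = f * x * e * (f * x * e) := by rw [h3]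
      _ = f * (x * (e * f) * x) * e := by simp only [mul_assoc]
      _ = x := by rw [h2, h3]
  have h5 : e * f = x⁻¹ := inv_unique _ _ h2 h1
  have h6 : x = x⁻¹ := inv_unique _ _ (by rw [h4, h4]) (by rw [h4, h4])
  rw [h5, ← h6, h4]

/-- Both `f e` and `e f` are generalised inverses of the idempotent `e f`, and inverses are unique.
-/
theorem idem_comm {e f : S} (he : e * e = e) (hf : f * f = f) : e * f = f * e := by
  have h1 := idem_mul_idem he hf
  have h2 := idem_mul_idem hf he
  have h3 : f * e = (e * f)⁻¹ := inv_unique _ _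
    (by calc e * f * (f * e) * (e * f) = e * (f * f) * (e * e) * f := by simp only [mul_assoc]
          _ = e * f := by rw [hf, he, mul_assoc, h1])
    (by calc f * e * (e * f) * (f * e) = f * (e * e) * (f * f) * e := by simp only [mul_assoc]
          _ = f * e := by rw [hf, he, mul_assoc, h2])
  have h4 : e * f = (e * f)⁻¹ := inv_unique _ _ (by rw [h1, h1]) (by rw [h1, h1])
  rw [h3, ← h4]

theorem inv_mul_self_idem (t : S) : t⁻¹ * t * (t⁻¹ * t) = t⁻¹ * t := by
  rw [← mul_assoc, inv_mul_inv]

theorem mul_inv_self_idem (t : S) : t * t⁻¹ * (t * t⁻¹) = t * t⁻¹ := by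
  rw [← mul_assoc, mul_inv_mul]

theorem inv_of_idem {e : S} (he : e * e = e) : e⁻¹ = e :=
  (inv_unique e e (by rw [he, he]) (by rw [he, he])).symm

theorem inv_mul_idem_right (t : S) {f : S} (hf : f * f = f) : (t * f)⁻¹ = f * t⁻¹ := by
  have hc := idem_comm (inv_mul_self_idem t) hf
  symm
  refine inv_unique _ _ ?_ ?_
  · calc t * f * (f * t⁻¹) * (t * f) = t * ((f * f) * (t⁻¹ * t) * f) := by simp only [mul_assoc]
      _ = t * (t⁻¹ * t * (f * f)) := by rw [hf, ← hc, mul_assoc, hf]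
      _ = t * f := by rw [hf, ← mul_assoc, ← mul_assoc, mul_inv_mul]
  · calc f * t⁻¹ * (t * f) * (f * t⁻¹) = f * (t⁻¹ * t * (f * f)) * t⁻¹ := by
          simp only [mul_assoc]
      _ = f * f * (t⁻¹ * t * t⁻¹) := by simp only [hf, hc]; rw [← mul_assoc f f, hf]; simp only [mul_assoc]
      _ = f * t⁻¹ := by rw [hf, inv_mul_inv]

theorem mul_idem_le (t : S) {f : S} (hf : f * f = f) : LE (t * f) t := by
  rw [LE, inv_mul_idem_right t hf]
  calc t * f = t * t⁻¹ * t * (f * f) := by rw [mul_inv_mul, hf]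
    _ = t * (t⁻¹ * t * f * f) := by simp only [mul_assoc]
    _ = t * (f * t⁻¹ * (t * f)) := by
      rw [idem_comm (inv_mul_self_idem t) hf]; simp only [mul_assoc]

theorem le_trans' {w v t : S} (h1 : LE w v) (h2 : LE v t) : LE w t := by
  rw [LE] at *
  -- The domain idempotent of `w` is absorbed by that of `v`.
  have h3 : w * (v⁻¹ * v) = w := by
    conv_lhs => rw [h1]
    rw [mul_assoc, idem_comm (inv_mul_self_idem w) (inv_mul_self_idem v), ← mul_assoc,
      ← mul_assoc v, mul_inv_mul, ← h1]
  have h4 : w⁻¹ * w * (v⁻¹ * v) = w⁻¹ * w := by rw [mul_assoc, h3]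
  calc w = v * (w⁻¹ * w) := h1
    _ = t * (v⁻¹ * v) * (w⁻¹ * w) := by rw [← h2]
    _ = t * (w⁻¹ * w) := by
      rw [mul_assoc, idem_comm (inv_mul_self_idem v) (inv_mul_self_idem w), h4]

theorem le_refl' (t : S) : LE t t := by rw [LE, ← mul_assoc, mul_inv_mul]

/-- If `s ≤ t` then `s = s s⁻¹ t`. -/
theorem LE.range_mul {s t : S} (h : LE s t) : s * s⁻¹ * t = s := by
  have hf := inv_mul_self_idem s
  set f := s⁻¹ * s with hfd
  have h1 : s = t * f := h
  have h2 : s⁻¹ = f * t⁻¹ := by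
    conv_lhs => rw [h1]
    exact inv_mul_idem_right t hf
  calc s * s⁻¹ * t = t * f * (f * t⁻¹) * t := by rw [h2, ← h1]
    _ = t * (f * f * (t⁻¹ * t)) := by simp only [mul_assoc]
    _ = t * t⁻¹ * t * f := by
      rw [hf, ← idem_comm (inv_mul_self_idem t) hf]; simp only [mul_assoc]
    _ = s := by rw [mul_inv_mul, ← h1]

end InverseSemigroup

open InverseSemigroup

/-! ### Germs and the partial homeomorphisms along the natural order. -/

namespace TwistedAction

variable {𝕜 X S : Type*} [RCLike 𝕜] [TopologicalSpace X] [InverseSemigroup S]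
  (T : TwistedAction 𝕜 X S)

/-- Elements `v` and `w` below a common `q` are restrictions of `q`, so `v w⁻¹ w = w v⁻¹ v` because
idempotents commute. This element lies below both and is still defined at the given point. -/
theorem GermRel.trans {p q r : Σ t : S, (T.h t).source} (h : T.GermRel p q)
    (h' : T.GermRel q r) : T.GermRel p r := by
  obtain ⟨e, v, hv, hv', hx⟩ := h
  obtain ⟨e', w, hw, hw', hx'⟩ := h'
  have hle : LE (v * (w⁻¹ * w)) v := mul_idem_le v (InverseSemigroup.inv_mul_self_idem w)
  have hle' : LE (v * (w⁻¹ * w)) w := by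
    have h1 : v * (w⁻¹ * w) = w * (v⁻¹ * v) := by
      conv_lhs => rw [show v = q.1 * (v⁻¹ * v) from hv']
      conv_rhs => rw [show w = q.1 * (w⁻¹ * w) from hw]
      rw [mul_assoc q.1, mul_assoc q.1,
        idem_comm (InverseSemigroup.inv_mul_self_idem v) (InverseSemigroup.inv_mul_self_idem w)]
    rw [h1]
    exact mul_idem_le w (InverseSemigroup.inv_mul_self_idem v)
  refine ⟨e.trans e', v * (w⁻¹ * w), le_trans' hle hv, le_trans' hle' hw', ?_⟩
  have h1 : (p.2 : X) ∈ (T.h (w⁻¹ * w)).source := by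
    rw [e]
    exact T.mem_source_mul.2 ⟨hx', (T.h_inv_h hx').1⟩
  rw [T.mem_source_mul]
  refine ⟨h1, ?_⟩
  rwa [T.h_idem (InverseSemigroup.inv_mul_self_idem w) h1]

/-- The quotient is taken by the generated equivalence relation; by transitivity that is the
relation itself. This identifies exactly the points where two bisections `U_s` and `U_t` meet. -/
theorem germ_eq_iff {s t : S} {x : (T.h s).source} {y : (T.h t).source} :
    T.germ s x = T.germ t y ↔ (x : X) = y ∧ ∃ v, LE v s ∧ LE v t ∧ (x : X) ∈ (T.h v).source := by
  constructor
  · intro h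
    have key : ∀ p q, Relation.EqvGen T.GermRel p q → T.GermRel p q := by
      intro p q h
      induction h with
      | rel p q h => exact h
      | refl p => exact ⟨rfl, p.1, le_refl' _, le_refl' _, p.2.2⟩
      | symm p q _ ih =>
        obtain ⟨e, v, hv, hv', hx⟩ := ih
        exact ⟨e.symm, v, hv', hv, e ▸ hx⟩
      | trans p q r _ _ ih ih' => exact ih.trans T ih'
    exact key _ _ (Quot.eqvGen_exact h)
  · rintro ⟨h, v, hv, hv', hx⟩
    exact Quot.sound ⟨h, v, hv, hv', hx⟩

theorem h_eq_of_le {s t : S} (h : LE s t) {x : X} (hx : x ∈ (T.h s).source) :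
    T.h s x = T.h t x := by
  have h1 : x ∈ (T.h (t * (s⁻¹ * s))).source := by rwa [← show s = t * (s⁻¹ * s) from h]
  have h2 : T.h s x = T.h (t * (s⁻¹ * s)) x := congrArg (fun r => T.h r x) h
  rw [h2, T.h_mul h1, T.h_idem (InverseSemigroup.inv_mul_self_idem s) (T.mem_source_mul.1 h1).1]

theorem target_mono {s t : S} (h : LE s t) : (T.h s).target ⊆ (T.h t).target := by
  intro y hy
  rw [← (T.h s).right_inv hy, T.h_eq_of_le h ((T.h s).map_target hy)]
  exact (T.h t).map_source (T.source_mono h ((T.h s).map_target hy))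

theorem symm_eq_of_le {s t : S} (h : LE s t) {y : X} (hy : y ∈ (T.h s).target) :
    (T.h s).symm y = (T.h t).symm y := by
  have h1 := (T.h s).map_target hy
  have h2 := T.h_eq_of_le h h1
  rw [(T.h s).right_inv hy] at h2
  conv_rhs => rw [h2]
  rw [(T.h t).left_inv (T.source_mono h h1)]

theorem target_idem {e : S} (he : e * e = e) : (T.h e).target = (T.h e).source := by
  rw [← T.source_inv, InverseSemigroup.inv_of_idem he]

theorem symm_idem {e : S} (he : e * e = e) {x : X} (hx : x ∈ (T.h e).target) :
    (T.h e).symm x = x := by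
  have h1 : x ∈ (T.h e).source := by rwa [← T.target_idem he]
  conv_lhs => rw [← T.h_idem he h1]
  exact (T.h e).left_inv h1

theorem target_inv_mul (t : S) : (T.h (t⁻¹ * t)).target = (T.h t).source := by
  rw [T.target_idem (InverseSemigroup.inv_mul_self_idem t)]
  ext x
  rw [T.mem_source_mul]
  exact ⟨fun h => h.1, fun h => ⟨h, (T.h_inv_h h).1⟩⟩

theorem symm_inv_apply {t : S} {y : X} (hy : y ∈ (T.h t).source) :
    (T.h t⁻¹).symm y = T.h t y := by
  have h1 := T.h_inv_h hy
  conv_lhs => rw [← h1.2]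
  exact (T.h t⁻¹).left_inv h1.1

/-- `u(t⁻¹, t) = u(t, t⁻¹) ∘ h_t`. -/
theorem u_inv_left {t : S} {x : X} (hx : x ∈ (T.h t).target) :
    T.u t⁻¹ t ((T.h t).symm x) = T.u t t⁻¹ x := by
  have h1 : (T.h t).symm x ∈ (T.h (t⁻¹ * t)).target := by
    rw [T.target_inv_mul]; exact (T.h t).map_target hx
  -- In the cocycle identity for `(t, t⁻¹, t)` the factors `u(t, t⁻¹ t)` and `u(t t⁻¹, t)` are 1.
  have h := T.cocycle t t⁻¹ t x hx h1
  rwa [T.u_right t x hx, T.u_left t x hx, mul_one, mul_one] at h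

end TwistedAction

/-! ### Functions with compact support, approximate units of ideals of `C₀(X)` -/

section CutOff

variable {𝕜 X : Type*} [RCLike 𝕜] [TopologicalSpace X]

/-- The functions in `C₀(U)` that vanish outside of a compact subset of `U`. -/
def CcOn (𝕜 : Type*) [RCLike 𝕜] {X : Type*} [TopologicalSpace X] (U : Set X) :
    Submodule 𝕜 (C0on 𝕜 U) where
  carrier := {a | ∃ K ⊆ U, IsCompact K ∧ ∀ x, x ∉ K → (a : C₀(X, 𝕜)) x = 0}
  add_mem' := by
    rintro a b ⟨K, hKU, hK, ha⟩ ⟨K', hKU', hK', hb⟩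
    refine ⟨K ∪ K', Set.union_subset hKU hKU', hK.union hK', fun x hx => ?_⟩
    have h1 := ha x fun h => hx (Or.inl h)
    have h2 := hb x fun h => hx (Or.inr h)
    simp [h1, h2]
  zero_mem' := ⟨∅, Set.empty_subset _, isCompact_empty, fun _ _ => rfl⟩
  smul_mem' := by
    rintro c a ⟨K, hKU, hK, ha⟩
    exact ⟨K, hKU, hK, fun x hx => by simp [ha x hx]⟩

/-- A compactly supported real function as an element of `C₀(X, 𝕜)`. -/
def ofRealC0 (𝕜 : Type*) [RCLike 𝕜] {X : Type*} [TopologicalSpace X] (f : C(X, ℝ))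
    (hf : HasCompactSupport f) : C₀(X, 𝕜) where
  toFun x := (f x : 𝕜)
  continuous_toFun := RCLike.continuous_ofReal.comp f.continuous
  zero_at_infty' := by
    have : HasCompactSupport fun x => ((f x : ℝ) : 𝕜) :=
      hf.comp_left (g := fun r : ℝ => (r : 𝕜)) RCLike.ofReal_zero
    exact this.is_zero_at_infty

@[simp]
theorem ofRealC0_apply (f : C(X, ℝ)) (hf : HasCompactSupport f) (x : X) :
    ofRealC0 𝕜 f hf x = (f x : 𝕜) := rfl

/-- The product of elements of `C₀(X)` and `C₀(U)`. -/
def cmul {U : Set X} (c : C₀(X, 𝕜)) (a : C0on 𝕜 U) : C0on 𝕜 U :=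
  ⟨c * a, fun x hx => by simp [a.2 x hx]⟩

@[simp]
theorem coe_cmul {U : Set X} (c : C₀(X, 𝕜)) (a : C0on 𝕜 U) :
    (cmul c a : C₀(X, 𝕜)) = c * a := rfl

theorem C0on_add_apply {U : Set X} (a b : C0on 𝕜 U) (x : X) :
    ((a + b : C0on 𝕜 U) : C₀(X, 𝕜)) x = (a : C₀(X, 𝕜)) x + (b : C₀(X, 𝕜)) x := rfl

theorem C0on_sub_apply {U : Set X} (a b : C0on 𝕜 U) (x : X) :
    ((a - b : C0on 𝕜 U) : C₀(X, 𝕜)) x = (a : C₀(X, 𝕜)) x - (b : C₀(X, 𝕜)) x := rfl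

theorem C0on_smul_apply {U : Set X} (c : 𝕜) (a : C0on 𝕜 U) (x : X) :
    ((c • a : C0on 𝕜 U) : C₀(X, 𝕜)) x = c * (a : C₀(X, 𝕜)) x := rfl

theorem cmul_apply {U : Set X} (c : C₀(X, 𝕜)) (a : C0on 𝕜 U) (x : X) :
    (cmul c a : C₀(X, 𝕜)) x = c x * (a : C₀(X, 𝕜)) x := rfl

theorem C0on_norm_le {U : Set X} {a : C0on 𝕜 U} {C : ℝ} (hC : 0 ≤ C)
    (h : ∀ x, ‖(a : C₀(X, 𝕜)) x‖ ≤ C) : ‖a‖ ≤ C := C0_norm_le hC h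

theorem norm_C0on_apply_le {U : Set X} (a : C0on 𝕜 U) (x : X) : ‖(a : C₀(X, 𝕜)) x‖ ≤ ‖a‖ :=
  norm_apply_le _ x

theorem cmul_mem_CcOn' {U : Set X} {c : C0on 𝕜 U} (hc : c ∈ CcOn 𝕜 U) (a : C0on 𝕜 U) :
    cmul c a ∈ CcOn 𝕜 U := by
  obtain ⟨K, hKU, hK, ha⟩ := hc
  exact ⟨K, hKU, hK, fun x hx => by simp [ha x hx]⟩

theorem isCompact_superlevel [T2Space X] {U : Set X} (a : C0on 𝕜 U) {ε : ℝ} (hε : 0 < ε) :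
    IsCompact {x | ε ≤ ‖(a : C₀(X, 𝕜)) x‖} ∧ {x | ε ≤ ‖(a : C₀(X, 𝕜)) x‖} ⊆ U := by
  constructor
  · have h0 : ∀ᶠ y in Filter.cocompact X, ‖(a : C₀(X, 𝕜)) y‖ < ε := by
      have := (a : C₀(X, 𝕜)).zero_at_infty'.norm
      simp only [norm_zero] at this
      exact this.eventually (gt_mem_nhds hε)
    obtain ⟨K, hK, hKa⟩ := Filter.mem_cocompact.1 h0
    refine hK.of_isClosed_subset
      (isClosed_le continuous_const (a : C₀(X, 𝕜)).continuous.norm) fun y hy => ?_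
    by_contra hyK
    exact absurd (show ‖(a : C₀(X, 𝕜)) y‖ < ε from hKa hyK) (not_lt.2 hy)
  · intro y hy
    by_contra hyU
    have h2 : ε ≤ ‖(a : C₀(X, 𝕜)) y‖ := hy
    rw [a.2 y hyU, norm_zero] at h2
    exact absurd h2 (not_le.2 hε)

variable [T2Space X] [LocallyCompactSpace X]

/-- Urysohn's lemma. The bound on `1 - c` is recorded because it controls the error `c a - a` where
`c` is not 1. -/
theorem exists_cutoff {U K : Set X} (hU : IsOpen U) (hK : IsCompact K) (hKU : K ⊆ U) :
    ∃ c ∈ CcOn 𝕜 U, (∀ x ∈ K, (c : C₀(X, 𝕜)) x = 1) ∧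
      ∀ x, ‖(c : C₀(X, 𝕜)) x‖ ≤ 1 ∧ ‖1 - (c : C₀(X, 𝕜)) x‖ ≤ 1 := by
  obtain ⟨f, h1, h2, h3, h4⟩ := exists_continuousMap_one_of_isCompact_subset_isOpen hK hU hKU
  have h2 : HasCompactSupport f := h2
  refine ⟨⟨ofRealC0 𝕜 f h2, fun x hx => ?_⟩, ⟨tsupport f, h3, h2, fun x hx => ?_⟩,
    fun x hx => ?_, fun x => ?_⟩
  · simp [image_eq_zero_of_notMem_tsupport fun h => hx (h3 h)]
  · simp [image_eq_zero_of_notMem_tsupport hx]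
  · simp [h1 hx]
  · obtain ⟨h5, h6⟩ := h4 x
    constructor
    · simp [abs_of_nonneg h5, h6]
    · have : (1 : 𝕜) - (f x : 𝕜) = ((1 - f x : ℝ) : 𝕜) := by push_cast; ring
      simp only [ofRealC0_apply]
      rw [this, RCLike.norm_ofReal, abs_of_nonneg (by linarith)]
      linarith

/-- Approximation of elements of `C₀(U)` by multiplication with functions in `C_c(U)`. -/
theorem norm_cutoff_sub_le {c a : C₀(X, 𝕜)} {ε : ℝ} (hε : 0 < ε)
    (h1 : ∀ x, ε ≤ ‖a x‖ → c x = 1) (h2 : ∀ x, ‖1 - c x‖ ≤ 1) : ‖c * a - a‖ ≤ ε := by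
  refine C0_norm_le hε.le fun x => ?_
  have h3 : (c * a - a) x = -((1 - c x) * a x) := by simp; ring
  rw [h3, norm_neg, norm_mul]
  by_cases hx : ε ≤ ‖a x‖
  · rw [h1 x hx]; simpa using hε.le
  · calc ‖1 - c x‖ * ‖a x‖ ≤ 1 * ε :=
        mul_le_mul (h2 x) (not_le.1 hx).le (norm_nonneg _) zero_le_one
      _ = ε := one_mul ε

theorem exists_cutoff_approx {U : Set X} (hU : IsOpen U) (a : C0on 𝕜 U) {ε : ℝ} (hε : 0 < ε) :
    ∃ c ∈ CcOn 𝕜 U, ‖(c : C₀(X, 𝕜))‖ ≤ 1 ∧ ‖(c : C₀(X, 𝕜)) * a - a‖ ≤ ε := by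
  obtain ⟨hK, hKU⟩ := isCompact_superlevel a hε
  obtain ⟨c, hc, h1, h2⟩ := exists_cutoff (𝕜 := 𝕜) hU hK hKU
  exact ⟨c, hc, C0_norm_le zero_le_one fun x => (h2 x).1,
    norm_cutoff_sub_le hε (fun x hx => h1 x hx) fun x => (h2 x).2⟩

theorem exists_CcOn_approx {U : Set X} (hU : IsOpen U) (a : C0on 𝕜 U) {ε : ℝ} (hε : 0 < ε) :
    ∃ b ∈ CcOn 𝕜 U, ‖b - a‖ ≤ ε := by
  obtain ⟨c, hc, -, h⟩ := exists_cutoff_approx hU a hε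
  exact ⟨cmul c a, cmul_mem_CcOn' hc a, h⟩

/-- The net consists of cutoffs indexed by the compact subsets of `U`, directed by inclusion. The
error on `b` is at most `ε / 2` once the index contains the compact set where `|b| ≥ ε / 2`. -/
theorem exists_isApproxUnit {U : Set X} (hU : IsOpen U) :
    ∃ l : Filter C₀(X, 𝕜), IsApproxUnit (C0on 𝕜 U) l := by
  let ι := {K : Set X // K ⊆ U ∧ IsCompact K}
  have : Nonempty ι := ⟨⟨∅, Set.empty_subset _, isCompact_empty⟩⟩
  have : IsDirectedOrder ι := ⟨fun K K' =>
    ⟨⟨K.1 ∪ K'.1, Set.union_subset K.2.1 K'.2.1, K.2.2.union K'.2.2⟩,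
      Set.subset_union_left, Set.subset_union_right⟩⟩
  choose c _ h1 h2 using fun K : ι => exists_cutoff (𝕜 := 𝕜) hU K.2.2 K.2.1
  refine ⟨Filter.map (fun K => (c K : C₀(X, 𝕜))) Filter.atTop, inferInstance, ?_, ?_⟩
  · exact Filter.eventually_map.2 (Filter.Eventually.of_forall fun K =>
      ⟨(c K).2, C0_norm_le zero_le_one fun x => (h2 K x).1⟩)
  · intro b hb
    rw [Filter.tendsto_map'_iff, Metric.tendsto_nhds]
    intro ε hε
    obtain ⟨hK, hKU⟩ := isCompact_superlevel (⟨b, hb⟩ : C0on 𝕜 U) (half_pos hε)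
    filter_upwards [Filter.eventually_ge_atTop (⟨_, hKU, hK⟩ : ι)] with K hKle
    rw [dist_eq_norm]
    exact (norm_cutoff_sub_le (half_pos hε) (fun x hx => h1 K x (hKle hx))
      fun x => (h2 K x).2).trans_lt (half_lt_self hε)

/-- A bounded functional on `C₀(U)` is concentrated on a compact subset of `U`. -/
theorem exists_concentrated {U : Set X} (hU : IsOpen U) (g : C0on 𝕜 U →ₗ[𝕜] 𝕜) {C : ℝ}
    (hg : ∀ a, ‖g a‖ ≤ C * ‖a‖) {ε : ℝ} (hε : 0 < ε) :
    ∃ c : C0on 𝕜 U, ∀ a : C0on 𝕜 U, ‖a‖ ≤ 1 → ‖g a - g (cmul c a)‖ ≤ ε := by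
  set A : Set ℝ := {r | ∃ a : C0on 𝕜 U, ‖a‖ ≤ 1 ∧ r = ‖g a‖} with hA
  have hC : 0 ≤ |C| := abs_nonneg C
  have hbdd : BddAbove A := by
    refine ⟨|C|, ?_⟩
    rintro _ ⟨a, ha, rfl⟩
    calc ‖g a‖ ≤ C * ‖a‖ := hg a
      _ ≤ |C| * ‖a‖ := by gcongr; exact le_abs_self C
      _ ≤ |C| * 1 := by gcongr
      _ = |C| := mul_one _
  have hne : A.Nonempty := ⟨_, 0, by simp, rfl⟩
  -- `b` almost attains the norm of `g`. One half of `ε` is spent here, the other on replacing `b`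
  -- by a compactly supported function; the denominator `|C| + 1` below stays positive even if `C =
  -- 0`.
  obtain ⟨_, ⟨b, hb, rfl⟩, hgb⟩ := exists_lt_of_lt_csSup hne (sub_lt_self (sSup A) (half_pos hε))
  obtain ⟨c₀, hc₀, hc₀1, hc₀b⟩ := exists_cutoff_approx hU b
    (show 0 < ε / 2 / (|C| + 1) by positivity)
  have hcb : cmul c₀ b ∈ CcOn 𝕜 U := cmul_mem_CcOn' hc₀ b
  have hb1 : ∀ x, ‖(cmul c₀ b : C₀(X, 𝕜)) x‖ ≤ 1 := fun x => by
    rw [coe_cmul, ZeroAtInftyContinuousMap.mul_apply, norm_mul]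
    exact mul_le_one₀ ((norm_apply_le _ x).trans hc₀1) (norm_nonneg _)
      ((norm_apply_le (b : C₀(X, 𝕜)) x).trans hb)
  have hgb' : sSup A - ε ≤ ‖g (cmul c₀ b)‖ := by
    have h1 : ‖g (cmul c₀ b) - g b‖ ≤ ε / 2 := by
      rw [← map_sub]
      calc ‖g (cmul c₀ b - b)‖ ≤ C * ‖cmul c₀ b - b‖ := hg _
        _ ≤ (|C| + 1) * (ε / 2 / (|C| + 1)) := by
          refine mul_le_mul ((le_abs_self C).trans (by linarith)) hc₀b
            (norm_nonneg (cmul c₀ b - b : C0on 𝕜 U).1) (by positivity)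
        _ = ε / 2 := by field_simp
    have h2 := norm_sub_norm_le (g b) (g (cmul c₀ b))
    rw [norm_sub_rev] at h2
    linarith
  obtain ⟨K, hKU, hK, hKb⟩ := hcb
  -- `c = 1` on the support of the almost norming function, so `a - c a` lives off that support.
  obtain ⟨c, hc, hc1, hc2⟩ := exists_cutoff (𝕜 := 𝕜) hU hK hKU
  refine ⟨c, fun a ha => ?_⟩
  rw [← map_sub]
  obtain ⟨θ, hθ, hθg⟩ := RCLike.exists_norm_eq_mul_self (g (a - cmul c a))
  obtain ⟨ω, hω, hωg⟩ := RCLike.exists_norm_eq_mul_self (g (cmul c₀ b))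
  -- Two functions of norm at most 1 that are nowhere simultaneously nonzero have a sum of norm at
  -- most 1. With phases that make both values of `g` nonnegative, these values add up to at most
  -- the norm of `g`. The first one already exhausts this norm up to `ε`, so the second is at most
  -- `ε`.
  have h3 : ‖ω • cmul c₀ b + θ • (a - cmul c a)‖ ≤ 1 := by
    refine C0on_norm_le zero_le_one fun x => ?_
    rw [C0on_add_apply, C0on_smul_apply, C0on_smul_apply, C0on_sub_apply, cmul_apply c.1]
    by_cases hx : x ∈ K
    · rw [hc1 x hx, one_mul, sub_self, mul_zero, add_zero, norm_mul, hω, one_mul]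
      exact hb1 x
    · have h4 : (a : C₀(X, 𝕜)) x - (c : C₀(X, 𝕜)) x * (a : C₀(X, 𝕜)) x
          = (1 - (c : C₀(X, 𝕜)) x) * (a : C₀(X, 𝕜)) x := by ring
      rw [h4, hKb x hx, mul_zero, zero_add, norm_mul, hθ, one_mul, norm_mul]
      exact mul_le_one₀ (hc2 x).2 (norm_nonneg _) ((norm_apply_le (a : C₀(X, 𝕜)) x).trans ha)
  have h5 : ‖g (cmul c₀ b)‖ + ‖g (a - cmul c a)‖ ≤ sSup A := by
    have h6 : g (ω • cmul c₀ b + θ • (a - cmul c a))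
        = ((‖g (cmul c₀ b)‖ + ‖g (a - cmul c a)‖ : ℝ) : 𝕜) := by
      rw [map_add, map_smul, map_smul, smul_eq_mul, smul_eq_mul, ← hθg, ← hωg]
      push_cast; rfl
    have h7 := le_csSup hbdd ⟨_, h3, rfl⟩
    rw [h6, RCLike.norm_ofReal, abs_of_nonneg (by positivity)] at h7
    exact h7
  linarith

/-- Limits of a bounded functional along approximate units of `C₀(U)` do not depend on the
approximate unit. -/
theorem limit_unique {U : Set X} (hU : IsOpen U) {g g' : C₀(X, 𝕜) →ₗ[𝕜] 𝕜} {C : ℝ}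
    (hg : ∀ a, ‖g a‖ ≤ C * ‖a‖) (h : ∀ a ∈ C0on 𝕜 U, g a = g' a) {l l' : Filter C₀(X, 𝕜)}
    (hl : IsApproxUnit (C0on 𝕜 U) l) (hl' : IsApproxUnit (C0on 𝕜 U) l') {z z' : 𝕜}
    (hz : Filter.Tendsto g l (𝓝 z)) (hz' : Filter.Tendsto g' l' (𝓝 z')) : z = z' := by
  -- The number `w = g(c)` depends only on `g` and `ε`. Along any approximate unit `g(c μ)` tends to
  -- `g(c)`, while `g(μ)` stays within `ε` of `g(c μ)` by concentration.
  have key : ∀ ε > 0, ∃ w : 𝕜, ∀ l : Filter C₀(X, 𝕜), IsApproxUnit (C0on 𝕜 U) l → ∀ z : 𝕜,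
      Filter.Tendsto g l (𝓝 z) → ‖z - w‖ ≤ ε := by
    intro ε hε
    obtain ⟨c, hc⟩ := exists_concentrated hU (g.comp (C0on 𝕜 U).subtype) (fun a => hg a) hε
    refine ⟨g c, fun l hl z hz => ?_⟩
    have := hl.neBot
    have h1 : Filter.Tendsto (fun a => g (a * c)) l (𝓝 (g c)) := by
      rw [tendsto_iff_norm_sub_tendsto_zero]
      have h2 := tendsto_iff_norm_sub_tendsto_zero.1 (hl.tendsto c c.2)
      refine squeeze_zero (fun _ => norm_nonneg _) (fun a => ?_)
        (by simpa using h2.const_mul C)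
      rw [← map_sub]
      exact hg _
    refine le_of_tendsto (hz.sub h1).norm ?_
    filter_upwards [hl.mem] with a ha
    have h3 := hc ⟨a, ha.1⟩ ha.2
    have h4 : a * (c : C₀(X, 𝕜)) = c * a := mul_comm _ _
    rw [h4]
    exact h3
  have hz'' : Filter.Tendsto g l' (𝓝 z') := hz'.congr' (by
    filter_upwards [hl'.mem] with a ha
    exact (h a ha.1).symm)
  rw [← sub_eq_zero, ← norm_le_zero_iff]
  refine le_of_forall_pos_le_add fun ε hε => ?_
  obtain ⟨w, hw⟩ := key (ε / 2) (half_pos hε)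
  have h1 := hw l hl z hz
  have h2 := hw l' hl' z' hz''
  calc ‖z - z'‖ = ‖(z - w) - (z' - w)‖ := by congr 1; ring
    _ ≤ ‖z - w‖ + ‖z' - w‖ := norm_sub_le _ _
    _ ≤ 0 + ε := by linarith

/-- An additive property of functions that holds for all functions with small support holds for
all functions with compact support. -/
theorem partition_induction {P : C₀(X, 𝕜) → Prop} (h0 : P 0)
    (hadd : ∀ a b, P a → P b → P (a + b)) {a : C₀(X, 𝕜)} {K : Set X} (hK : IsCompact K)
    (haK : ∀ x, x ∉ K → a x = 0) {ι : Type*} {V : ι → Set X} (hV : ∀ i, IsOpen (V i))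
    (hKV : K ⊆ ⋃ i, V i)
    (h : ∀ i (c : C₀(X, 𝕜)), (∃ K' ⊆ V i ∩ K, IsCompact K' ∧ ∀ x, x ∉ K' → (c * a) x = 0) →
      P (c * a)) : P a := by
  obtain ⟨t, ht⟩ := hK.elim_finite_subcover V hV hKV
  let W : Fin t.card → Set X := fun i => V (t.equivFin.symm i).1
  obtain ⟨ρ, hρs, hρ1, -, hρc⟩ := exists_continuous_sum_one_of_isOpen_isCompact
    (t := K) (s := W) (fun i => hV _) hK (by
      intro x hx
      obtain ⟨i, hi⟩ := Set.mem_iUnion.1 (ht hx)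
      obtain ⟨hit, hxi⟩ := Set.mem_iUnion.1 hi
      refine Set.mem_iUnion.2 ⟨t.equivFin ⟨i, hit⟩, ?_⟩
      simp only [W, Equiv.symm_apply_apply]
      exact hxi)
  have hsum : a = ∑ i, ofRealC0 𝕜 (ρ i) (hρc i) * a := by
    ext x
    have h1 : ∀ s : Finset (Fin t.card), (∑ i ∈ s, ofRealC0 𝕜 (ρ i) (hρc i) * a) x
        = ((∑ i ∈ s, ρ i x : ℝ) : 𝕜) * a x := by
      intro s
      classical
      induction s using Finset.induction_on with
      | empty => simp
      | insert i s hi ih =>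
        rw [Finset.sum_insert hi, Finset.sum_insert hi, ZeroAtInftyContinuousMap.add_apply, ih]
        simp; ring
    rw [h1]
    by_cases hx : x ∈ K
    · have h2 := hρ1 hx
      simp only [Finset.sum_apply, Pi.one_apply] at h2
      rw [h2]; simp
    · rw [haK x hx, mul_zero]
  have hP : ∀ s : Finset (Fin t.card), P (∑ i ∈ s, ofRealC0 𝕜 (ρ i) (hρc i) * a) := by
    intro s
    classical
    induction s using Finset.induction_on with
    | empty => simpa using h0
    | insert i s hi ih =>
      rw [Finset.sum_insert hi]
      refine hadd _ _ (h _ _ ⟨tsupport (ρ i) ∩ K, Set.inter_subset_inter_left _ (hρs i),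
        (hρc i).isCompact.inter hK, fun x hx => ?_⟩) ih
      by_cases hxK : x ∈ K
      · have h2 : ρ i x = 0 := image_eq_zero_of_notMem_tsupport fun h => hx ⟨h, hxK⟩
        simp [h2]
      · simp [haK x hxK]
  rw [hsum]
  exact hP _

end CutOff

/-! ### Extension by density and weak-* limits -/

section Extension

variable {𝕜 : Type*} [RCLike 𝕜] {V B : Type*} [NormedAddCommGroup V] [NormedSpace 𝕜 V]
  [NormedAddCommGroup B] [NormedSpace 𝕜 B]

/-- Density is meant in the seminorm pulled back along `ι`. Since `f` is dominated by it, `f`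
extends continuously from the dense image of `W` to the range of `ι`, and the extension is then
composed with `ι`. -/
theorem exists_extension [CompleteSpace B] {J : Type*} [AddCommMonoid J] [Module 𝕜 J]
    (ι : J →ₗ[𝕜] V) (W : Submodule 𝕜 J) (hW : ∀ v, ∀ ε > 0, ∃ w ∈ W, ‖ι w - ι v‖ ≤ ε)
    (f : W →ₗ[𝕜] B) (hf : ∀ w : W, ‖f w‖ ≤ ‖ι w‖) :
    ∃ g : J →ₗ[𝕜] B, (∀ v, ‖g v‖ ≤ ‖ι v‖) ∧ ∀ w : W, g w = f w := by
  let _ : AddCommGroup J := Module.addCommMonoidToAddCommGroup 𝕜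
  let e : W →ₗ[𝕜] LinearMap.range ι := ι.rangeRestrict.comp W.subtype
  have hd : DenseRange e := by
    rintro ⟨_, v, rfl⟩
    rw [Metric.mem_closure_iff]
    intro ε hε
    obtain ⟨w, hw, h⟩ := hW v (ε / 2) (half_pos hε)
    refine ⟨_, ⟨⟨w, hw⟩, rfl⟩, ?_⟩
    rw [dist_comm, Subtype.dist_eq, dist_eq_norm]
    change ‖ι w - ι v‖ < ε
    exact h.trans_lt (half_lt_self hε)
  have hf' : ∀ w : W, ‖f w‖ ≤ 1 * ‖e w‖ := fun w => by rw [one_mul]; exact hf w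
  refine ⟨(f.extendOfNorm e).toLinearMap.comp ι.rangeRestrict, fun v => ?_, fun w => ?_⟩
  · have := LinearMap.norm_extendOfNorm_apply_le hd 1 hf' (ι.rangeRestrict v)
    rwa [one_mul] at this
  · exact LinearMap.extendOfNorm_eq hd ⟨1, hf'⟩ w

/-- The gauge `N` need not be a seminorm: only the two bounds at the single vector `w - v` are used.
-/
theorem linear_ext_of_dense {J : Type*} [AddCommGroup J] [Module 𝕜 J] {N : J → ℝ}
    (hN : ∀ v, 0 ≤ N v) (W : Submodule 𝕜 J)
    (hW : ∀ v, ∀ ε > 0, ∃ w ∈ W, N (w - v) ≤ ε) {f g : J →ₗ[𝕜] B} {C : ℝ}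
    (hf : ∀ v, ‖f v‖ ≤ C * N v) (hg : ∀ v, ‖g v‖ ≤ C * N v) (h : ∀ w ∈ W, f w = g w) (v : J) :
    f v = g v := by
  rw [← sub_eq_zero, ← norm_le_zero_iff]
  refine le_of_forall_pos_le_add fun ε hε => ?_
  obtain ⟨w, hw, hwv⟩ := hW v (ε / (2 * (|C| + 1))) (by positivity)
  have h1 : f v - g v = -(f (w - v) - g (w - v)) := by
    rw [map_sub, map_sub, h w hw]; abel
  have hC : C ≤ |C| + 1 := (le_abs_self C).trans (by linarith)
  have h2 : ∀ k : J →ₗ[𝕜] B, (∀ v, ‖k v‖ ≤ C * N v) → ‖k (w - v)‖ ≤ ε / 2 := fun k hk => by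
    calc ‖k (w - v)‖ ≤ C * N (w - v) := hk _
      _ ≤ (|C| + 1) * (ε / (2 * (|C| + 1))) :=
        mul_le_mul hC hwv (hN _) (by positivity)
      _ = ε / 2 := by field_simp
  rw [h1, norm_neg]
  calc ‖f (w - v) - g (w - v)‖ ≤ ‖f (w - v)‖ + ‖g (w - v)‖ := norm_sub_le _ _
    _ ≤ 0 + ε := by linarith [h2 f hf, h2 g hg]

/-- Weak-* compactness of the unit ball, in terms of ultrafilters. -/
theorem exists_ultralimit {ι : Type*} (l : Ultrafilter ι) (φ : ι → StrongDual 𝕜 V)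
    (hφ : ∀ᶠ i in l, ‖φ i‖ ≤ 1) :
    ∃ ψ : StrongDual 𝕜 V, ‖ψ‖ ≤ 1 ∧ ∀ x, Filter.Tendsto (fun i => φ i x) l (𝓝 (ψ x)) := by
  have hc := WeakDual.isCompact_closedBall (𝕜 := 𝕜) (0 : StrongDual 𝕜 V) 1
  obtain ⟨ψ, hψ, hl⟩ := hc.ultrafilter_le_nhds (l.map fun i => StrongDual.toWeakDual (φ i)) (by
    rw [Filter.le_principal_iff]
    change ∀ᶠ i in (l : Filter ι), _
    filter_upwards [hφ] with i hi
    simpa using hi)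
  refine ⟨WeakDual.toStrongDual ψ, by simpa using hψ, fun x => ?_⟩
  exact ((WeakDual.eval_continuous x).tendsto ψ).comp hl

end Extension

end

section

/-! ### Multiplication by unimodular functions -/

section MulUnit

variable {𝕜 X : Type*} [RCLike 𝕜] [TopologicalSpace X]

/-- The product of an element of `C₀(U)` with a continuous function on `U` with values in the unit
ball. -/
def mulUnit {U : Set X} (hU : IsOpen U) (m : X → 𝕜) (hm : ContinuousOn m U)
    (hm1 : ∀ x ∈ U, ‖m x‖ ≤ 1) (a : C0on 𝕜 U) : C0on 𝕜 U :=
  dominated hU a (fun x => (a : C₀(X, 𝕜)) x * m x) 1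
    ((a : C₀(X, 𝕜)).continuous.continuousOn.mul hm) fun x => by
      by_cases hx : x ∈ U
      · rw [norm_mul, mul_comm]
        exact mul_le_mul_of_nonneg_right (hm1 x hx) (norm_nonneg _)
      · simp [a.2 x hx]

@[simp]
theorem mulUnit_apply {U : Set X} (hU : IsOpen U) (m : X → 𝕜) (hm : ContinuousOn m U)
    (hm1 : ∀ x ∈ U, ‖m x‖ ≤ 1) (a : C0on 𝕜 U) (x : X) :
    (mulUnit hU m hm hm1 a : C₀(X, 𝕜)) x = (a : C₀(X, 𝕜)) x * m x := rfl

theorem norm_mulUnit_le {U : Set X} (hU : IsOpen U) (m : X → 𝕜) (hm : ContinuousOn m U)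
    (hm1 : ∀ x ∈ U, ‖m x‖ ≤ 1) (a : C0on 𝕜 U) : ‖mulUnit hU m hm hm1 a‖ ≤ ‖a‖ := by
  refine C0on_norm_le (norm_nonneg (a : C₀(X, 𝕜))) fun x => ?_
  rw [mulUnit_apply]
  by_cases hx : x ∈ U
  · rw [norm_mul]
    exact (mul_le_of_le_one_right (norm_nonneg _) (hm1 x hx)).trans (norm_C0on_apply_le a x)
  · rw [a.2 x hx, zero_mul, norm_zero]
    exact norm_nonneg (a : C₀(X, 𝕜))

/-- A function in `C₀(U)` that vanishes outside of `V` is in `C₀(V)`. -/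
def C0on.cast {U : Set X} (V : Set X) (a : C0on 𝕜 U)
    (h : ∀ x, x ∉ V → (a : C₀(X, 𝕜)) x = 0) : C0on 𝕜 V := ⟨a, h⟩

@[simp]
theorem C0on.coe_cast {U V : Set X} (a : C0on 𝕜 U) (h : ∀ x, x ∉ V → (a : C₀(X, 𝕜)) x = 0) :
    (C0on.cast V a h : C₀(X, 𝕜)) = a := rfl

end MulUnit

/-! ### Graded representations -/

section Graded

variable {𝕜 X S : Type*} [RCLike 𝕜] [TopologicalSpace X] [T2Space X] [InverseSemigroup S]

/-- A family of contractions `Ψ_t : I_t → F` that is compatible with the natural order of `S`. -/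
structure GradedFamily (T : TwistedAction 𝕜 X S) (F : Type*) [NormedAddCommGroup F]
    [NormedSpace 𝕜 F] where
  map : ∀ t, T.I t →ₗ[𝕜] F
  norm_le : ∀ t a, ‖map t a‖ ≤ ‖a‖
  /-- `Ψ_t(a) = Ψ_s(a u(s s⁻¹, t))` for `s ≤ t` and `a ∈ I_s` -/
  restrict : ∀ s t, LE s t → ∀ (a : T.I t) (b : T.I s),
    (∀ x, x ∉ (T.h s).target → (a : C₀(X, 𝕜)) x = 0) →
    (∀ x ∈ (T.h s).target, (b : C₀(X, 𝕜)) x = (a : C₀(X, 𝕜)) x * T.u (s * s⁻¹) t x) →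
    map t a = map s b

/-- A graded family with values in a Banach algebra that is multiplicative. -/
structure GradedRep (T : TwistedAction 𝕜 X S) (B : Type*) [NonUnitalNormedRing B]
    [NormedSpace 𝕜 B] extends GradedFamily T B where
  mul : ∀ s t (a : T.I s) (b : T.I t), map s a * map t b = map (s * t) (T.coeffMul s t a b)

theorem GradedFamily.map_congr {T : TwistedAction 𝕜 X S} {F : Type*} [NormedAddCommGroup F]
    [NormedSpace 𝕜 F] (Ψ : GradedFamily T F) {s t : S} (h : s = t) {a : T.I s} {b : T.I t}
    (hab : (a : C₀(X, 𝕜)) = b) : Ψ.map s a = Ψ.map t b := by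
  subst h
  rw [Subtype.ext hab]

/-- The function `u(s s⁻¹, t)` is continuous and unimodular on `X_s` if `s ≤ t`. -/
theorem TwistedAction.u_of_le (T : TwistedAction 𝕜 X S) {s t : S} (h : LE s t) :
    ContinuousOn (T.u (s * s⁻¹) t) (T.h s).target ∧
      ∀ x ∈ (T.h s).target, ‖T.u (s * s⁻¹) t x‖ = 1 := by
  have h1 := h.range_mul
  have h2 := T.continuousOn_u (s * s⁻¹) t
  have h3 := T.norm_u (s * s⁻¹) t
  rw [h1] at h2 h3
  exact ⟨h2, h3⟩

theorem star_mul_self_of_norm {z : 𝕜} (hz : ‖z‖ = 1) : star z * z = 1 := by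
  rw [RCLike.star_def, RCLike.conj_mul, hz]; simp

end Graded

/-! ### The sections `a δ_t`, their relations, and the description of `C_c(U_t, L)`. -/

namespace Models

open Bundle (TotalSpace)

variable {𝕜 X S Y G : Type*} [RCLike 𝕜] [TopologicalSpace X] [T2Space X]
  [InverseSemigroup S] [TopologicalSpace Y] [TopologicalSpace G] {T : TwistedAction 𝕜 X S}
  {𝓖 : EtaleGroupoid Y G} {L : G → Type*} [∀ γ, NormedAddCommGroup (L γ)]
  [∀ γ, NormedSpace 𝕜 (L γ)] [TopologicalSpace (TotalSpace 𝕜 L)] {𝓛 : Twist 𝕜 𝓖 L}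
  (M : Models T 𝓛)

theorem norm_deltaFun_apply (t : S) (a : T.I t) (x : (T.h t).source) :
    ‖M.deltaFun t a (M.φ (T.germ t x))‖ = ‖(a : C₀(X, 𝕜)) (T.h t x)‖ := by
  rw [M.deltaFun_apply, M.norm_vec]

theorem norm_deltaFun_le (t : S) (a : T.I t) (γ : G) : ‖M.deltaFun t a γ‖ ≤ ‖a‖ := by
  by_cases h : γ ∈ M.U t
  · obtain ⟨x, rfl⟩ := h
    rw [M.norm_deltaFun_apply]
    exact norm_C0on_apply_le a _
  · rw [M.deltaFun_eq_zero t a h, norm_zero]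
    exact norm_nonneg (a : C₀(X, 𝕜))

/-- The section `a δ_t` as a linear function of `a`. -/
def deltaLin (t : S) : T.I t →ₗ[𝕜] ∀ γ, L γ where
  toFun := M.deltaFun t
  map_add' a b := by
    funext γ
    by_cases h : γ ∈ M.U t
    · obtain ⟨x, rfl⟩ := h
      simp only [Pi.add_apply, M.deltaFun_apply, map_add]
    · simp only [Pi.add_apply, M.deltaFun_eq_zero t _ h, add_zero]
  map_smul' c a := by
    funext γ
    by_cases h : γ ∈ M.U t
    · obtain ⟨x, rfl⟩ := h
      simp only [Pi.smul_apply, M.deltaFun_apply, map_smul, RingHom.id_apply]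
    · simp only [Pi.smul_apply, M.deltaFun_eq_zero t _ h, smul_zero, RingHom.id_apply]

theorem deltaLin_apply (t : S) (a : T.I t) : M.deltaLin t a = M.deltaFun t a := rfl

theorem deltaFun_sub (t : S) (a b : T.I t) :
    M.deltaFun t (a - b) = M.deltaFun t a - M.deltaFun t b := map_sub (M.deltaLin t) a b

theorem deltaFun_add (t : S) (a b : T.I t) :
    M.deltaFun t (a + b) = M.deltaFun t a + M.deltaFun t b := map_add (M.deltaLin t) a b

theorem germ_eq_of_le {s t : S} (h : LE s t) {x : X} (hx : x ∈ (T.h s).source) :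
    T.germ s ⟨x, hx⟩ = T.germ t ⟨x, T.source_mono h hx⟩ :=
  T.germ_eq_iff.2 ⟨rfl, s, le_refl' s, h, hx⟩

/-- This relation between the sections is the source of the field `restrict` of `GradedFamily`. Over
`U_s` both sections have the same class in the line bundle. Off `U_s` both vanish: a germ of `U_t`
with range in `X_s` already belongs to `U_s`. -/
theorem deltaFun_restrict {s t : S} (h : LE s t) (a : T.I t) (b : T.I s)
    (ha : ∀ x, x ∉ (T.h s).target → (a : C₀(X, 𝕜)) x = 0)
    (hb : ∀ x ∈ (T.h s).target, (b : C₀(X, 𝕜)) x = (a : C₀(X, 𝕜)) x * T.u (s * s⁻¹) t x) :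
    M.deltaFun t a = M.deltaFun s b := by
  funext γ
  by_cases hs : γ ∈ M.U s
  · obtain ⟨⟨x, hx⟩, rfl⟩ := hs
    have h1 : T.lineGerm t a ⟨x, T.source_mono h hx⟩ = T.lineGerm s b ⟨x, hx⟩ := by
      -- The witness is `s` itself, for which the twist on the side of `b` is `u(s s⁻¹, s) = 1`.
      refine Quot.sound ⟨rfl, s, h, le_refl' s, hx, ?_⟩
      change (a : C₀(X, 𝕜)) (T.h s x) * T.u (s * s⁻¹) t (T.h s x)
        = (b : C₀(X, 𝕜)) (T.h s x) * T.u (s * s⁻¹) s (T.h s x)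
      have h2 := (T.h s).map_source hx
      rw [T.u_left s _ h2, hb _ h2, mul_one]
    have h3 := congrArg M.Φ h1
    rw [M.Φ_apply, M.Φ_apply] at h3
    have h4 := M.deltaFun_apply t a ⟨x, T.source_mono h hx⟩
    have h5 := M.deltaFun_apply s b ⟨x, hx⟩
    rw [← h4, ← h5, ← germ_eq_of_le h hx] at h3
    simpa using h3
  · rw [M.deltaFun_eq_zero s b hs]
    by_cases ht : γ ∈ M.U t
    · obtain ⟨x, rfl⟩ := ht
      have h1 : T.h t x ∉ (T.h s).target := fun hy => by
        have h2 : (T.h s).symm (T.h t x) = x := by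
          rw [T.symm_eq_of_le h hy, (T.h t).left_inv x.2]
        have h3 : (x : X) ∈ (T.h s).source := by rw [← h2]; exact (T.h s).map_target hy
        exact hs ⟨⟨x, h3⟩, congrArg M.φ (germ_eq_of_le h h3)⟩
      rw [← norm_eq_zero]
      change ‖M.deltaFun t a (M.φ (T.germ t x))‖ = 0
      rw [M.norm_deltaFun_apply, ha _ h1, norm_zero]
    · exact M.deltaFun_eq_zero t a ht

/-- Since `r` is injective on `U_s`, at most one factorisation of `ζ` contributes to the
convolution, and the product of the corresponding vectors is prescribed by `mul_vec`. -/
theorem conv_deltaFun (s t : S) (a : T.I s) (b : T.I t) :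
    𝓛.conv (M.deltaFun s a) (M.deltaFun t b) = M.deltaFun (s * t) (T.coeffMul s t a b) := by
  have h0 : ∀ γ, γ ∉ M.U s → M.deltaFun s a γ = 0 := fun γ => M.deltaFun_eq_zero s a
  have hi := (M.isBisection_U s).injOn_r
  funext ζ
  by_cases hζ : ζ ∈ M.U (s * t)
  · obtain ⟨x, rfl⟩ := hζ
    change 𝓛.conv _ _ (M.φ (T.germ (s * t) x)) = M.deltaFun _ _ (M.φ (T.germ (s * t) x))
    rw [𝓛.conv_apply hi h0 _ ⟨_, rfl⟩ (M.mul_φ s t x), M.deltaFun_apply, M.deltaFun_apply,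
      M.deltaFun_apply, M.mul_vec]
  · rw [M.deltaFun_eq_zero _ _ hζ]
    by_cases h1 : 𝓖.r ζ ∈ 𝓖.r '' M.U s
    · obtain ⟨γ, hγ, hr⟩ := h1
      have hp := 𝓖.isProd_inv_mul hr
      rw [𝓛.conv_apply hi h0 _ hγ hp, M.deltaFun_eq_zero t b, map_zero]
      intro hη
      exact hζ (by rw [← M.setMul_U]; exact ⟨γ, hγ, _, hη, hp⟩)
    · exact 𝓛.conv_eq_zero h0 _ h1

theorem germ_continuous (t : S) : Continuous fun y : (T.h t).target =>
    M.φ (T.germ t ⟨(T.h t).symm y, (T.h t).map_target y.2⟩) := by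
  have h1 : Continuous fun y : (T.h t).target => (T.h t).symm y :=
    continuousOn_iff_continuous_domRestrict.1 (T.h t).continuousOn_symm
  exact M.φ.continuous.comp (continuous_quot_mk.comp (continuous_sigmaMk.comp
    (Continuous.subtype_mk h1 fun y => (T.h t).map_target y.2)))

variable [LocallyCompactSpace X]

/-- A section over `U_t` is a scalar function in the local frames given by the sections `c δ_t` with
`c` a cutoff. The norm of `[a, t, x]` is `|a(h_t(x))|`, so continuity of the norm on the bundle
gives continuity of this function. The norm bound makes the norm of `F^S(G, L)` computable from
coefficients. -/
theorem exists_deltaFun_eq (t : S) {f : ∀ γ, L γ} (hf : f ∈ 𝓛.Cc (M.U t)) :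
    ∃ a ∈ T.Ic t, f = M.deltaFun t a ∧ ‖a‖ ≤ Twist.supNorm f := by
  classical
  have hcut : ∀ y ∈ (T.h t).target, ∃ c ∈ CcOn 𝕜 (T.h t).target, (c : C₀(X, 𝕜)) y = 1 := by
    intro y hy
    obtain ⟨c, hc, h1, -⟩ := exists_cutoff (𝕜 := 𝕜) (T.h t).open_target
      (isCompact_singleton (x := y)) (Set.singleton_subset_iff.2 hy)
    exact ⟨c, hc, h1 y rfl⟩
  -- The fibre is a line spanned by the value of a cutoff that is 1 at `h_t(x)`. The vector `vec t x
  -- a` depends only on `a(h_t(x))`, since its norm vanishes with this number.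
  have hscal : ∀ x : (T.h t).source, ∃ z : 𝕜, ∀ a : T.I t,
      (a : C₀(X, 𝕜)) (T.h t x) = z → f (M.φ (T.germ t x)) = M.vec t x a := by
    intro x
    obtain ⟨c, -, hc⟩ := hcut _ ((T.h t).map_source x.2)
    have hc0 : M.vec t x c ≠ 0 := by
      rw [← norm_ne_zero_iff, M.norm_vec, hc, norm_one]
      exact one_ne_zero
    obtain ⟨z, hz⟩ := (finrank_eq_one_iff_of_nonzero' _ hc0).1
      (𝓛.finrank (M.φ (T.germ t x))) (f (M.φ (T.germ t x)))
    refine ⟨z, fun a ha => ?_⟩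
    rw [← hz, ← sub_eq_zero, ← map_smul, ← map_sub, ← norm_eq_zero, M.norm_vec,
      C0on_sub_apply, C0on_smul_apply, hc, ha, mul_one, sub_self, norm_zero]
  choose z hz using hscal
  let g : X → 𝕜 := fun y =>
    if hy : y ∈ (T.h t).target then z ⟨(T.h t).symm y, (T.h t).map_target hy⟩ else 0
  have hg : ∀ x : (T.h t).source, g (T.h t x) = z x := fun x => by
    have hy := (T.h t).map_source x.2
    simp only [g, dif_pos hy]
    congr 1
    exact Subtype.ext ((T.h t).left_inv x.2)
  -- Norms of differences in the fibre are absolute values of differences of coefficients; this is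
  -- how topological information passes from `L` to `g`.
  have hgz : ∀ x a w, ‖f (M.φ (T.germ t x)) - w • M.vec t x a‖
      = ‖g (T.h t x) - w * (a : C₀(X, 𝕜)) (T.h t x)‖ := by
    intro x a w
    obtain ⟨c, -, hc⟩ := hcut _ ((T.h t).map_source x.2)
    rw [hz x (z x • c) (by rw [C0on_smul_apply, hc, mul_one]), ← map_smul, ← map_sub, M.norm_vec,
      C0on_sub_apply, C0on_smul_apply, C0on_smul_apply, hc, mul_one, hg]
  have hnorm : ∀ x : (T.h t).source, ‖g (T.h t x)‖ = ‖f (M.φ (T.germ t x))‖ := fun x => by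
    have := hgz x 0 0
    simpa using this.symm
  have hcont : ContinuousOn g (T.h t).target := by
    rw [continuousOn_iff_continuous_domRestrict, continuous_iff_continuousAt]
    intro y₀
    obtain ⟨c, hc, hc1⟩ := hcut y₀ y₀.2
    -- Freezing the coefficient at `y₀` gives a section that vanishes there. Its norm is continuous,
    -- so `g - g(y₀) c` tends to 0, while `g(y₀) c` tends to `g(y₀)`.
    have h1 : f - g y₀ • M.deltaFun t c ∈ 𝓛.Cc (M.U t) :=
      sub_mem hf (Submodule.smul_mem _ _ (M.deltaFun_mem t hc))
    have h2 : Continuous fun y : (T.h t).target => ‖(f - g y₀ • M.deltaFun t c)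
        (M.φ (T.germ t ⟨(T.h t).symm y, (T.h t).map_target y.2⟩))‖ := by
      rw [← continuousOn_univ]
      have h2' := 𝓛.continuous_norm.comp_continuousOn h1.1
      exact h2'.comp (M.germ_continuous t).continuousOn fun y _ => ⟨_, rfl⟩
    have h3 : ∀ y : (T.h t).target, ‖(f - g y₀ • M.deltaFun t c)
        (M.φ (T.germ t ⟨(T.h t).symm y, (T.h t).map_target y.2⟩))‖
          = ‖g y - g y₀ * (c : C₀(X, 𝕜)) y‖ := fun y => by
      rw [Pi.sub_apply, Pi.smul_apply, M.deltaFun_apply, hgz]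
      simp only [(T.h t).right_inv y.2]
    simp only [h3] at h2
    have h4 : Filter.Tendsto (fun y : (T.h t).target => g y - g y₀ * (c : C₀(X, 𝕜)) y)
        (𝓝 y₀) (𝓝 0) := by
      rw [tendsto_zero_iff_norm_tendsto_zero]
      have := h2.tendsto y₀
      rwa [hc1, mul_one, sub_self, norm_zero] at this
    have h5 : Filter.Tendsto (fun y : (T.h t).target => g y₀ * (c : C₀(X, 𝕜)) y)
        (𝓝 y₀) (𝓝 (g y₀)) := by
      have h6 : Continuous fun y : (T.h t).target => g y₀ * (c : C₀(X, 𝕜)) y :=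
        continuous_const.mul ((c : C₀(X, 𝕜)).continuous.comp continuous_subtype_val)
      have := h6.tendsto y₀
      rwa [hc1, mul_one] at this
    have h7 := h4.add h5
    simp only [sub_add_cancel, zero_add] at h7
    exact h7
  obtain ⟨hfc, K, hKU, hK, hfK⟩ := id hf
  set K' : Set X := M.base.symm '' (𝓖.r '' K) with hK'
  have hK'c : IsCompact K' := (hK.image 𝓖.continuous_r).image M.base.symm.continuous
  have hK't : K' ⊆ (T.h t).target := by
    rintro _ ⟨_, ⟨γ, hγ, rfl⟩, rfl⟩
    obtain ⟨x, rfl⟩ := hKU hγ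
    change M.base.symm (𝓖.r (M.φ (T.germ t x))) ∈ _
    rw [M.r_φ, Homeomorph.symm_apply_apply]
    exact (T.h t).map_source x.2
  have hg0 : ∀ y, y ∉ K' → g y = 0 := by
    intro y hy
    by_cases hyt : y ∈ (T.h t).target
    · have h1 := hnorm ⟨(T.h t).symm y, (T.h t).map_target hyt⟩
      simp only [(T.h t).right_inv hyt] at h1
      rw [← norm_eq_zero, h1, hfK, norm_zero]
      intro hγ
      refine hy ⟨_, ⟨_, hγ, rfl⟩, ?_⟩
      rw [M.r_φ, Homeomorph.symm_apply_apply]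
      exact (T.h t).right_inv hyt
    · simp only [g, dif_neg hyt]
  -- A cutoff equal to 1 on the support of `g` dominates `g` up to the sup-norm of `f`; this places
  -- `g` in `C₀(X_t)`.
  obtain ⟨c, hc, hc1, -⟩ := exists_cutoff (𝕜 := 𝕜) (T.h t).open_target hK'c hK't
  have hgle : ∀ y, ‖g y‖ ≤ Twist.supNorm f := by
    intro y
    by_cases hyt : y ∈ (T.h t).target
    · have h1 := hnorm ⟨(T.h t).symm y, (T.h t).map_target hyt⟩
      simp only [(T.h t).right_inv hyt] at h1
      rw [h1]
      exact Twist.norm_le_supNorm hf _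
    · simp only [g, dif_neg hyt, norm_zero]
      exact Twist.supNorm_nonneg f
  refine ⟨dominated (T.h t).open_target c g (Twist.supNorm f) hcont fun y => ?_,
    ⟨K', hK't, hK'c, fun y hy => hg0 y hy⟩, ?_, ?_⟩
  · by_cases hy : y ∈ K'
    · rw [hc1 y hy, norm_one, mul_one]
      exact hgle y
    · rw [hg0 y hy, norm_zero]
      exact mul_nonneg (Twist.supNorm_nonneg f) (norm_nonneg _)
  · funext γ
    by_cases h : γ ∈ M.U t
    · obtain ⟨x, rfl⟩ := h
      change f (M.φ (T.germ t x)) = M.deltaFun t _ (M.φ (T.germ t x))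
      rw [M.deltaFun_apply]
      exact hz x _ (hg x)
    · rw [M.deltaFun_eq_zero t _ h, Twist.eq_zero_of_mem_Cc hf h]
  · exact C0on_norm_le (Twist.supNorm_nonneg f) hgle

end Models

end

section

/-! ### Integration of graded families -/

/-- A function in `C₀(U)` is the sum of a function supported in `{ε ≤ |a|}` and a function of norm at
most `ε`. -/
theorem exists_truncation {𝕜 X : Type*} [RCLike 𝕜] [TopologicalSpace X] {U : Set X}
    (hU : IsOpen U) (a : C0on 𝕜 U) {ε : ℝ} (hε : 0 < ε) :
    ∃ b : C0on 𝕜 U, ‖a - b‖ ≤ ε ∧ ∀ x, ¬ ε ≤ ‖(a : C₀(X, 𝕜)) x‖ → (b : C₀(X, 𝕜)) x = 0 := by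
  -- `a r` is the radial truncation of `a` to absolute value at most `ε`, because `r = ε / |a|`
  -- where `|a| ≥ ε`. Elsewhere `r = 1`, so `b = a (1 - r)` vanishes there.
  let r : X → ℝ := fun x => ε / max ‖(a : C₀(X, 𝕜)) x‖ ε
  have hpos : ∀ x, 0 < max ‖(a : C₀(X, 𝕜)) x‖ ε := fun x => hε.trans_le (le_max_right _ _)
  have hr0 : ∀ x, 0 ≤ r x := fun x => div_nonneg hε.le (hpos x).le
  have hr1 : ∀ x, r x ≤ 1 := fun x => (div_le_one (hpos x)).2 (le_max_right _ _)
  have hrc : Continuous r :=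
    continuous_const.div ((a : C₀(X, 𝕜)).continuous.norm.max continuous_const)
      fun x => (hpos x).ne'
  have hm : ∀ x ∈ U, ‖((1 - r x : ℝ) : 𝕜)‖ ≤ 1 := fun x _ => by
    rw [RCLike.norm_ofReal, abs_of_nonneg (by linarith [hr1 x])]
    linarith [hr0 x]
  let b : C0on 𝕜 U := mulUnit hU (fun x => ((1 - r x : ℝ) : 𝕜))
    (RCLike.continuous_ofReal.comp (continuous_const.sub hrc)).continuousOn hm a
  have hb : ∀ x, (b : C₀(X, 𝕜)) x = (a : C₀(X, 𝕜)) x * ((1 - r x : ℝ) : 𝕜) := fun x => rfl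
  refine ⟨b, C0on_norm_le hε.le fun x => ?_, fun x hx => ?_⟩
  · have h1 : ((a - b : C0on 𝕜 U) : C₀(X, 𝕜)) x = (a : C₀(X, 𝕜)) x * (r x : 𝕜) := by
      rw [C0on_sub_apply, hb]; push_cast; ring
    rw [h1, norm_mul, RCLike.norm_ofReal, abs_of_nonneg (hr0 x)]
    calc ‖(a : C₀(X, 𝕜)) x‖ * r x = ε * (‖(a : C₀(X, 𝕜)) x‖ / max ‖(a : C₀(X, 𝕜)) x‖ ε) := by
          simp only [r]; ring
      _ ≤ ε * 1 := by
        gcongr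
        exact (div_le_one (hpos x)).2 (le_max_left _ _)
      _ = ε := mul_one ε
  · have h1 : r x = 1 := by
      simp only [r]
      rw [max_eq_right (not_le.1 hx).le, div_self hε.ne']
    rw [hb, h1]
    simp

/-- Linear maps on a family of modules descend to the sum of their images under another family if
relations are respected. -/
theorem exists_descend {R ι A F : Type*} {W : ι → Type*} [CommRing R] [∀ i, AddCommMonoid (W i)]
    [∀ i, Module R (W i)] [AddCommGroup A] [Module R A] [AddCommGroup F] [Module R F]
    (D : ∀ i, W i →ₗ[R] A) (J : ∀ i, W i →ₗ[R] F)
    (hker : ∀ (s : Finset ι) (a : ∀ i, W i), ∑ i ∈ s, D i (a i) = 0 → ∑ i ∈ s, J i (a i) = 0)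
    (hspan : ∀ f : A, f ∈ ⨆ i, LinearMap.range (D i)) :
    ∃ J' : A →ₗ[R] F, ∀ i a, J' (D i a) = J i a := by
  classical
  let _ : ∀ i, AddCommGroup (W i) := fun i => Module.addCommMonoidToAddCommGroup R
  -- `D` and `J` are assembled into maps on the direct sum of the modules. The first map is onto
  -- `A`, and the relations say that its kernel is contained in that of the second.
  let D' := DFinsupp.lsum ℕ D
  let J₀ := DFinsupp.lsum ℕ J
  have hker' : LinearMap.ker D' ≤ LinearMap.ker J₀ := by
    intro x hx
    rw [LinearMap.mem_ker] at hx ⊢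
    simp only [D', J₀, DFinsupp.lsum_apply_apply, DFinsupp.sumAddHom_apply, DFinsupp.sum] at hx ⊢
    exact hker x.support x hx
  have hsurj : Function.Surjective D' := fun f => by
    have h := hspan f
    induction h using Submodule.iSup_induction' with
    | mem i x hx =>
      obtain ⟨a, rfl⟩ := hx
      exact ⟨DFinsupp.single i a, DFinsupp.lsum_single _ _ _ _⟩
    | zero => exact ⟨0, map_zero D'⟩
    | add x y _ _ hx hy =>
      obtain ⟨x', rfl⟩ := hx
      obtain ⟨y', rfl⟩ := hy
      exact ⟨x' + y', map_add D' x' y'⟩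
  refine ⟨((LinearMap.ker D').liftQ J₀ hker').comp
    (D'.quotKerEquivOfSurjective hsurj).symm.toLinearMap, fun i a => ?_⟩
  have h1 : D' (DFinsupp.single i a) = D i a := DFinsupp.lsum_single _ _ _ _
  have h2 : (D'.quotKerEquivOfSurjective hsurj).symm (D i a)
      = (LinearMap.ker D').mkQ (DFinsupp.single i a) := by
    rw [LinearEquiv.symm_apply_eq, ← h1]
    rfl
  rw [LinearMap.comp_apply, LinearEquiv.coe_coe, h2]
  exact (Submodule.liftQ_apply _ _ _).trans (DFinsupp.lsum_single _ _ _ _)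

namespace Models

open Bundle (TotalSpace)

variable {𝕜 X S Y G : Type*} [RCLike 𝕜] [TopologicalSpace X] [T2Space X]
  [InverseSemigroup S] [TopologicalSpace Y] [TopologicalSpace G] {T : TwistedAction 𝕜 X S}
  {𝓖 : EtaleGroupoid Y G} {L : G → Type*} [∀ γ, NormedAddCommGroup (L γ)]
  [∀ γ, NormedSpace 𝕜 (L γ)] [TopologicalSpace (TotalSpace 𝕜 L)] {𝓛 : Twist 𝕜 𝓖 L}
  (M : Models T 𝓛) {F : Type*} [NormedAddCommGroup F] [NormedSpace 𝕜 F] (Ψ : GradedFamily T F)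

/-- A section `a δ_t` with `a ∈ C₀(X_v)`, `v ≤ t, k`, is of the form `b δ_k`. -/
theorem exists_transfer {v t k : S} (ht : LE v t) (hk : LE v k) (a : T.I t)
    (ha : ∀ x, x ∉ (T.h v).target → (a : C₀(X, 𝕜)) x = 0) :
    ∃ b : T.I k, M.deltaFun t a = M.deltaFun k b ∧ Ψ.map t a = Ψ.map k b := by
  obtain ⟨ht1, ht2⟩ := T.u_of_le ht
  obtain ⟨hk1, hk2⟩ := T.u_of_le hk
  -- `d` is the coefficient of the same section with respect to `v`. It is common to `t` and `k`;
  -- multiplying by the conjugate of `u(v v⁻¹, k)` converts it into a coefficient for `k`.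
  let d : T.I v := mulUnit (T.h v).open_target (T.u (v * v⁻¹) t) ht1 (fun x hx => (ht2 x hx).le)
    (C0on.cast _ a ha)
  let d' : T.I v := mulUnit (T.h v).open_target (fun x => star (T.u (v * v⁻¹) k x)) hk1.star
    (fun x hx => by rw [norm_star, hk2 x hx]) d
  let b : T.I k := C0on.cast _ d' fun x hx => d'.2 x fun h => hx (T.target_mono hk h)
  have hd : ∀ x ∈ (T.h v).target,
      (d : C₀(X, 𝕜)) x = (a : C₀(X, 𝕜)) x * T.u (v * v⁻¹) t x := fun x _ => rfl
  have hb0 : ∀ x, x ∉ (T.h v).target → (b : C₀(X, 𝕜)) x = 0 := fun x hx => d'.2 x hx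
  have hb : ∀ x ∈ (T.h v).target,
      (d : C₀(X, 𝕜)) x = (b : C₀(X, 𝕜)) x * T.u (v * v⁻¹) k x := fun x hx => by
    change (d : C₀(X, 𝕜)) x
      = (d : C₀(X, 𝕜)) x * star (T.u (v * v⁻¹) k x) * T.u (v * v⁻¹) k x
    rw [mul_assoc, star_mul_self_of_norm (hk2 x hx), mul_one]
  refine ⟨b, ?_, ?_⟩
  · rw [M.deltaFun_restrict ht a d ha hd, M.deltaFun_restrict hk b d hb0 hb]
  · rw [Ψ.restrict v t ht a d ha hd, Ψ.restrict v k hk b d hb0 hb]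

variable [LocallyCompactSpace X]

/-- Over `K` the bisection `U_t` is covered by its overlaps with the `U_k`, `k ∈ s`. A partition of
unity subordinate to the sets `X_v` with `v ≤ t, k` cuts `a` into pieces, and each piece is moved to
one `k`. The same coefficients `b` serve for the sections and for `Ψ`. -/
theorem exists_transfer_sum (t : S) (s : Finset S) (a : T.I t) {K : Set X} (hK : IsCompact K)
    (haK : ∀ x, x ∉ K → (a : C₀(X, 𝕜)) x = 0)
    (hKs : ∀ x ∈ K, ∃ k ∈ s, ∃ v, LE v t ∧ LE v k ∧ x ∈ (T.h v).target) :
    ∃ b : ∀ k, T.I k, M.deltaFun t a = ∑ k ∈ s, M.deltaFun k (b k) ∧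
      Ψ.map t a = ∑ k ∈ s, Ψ.map k (b k) := by
  classical
  let P : C₀(X, 𝕜) → Prop := fun c => ∃ a : T.I t, (a : C₀(X, 𝕜)) = c ∧
    ∃ b : ∀ k, T.I k, M.deltaFun t a = ∑ k ∈ s, M.deltaFun k (b k) ∧
      Ψ.map t a = ∑ k ∈ s, Ψ.map k (b k)
  have hP : P a := by
    refine partition_induction (P := P) ?_ ?_ hK haK
      (ι := {q : S × S // q.1 ∈ s ∧ LE q.2 t ∧ LE q.2 q.1})
      (V := fun q => (T.h q.1.2).target) (fun q => (T.h q.1.2).open_target) ?_ ?_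
    · refine ⟨0, rfl, 0, ?_, ?_⟩
      · rw [← M.deltaLin_apply, map_zero]
        exact (Finset.sum_eq_zero fun k _ => map_zero (M.deltaLin k)).symm
      · rw [map_zero]
        exact (Finset.sum_eq_zero fun k _ => map_zero (Ψ.map k)).symm
    · rintro _ _ ⟨a, rfl, b, h1, h2⟩ ⟨a', rfl, b', h1', h2'⟩
      refine ⟨a + a', rfl, b + b', ?_, ?_⟩
      · simp only [M.deltaFun_add, Pi.add_apply, h1, h1', Finset.sum_add_distrib]
      · simp only [map_add, Pi.add_apply, h2, h2', Finset.sum_add_distrib]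
    · intro x hx
      obtain ⟨k, hk, v, hv, hv', hxv⟩ := hKs x hx
      exact Set.mem_iUnion.2 ⟨⟨(k, v), hk, hv, hv'⟩, hxv⟩
    · rintro ⟨⟨k, v⟩, hk, hv, hv'⟩ c ⟨K', hK', -, hc⟩
      obtain ⟨b, h1, h2⟩ := M.exists_transfer Ψ hv hv' (cmul c a)
        fun x hx => hc x fun h => hx (hK' h).1
      refine ⟨cmul c a, rfl, Pi.single k b, ?_, ?_⟩
      · rw [h1, Finset.sum_eq_single k, Pi.single_eq_same]
        · intro j _ hj
          rw [Pi.single_eq_of_ne hj]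
          exact map_zero (M.deltaLin j)
        · exact fun h => absurd hk h
      · rw [h2, Finset.sum_eq_single k, Pi.single_eq_same]
        · intro j _ hj
          rw [Pi.single_eq_of_ne hj]
          exact map_zero (Ψ.map j)
        · exact fun h => absurd hk h
  obtain ⟨a', ha', h⟩ := hP
  rwa [Subtype.ext ha'] at h

/-- On sums of sections supported on finitely many given bisections, the sup-norm dominates the
integrated form of a graded family. -/
theorem exists_bound (s : Finset S) : ∃ C : ℝ, 0 ≤ C ∧ ∀ (a : ∀ t, T.I t) (ε : ℝ), 0 < ε →
    (∀ γ, ‖∑ t ∈ s, M.deltaFun t (a t) γ‖ ≤ ε) → ‖∑ t ∈ s, Ψ.map t (a t)‖ ≤ C * ε := by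
  classical
  induction s using Finset.induction_on with
  | empty => exact ⟨0, le_rfl, fun a ε _ _ => by simp⟩
  | insert n s hn ih =>
    obtain ⟨C, hC, ih⟩ := ih
    -- The remainder of `a n` contributes `2ε`. The modified sum over `s` has sup-norm at most `3ε`,
    -- to which the constant `C` of the induction hypothesis applies.
    refine ⟨3 * C + 2, by positivity, fun a ε hε h => ?_⟩
    obtain ⟨a', ha', ha'0⟩ := exists_truncation (T.h n).open_target (a n)
      (show 0 < 2 * ε by positivity)
    obtain ⟨hK, hKn⟩ := isCompact_superlevel (a n) (show 0 < 2 * ε by positivity)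
    -- If no `U_k` with `k ∈ s` met `U_n` at the germ with range `y`, the total there would have
    -- norm `|a_n(y)| ≥ 2ε`, against the bound `ε`. Hence the truncated part `a'` can be distributed
    -- over `s`.
    obtain ⟨b, hb1, hb2⟩ := M.exists_transfer_sum Ψ n s a' hK ha'0 (by
      intro y hy
      by_contra! hcon
      have hyt := hKn hy
      set x : (T.h n).source := ⟨(T.h n).symm y, (T.h n).map_target hyt⟩ with hx
      have hxy : T.h n x = y := (T.h n).right_inv hyt
      have h0 : ∀ k ∈ s, M.deltaFun k (a k) (M.φ (T.germ n x)) = 0 := by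
        intro k hk
        refine M.deltaFun_eq_zero k _ ?_
        rintro ⟨x', hx'⟩
        obtain ⟨e, v, hv, hv', hxv⟩ := T.germ_eq_iff.1 (M.φ.injective hx')
        refine hcon k hk v hv' hv ?_
        rw [e] at hxv
        rw [← hxy, ← T.h_eq_of_le hv' hxv]
        exact (T.h v).map_source hxv
      have h1 := h (M.φ (T.germ n x))
      rw [Finset.sum_insert hn, Finset.sum_eq_zero h0, add_zero, M.norm_deltaFun_apply, hxy] at h1
      have h2 : 2 * ε ≤ ‖(a n : C₀(X, 𝕜)) y‖ := hy
      linarith)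
    -- Once `a' δ_n` has been distributed, the sum over `s` differs from the original total only by
    -- `(a n - a') δ_n`.
    have h1 : ∀ γ, ‖∑ k ∈ s, M.deltaFun k (a k + b k) γ‖ ≤ 3 * ε := by
      intro γ
      have h2 : ∑ k ∈ s, M.deltaFun k (a k + b k) γ
          = ∑ k ∈ insert n s, M.deltaFun k (a k) γ - M.deltaFun n (a n - a') γ := by
        have h3 := congrFun hb1 γ
        rw [Finset.sum_apply] at h3
        simp only [M.deltaFun_add, M.deltaFun_sub, Pi.add_apply, Pi.sub_apply,
          Finset.sum_add_distrib, Finset.sum_insert hn, h3]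
        abel
      rw [h2]
      calc _ ≤ ‖∑ k ∈ insert n s, M.deltaFun k (a k) γ‖ + ‖M.deltaFun n (a n - a') γ‖ :=
            norm_sub_le _ _
        _ ≤ ε + 2 * ε := add_le_add (h γ) ((M.norm_deltaFun_le n _ γ).trans ha')
        _ = 3 * ε := by ring
    have h4 := ih (fun k => a k + b k) (3 * ε) (by positivity) h1
    have h5 : ∑ k ∈ insert n s, Ψ.map k (a k)
        = Ψ.map n (a n - a') + ∑ k ∈ s, Ψ.map k (a k + b k) := by
      have h6 : Ψ.map n (a n - a') = Ψ.map n (a n) - Ψ.map n a' := map_sub (Ψ.map n) (a n) a'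
      rw [h6, hb2, Finset.sum_insert hn]
      simp only [map_add, Finset.sum_add_distrib]
      abel
    rw [h5]
    calc _ ≤ ‖Ψ.map n (a n - a')‖ + ‖∑ k ∈ s, Ψ.map k (a k + b k)‖ := norm_add_le _ _
      _ ≤ 2 * ε + C * (3 * ε) := add_le_add ((Ψ.norm_le n _).trans ha') h4
      _ = (3 * C + 2) * ε := by ring

/-- If the sections add up to zero, `exists_bound` applies with every `ε > 0`, with one constant for
the finite set `s`. So the integrated form does not depend on the decomposition. -/
theorem sum_map_eq_zero (s : Finset S) (a : ∀ t, T.I t)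
    (h : ∑ t ∈ s, M.deltaFun t (a t) = 0) : ∑ t ∈ s, Ψ.map t (a t) = 0 := by
  obtain ⟨C, hC, hs⟩ := M.exists_bound Ψ s
  rw [← norm_le_zero_iff]
  refine le_of_forall_pos_le_add fun ε hε => ?_
  have h1 := hs a (ε / (C + 1)) (by positivity) fun γ => by
    have := congrFun h γ
    rw [Finset.sum_apply] at this
    rw [this, Pi.zero_apply, norm_zero]
    positivity
  calc _ ≤ C * (ε / (C + 1)) := h1
    _ ≤ (C + 1) * (ε / (C + 1)) := by gcongr; linarith
    _ = 0 + ε := by field_simp; ring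

variable [T2Space Y] [LocallyCompactSpace Y]

/-- Each summand of a decomposition over the `U_t` is some `a δ_t`, with the norm of `a` at most the
sup-norm of the summand. -/
theorem exists_sum_delta {c : ℝ} {f : 𝓛.Alg} (hc : c ∈ 𝓛.costs M.bisections f.val) :
    ∃ (ι : Type) (_ : Fintype ι) (t : ι → S) (a : ∀ i, T.Ic (t i)),
      f = ∑ i, M.delta (t i) (a i) ∧ ∑ i, ‖(a i).1‖ ≤ c := by
  obtain ⟨ι, hι, F', U, h, h1, rfl⟩ := hc
  choose t ht using fun i => (h i).1
  have hF : ∀ i, ∃ a ∈ T.Ic (t i), F' i = M.deltaFun (t i) a ∧ ‖a‖ ≤ Twist.supNorm (F' i) :=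
    fun i => M.exists_deltaFun_eq (t i) (by rw [ht i]; exact (h i).2)
  choose a ha ha1 ha2 using hF
  refine ⟨ι, hι, t, fun i => ⟨a i, ha i⟩, Twist.Alg.ext ?_, Finset.sum_le_sum fun i _ => ha2 i⟩
  have hval : ∀ s : Finset ι, (∑ i ∈ s, M.delta (t i) ⟨a i, ha i⟩).val
      = ∑ i ∈ s, M.deltaFun (t i) (a i) := fun s =>
    map_sum (𝓛.sections.subtype) _ s
  rw [h1, hval]
  exact Finset.sum_congr rfl fun i _ => ha1 i

/-- The elements `a δ_t` generate the algebra additively: decompositions over the covering semigroup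
exist for sections over arbitrary bisections, by a partition of unity already contained in
`costs_nonempty`. -/
theorem alg_induction {P : 𝓛.Alg → Prop} (h0 : P 0) (hadd : ∀ f g, P f → P g → P (f + g))
    (h : ∀ t a, P (M.delta t a)) (f : 𝓛.Alg) : P f := by
  classical
  obtain ⟨c, hc⟩ := Twist.costs_nonempty (𝒮 := M.bisections) f.mem
  obtain ⟨ι, _, t, a, rfl, -⟩ := M.exists_sum_delta hc
  exact Finset.sum_induction _ P hadd h0 fun i _ => h _ _

/-- The element `a δ_t` as a linear function of `a`. -/
def deltaAlg (t : S) : CcOn 𝕜 (T.h t).target →ₗ[𝕜] 𝓛.Alg where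
  toFun a := M.delta t a
  map_add' a b := Twist.Alg.ext (M.deltaFun_add t a.1 b.1)
  map_smul' c a := Twist.Alg.ext (map_smul (M.deltaLin t) c a.1)

/-- The integrated form of a graded family on the algebra of sections. -/
theorem exists_integrated : ∃ J : 𝓛.Alg →ₗ[𝕜] F,
    (∀ t (a : T.Ic t), J (M.delta t a) = Ψ.map t a) ∧
      ∀ f, ‖J f‖ ≤ (𝓛.maxNorm M.bisections).toSeminorm f := by
  have hspan : ∀ f : 𝓛.Alg, f ∈ ⨆ t, LinearMap.range (M.deltaAlg t) :=
    M.alg_induction (P := fun f => f ∈ ⨆ t, LinearMap.range (M.deltaAlg t))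
      (zero_mem _) (fun f g => add_mem)
      fun t a => Submodule.mem_iSup_of_mem t ⟨⟨a.1, a.2⟩, rfl⟩
  obtain ⟨J, hJ⟩ := exists_descend (W := fun t => CcOn 𝕜 (T.h t).target) M.deltaAlg
    (fun t => (Ψ.map t).comp (CcOn 𝕜 (T.h t).target).subtype) (by
      intro s a h
      refine M.sum_map_eq_zero Ψ s (fun t => (a t).1) ?_
      have h1 := congrArg Twist.Alg.val h
      have h2 : (∑ t ∈ s, M.deltaAlg t (a t)).val = ∑ t ∈ s, M.deltaFun t (a t).1 :=
        map_sum (𝓛.sections.subtype) _ s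
      rw [← h2, h1]
      rfl) hspan
  have hJ : ∀ t (a : T.Ic t), J (M.delta t a) = Ψ.map t a := fun t a => hJ t ⟨a.1, a.2⟩
  -- The value of `J` may be computed from any decomposition of `f`; hence it is bounded by the cost
  -- of each one, and so by the infimum.
  refine ⟨J, hJ, fun f => le_csInf (Twist.costs_nonempty f.mem) fun c hc => ?_⟩
  obtain ⟨ι, _, t, a, h1, h2⟩ := M.exists_sum_delta hc
  calc ‖J f‖ = ‖∑ i, Ψ.map (t i) (a i)‖ := by rw [h1, map_sum]; simp only [hJ]
    _ ≤ ∑ i, ‖Ψ.map (t i) (a i)‖ := norm_sum_le _ _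
    _ ≤ ∑ i, ‖(a i).1‖ := Finset.sum_le_sum fun i _ => Ψ.norm_le _ _
    _ ≤ c := h2

theorem delta_mul (s t : S) (a : T.Ic s) (b : T.Ic t) :
    ∃ h : T.coeffMul s t a b ∈ T.Ic (s * t),
      M.delta s a * M.delta t b = M.delta (s * t) ⟨T.coeffMul s t a b, h⟩ := by
  obtain ⟨a, K, hK, hKc, haK⟩ := a
  obtain ⟨b, K', hK', hKc', hbK⟩ := b
  have h : T.coeffMul s t a b ∈ T.Ic (s * t) := by
    have hc : IsCompact ((T.h s).symm '' K ∩ K') :=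
      (hKc.image_of_continuousOn ((T.h s).continuousOn_symm.mono hK)).inter hKc'
    have hs : (T.h s).symm '' K ∩ K' ⊆ (T.h s).source := by
      rintro _ ⟨⟨y, hy, rfl⟩, -⟩
      exact (T.h s).map_target (hK hy)
    -- The product `α_s(α_s⁻¹(a) b)` can be nonzero only at points `x ∈ K` with `h_s⁻¹(x) ∈ K'`.
    refine ⟨T.h s '' ((T.h s).symm '' K ∩ K'), ?_,
      hc.image_of_continuousOn ((T.h s).continuousOn.mono hs), fun x hx => ?_⟩
    · rintro _ ⟨y, hy, rfl⟩
      rw [T.mem_target_mul]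
      refine ⟨(T.h s).map_source (hs hy), ?_⟩
      rw [(T.h s).left_inv (hs hy)]
      exact hK' hy.2
    · by_cases hx' : x ∈ (T.h (s * t)).target
      · obtain ⟨h1, h2⟩ := T.mem_target_mul.1 hx'
        rw [T.coeffMul_apply _ _ hx']
        by_cases h3 : x ∈ K
        · by_cases h4 : (T.h s).symm x ∈ K'
          · exact absurd ⟨_, ⟨⟨x, h3, rfl⟩, h4⟩, (T.h s).right_inv h1⟩ hx
          · rw [hbK _ h4, mul_zero, zero_mul]
        · rw [haK _ h3, zero_mul, zero_mul]
      · exact (T.coeffMul s t a b).2 x hx'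
  exact ⟨h, Twist.Alg.ext (M.conv_deltaFun s t a b)⟩

/-- The integrated form of a graded representation is multiplicative. -/
theorem integrated_mul {B : Type*} [NonUnitalNormedRing B] [NormedSpace 𝕜 B]
    (Ψ : GradedRep T B) {J : 𝓛.Alg →ₗ[𝕜] B}
    (hJ : ∀ t (a : T.Ic t), J (M.delta t a) = Ψ.map t a) (f g : 𝓛.Alg) :
    J (f * g) = J f * J g := by
  refine M.alg_induction (P := fun f => J (f * g) = J f * J g) ?_ ?_ ?_ f
  · rw [zero_mul, map_zero, zero_mul]
  · intro f f' h h'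
    rw [add_mul, map_add, map_add, add_mul, h, h']
  · intro s a
    refine M.alg_induction (P := fun g => J (M.delta s a * g) = J (M.delta s a) * J g) ?_ ?_ ?_ g
    · rw [mul_zero, map_zero, mul_zero]
    · intro g g' h h'
      rw [mul_add, map_add, map_add, mul_add, h, h']
    · intro t b
      obtain ⟨h, h1⟩ := M.delta_mul s t a b
      rw [h1, hJ, hJ, hJ, Ψ.mul]

end Models

end

section

/-! ### Representations of completions -/

namespace AlgSeminorm

variable {𝕜 : Type*} [RCLike 𝕜] {A : Type*} [NonUnitalRing A] [Module 𝕜 A] (p : AlgSeminorm 𝕜 A)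
  {B : Type*} [NonUnitalNormedRing B] [NormedSpace 𝕜 B]

theorem exists_rep [CompleteSpace B] (j : A →ₗ[𝕜] B) (hmul : ∀ a b, j (a * b) = j a * j b)
    (hle : ∀ a, ‖j a‖ ≤ p.toSeminorm a) :
    ∃ ψ : BanachRep 𝕜 p.Compl B, ∀ a, ψ (p.toCompl a) = j a := by
  have hd := p.denseRange_toCompl
  have hj : ∀ a, ‖j a‖ ≤ 1 * ‖p.toCompl a‖ := fun a => by
    rw [one_mul, p.norm_toCompl]; exact hle a
  have h1 : ∀ a, j.extendOfNorm p.toCompl (p.toCompl a) = j a :=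
    LinearMap.extendOfNorm_eq hd ⟨1, hj⟩
  refine ⟨⟨{ (j.extendOfNorm p.toCompl) with
    toFun := j.extendOfNorm p.toCompl
    map_zero' := map_zero _
    map_mul' := fun x y => ?_ }, fun x => ?_⟩, h1⟩
  · refine hd.induction_on₂ (p := fun x y => j.extendOfNorm p.toCompl (x * y)
      = j.extendOfNorm p.toCompl x * j.extendOfNorm p.toCompl y) ?_ ?_ x y
    · refine isClosed_eq ?_ ?_
      · exact (j.extendOfNorm p.toCompl).continuous.comp continuous_mul
      · exact ((j.extendOfNorm p.toCompl).continuous.comp continuous_fst).mul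
          ((j.extendOfNorm p.toCompl).continuous.comp continuous_snd)
    · intro a b
      rw [← p.toCompl_mul, h1, h1, h1, hmul]
  · have := LinearMap.norm_extendOfNorm_apply_le hd 1 hj x
    rwa [one_mul] at this

variable {p}

theorem continuous_rep {A' : Type*} [NonUnitalNormedRing A'] [NormedSpace 𝕜 A']
    (ψ : BanachRep 𝕜 A' B) : Continuous ψ :=
  AddMonoidHomClass.continuous_of_bound ψ.toHom 1 fun a => by
    rw [one_mul]; exact ψ.contractive a

theorem rep_ext {ψ ψ' : BanachRep 𝕜 p.Compl B} (h : ∀ a, ψ (p.toCompl a) = ψ' (p.toCompl a)) :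
    ψ = ψ' := by
  refine BanachRep.ext (NonUnitalAlgHom.ext fun x => ?_)
  exact congrFun (p.denseRange_toCompl.equalizer (continuous_rep ψ) (continuous_rep ψ')
    (funext h)) x

theorem norm_rep {ψ : BanachRep 𝕜 p.Compl B} (h : ∀ a, ‖ψ (p.toCompl a)‖ = p.toSeminorm a)
    (x : p.Compl) : ‖ψ x‖ = ‖x‖ := by
  refine congrFun (p.denseRange_toCompl.equalizer (continuous_rep ψ).norm continuous_norm
    (funext fun a => ?_)) x
  exact (h a).trans (p.norm_toCompl a).symm

/-- An isometric image of a complete space is closed, and here it is also dense. -/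
theorem surjective_rep {ψ : BanachRep 𝕜 p.Compl B} (h : ∀ x, ‖ψ x‖ = ‖x‖) (hd : DenseRange ψ) :
    Function.Surjective ψ := by
  have hi : Isometry ψ := AddMonoidHomClass.isometry_of_norm ψ.toHom h
  rw [← Set.range_eq_univ, ← hd.closure_range]
  exact hi.isClosedEmbedding.isClosed_range.closure_eq.symm

end AlgSeminorm

/-! ### Graded representations and representations of `F^S(G, L)` -/

/-- This reduces identities between bounded maps on `C₀(U)` to compactly supported functions, the
only ones for which `a δ_t` is a section in the algebra. -/
theorem C0on_dense {𝕜 X : Type*} [RCLike 𝕜] [TopologicalSpace X] [T2Space X]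
    [LocallyCompactSpace X] {F : Type*} [NormedAddCommGroup F] [NormedSpace 𝕜 F] {U : Set X}
    (hU : IsOpen U) {f g : C0on 𝕜 U →ₗ[𝕜] F} {C : ℝ} (hf : ∀ a, ‖f a‖ ≤ C * ‖a‖)
    (hg : ∀ a, ‖g a‖ ≤ C * ‖a‖) (h : ∀ a ∈ CcOn 𝕜 U, f a = g a) (a : C0on 𝕜 U) : f a = g a :=
  linear_ext_of_dense (N := fun v : C0on 𝕜 U => ‖v‖) (fun v => norm_nonneg (v : C₀(X, 𝕜)))
    (CcOn 𝕜 U) (fun a _ hε => exists_CcOn_approx hU a hε) hf hg h a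

theorem C0on_extend {𝕜 X : Type*} [RCLike 𝕜] [TopologicalSpace X] [T2Space X]
    [LocallyCompactSpace X] {F : Type*} [NormedAddCommGroup F] [NormedSpace 𝕜 F] [CompleteSpace F]
    {U : Set X} (hU : IsOpen U) (f : CcOn 𝕜 U →ₗ[𝕜] F) (hf : ∀ a : CcOn 𝕜 U, ‖f a‖ ≤ ‖a.1‖) :
    ∃ g : C0on 𝕜 U →ₗ[𝕜] F, (∀ a, ‖g a‖ ≤ ‖a‖) ∧ ∀ a : CcOn 𝕜 U, g a = f a :=
  exists_extension (C0on 𝕜 U).subtype (CcOn 𝕜 U) (fun a _ hε => exists_CcOn_approx hU a hε) f hf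

section

variable {𝕜 X S : Type*} [RCLike 𝕜] [TopologicalSpace X] [T2Space X] [InverseSemigroup S]
  (T : TwistedAction 𝕜 X S)

/-- The product of coefficients as a linear function of the first factor. -/
def TwistedAction.coeffMulLeft (s t : S) (b : T.I t) : T.I s →ₗ[𝕜] T.I (s * t) :=
  (T.gradedMul.m s t).flip b

/-- The product of coefficients as a linear function of the second factor. -/
def TwistedAction.coeffMulRight (s t : S) (a : T.I s) : T.I t →ₗ[𝕜] T.I (s * t) :=
  T.gradedMul.m s t a

end

namespace Models

open Bundle (TotalSpace)

variable {𝕜 X S Y G : Type*} [RCLike 𝕜] [TopologicalSpace X] [T2Space X]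
  [InverseSemigroup S] [TopologicalSpace Y] [TopologicalSpace G] {T : TwistedAction 𝕜 X S}
  {𝓖 : EtaleGroupoid Y G} {L : G → Type*} [∀ γ, NormedAddCommGroup (L γ)]
  [∀ γ, NormedSpace 𝕜 (L γ)] [TopologicalSpace (TotalSpace 𝕜 L)] {𝓛 : Twist 𝕜 𝓖 L}
  (M : Models T 𝓛) {B : Type*} [NonUnitalNormedRing B] [NormedSpace 𝕜 B]
  [LocallyCompactSpace X] [T2Space Y] [LocallyCompactSpace Y]

/-- The decomposition of `a δ_t` into the single summand `a δ_t` already costs at most the norm of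
`a`. -/
theorem norm_delta_le (t : S) (a : T.Ic t) : ‖M.toFS (M.delta t a)‖ ≤ ‖a.1‖ := by
  have h1 : Twist.supNorm (M.deltaFun t a.1) ∈ 𝓛.costs M.bisections (M.delta t a).val :=
    ⟨Unit, inferInstance, fun _ => M.deltaFun t a.1, fun _ => M.U t,
      fun _ => ⟨⟨t, rfl⟩, M.deltaFun_mem t a.2⟩, by simp; rfl, by simp⟩
  have h2 : ‖M.toFS (M.delta t a)‖ = sInf (𝓛.costs M.bisections (M.delta t a).val) :=
    (𝓛.maxNorm M.bisections).norm_toCompl _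
  rw [h2]
  refine (csInf_le (Twist.bddBelow_costs _) h1).trans ?_
  exact Real.iSup_le (M.norm_deltaFun_le t a.1) (norm_nonneg (a.1 : C₀(X, 𝕜)))

/-- A graded representation integrates to a unique representation of `F^S(G, L)`. -/
theorem existsUnique_rep [CompleteSpace B] (Ψ : GradedRep T B) : ∃! ψ : BanachRep 𝕜 M.FS B,
    ∀ t (a : T.Ic t), ψ (M.toFS (M.delta t a)) = Ψ.map t a := by
  obtain ⟨J, hJ, hJle⟩ := M.exists_integrated Ψ.toGradedFamily
  obtain ⟨ψ, hψ⟩ := (𝓛.maxNorm M.bisections).exists_rep J (M.integrated_mul Ψ hJ) hJle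
  refine ⟨ψ, fun t a => (hψ _).trans (hJ t a), fun ψ' hψ' => AlgSeminorm.rep_ext fun f => ?_⟩
  rw [hψ]
  refine M.alg_induction (P := fun f => ψ' ((𝓛.maxNorm M.bisections).toCompl f) = J f)
    ?_ ?_ ?_ f
  · rw [map_zero, map_zero, map_zero]
  · intro f g h h'
    rw [map_add, map_add, map_add, h, h']
  · exact fun t a => (hψ' t a).trans (hJ t a).symm

/-- Every representation of `F^S(G, L)` is the integrated form of a graded representation. -/
theorem exists_gradedRep [IsScalarTower 𝕜 B B] [SMulCommClass 𝕜 B B] [CompleteSpace B]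
    (ψ : BanachRep 𝕜 M.FS B) :
    ∃ Ψ : GradedRep T B, ∀ t (a : T.Ic t), Ψ.map t a = ψ (M.toFS (M.delta t a)) := by
  have hlin : ∀ t, ∃ g : T.I t →ₗ[𝕜] B, (∀ a, ‖g a‖ ≤ ‖a‖) ∧
      ∀ a : T.Ic t, g a = ψ (M.toFS (M.delta t a)) := by
    intro t
    let f : CcOn 𝕜 (T.h t).target →ₗ[𝕜] B :=
      ((ψ.toHom : M.FS →ₗ[𝕜] B).comp (𝓛.maxNorm M.bisections).toCompl).comp (M.deltaAlg t)
    obtain ⟨g, hg, hgf⟩ := C0on_extend (T.h t).open_target f fun a =>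
      (ψ.contractive _).trans (M.norm_delta_le t ⟨a.1, a.2⟩)
    exact ⟨g, hg, fun a => hgf ⟨a.1, a.2⟩⟩
  choose g hg hgψ using hlin
  refine ⟨⟨⟨g, hg, fun s t hst a b ha hb => ?_⟩, fun s t a b => ?_⟩, hgψ⟩
  · obtain ⟨h1, h2⟩ := T.u_of_le hst
    let inc : T.I s →ₗ[𝕜] T.I t :=
      { toFun := fun a => C0on.cast _ a fun x hx => a.2 x fun h => hx (T.target_mono hst h)
        map_add' := fun _ _ => rfl
        map_smul' := fun _ _ => rfl }
    have h2' : ∀ x ∈ (T.h s).target, ‖T.u (s * s⁻¹) t x‖ ≤ 1 := fun x hx => (h2 x hx).le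
    let mu : T.I s →ₗ[𝕜] T.I s :=
      { toFun := mulUnit (T.h s).open_target _ h1 h2'
        map_add' := fun a b => Subtype.ext (ZeroAtInftyContinuousMap.ext fun x => add_mul _ _ _)
        map_smul' := fun c a =>
          Subtype.ext (ZeroAtInftyContinuousMap.ext fun x => mul_assoc _ _ _) }
    -- Both sides are bounded in `c`. For `c` of compact support they are the values of `ψ` at one
    -- and the same section.
    have key : ∀ c, (g t).comp inc c = (g s).comp mu c := by
      refine C0on_dense (C := 1) (T.h s).open_target (fun c => ?_) (fun c => ?_) ?_
      · rw [one_mul]; exact hg t _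
      · rw [one_mul]; exact (hg s _).trans (norm_mulUnit_le (T.h s).open_target _ h1 h2' _)
      · rintro c ⟨K, hK, hKc, hcK⟩
        have h3 : inc c ∈ T.Ic t := ⟨K, hK.trans (T.target_mono hst), hKc, hcK⟩
        have h4 : mu c ∈ T.Ic s := ⟨K, hK, hKc, fun x hx => by
          change (c : C₀(X, 𝕜)) x * _ = 0
          rw [hcK x hx, zero_mul]⟩
        change g t (inc c) = g s (mu c)
        rw [hgψ t ⟨_, h3⟩, hgψ s ⟨_, h4⟩]
        congr 2
        exact Twist.Alg.ext (M.deltaFun_restrict hst (inc c) (mu c) (fun x hx => c.2 x hx)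
          fun x _ => rfl)
    have h5 := key (C0on.cast _ a ha)
    have h6 : mu (C0on.cast _ a ha) = b := T.I_ext fun x hx => (hb x hx).symm
    rw [LinearMap.comp_apply, LinearMap.comp_apply, h6] at h5
    exact h5
  -- Multiplicativity is known for compactly supported factors. It is extended by density first in
  -- `a`, for fixed `b` of compact support, and then in `b`.
  · have hmulL : ∀ b : T.I t, b ∈ CcOn 𝕜 (T.h t).target → ∀ a : T.I s,
        (LinearMap.mulRight 𝕜 (g t b)).comp (g s) a
          = (g (s * t)).comp (T.coeffMulLeft s t b) a := by
      intro b hb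
      refine C0on_dense (C := ‖(b : C₀(X, 𝕜))‖) (T.h s).open_target
        (fun a => ?_) (fun a => ?_) ?_
      · rw [mul_comm]
        exact (norm_mul_le _ _).trans (mul_le_mul (hg s a) (hg t b) (norm_nonneg _)
          (norm_nonneg (a : C₀(X, 𝕜))))
      · rw [mul_comm]
        exact (hg _ _).trans (T.norm_coeffMul_le s t a b)
      · intro a ha
        obtain ⟨h1, h2⟩ := M.delta_mul s t ⟨a, ha⟩ ⟨b, hb⟩
        change g s a * g t b = g (s * t) (T.coeffMul s t a b)
        rw [hgψ s ⟨a, ha⟩, hgψ t ⟨b, hb⟩, hgψ (s * t) ⟨_, h1⟩, ← h2, ← map_mul]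
        exact congrArg ψ (AlgSeminorm.toCompl_mul _ _ _).symm
    have hmul : ∀ b : T.I t, (LinearMap.mulLeft 𝕜 (g s a)).comp (g t) b
        = (g (s * t)).comp (T.coeffMulRight s t a) b := by
      refine C0on_dense (C := ‖(a : C₀(X, 𝕜))‖) (T.h t).open_target
        (fun b => ?_) (fun b => ?_) ?_
      · exact (norm_mul_le _ _).trans (mul_le_mul (hg s a) (hg t b) (norm_nonneg _)
          (norm_nonneg (a : C₀(X, 𝕜))))
      · exact (hg _ _).trans (T.norm_coeffMul_le s t a b)
      · exact fun b hb => hmulL b hb a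
    exact hmul b

end Models

end

section

/-! ### Covariant representations and graded representations -/

section Bidual

variable {𝕜 : Type*} [RCLike 𝕜] {B : Type*} [NonUnitalNormedRing B] [NormedSpace 𝕜 B]

theorem norm_toBidual (b : B) : ‖toBidual 𝕜 b‖ = ‖b‖ :=
  (NormedSpace.inclusionInDoubleDualLi 𝕜 (E := B)).norm_map b

theorem toBidual_injective : Function.Injective (toBidual 𝕜 : B →ₗ[𝕜] Bidual 𝕜 B) :=
  (NormedSpace.inclusionInDoubleDualLi 𝕜 (E := B)).injective

end Bidual

variable {𝕜 X S : Type*} [RCLike 𝕜] [TopologicalSpace X] [T2Space X] [InverseSemigroup S]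
  {T : TwistedAction 𝕜 X S} {B : Type*} [NonUnitalNormedRing B] [NormedSpace 𝕜 B]
  [IsScalarTower 𝕜 B B] [SMulCommClass 𝕜 B B]

namespace CovRep

theorem elt_congr (p : CovRep T B) {s t : S} (h : s = t) {a b : C₀(X, 𝕜)} (hab : a = b) :
    p.elt s a = p.elt t b := by rw [h, hab]

theorem elt_idem (p : CovRep T B) {e : S} (he : e * e = e) (a : T.I e) :
    p.elt e a = toBidual 𝕜 (p.π a) := p.idem e he a

/-- Covariance asserts that `v_t π(b)` is in `B` for `b ∈ I_{t⁻¹}`; it is applied to `b = α_t⁻¹(a)`.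
-/
theorem exists_elt (p : CovRep T B) (t : S) (a : T.I t) :
    ∃ b : B, toBidual 𝕜 b = p.elt t a := by
  obtain ⟨h1, b, h2⟩ := p.cov t (T.αinv t a)
  refine ⟨b, ?_⟩
  rw [← h2, h1, T.α_αinv]
  rfl

end CovRep

/-- The graded representation `Ψ_t(a) = π(a) v_t` is the one defined by `(π, v)`. -/
def GradedRep.Matches (Ψ : GradedRep T B) (p : CovRep T B) : Prop :=
  ∀ t (a : T.I t), toBidual 𝕜 (Ψ.map t a) = p.elt t a

/-- The values `π(a) v_t` are in `B`, and linearity, contractivity and multiplicativity are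
inherited from `B''` through the isometric embedding. Compatibility with the order uses that `v_e`
acts as a unit on `π(I_e)`. -/
theorem CovRep.exists_gradedRep (p : CovRep T B) : ∃ Ψ : GradedRep T B, Ψ.Matches p := by
  choose b hb using p.exists_elt
  refine ⟨⟨⟨fun t => ⟨⟨b t, fun a a' => ?_⟩, fun c a => ?_⟩, fun t a => ?_, ?_⟩, ?_⟩, hb⟩
  · apply toBidual_injective (𝕜 := 𝕜)
    rw [map_add, hb, hb, hb]
    exact p.elt_add t _ _
  · apply toBidual_injective (𝕜 := 𝕜)
    change toBidual 𝕜 (b t (c • a)) = toBidual 𝕜 (c • b t a)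
    rw [map_smul, hb, hb]
    exact p.elt_smul t c _
  · change ‖b t a‖ ≤ ‖a‖
    rw [← norm_toBidual (𝕜 := 𝕜), hb]
    exact p.norm_elt_le t _
  · intro s t hst a a' ha ha'
    apply toBidual_injective (𝕜 := 𝕜)
    change toBidual 𝕜 (b t a) = toBidual 𝕜 (b s a')
    rw [hb, hb]
    have h1 : (a : C₀(X, 𝕜)) ∈ T.I (s * s⁻¹ * t) := by rw [hst.range_mul]; exact ha
    have h2 : (a : C₀(X, 𝕜)) ∈ T.I (s * s⁻¹) := by
      intro x hx
      rw [T.target_mul_inv] at hx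
      exact ha x hx
    have h3 := p.mul (s * s⁻¹) t ⟨a, h1⟩
    have h4 := p.idem _ (mul_inv_self_idem s) ⟨a, h2⟩
    -- For `s ≤ t` and `a` supported in `X_s`: `π(a) v_t = π(a) v_{s s⁻¹} v_t = π(a u(s s⁻¹, t))
    -- v_{s s⁻¹ t}`, and `s s⁻¹ t = s`.
    have h5 : p.elt t a = p.elt (s * s⁻¹ * t) (T.mulU (s * s⁻¹) t ⟨a, h1⟩) := by
      refine Eq.trans ?_ h3
      exact congrArg (fun z => arens z (p.v t)) h4.symm
    rw [h5]
    refine p.elt_congr hst.range_mul (ZeroAtInftyContinuousMap.ext fun x => ?_)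
    rw [T.mulU_apply]
    by_cases hx : x ∈ (T.h s).target
    · exact (ha' x hx).symm
    · rw [a'.2 x hx]
      exact (congrArg (· * _) (ha x hx)).trans (zero_mul _)
  · intro s t a a'
    apply toBidual_injective (𝕜 := 𝕜)
    change toBidual 𝕜 (b s a * b t a') = toBidual 𝕜 (b (s * t) (T.coeffMul s t a a'))
    rw [← arens_toBidual, hb, hb, hb, p.elt_mul]

variable [LocallyCompactSpace X]

/-- Bounded linear maps on `C₀(X)` that agree on the ideals `I_e` are equal. -/
theorem TwistedAction.C0_ext (hT : T.AbsorbsCompacts) {F : Type*} [NormedAddCommGroup F]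
    [NormedSpace 𝕜 F] {f g : C₀(X, 𝕜) →ₗ[𝕜] F} {C : ℝ} (hf : ∀ a, ‖f a‖ ≤ C * ‖a‖)
    (hg : ∀ a, ‖g a‖ ≤ C * ‖a‖) (h : ∀ e, e * e = e → ∀ a : T.I e, f a = g a) (a : C₀(X, 𝕜)) :
    f a = g a := by
  refine C0on_dense (U := Set.univ) (f := f.comp (Submodule.subtype _))
    (g := g.comp (Submodule.subtype _)) isOpen_univ (C := C) (fun a => hf a) (fun a => hg a) ?_
    ⟨a, fun x hx => absurd trivial hx⟩
  rintro b ⟨K, -, hK, hbK⟩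
  obtain ⟨e, he, hKe⟩ := hT K hK
  exact h e he ⟨b, fun x hx => hbK x fun hxK => hx (hKe hxK)⟩

namespace GradedRep

variable (Ψ : GradedRep T B)

/-- Both sides restrict to `e f`, which lies below `e` and `f`. The common function is supported in
`X_{ef} = X_e ∩ X_f`, and the twists between idempotents are trivial. -/
theorem map_idem_eq {e f : S} (he : e * e = e) (hf : f * f = f) (a : T.I e) (b : T.I f)
    (hab : (a : C₀(X, 𝕜)) = b) : Ψ.map e a = Ψ.map f b := by
  have hg : e * f * (e * f) = e * f := idem_mul_idem he hf
  have hle : LE (e * f) e := mul_idem_le e hf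
  have hle' : LE (e * f) f := by rw [idem_comm he hf]; exact mul_idem_le f he
  have h0 : ∀ x, x ∉ (T.h (e * f)).target → (a : C₀(X, 𝕜)) x = 0 := by
    intro x hx
    by_contra h
    have h1 : x ∈ (T.h e).target := by by_contra h'; exact h (a.2 x h')
    have h2 : x ∈ (T.h f).target := by by_contra h'; exact h (by rw [hab]; exact b.2 x h')
    exact hx (T.mem_target_mul.2 ⟨h1, by rwa [T.symm_idem he h1]⟩)
  have hu : ∀ {k : S}, k * k = k → LE (e * f) k → ∀ x ∈ (T.h (e * f)).target,
      T.u (e * f * (e * f)⁻¹) k x = 1 := by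
    intro k hk hle x hx
    refine T.u_idem _ _ (mul_inv_self_idem _) hk x ?_
    rwa [hle.range_mul]
  rw [Ψ.restrict _ _ hle a (C0on.cast _ a h0) h0 fun x hx => by
      rw [hu he hle x hx, mul_one]; rfl,
    Ψ.restrict _ _ hle' b (C0on.cast _ a h0) (fun x hx => by rw [← hab]; exact h0 x hx)
      fun x hx => by rw [hu hf hle' x hx, mul_one, ← hab]; rfl]

/-- The representation of `C₀(X)` defined by a graded representation. -/
theorem exists_pi [CompleteSpace B] (hT : T.AbsorbsCompacts) :
    ∃ π : BanachRep 𝕜 C₀(X, 𝕜) B, ∀ e, e * e = e → ∀ a : T.I e, π a = Ψ.map e a := by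
  have hex : ∀ a : CcOn 𝕜 (Set.univ : Set X), ∃ e, e * e = e ∧ (a.1 : C₀(X, 𝕜)) ∈ T.I e := by
    rintro ⟨a, K, -, hK, haK⟩
    obtain ⟨e, he, hKe⟩ := hT K hK
    exact ⟨e, he, fun x hx => haK x fun hxK => hx (hKe hxK)⟩
  choose e he hae using hex
  -- The value does not depend on the chosen idempotent. For a sum one can therefore use an
  -- idempotent that absorbs both supports, which gives additivity.
  have key : ∀ (a : CcOn 𝕜 (Set.univ : Set X)) {f : S}, f * f = f → ∀ b : T.I f,
      (a.1 : C₀(X, 𝕜)) = b → Ψ.map (e a) ⟨a.1, hae a⟩ = Ψ.map f b :=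
    fun a f hf b hab => Ψ.map_idem_eq (he a) hf _ b hab
  let π₀ : CcOn 𝕜 (Set.univ : Set X) →ₗ[𝕜] B :=
    { toFun := fun a => Ψ.map (e a) ⟨a.1, hae a⟩
      map_add' := by
        intro a b
        obtain ⟨K, -, hK, haK⟩ := a.2
        obtain ⟨K', -, hK', hbK⟩ := b.2
        obtain ⟨f, hf, hKf⟩ := hT (K ∪ K') (hK.union hK')
        let a' : T.I f := ⟨a.1, fun x hx => haK x fun h => hx (hKf (Or.inl h))⟩
        let b' : T.I f := ⟨b.1, fun x hx => hbK x fun h => hx (hKf (Or.inr h))⟩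
        rw [key a hf a' rfl, key b hf b' rfl, key (a + b) hf (a' + b') rfl, map_add]
      map_smul' := by
        intro c a
        rw [key (c • a) (he a) (c • ⟨a.1, hae a⟩) rfl, map_smul]
        rfl }
  obtain ⟨g, hg, hgπ⟩ := C0on_extend isOpen_univ π₀ fun a => Ψ.norm_le _ _
  let inc : C₀(X, 𝕜) →ₗ[𝕜] C0on 𝕜 (Set.univ : Set X) :=
    { toFun := fun a => ⟨a, fun x hx => absurd trivial hx⟩
      map_add' := fun _ _ => rfl
      map_smul' := fun _ _ => rfl }
  let π : C₀(X, 𝕜) →ₗ[𝕜] B := g.comp inc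
  have hπle : ∀ a, ‖π a‖ ≤ ‖a‖ := fun a => hg (inc a)
  have hπ : ∀ f, f * f = f → ∀ a : T.I f, π a = Ψ.map f a := by
    intro f hf a
    refine C0on_dense (f := π.comp (T.I f).subtype) (g := Ψ.map f) (C := 1) (T.h f).open_target
      (fun a => ?_) (fun a => ?_) ?_ a
    · rw [one_mul]; exact hπle _
    · rw [one_mul]; exact Ψ.norm_le _ _
    · rintro b ⟨K, hKf, hK, hbK⟩
      have h1 := hgπ ⟨inc b, K, Set.subset_univ _, hK, hbK⟩
      exact h1.trans (key _ hf b rfl)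
  -- Multiplicativity is reduced, one variable at a time, to ideals of idempotents. There `h_k` is
  -- the identity and `u(k, f) = 1`, so the graded product is the pointwise product.
  have hmul' : ∀ f, f * f = f → ∀ (b : T.I f) (a : C₀(X, 𝕜)),
      (π.comp (LinearMap.mulRight 𝕜 (b : C₀(X, 𝕜)))) a
        = ((LinearMap.mulRight 𝕜 (π b)).comp π) a := by
    intro f hf b
    refine T.C0_ext hT (C := ‖(b : C₀(X, 𝕜))‖) (fun a => ?_) (fun a => ?_) fun k hk a => ?_
    · rw [mul_comm]
      exact (hπle _).trans (norm_mul_le _ _)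
    · rw [mul_comm]
      exact (norm_mul_le _ _).trans (mul_le_mul (hπle _) (hπle _) (norm_nonneg _) (norm_nonneg _))
    · change π ((a : C₀(X, 𝕜)) * b) = π a * π b
      rw [hπ k hk, hπ f hf, Ψ.mul, ← hπ _ (idem_mul_idem hk hf)]
      congr 1
      ext x
      rw [ZeroAtInftyContinuousMap.mul_apply]
      by_cases hx : x ∈ (T.h (k * f)).target
      · have hxk := (T.mem_target_mul.1 hx).1
        rw [T.coeffMul_apply _ _ hx, T.symm_idem hk hxk, T.u_idem k f hk hf x hx, mul_one]
      · rw [(T.coeffMul k f a b).2 x hx]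
        by_cases hxk : x ∈ (T.h k).target
        · have hxf : x ∉ (T.h f).target := fun h =>
            hx (T.mem_target_mul.2 ⟨hxk, by rwa [T.symm_idem hk hxk]⟩)
          rw [b.2 x hxf, mul_zero]
        · rw [a.2 x hxk, zero_mul]
  have hmul : ∀ a b, (π.comp (LinearMap.mulLeft 𝕜 a)) b = ((LinearMap.mulLeft 𝕜 (π a)).comp π) b := by
    intro a
    refine T.C0_ext hT (C := ‖a‖) (fun b => ?_) (fun b => ?_) fun k hk b => hmul' k hk b a
    · exact (hπle _).trans (norm_mul_le _ _)
    · exact (norm_mul_le _ _).trans (mul_le_mul (hπle _) (hπle _) (norm_nonneg _) (norm_nonneg _))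
  exact ⟨⟨{ toFun := π
            map_smul' := map_smul π
            map_zero' := map_zero π
            map_add' := map_add π
            map_mul' := hmul }, hπle⟩, hπ⟩

end GradedRep

end

/-! ### From graded representations to normalized covariant representations. -/

section

variable {𝕜 X S : Type*} [RCLike 𝕜] [TopologicalSpace X] [T2Space X] [InverseSemigroup S]
  {T : TwistedAction 𝕜 X S} {B : Type*} [NonUnitalNormedRing B] [NormedSpace 𝕜 B]
  [IsScalarTower 𝕜 B B] [SMulCommClass 𝕜 B B]

theorem IsApproxUnit.mono {J : Submodule 𝕜 C₀(X, 𝕜)} {l l' : Filter C₀(X, 𝕜)}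
    (h : IsApproxUnit J l) (hl : l' ≤ l) (hl' : l'.NeBot) : IsApproxUnit J l' :=
  ⟨hl', h.mem.filter_mono hl, fun b hb => (h.tendsto b hb).mono_left hl⟩

/-- The ideal `C₀(U)` has an approximate unit that is an ultrafilter. -/
theorem exists_ultra_approxUnit [LocallyCompactSpace X] {U : Set X} (hU : IsOpen U) :
    ∃ l : Ultrafilter C₀(X, 𝕜), IsApproxUnit (C0on 𝕜 U) l := by
  obtain ⟨l, hl⟩ := exists_isApproxUnit (𝕜 := 𝕜) hU
  have := hl.neBot
  exact ⟨Ultrafilter.of l, hl.mono (Ultrafilter.of_le l) inferInstance⟩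

open Classical in
/-- The extension by zero of the map `Ψ_t` to `C₀(X)`. -/
def GradedFamily.ext {F : Type*} [NormedAddCommGroup F] [NormedSpace 𝕜 F] (Ψ : GradedFamily T F)
    (t : S) (a : C₀(X, 𝕜)) : F :=
  if h : a ∈ T.I t then Ψ.map t ⟨a, h⟩ else 0

theorem GradedFamily.ext_of_mem {F : Type*} [NormedAddCommGroup F] [NormedSpace 𝕜 F]
    (Ψ : GradedFamily T F) {t : S} {a : C₀(X, 𝕜)} (h : a ∈ T.I t) :
    Ψ.ext t a = Ψ.map t ⟨a, h⟩ := dif_pos h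

theorem GradedFamily.tendsto_map {F : Type*} [NormedAddCommGroup F] [NormedSpace 𝕜 F]
    (Ψ : GradedFamily T F) {t : S} {l : Filter C₀(X, 𝕜)} (hl : IsApproxUnit (T.I t) l)
    (a : T.I t) : Filter.Tendsto (fun μ => Ψ.map t (cmul μ a)) l (𝓝 (Ψ.map t a)) := by
  rw [tendsto_iff_norm_sub_tendsto_zero]
  refine squeeze_zero (fun _ => norm_nonneg _) (fun μ => ?_)
    (tendsto_iff_norm_sub_tendsto_zero.1 (hl.tendsto a a.2))
  rw [← map_sub]
  exact Ψ.norm_le t _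

namespace GradedRep

variable (Ψ : GradedRep T B) {π : BanachRep 𝕜 C₀(X, 𝕜) B}

/-- On `I_t = I_{t t⁻¹}` the representation `π` is `Ψ_{t t⁻¹}`, and the product `Ψ_{t t⁻¹}(b)
Ψ_t(a)` carries the trivial twist `u(t t⁻¹, t) = 1`. -/
theorem pi_mul_map (hπ : ∀ e, e * e = e → ∀ a : T.I e, π a = Ψ.map e a) {t : S} (b a : T.I t) :
    π b * Ψ.map t a = Ψ.map t (cmul b a) := by
  have h1 : (b : C₀(X, 𝕜)) ∈ T.I (t * t⁻¹) := fun x hx => b.2 x (by rwa [T.target_mul_inv] at hx)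
  have h2 := hπ _ (mul_inv_self_idem t) ⟨b, h1⟩
  change π b = _ at h2
  rw [h2, Ψ.mul]
  have h3 : t * t⁻¹ * t = t := mul_inv_mul t
  refine Ψ.map_congr h3 (ZeroAtInftyContinuousMap.ext fun x => ?_)
  rw [cmul_apply]
  by_cases hx : x ∈ (T.h t).target
  · have hx' : x ∈ (T.h (t * t⁻¹ * t)).target := by rwa [h3]
    have hx'' : x ∈ (T.h (t * t⁻¹)).target := by rwa [T.target_mul_inv]
    rw [T.coeffMul_apply _ _ hx', T.u_left t x hx, mul_one,
      T.symm_idem (mul_inv_self_idem t) hx'']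
  · have hx' : x ∉ (T.h (t * t⁻¹ * t)).target := by rwa [h3]
    rw [(T.coeffMul (t * t⁻¹) t ⟨b, h1⟩ a).2 x hx', b.2 x hx, zero_mul]

/-- The mirror image of `pi_mul_map`: now `π` is `Ψ_{t⁻¹ t}` on `I_{t⁻¹}`, the twist is `u(t, t⁻¹ t)
= 1`, and moving `b` to the left applies `α_t`. -/
theorem map_mul_pi (hπ : ∀ e, e * e = e → ∀ a : T.I e, π a = Ψ.map e a) {t : S} (a : T.I t)
    (b : T.I' t) : Ψ.map t a * π b = Ψ.map t (cmul a (T.α t b)) := by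
  have h1 : (b : C₀(X, 𝕜)) ∈ T.I (t⁻¹ * t) := fun x hx => b.2 x (by rwa [T.target_inv_mul] at hx)
  have h2 := hπ _ (inv_mul_self_idem t) ⟨b, h1⟩
  change π b = _ at h2
  rw [h2, Ψ.mul]
  have h3 : t * (t⁻¹ * t) = t := by rw [← mul_assoc, mul_inv_mul]
  refine Ψ.map_congr h3 (ZeroAtInftyContinuousMap.ext fun x => ?_)
  rw [cmul_apply]
  by_cases hx : x ∈ (T.h t).target
  · have hx' : x ∈ (T.h (t * (t⁻¹ * t))).target := by rwa [h3]
    rw [T.coeffMul_apply _ _ hx', T.u_right t x hx, mul_one, T.α_apply _ hx]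
  · have hx' : x ∉ (T.h (t * (t⁻¹ * t))).target := by rwa [h3]
    rw [(T.coeffMul t (t⁻¹ * t) a ⟨b, h1⟩).2 x hx', a.2 x hx, zero_mul]

variable [LocallyCompactSpace X]

/-- `Ψ_s(a) v_t = Ψ_{s t}(a u(s, t))` for `a ∈ I_{s t}`. -/
theorem map_arens (hπ : ∀ e, e * e = e → ∀ a : T.I e, π a = Ψ.map e a) {v : Bidual 𝕜 B}
    (hv : ‖v‖ ≤ 1) (s t : S)
    (h : ∀ a : T.I t, arens (toBidual 𝕜 (π a)) v = toBidual 𝕜 (Ψ.map t a))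
    (a : T.I (s * t)) (a' : T.I s) (haa' : (a : C₀(X, 𝕜)) = a') :
    arens (toBidual 𝕜 (Ψ.map s a')) v = toBidual 𝕜 (Ψ.map (s * t) (T.mulU s t a)) := by
  have hsub : ∀ x, x ∉ (T.h s).target → x ∉ (T.h (s * t)).target :=
    fun x hx hx' => hx (T.mem_target_mul.1 hx').1
  let inc : T.I (s * t) →ₗ[𝕜] T.I s :=
    { toFun := fun a => C0on.cast _ a fun x hx => a.2 x (hsub x hx)
      map_add' := fun _ _ => rfl
      map_smul' := fun _ _ => rfl }
  let f : T.I (s * t) →ₗ[𝕜] Bidual 𝕜 B :=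
    { toFun := fun a => arens (toBidual 𝕜 (Ψ.map s (inc a))) v
      map_add' := fun a b => by rw [map_add, map_add, map_add, arens_add_left]
      map_smul' := fun c a => by
        rw [map_smul, map_smul, map_smul, arens_smul_left, RingHom.id_apply] }
  let g : T.I (s * t) →ₗ[𝕜] Bidual 𝕜 B :=
    { toFun := fun a => toBidual 𝕜 (Ψ.map (s * t) (T.mulU s t a))
      map_add' := fun a b => by
        rw [← map_add, ← map_add]
        congr 2
        exact Subtype.ext (ZeroAtInftyContinuousMap.ext fun x => add_mul _ _ _)
      map_smul' := fun c a => by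
        rw [RingHom.id_apply, ← map_smul, ← map_smul]
        congr 2
        exact Subtype.ext (ZeroAtInftyContinuousMap.ext fun x => mul_assoc _ _ _) }
  have key : ∀ a, f a = g a := by
    refine C0on_dense (C := 1) (T.h (s * t)).open_target (fun a => ?_) (fun a => ?_) ?_
    · calc ‖f a‖ ≤ ‖toBidual 𝕜 (Ψ.map s (inc a))‖ * ‖v‖ := norm_arens_le _ _
        _ ≤ ‖(a : C₀(X, 𝕜))‖ * 1 := by
          refine mul_le_mul ?_ hv (norm_nonneg _) (norm_nonneg _)
          exact (norm_toBidual_le _).trans (Ψ.norm_le s _)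
        _ = 1 * ‖(a : C₀(X, 𝕜))‖ := mul_comm _ _
    · rw [one_mul]
      refine (norm_toBidual_le _).trans ((Ψ.norm_le _ _).trans ?_)
      exact norm_mulUnit_le (T.h (s * t)).open_target (T.u s t) (T.continuousOn_u s t)
        (fun x hx => (T.norm_u s t x hx).le) a
    · rintro a ⟨K, hK, hKc, haK⟩
      -- Since `a = a c`, the cutoff can be split off on the right as `Ψ_s(a) = Ψ_s(a) π(d)` with `d
      -- = α_s⁻¹(c)`. As `c` is supported in `X_{st}`, the function `d` is in `I_t`, and `π(d) v =
      -- Ψ_t(d)` by assumption.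
      obtain ⟨c, -, hc1, -⟩ := exists_cutoff (𝕜 := 𝕜) (T.h (s * t)).open_target hKc hK
      let d : T.I' s := T.αinv s (inc c)
      have hd0 : ∀ x, x ∉ (T.h t).target → (d : C₀(X, 𝕜)) x = 0 := by
        intro x hx
        by_cases hxs : x ∈ (T.h s).source
        · rw [T.αinv_apply _ hxs]
          refine c.2 _ fun h => hx ?_
          have := (T.mem_target_mul.1 h).2
          rwa [(T.h s).left_inv hxs] at this
        · exact d.2 x hxs
      let d' : T.I t := ⟨d, hd0⟩
      have h1 : Ψ.map s (inc a) = Ψ.map s (inc a) * π d := by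
        rw [Ψ.map_mul_pi hπ, T.α_αinv]
        congr 1
        refine Subtype.ext (ZeroAtInftyContinuousMap.ext fun x => ?_)
        rw [cmul_apply]
        change (a : C₀(X, 𝕜)) x = (a : C₀(X, 𝕜)) x * (c : C₀(X, 𝕜)) x
        by_cases hx : x ∈ K
        · rw [hc1 x hx, mul_one]
        · rw [haK x hx, zero_mul]
      change arens (toBidual 𝕜 (Ψ.map s (inc a))) v = toBidual 𝕜 (Ψ.map (s * t) (T.mulU s t a))
      have h2 : arens (toBidual 𝕜 (π d)) v = toBidual 𝕜 (Ψ.map t d') := h d'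
      rw [h1, ← arens_toBidual, arens_assoc, h2, arens_toBidual, Ψ.mul]
      congr 2
      refine T.I_ext fun x hx => ?_
      have hxs := (T.mem_target_mul.1 hx).1
      rw [T.coeffMul_apply _ _ hx, T.mulU_apply]
      change (a : C₀(X, 𝕜)) x * (d : C₀(X, 𝕜)) _ * _ = _
      rw [T.αinv_apply _ ((T.h s).map_target hxs), (T.h s).right_inv hxs]
      change (a : C₀(X, 𝕜)) x * (c : C₀(X, 𝕜)) x * _ = _
      by_cases hx : x ∈ K
      · rw [hc1 x hx, mul_one]
      · rw [haK x hx, zero_mul]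
  have h1 : inc a = a' := Subtype.ext haa'
  rw [← h1]
  exact key a

/-- The covariant representation defined by a graded representation and a family `v` with
`π(a) v_t = Ψ_t(a)` and `v_t π(b) = Ψ_t(α_t(b))`. -/
def toCovRep (π : BanachRep 𝕜 C₀(X, 𝕜) B)
    (hπ : ∀ e, e * e = e → ∀ a : T.I e, π a = Ψ.map e a) (v : S → Bidual 𝕜 B)
    (hv : ∀ t, ‖v t‖ ≤ 1)
    (h1 : ∀ t (a : T.I t), arens (toBidual 𝕜 (π a)) (v t) = toBidual 𝕜 (Ψ.map t a))
    (h2 : ∀ t (a : T.I' t), arens (v t) (toBidual 𝕜 (π a)) = toBidual 𝕜 (Ψ.map t (T.α t a))) :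
    CovRep T B where
  π := π
  v := v
  norm_v := hv
  cov t a := ⟨(h2 t a).trans (h1 t (T.α t a)).symm, _, h2 t a⟩
  mul s t a := by
    have h3 : (a : C₀(X, 𝕜)) ∈ T.I s := fun x hx => a.2 x fun hx' => hx (T.mem_target_mul.1 hx').1
    have h4 : arens (toBidual 𝕜 (π a)) (v s) = toBidual 𝕜 (Ψ.map s ⟨a, h3⟩) := h1 s ⟨a, h3⟩
    rw [h4, Ψ.map_arens hπ (hv t) s t (h1 t) a _ rfl, h1 (s * t)]
  idem e he a := by rw [h1, hπ e he]

end GradedRep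

namespace CovRep

variable {p p' : CovRep T B} {Ψ : GradedRep T B}

theorem pi_of_matches (h : Ψ.Matches p) {e : S} (he : e * e = e) (a : T.I e) :
    p.π a = Ψ.map e a :=
  toBidual_injective (𝕜 := 𝕜) ((p.elt_idem he a).symm.trans (h e a).symm)

variable [LocallyCompactSpace X]

theorem pi_unique (hT : T.AbsorbsCompacts) {π π' : BanachRep 𝕜 C₀(X, 𝕜) B}
    (h : ∀ e : S, e * e = e → ∀ a : T.I e, π a = π' a) : π = π' := by
  refine BanachRep.ext (NonUnitalAlgHom.ext fun a => ?_)
  refine T.C0_ext hT (C := 1) (f := (π.toHom : C₀(X, 𝕜) →ₗ[𝕜] B))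
    (g := (π'.toHom : C₀(X, 𝕜) →ₗ[𝕜] B)) (fun a => ?_) (fun a => ?_) h a
  · rw [one_mul]; exact π.contractive a
  · rw [one_mul]; exact π'.contractive a

theorem pi_unique_of_matches (hT : T.AbsorbsCompacts) (h : Ψ.Matches p) (h' : Ψ.Matches p') :
    p.π = p'.π :=
  pi_unique hT fun _ he a => (pi_of_matches h he a).trans (pi_of_matches h' he a).symm

/-- `a ↦ f(π(a) v_t)` as a linear functional. -/
def eltFunctional (p : CovRep T B) (t : S) (f : StrongDual 𝕜 B) : C₀(X, 𝕜) →ₗ[𝕜] 𝕜 where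
  toFun a := (p.elt t a).fn f
  map_add' a b := by rw [p.elt_add]; rfl
  map_smul' c a := by rw [p.elt_smul]; rfl

theorem norm_eltFunctional_le (p : CovRep T B) (t : S) (f : StrongDual 𝕜 B) (a : C₀(X, 𝕜)) :
    ‖p.eltFunctional t f a‖ ≤ ‖f‖ * ‖a‖ := by
  calc ‖(p.elt t a).fn f‖ ≤ ‖(p.elt t a).fn‖ * ‖f‖ := (p.elt t a).fn.le_opNorm f
    _ ≤ ‖a‖ * ‖f‖ := mul_le_mul_of_nonneg_right (p.norm_elt_le t a) (norm_nonneg _)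
    _ = ‖f‖ * ‖a‖ := mul_comm _ _

/-- The numbers `v_t(f)` for both pairs are limits of functionals that agree on `I_t`, though
possibly along different approximate units; `limit_unique` removes this dependence. -/
theorem IsNormalized.unique (hT : T.AbsorbsCompacts) (hp : p.IsNormalized) (hp' : p'.IsNormalized)
    (h : Ψ.Matches p) (h' : Ψ.Matches p') : p = p' := by
  refine CovRep.ext (pi_unique_of_matches hT h h') (funext fun t => Bidual.ext fun f => ?_)
  obtain ⟨l, hl, hlt⟩ := hp t
  obtain ⟨l', hl', hlt'⟩ := hp' t
  refine limit_unique (T.h t).open_target (g := p.eltFunctional t f) (g' := p'.eltFunctional t f)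
    (p.norm_eltFunctional_le t f) (fun a ha => ?_) hl hl' (hlt f) (hlt' f)
  change (p.elt t a).fn f = (p'.elt t a).fn f
  rw [← h t ⟨a, ha⟩, ← h' t ⟨a, ha⟩]

/-- As for `IsNormalized.unique`, with the functional `a ↦ ⟨π(a) w, x⟩` for `x` in the predual. -/
theorem IsPredualNormalized.unique (hT : T.AbsorbsCompacts) {P : Type*} [NormedAddCommGroup P]
    [NormedSpace 𝕜 P] {e : StrongDual 𝕜 P ≃ₗᵢ[𝕜] B} (hp : p.IsPredualNormalized e)
    (hp' : p'.IsPredualNormalized e) (h : Ψ.Matches p) (h' : Ψ.Matches p') : p = p' := by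
  refine CovRep.ext (pi_unique_of_matches hT h h') (funext fun t => ?_)
  obtain ⟨w, hw, l, hl, hlt⟩ := hp t
  obtain ⟨w', hw', l', hl', hlt'⟩ := hp' t
  have key : ∀ {p : CovRep T B} {w : B}, p.v t = toBidual 𝕜 w → Ψ.Matches p →
      ∀ a : T.I t, p.π a * w = Ψ.map t a := by
    intro p w hw h a
    apply toBidual_injective (𝕜 := 𝕜)
    rw [h t a, ← arens_toBidual, ← hw]
    rfl
  rw [hw, hw']
  congr 1
  apply e.symm.injective
  ext x
  let g : BanachRep 𝕜 C₀(X, 𝕜) B → B → C₀(X, 𝕜) →ₗ[𝕜] 𝕜 := fun π w =>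
    { toFun := fun a => e.symm (π a * w) x
      map_add' := fun a b => by rw [map_add, add_mul, map_add]; rfl
      map_smul' := fun c a => by rw [map_smul, smul_mul_assoc, map_smul]; rfl }
  refine limit_unique (T.h t).open_target (g := g p.π w) (g' := g p'.π w') (C := ‖w‖ * ‖x‖)
    (fun a => ?_) (fun a ha => ?_) hl hl' (hlt x) (hlt' x)
  · calc ‖e.symm (p.π a * w) x‖ ≤ ‖e.symm (p.π a * w)‖ * ‖x‖ := (e.symm _).le_opNorm x
      _ = ‖p.π a * w‖ * ‖x‖ := by rw [e.symm.norm_map]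
      _ ≤ ‖a‖ * ‖w‖ * ‖x‖ := by
        gcongr
        exact (norm_mul_le _ _).trans (mul_le_mul_of_nonneg_right (p.π.contractive a)
          (norm_nonneg _))
      _ = ‖w‖ * ‖x‖ * ‖a‖ := by ring
  · change e.symm (p.π a * w) x = e.symm (p'.π a * w') x
    have h1 : p.π a * w = _ := key hw h ⟨a, ha⟩
    have h2 : p'.π a * w' = _ := key hw' h' ⟨a, ha⟩
    rw [h1, h2]

end CovRep

namespace GradedRep

variable (Ψ : GradedRep T B) [LocallyCompactSpace X] [CompleteSpace B]

/-- `v_t` is the weak-* limit in `B''` of `Ψ_t(μ)` along an ultrafilter that is an approximate unit.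
The values are contractions, so the limit exists by weak-* compactness of the unit ball. -/
theorem existsUnique_normalized (hT : T.AbsorbsCompacts) :
    ∃! p : CovRep T B, p.IsNormalized ∧ Ψ.Matches p := by
  obtain ⟨π, hπ⟩ := Ψ.exists_pi hT
  choose l hl using fun t => exists_ultra_approxUnit (𝕜 := 𝕜) (T.h t).open_target
  have hex : ∀ t, ∃ v : Bidual 𝕜 B, ‖v‖ ≤ 1 ∧ ∀ f : StrongDual 𝕜 B,
      Filter.Tendsto (fun μ => f (Ψ.ext t μ)) (l t) (𝓝 (v.fn f)) := by
    intro t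
    refine exists_ultralimit (l t) (fun μ => (toBidual 𝕜 (Ψ.ext t μ)).fn) ?_
    filter_upwards [(hl t).mem] with μ hμ
    rw [Ψ.ext_of_mem hμ.1]
    exact (norm_toBidual_le _).trans ((Ψ.norm_le t _).trans hμ.2)
  choose v hv hlim using hex
  -- Weak-* continuity of the second Arens product in the second variable: `π(a) v_t` is the limit
  -- of `π(a) Ψ_t(μ) = Ψ_t(μ a)`, which converges in norm.
  have h1 : ∀ t (a : T.I t), arens (toBidual 𝕜 (π a)) (v t) = toBidual 𝕜 (Ψ.map t a) := by
    intro t a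
    refine Bidual.ext fun f => ?_
    have := (hl t).neBot
    refine tendsto_nhds_unique (hlim t ((toBidual 𝕜 (π a)).fn.comp (translate 𝕜 B f))) ?_
    refine ((f.continuous.tendsto _).comp (Ψ.tendsto_map (hl t) a)).congr' ?_
    filter_upwards [(hl t).mem] with μ hμ
    change f _ = f (π a * Ψ.ext t μ)
    rw [Ψ.ext_of_mem hμ.1, Ψ.pi_mul_map hπ]
    exact congrArg (fun z => f (Ψ.map t z)) (Subtype.ext (mul_comm μ (a : C₀(X, 𝕜))))
  -- In the first variable the product is weak-* continuous because the second factor is in `B`: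
  -- `v_t π(a)` is the limit of `Ψ_t(μ) π(a) = Ψ_t(μ α_t(a))`.
  have h2 : ∀ t (a : T.I' t),
      arens (v t) (toBidual 𝕜 (π a)) = toBidual 𝕜 (Ψ.map t (T.α t a)) := by
    intro t a
    refine Bidual.ext fun f => ?_
    have := (hl t).neBot
    refine tendsto_nhds_unique (hlim t (translate 𝕜 B f (π a))) ?_
    refine ((f.continuous.tendsto _).comp (Ψ.tendsto_map (hl t) (T.α t a))).congr' ?_
    filter_upwards [(hl t).mem] with μ hμ
    change f _ = f (Ψ.ext t μ * π a)
    rw [Ψ.ext_of_mem hμ.1, Ψ.map_mul_pi hπ]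
  let p := Ψ.toCovRep π hπ v hv h1 h2
  have hp : Ψ.Matches p := fun t a => (h1 t a).symm
  have hpn : p.IsNormalized := fun t => ⟨l t, hl t, fun f => by
    refine (hlim t f).congr' ?_
    filter_upwards [(hl t).mem] with μ hμ
    rw [Ψ.ext_of_mem hμ.1]
    exact congrArg (fun z => Bidual.fn z f) (hp t ⟨μ, hμ.1⟩)⟩
  exact ⟨p, ⟨hpn, hp⟩, fun p' hp' => hp'.1.unique hT hpn hp'.2 hp⟩

/-- The limits are now taken in the unit ball of `B = P'` itself; separate weak-* continuity of its
multiplication takes over the role of the Arens product. -/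
theorem existsUnique_predualNormalized (hT : T.AbsorbsCompacts) {P : Type*}
    [NormedAddCommGroup P] [NormedSpace 𝕜 P] {e : StrongDual 𝕜 P ≃ₗᵢ[𝕜] B}
    (he : IsDualBanachAlgebra e) :
    ∃! p : CovRep T B, p.IsPredualNormalized e ∧ Ψ.Matches p := by
  obtain ⟨π, hπ⟩ := Ψ.exists_pi hT
  choose l hl using fun t => exists_ultra_approxUnit (𝕜 := 𝕜) (T.h t).open_target
  have hex : ∀ t, ∃ v : StrongDual 𝕜 P, ‖v‖ ≤ 1 ∧ ∀ x : P,
      Filter.Tendsto (fun μ => e.symm (Ψ.ext t μ) x) (l t) (𝓝 (v x)) := by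
    intro t
    refine exists_ultralimit (l t) (fun μ => e.symm (Ψ.ext t μ)) ?_
    filter_upwards [(hl t).mem] with μ hμ
    rw [Ψ.ext_of_mem hμ.1, e.symm.norm_map]
    exact (Ψ.norm_le t _).trans hμ.2
  choose v hv hlim using hex
  have hweak : ∀ t, Filter.Tendsto (fun μ => StrongDual.toWeakDual (e.symm (Ψ.ext t μ))) (l t)
      (𝓝 (StrongDual.toWeakDual (v t))) := by
    intro t
    rw [tendsto_iff_forall_eval_tendsto_topDualPairing]
    exact hlim t
  -- If a net converges in norm to `c` and weak-* to `b`, then `b = c`.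
  have key : ∀ {t} {b : B} (g : C₀(X, 𝕜) → B) {c : B},
      Filter.Tendsto g (l t) (𝓝 c) → Filter.Tendsto (fun μ => StrongDual.toWeakDual
        (e.symm (g μ))) (l t) (𝓝 (StrongDual.toWeakDual (e.symm b))) → b = c := by
    intro t b g c h1 h2
    have := (hl t).neBot
    apply e.symm.injective
    ext x
    rw [tendsto_iff_forall_eval_tendsto_topDualPairing] at h2
    refine tendsto_nhds_unique (h2 x) ?_
    have h3 : Continuous fun b : B => e.symm b x :=
      (ContinuousLinearMap.apply 𝕜 𝕜 x).continuous.comp e.symm.continuous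
    exact (h3.tendsto c).comp h1
  have h1 : ∀ t (a : T.I t), π a * e (v t) = Ψ.map t a := by
    intro t a
    have h3 := ((he (π a)).1.tendsto (StrongDual.toWeakDual (v t))).comp (hweak t)
    refine key (t := t) (fun μ => π a * Ψ.ext t μ) ?_ ?_
    · refine (Ψ.tendsto_map (hl t) a).congr' ?_
      filter_upwards [(hl t).mem] with μ hμ
      rw [Ψ.ext_of_mem hμ.1, Ψ.pi_mul_map hπ]
      exact congrArg (fun z => Ψ.map t z) (Subtype.ext (mul_comm μ (a : C₀(X, 𝕜))))
    · refine h3.congr fun μ => ?_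
      simp
  have h2 : ∀ t (a : T.I' t), e (v t) * π a = Ψ.map t (T.α t a) := by
    intro t a
    have h3 := ((he (π a)).2.tendsto (StrongDual.toWeakDual (v t))).comp (hweak t)
    refine key (t := t) (fun μ => Ψ.ext t μ * π a) ?_ ?_
    · refine (Ψ.tendsto_map (hl t) (T.α t a)).congr' ?_
      filter_upwards [(hl t).mem] with μ hμ
      rw [Ψ.ext_of_mem hμ.1, Ψ.map_mul_pi hπ]
    · refine h3.congr fun μ => ?_
      simp
  let p := Ψ.toCovRep π hπ (fun t => toBidual 𝕜 (e (v t)))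
    (fun t => (norm_toBidual_le _).trans ((e.norm_map _).trans_le (hv t)))
    (fun t a => by rw [arens_toBidual, h1]) (fun t a => by rw [arens_toBidual, h2])
  have hp : Ψ.Matches p := fun t a => congrArg (toBidual 𝕜) (h1 t a).symm
  have hpn : p.IsPredualNormalized e := fun t => ⟨e (v t), rfl, l t, hl t, fun x => by
    rw [e.symm_apply_apply]
    refine (hlim t x).congr' ?_
    filter_upwards [(hl t).mem] with μ hμ
    rw [Ψ.ext_of_mem hμ.1]
    exact congrArg (fun z => e.symm z x) (h1 t ⟨μ, hμ.1⟩).symm⟩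
  exact ⟨p, ⟨hpn, hp⟩, fun p' hp' => hp'.1.unique hT hpn hp'.2 hp⟩

end GradedRep

/-! ### Compact ideals -/

section Compact

variable [LocallyCompactSpace X]

theorem exists_unit {t : S} (ht : IsCompact (T.h t).target) :
    ∃ q : T.I t, (∀ x ∈ (T.h t).target, (q : C₀(X, 𝕜)) x = 1) ∧ ‖(q : C₀(X, 𝕜))‖ ≤ 1 := by
  obtain ⟨q, -, h1, h2⟩ := exists_cutoff (𝕜 := 𝕜) (T.h t).open_target ht subset_rfl
  exact ⟨q, h1, C0_norm_le zero_le_one fun x => (h2 x).1⟩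

theorem mul_unit {t : S} {q : T.I t} (hq : ∀ x ∈ (T.h t).target, (q : C₀(X, 𝕜)) x = 1)
    {a : C₀(X, 𝕜)} (ha : a ∈ T.I t) : a * q = a := by
  ext x
  rw [ZeroAtInftyContinuousMap.mul_apply]
  by_cases hx : x ∈ (T.h t).target
  · rw [hq x hx, mul_one]
  · rw [ha x hx, zero_mul]

theorem isApproxUnit_pure {t : S} {q : T.I t}
    (hq : ∀ x ∈ (T.h t).target, (q : C₀(X, 𝕜)) x = 1) :
    IsApproxUnit (T.I t) (pure (q : C₀(X, 𝕜))) := by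
  refine ⟨inferInstance, ⟨q.2, C0_norm_le zero_le_one fun x => ?_⟩, fun b hb => ?_⟩
  · by_cases hx : x ∈ (T.h t).target
    · rw [hq x hx, norm_one]
    · rw [q.2 x hx, norm_zero]; exact zero_le_one
  · rw [Filter.tendsto_pure_left]
    intro s hs
    rw [mul_comm, mul_unit hq hb]
    exact mem_of_mem_nhds hs

/-- In the presence of a unit, approximate units converge in norm. -/
theorem IsApproxUnit.tendsto_unit {t : S} {q : T.I t}
    (hq : ∀ x ∈ (T.h t).target, (q : C₀(X, 𝕜)) x = 1) {l : Filter C₀(X, 𝕜)}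
    (hl : IsApproxUnit (T.I t) l) : Filter.Tendsto id l (𝓝 (q : C₀(X, 𝕜))) := by
  refine (hl.tendsto q q.2).congr' ?_
  filter_upwards [hl.mem] with μ hμ
  exact mul_unit hq hμ.1

/-- `1_{X_t}` is a unit of `I_t`, so every approximate unit converges to it in norm, and the limit
of `π(μ) v_t` is `π(1_{X_t}) v_t ∈ B`. Conversely, the constant net `1_{X_t}` is an approximate
unit. -/
theorem CovRep.isNormalized_iff (hc : ∀ t, IsCompact (T.h t).target) (p : CovRep T B) :
    p.IsNormalized ↔ p.IsUnitNormalized := by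
  constructor
  · intro hp t
    obtain ⟨l, hl, hlim⟩ := hp t
    obtain ⟨q, hq, -⟩ := exists_unit (hc t)
    obtain ⟨w, hw⟩ := p.exists_elt t q
    have hv : p.v t = toBidual 𝕜 w := by
      refine Bidual.ext fun f => ?_
      have := hl.neBot
      refine tendsto_nhds_unique (hlim f) ?_
      have hcont : Continuous (p.eltFunctional t f) :=
        AddMonoidHomClass.continuous_of_bound _ _ (p.norm_eltFunctional_le t f)
      rw [hw]
      exact (hcont.tendsto q).comp (hl.tendsto_unit hq)
    refine ⟨q, hq, w, hv, toBidual_injective (𝕜 := 𝕜) ?_⟩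
    rw [← arens_toBidual, ← hv]
    exact hv.trans hw
  · intro hp t
    obtain ⟨q, hq, w, hv, hw⟩ := hp t
    refine ⟨pure q, isApproxUnit_pure hq, fun f => ?_⟩
    have h1 : p.elt t q = p.v t := by rw [CovRep.elt, hv, arens_toBidual, ← hw]
    rw [Filter.tendsto_pure_left]
    intro s hs
    rw [h1]
    exact mem_of_mem_nhds hs

theorem CovRep.isPredualNormalized_iff (hc : ∀ t, IsCompact (T.h t).target) {P : Type*}
    [NormedAddCommGroup P] [NormedSpace 𝕜 P] {e : StrongDual 𝕜 P ≃ₗᵢ[𝕜] B} (p : CovRep T B) :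
    p.IsPredualNormalized e ↔ p.IsUnitNormalized := by
  constructor
  · intro hp t
    obtain ⟨w, hv, l, hl, hlim⟩ := hp t
    obtain ⟨q, hq, -⟩ := exists_unit (hc t)
    refine ⟨q, hq, w, hv, ?_⟩
    apply e.symm.injective
    ext x
    have := hl.neBot
    refine tendsto_nhds_unique (hlim x) ?_
    have h3 : Continuous fun a : C₀(X, 𝕜) => e.symm (p.π a * w) x :=
      (ContinuousLinearMap.apply 𝕜 𝕜 x).continuous.comp
        (e.symm.continuous.comp ((AlgSeminorm.continuous_rep p.π).mul continuous_const))
    exact (h3.tendsto q).comp (hl.tendsto_unit hq)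
  · intro hp t
    obtain ⟨q, hq, w, hv, hw⟩ := hp t
    refine ⟨w, hv, pure q, isApproxUnit_pure hq, fun x => ?_⟩
    rw [Filter.tendsto_pure_left]
    intro s hs
    rw [← hw]
    exact mem_of_mem_nhds hs

end Compact

end

section

/-! ### Weak limits of operators -/

section WeakLimits

variable {𝕜 : Type*} [RCLike 𝕜] {E : Type*} [NormedAddCommGroup E] [NormedSpace 𝕜 E] {ι : Type*}
  {l : Filter ι}

/-- Convergence of a net of operators in the weak operator topology. -/
def WeakOpTendsto (R : ι → E →L[𝕜] E) (l : Filter ι) (V : E →L[𝕜] E) : Prop :=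
  ∀ ξ (f : StrongDual 𝕜 E), Filter.Tendsto (fun i => f (R i ξ)) l (𝓝 (f (V ξ)))

theorem eq_of_forall_dual {x y : E} (h : ∀ f : StrongDual 𝕜 E, f x = f y) : x = y :=
  (SeparatingDual.eq_iff_forall_dual_eq (R := 𝕜)).2 h

/-- Closed subspaces are weakly closed: functionals on `E / K`, pulled back to `E`, separate the
points outside `K` from `K`. -/
theorem mem_of_weak_limit [l.NeBot] {K : Submodule 𝕜 E} (hK : IsClosed (K : Set E)) {y : ι → E}
    {z : E} (hy : ∀ᶠ i in l, y i ∈ K)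
    (h : ∀ f : StrongDual 𝕜 E, Filter.Tendsto (fun i => f (y i)) l (𝓝 (f z))) : z ∈ K := by
  have := hK
  rw [← Submodule.Quotient.mk_eq_zero]
  refine SeparatingDual.eq_zero_of_forall_dual_eq_zero (R := 𝕜) fun f => ?_
  let q : E →L[𝕜] E ⧸ K := K.mkQ.mkContinuous 1 fun x => by
    rw [one_mul]; exact Submodule.Quotient.norm_mk_le K x
  refine tendsto_nhds_unique (h (f.comp q)) (tendsto_const_nhds.congr' ?_)
  filter_upwards [hy] with i hi
  have h1 : q (y i) = 0 := (Submodule.Quotient.mk_eq_zero K).2 hi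
  rw [ContinuousLinearMap.comp_apply, h1, map_zero]

namespace WeakOpTendsto

variable {R R' : ι → E →L[𝕜] E} {V V' : E →L[𝕜] E}

theorem unique [l.NeBot] (h : WeakOpTendsto R l V) (h' : WeakOpTendsto R l V') : V = V' :=
  ContinuousLinearMap.ext fun ξ => eq_of_forall_dual fun f => tendsto_nhds_unique (h ξ f) (h' ξ f)

theorem of_tendsto (h : Filter.Tendsto R l (𝓝 V)) : WeakOpTendsto R l V := fun ξ f =>
  ((f.continuous.comp (ContinuousLinearMap.apply 𝕜 E ξ).continuous).tendsto V).comp h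

theorem congr' (h : WeakOpTendsto R l V) (hR : ∀ᶠ i in l, R i = R' i) : WeakOpTendsto R' l V :=
  fun ξ f => (h ξ f).congr' (by filter_upwards [hR] with i hi; rw [hi])

theorem mul_left (h : WeakOpTendsto R l V) (A : E →L[𝕜] E) :
    WeakOpTendsto (fun i => A * R i) l (A * V) := fun ξ f => h ξ (f.comp A)

theorem mul_right (h : WeakOpTendsto R l V) (A : E →L[𝕜] E) :
    WeakOpTendsto (fun i => R i * A) l (V * A) := fun ξ f => h (A ξ) f

theorem apply_mem [l.NeBot] (h : WeakOpTendsto R l V) {K : Submodule 𝕜 E}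
    (hK : IsClosed (K : Set E)) {ξ : E} (hR : ∀ᶠ i in l, R i ξ ∈ K) : V ξ ∈ K :=
  mem_of_weak_limit hK hR (h ξ)

end WeakOpTendsto

/-- On a reflexive space, ultranets of contractions have weak limits. -/
theorem exists_weakOpLimit (hE : IsReflexive 𝕜 E) (l : Ultrafilter ι) {R : ι → E →L[𝕜] E}
    (hR : ∀ᶠ i in l, ‖R i‖ ≤ 1) : ∃ V : E →L[𝕜] E, ‖V‖ ≤ 1 ∧ WeakOpTendsto R l V := by
  have hex : ∀ ξ, ∃ z : E, ∀ f : StrongDual 𝕜 E,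
      Filter.Tendsto (fun i => f (R i ξ)) l (𝓝 (f z)) := by
    intro ξ
    -- Scaling moves the orbit of `ξ` into the unit ball, where weak-* compactness is available; the
    -- summand 1 avoids a separate case `ξ = 0`.
    set c : 𝕜 := ((‖ξ‖ + 1 : ℝ) : 𝕜) with hc
    have hc0 : c ≠ 0 := by
      rw [hc, Ne, RCLike.ofReal_eq_zero]
      positivity
    obtain ⟨ψ, -, h⟩ := exists_ultralimit l
      (fun i => NormedSpace.inclusionInDoubleDual 𝕜 E (R i (c⁻¹ • ξ))) (by
        filter_upwards [hR] with i hi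
        refine (NormedSpace.double_dual_bound 𝕜 E _).trans ?_
        calc ‖R i (c⁻¹ • ξ)‖ ≤ 1 * ‖c⁻¹ • ξ‖ := (R i).le_of_opNorm_le hi _
          _ = (‖ξ‖ + 1)⁻¹ * ‖ξ‖ := by
            rw [one_mul, norm_smul, norm_inv, hc, RCLike.norm_ofReal, abs_of_nonneg (by positivity)]
          _ ≤ (‖ξ‖ + 1)⁻¹ * (‖ξ‖ + 1) := by gcongr; linarith
          _ = 1 := inv_mul_cancel₀ (by positivity))
    -- This is where reflexivity enters: the weak-* limit in `E''` is a vector of `E`.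
    obtain ⟨z, rfl⟩ := hE ψ
    refine ⟨c • z, fun f => ?_⟩
    have h1 := (h f).const_mul c
    simp only [NormedSpace.dual_def] at h1
    rw [map_smul, smul_eq_mul]
    refine h1.congr fun i => ?_
    rw [map_smul, map_smul, smul_eq_mul, mul_inv_cancel_left₀ hc0]
  choose V hV using hex
  let V' : E →ₗ[𝕜] E :=
    { toFun := V
      map_add' := fun ξ η => eq_of_forall_dual fun f => by
        refine tendsto_nhds_unique (hV (ξ + η) f) ?_
        rw [map_add]
        refine ((hV ξ f).add (hV η f)).congr fun i => ?_
        rw [map_add, map_add]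
      map_smul' := fun c ξ => eq_of_forall_dual fun f => by
        refine tendsto_nhds_unique (hV (c • ξ) f) ?_
        rw [RingHom.id_apply, map_smul, smul_eq_mul]
        refine ((hV ξ f).const_mul c).congr fun i => ?_
        rw [map_smul, map_smul, smul_eq_mul] }
  have hle : ∀ ξ, ‖V' ξ‖ ≤ 1 * ‖ξ‖ := by
    intro ξ
    refine NormedSpace.norm_le_dual_bound 𝕜 _ (by positivity) fun f => ?_
    refine le_of_tendsto (hV ξ f).norm ?_
    filter_upwards [hR] with i hi
    calc ‖f (R i ξ)‖ ≤ ‖f‖ * ‖R i ξ‖ := f.le_opNorm _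
      _ ≤ ‖f‖ * (1 * ‖ξ‖) := by gcongr; exact (R i).le_of_opNorm_le hi ξ
      _ = 1 * ‖ξ‖ * ‖f‖ := mul_comm _ _
  exact ⟨V'.mkContinuous 1 hle, LinearMap.mkContinuous_norm_le _ zero_le_one hle, hV⟩

end WeakLimits

/-! ### Essential subspaces -/

section Essential

variable {𝕜 X : Type*} [RCLike 𝕜] [TopologicalSpace X] [T2Space X] {E : Type*} [NormedAddCommGroup E]
  [NormedSpace 𝕜 E] {π : BanachRep 𝕜 C₀(X, 𝕜) (E →L[𝕜] E)} {J : Submodule 𝕜 C₀(X, 𝕜)}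

theorem isClosed_essSubspace : IsClosed (essSubspace π J : Set E) :=
  Submodule.isClosed_topologicalClosure _

theorem essSubspace_le {K : Submodule 𝕜 E} (hK : IsClosed (K : Set E))
    (h : ∀ a ∈ J, ∀ x, π a x ∈ K) : essSubspace π J ≤ K := by
  refine Submodule.topologicalClosure_minimal _ (Submodule.span_le.2 ?_) hK
  rintro _ ⟨a, ha, x, rfl⟩
  exact h a ha x

/-- Operators that agree on `π(J) E` agree on its closed span. -/
theorem eq_on_essSubspace {F : Type*} [NormedAddCommGroup F] [NormedSpace 𝕜 F] {A A' : E →L[𝕜] F}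
    (h : ∀ a ∈ J, ∀ x, A (π a x) = A' (π a x)) {ζ : E} (hζ : ζ ∈ essSubspace π J) :
    A ζ = A' ζ := by
  have h1 : essSubspace π J ≤ LinearMap.eqLocus A.toLinearMap A'.toLinearMap :=
    essSubspace_le (isClosed_eq A.continuous A'.continuous) h
  exact h1 hζ

theorem ext_essSubspace {F : Type*} [NormedAddCommGroup F] [NormedSpace 𝕜 F]
    {A A' : essSubspace π J →L[𝕜] F}
    (h : ∀ (a : J) (x : E), A ⟨π a x, mem_essSubspace π a.2 x⟩ = A' ⟨π a x, mem_essSubspace π a.2 x⟩)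
    (ζ : essSubspace π J) : A ζ = A' ζ := by
  have h1 : essSubspace π J ≤
      (LinearMap.eqLocus A.toLinearMap A'.toLinearMap).map (essSubspace π J).subtype := by
    refine essSubspace_le ?_ fun a ha x => ⟨⟨_, mem_essSubspace π ha x⟩, h ⟨a, ha⟩ x, rfl⟩
    rw [Submodule.map_coe]
    exact (isClosed_essSubspace.isClosedEmbedding_subtypeVal).isClosedMap _
      (isClosed_eq A.continuous A'.continuous)
  obtain ⟨ζ', h2, h3⟩ := h1 ζ.2
  rw [← Subtype.ext (a1 := ζ') (a2 := ζ) h3]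
  exact h2

/-- On the span of `π(J) E` the operators `π(μ)` converge strongly to the identity. If `η` in this
span is close to `ζ` and `π(J)` kills `ζ`, then `π(μ) η = π(μ)(η - ζ)` is small; hence `η`, and with
it `ζ`, is small. -/
theorem eq_zero_of_essSubspace {l : Filter C₀(X, 𝕜)} (hl : IsApproxUnit J l) {ζ : E}
    (hζ : ζ ∈ essSubspace π J) (h : ∀ a ∈ J, π a ζ = 0) : ζ = 0 := by
  have hspan : ∀ η ∈ Submodule.span 𝕜 {y | ∃ a ∈ J, ∃ x, y = π a x},
      Filter.Tendsto (fun μ => π μ η) l (𝓝 η) := by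
    intro η hη
    induction hη using Submodule.span_induction with
    | mem y hy =>
      obtain ⟨a, ha, x, rfl⟩ := hy
      have h1 : Continuous fun b : C₀(X, 𝕜) => π b x :=
        (ContinuousLinearMap.apply 𝕜 E x).continuous.comp (AlgSeminorm.continuous_rep π)
      refine ((h1.tendsto a).comp (hl.tendsto a ha)).congr fun μ => ?_
      change π (μ * a) x = _
      rw [map_mul]
      rfl
    | zero =>
      simp only [map_zero]
      exact tendsto_const_nhds
    | add y z _ _ hy hz =>
      refine (hy.add hz).congr fun μ => ?_
      rw [map_add]
    | smul c y _ hy =>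
      refine (hy.const_smul c).congr fun μ => ?_
      rw [map_smul]
  have hne := hl.neBot
  rw [← norm_le_zero_iff]
  refine le_of_forall_pos_le_add fun ε hε => ?_
  obtain ⟨η, hη, hd⟩ := Metric.mem_closure_iff.1 hζ (ε / 2) (half_pos hε)
  rw [dist_eq_norm] at hd
  have h1 : ‖η‖ ≤ ε / 2 := by
    refine le_of_tendsto (hspan η hη).norm ?_
    filter_upwards [hl.mem] with μ hμ
    have h2 : π μ η = π μ (η - ζ) := by rw [map_sub, h μ hμ.1, sub_zero]
    rw [h2]
    calc ‖π μ (η - ζ)‖ ≤ 1 * ‖η - ζ‖ :=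
          (π μ).le_of_opNorm_le ((π.contractive μ).trans hμ.2) _
      _ ≤ ε / 2 := by rw [one_mul, norm_sub_rev]; exact hd.le
  have h2 : ζ = ζ - η + η := by abel
  calc ‖ζ‖ = ‖ζ - η + η‖ := by rw [← h2]
    _ ≤ ‖ζ - η‖ + ‖η‖ := norm_add_le _ _
    _ ≤ 0 + ε := by linarith

theorem essSubspace_ext {l : Filter C₀(X, 𝕜)} (hl : IsApproxUnit J l) {ζ ζ' : E}
    (hζ : ζ ∈ essSubspace π J) (hζ' : ζ' ∈ essSubspace π J) (h : ∀ a ∈ J, π a ζ = π a ζ') :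
    ζ = ζ' := by
  rw [← sub_eq_zero]
  refine eq_zero_of_essSubspace hl (sub_mem hζ hζ') fun a ha => ?_
  rw [map_sub, h a ha, sub_self]

end Essential

/-! ### Covariant representations on Banach spaces -/

variable {𝕜 X S : Type*} [RCLike 𝕜] [TopologicalSpace X] [T2Space X] [InverseSemigroup S]
  {T : TwistedAction 𝕜 X S} {E : Type*} [NormedAddCommGroup E] [NormedSpace 𝕜 E]

namespace CovRepOn

variable (q : CovRepOn T E)

theorem v_mem (t : S) (ξ : E) : q.v t ξ ∈ essSubspace q.π (T.I t) := by
  obtain ⟨w, -, -, -, -, h, -⟩ := q.cov t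
  rw [← SetLike.mem_coe, ← h]
  exact ⟨ξ, rfl⟩

/-- The operator `M` that implements a trivial twist is the identity on the vectors `π(a) x`, hence
on their closed span, which contains the range of `v_{st}`. -/
theorem v_mul_of_u_eq_one {s t : S} (h : ∀ x ∈ (T.h (s * t)).target, T.u s t x = 1) :
    q.v s * q.v t = q.v (s * t) := by
  obtain ⟨M, h1, h2⟩ := q.mul s t
  have h3 : ∀ ζ, (essSubspace q.π (T.I (s * t))).subtypeL.comp M ζ
      = (essSubspace q.π (T.I (s * t))).subtypeL ζ := by
    refine ext_essSubspace fun a x => ?_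
    have h4 : T.mulU s t a = a := T.I_ext fun x hx => by rw [T.mulU_apply, h x hx, mul_one]
    have h5 := h1 a x
    rw [h4] at h5
    exact h5
  ext ξ
  obtain ⟨hξ, h4⟩ := h2 ξ
  exact h4.trans (h3 ⟨_, hξ⟩)

theorem v_congr {s t : S} (h : s = t) : q.v s = q.v t := by rw [h]

/-- `v_t π(a) = π(α_t(a)) v_t`. -/
theorem v_mul_pi (t : S) (a : T.I' t) : q.v t * q.π a = q.π (T.α t a) * q.v t := by
  obtain ⟨w, -, hv, hw, hc, h1, h2⟩ := q.cov t
  have he := inv_mul_self_idem t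
  have h3 : t * (t⁻¹ * t) = t := by rw [← mul_assoc, mul_inv_mul]
  -- The twist `u(t, t⁻¹ t)` is trivial.
  have hve : q.v t * q.v (t⁻¹ * t) = q.v t := by
    rw [q.v_mul_of_u_eq_one, q.v_congr h3]
    intro x hx
    rw [h3] at hx
    exact T.u_right t x hx
  have hJ : T.I (t⁻¹ * t) = T.I' t := by
    change C0on 𝕜 _ = C0on 𝕜 _
    rw [T.target_inv_mul]
  -- The idempotent `w v_t` fixes the range of `w`, which is the closed span of `π(I_{t⁻¹}) E` and
  -- contains the range of `v_{t⁻¹ t}`. Together with `v_t v_{t⁻¹ t} = v_t` this gives `w v_t =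
  -- v_{t⁻¹ t}`. Then `π(α_t(a)) v_t = v_t π(a) w v_t = v_t π(a) v_{t⁻¹ t} = v_t π(a)`.
  have hwv : w * q.v t = q.v (t⁻¹ * t) := by
    ext ξ
    have h4 := q.v_mem (t⁻¹ * t) ξ
    rw [hJ, ← SetLike.mem_coe, ← h2] at h4
    obtain ⟨η, hη⟩ := h4
    calc (w * q.v t) ξ = (w * q.v t * q.v (t⁻¹ * t)) ξ := by rw [mul_assoc, hve]
      _ = (w * q.v t) (w η) := by rw [hη]; rfl
      _ = (w * q.v t * w) η := rfl
      _ = q.v (t⁻¹ * t) ξ := by rw [hw, hη]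
  have ha : (a : C₀(X, 𝕜)) ∈ T.I (t⁻¹ * t) := by rw [hJ]; exact a.2
  have h5 : q.π a * q.v (t⁻¹ * t) = q.π a := q.idem _ he ⟨a, ha⟩
  rw [← hc a, mul_assoc _ w, hwv, mul_assoc, h5]

/-- `π(a) M = π(a u(s, t))` on the closed span of `π(I_{st}) E`, since `a (b u(s, t)) = (a u(s, t))
b` for `b ∈ I_{st}`. -/
theorem pi_mul_v_mul_v (s t : S) (a : T.I (s * t)) :
    q.π a * q.v s * q.v t = q.π (T.mulU s t a) * q.v (s * t) := by
  obtain ⟨M, h1, h2⟩ := q.mul s t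
  have h3 : ∀ ζ, (q.π a).comp ((essSubspace q.π (T.I (s * t))).subtypeL.comp M) ζ
      = (q.π (T.mulU s t a)).comp (essSubspace q.π (T.I (s * t))).subtypeL ζ := by
    refine ext_essSubspace fun b x => ?_
    change q.π a (M ⟨q.π b x, _⟩) = q.π (T.mulU s t a) (q.π b x)
    rw [h1 b x]
    have h4 : (a : C₀(X, 𝕜)) * T.mulU s t b = T.mulU s t a * (b : C₀(X, 𝕜)) := by
      ext x
      simp only [ZeroAtInftyContinuousMap.mul_apply, T.mulU_apply]
      ring
    have h5 := congrArg (fun z => q.π z x) h4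
    simp only [map_mul] at h5
    exact h5
  ext ξ
  obtain ⟨hξ, h4⟩ := h2 ξ
  change q.π a (q.v s (q.v t ξ)) = _
  rw [h4]
  exact h3 ⟨_, hξ⟩

/-- A covariant representation on `E` is a covariant representation in `B(E)`. -/
def toCovRep : CovRep T (E →L[𝕜] E) where
  π := q.π
  v t := toBidual 𝕜 (q.v t)
  norm_v t := (norm_toBidual_le _).trans (q.norm_v t)
  cov t a := ⟨by rw [arens_toBidual, arens_toBidual, q.v_mul_pi], _, arens_toBidual _ _⟩
  mul s t a := by rw [arens_toBidual, arens_toBidual, arens_toBidual, q.pi_mul_v_mul_v]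
  idem e he a := by rw [arens_toBidual, q.idem e he]

theorem isCov_toCovRep : q.IsCov q.toCovRep := ⟨rfl, fun _ => rfl⟩

variable {q}

theorem IsCov.eq {p : CovRep T (E →L[𝕜] E)} (h : q.IsCov p) : p = q.toCovRep :=
  CovRep.ext h.1 (funext h.2)

theorem matches_iff {Ψ : GradedRep T (E →L[𝕜] E)} :
    Ψ.Matches q.toCovRep ↔ ∀ t (a : T.I t), q.π a * q.v t = Ψ.map t a :=
  forall₂_congr fun _ _ => ⟨fun h => (toBidual_injective (𝕜 := 𝕜) h).symm,
    fun h => congrArg (toBidual 𝕜) h.symm⟩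

/-- The graded representation determines `π(a) v_t ξ` for `a ∈ I_t`, and `v_t ξ` lies in the closed
span of `π(I_t) E`, where `π(I_t)` separates points. -/
theorem unique_of_matches [LocallyCompactSpace X] (hT : T.AbsorbsCompacts) {q' : CovRepOn T E}
    {Ψ : GradedRep T (E →L[𝕜] E)} (h : Ψ.Matches q.toCovRep) (h' : Ψ.Matches q'.toCovRep) :
    q = q' := by
  have hπ : q.π = q'.π := CovRep.pi_unique_of_matches hT h h'
  refine CovRepOn.ext hπ (funext fun t => ContinuousLinearMap.ext fun ξ => ?_)
  obtain ⟨l, hl⟩ := exists_isApproxUnit (𝕜 := 𝕜) (T.h t).open_target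
  refine essSubspace_ext hl (q.v_mem t ξ) (by rw [hπ]; exact q'.v_mem t ξ) fun a ha => ?_
  have h1 := matches_iff.1 h t ⟨a, ha⟩
  have h2 := matches_iff.1 h' t ⟨a, ha⟩
  rw [← hπ] at h2
  exact congrArg (fun z : E →L[𝕜] E => z ξ) (h1.trans h2.symm)

theorem isUnitNormalized [LocallyCompactSpace X] (hc : ∀ t, IsCompact (T.h t).target) :
    q.toCovRep.IsUnitNormalized := by
  intro t
  obtain ⟨u, hu, -⟩ := exists_unit (hc t)
  refine ⟨u, hu, q.v t, rfl, ContinuousLinearMap.ext fun ξ => ?_⟩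
  refine eq_on_essSubspace (A := ContinuousLinearMap.id 𝕜 E) (A' := q.π u) (fun a ha x => ?_)
    (q.v_mem t ξ)
  have h1 := congrArg (fun z => q.π z x) (mul_unit hu ha)
  simp only [mul_comm a, map_mul] at h1
  exact h1.symm

end CovRepOn

end

section

variable {𝕜 X S : Type*} [RCLike 𝕜] [TopologicalSpace X] [T2Space X] [InverseSemigroup S]
  {T : TwistedAction 𝕜 X S}

/-! ### Products with the adjoint of a graded representation -/

section Adjoint

variable (T)

theorem TwistedAction.continuousOn_star_u (t : S) :
    ContinuousOn (fun x => star (T.u t⁻¹ t x)) (T.h t⁻¹).target := by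
  have h := (T.continuousOn_u t⁻¹ t).star
  rwa [T.target_inv_mul, ← T.target_inv] at h

theorem TwistedAction.norm_star_u_le (t : S) (x : X) (hx : x ∈ (T.h t⁻¹).target) :
    ‖star (T.u t⁻¹ t x)‖ ≤ 1 := by
  rw [T.target_inv, ← T.target_inv_mul] at hx
  rw [norm_star, T.norm_u _ _ x hx]

/-- The product `a u(t⁻¹, t)^*` for `a ∈ I_{t⁻¹}`. -/
def TwistedAction.starU (t : S) : T.I t⁻¹ →ₗ[𝕜] T.I t⁻¹ where
  toFun := mulUnit (T.h t⁻¹).open_target (fun x => star (T.u t⁻¹ t x))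
    (T.continuousOn_star_u t) (T.norm_star_u_le t)
  map_add' _ _ := Subtype.ext (ZeroAtInftyContinuousMap.ext fun _ => add_mul _ _ _)
  map_smul' _ _ := Subtype.ext (ZeroAtInftyContinuousMap.ext fun _ => mul_assoc _ _ _)

theorem TwistedAction.starU_apply (t : S) (a : T.I t⁻¹) (x : X) :
    (T.starU t a : C₀(X, 𝕜)) x = (a : C₀(X, 𝕜)) x * star (T.u t⁻¹ t x) := rfl

theorem TwistedAction.norm_starU_le (t : S) (a : T.I t⁻¹) : ‖T.starU t a‖ ≤ ‖a‖ :=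
  norm_mulUnit_le (T.h t⁻¹).open_target _ (T.continuousOn_star_u t) (T.norm_star_u_le t) a

/-- The ideal `C₀(X_{t⁻¹})` as the ideal `I` of `t⁻¹`. -/
def TwistedAction.toInv (t : S) (a : T.I' t) : T.I t⁻¹ :=
  C0on.cast _ a fun x hx => a.2 x (by rwa [T.target_inv] at hx)

theorem TwistedAction.coe_toInv (t : S) (a : T.I' t) : (T.toInv t a : C₀(X, 𝕜)) = a := rfl

variable {T} {B : Type*} [NonUnitalNormedRing B] [NormedSpace 𝕜 B] [IsScalarTower 𝕜 B B]
  [SMulCommClass 𝕜 B B] (Ψ : GradedRep T B) {π : BanachRep 𝕜 C₀(X, 𝕜) B}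

/-- Formally this is `(π(a) v_t)(π(b) v_t^*)`: the elements `Ψ_{t⁻¹}(b u(t⁻¹, t)^*)` stand for `π(b)
v_t^*` before `v_t^*` is available. The twists cancel because `u(t⁻¹, t) = u(t, t⁻¹) ∘ h_t`. -/
theorem GradedRep.map_mul_star (hπ : ∀ e, e * e = e → ∀ a : T.I e, π a = Ψ.map e a) {t : S}
    (a : T.I t) (b : T.I' t) :
    Ψ.map t a * Ψ.map t⁻¹ (T.starU t (T.toInv t b)) = π ((a : C₀(X, 𝕜)) * T.α t b) := by
  rw [Ψ.mul, ← hπ _ (mul_inv_self_idem t)]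
  congr 1
  ext x
  rw [ZeroAtInftyContinuousMap.mul_apply]
  by_cases hx : x ∈ (T.h t).target
  · have hx' : x ∈ (T.h (t * t⁻¹)).target := by rwa [T.target_mul_inv]
    have h1 : star (T.u t t⁻¹ x) * T.u t t⁻¹ x = 1 := star_mul_self_of_norm (T.norm_u _ _ x hx')
    rw [T.coeffMul_apply _ _ hx', T.starU_apply, T.u_inv_left hx, T.α_apply _ hx, T.coe_toInv]
    linear_combination (a : C₀(X, 𝕜)) x * (b : C₀(X, 𝕜)) ((T.h t).symm x) * h1
  · have hx' : x ∉ (T.h (t * t⁻¹)).target := by rwa [T.target_mul_inv]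
    rw [(T.coeffMul t t⁻¹ a _).2 x hx', a.2 x hx, zero_mul]

theorem GradedRep.star_mul_map (hπ : ∀ e, e * e = e → ∀ a : T.I e, π a = Ψ.map e a) {t : S}
    (a : T.I t⁻¹) (b : T.I' t) :
    Ψ.map t⁻¹ (T.starU t a) * Ψ.map t (T.α t b) = π ((a : C₀(X, 𝕜)) * b) := by
  rw [Ψ.mul, ← hπ _ (inv_mul_self_idem t)]
  congr 1
  ext x
  rw [ZeroAtInftyContinuousMap.mul_apply]
  by_cases hx : x ∈ (T.h t).source
  · have hx' : x ∈ (T.h (t⁻¹ * t)).target := by rwa [T.target_inv_mul]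
    have h1 : star (T.u t⁻¹ t x) * T.u t⁻¹ t x = 1 := star_mul_self_of_norm (T.norm_u _ _ x hx')
    rw [T.coeffMul_apply _ _ hx', T.starU_apply, T.symm_inv_apply hx,
      T.α_apply _ ((T.h t).map_source hx), (T.h t).left_inv hx]
    linear_combination (a : C₀(X, 𝕜)) x * (b : C₀(X, 𝕜)) x * h1
  · have hx' : x ∉ (T.h (t⁻¹ * t)).target := by rwa [T.target_inv_mul]
    rw [(T.coeffMul t⁻¹ t _ _).2 x hx', b.2 x hx, mul_zero]

theorem GradedRep.star_mul_pi (hπ : ∀ e, e * e = e → ∀ a : T.I e, π a = Ψ.map e a) {t : S}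
    (a : T.I t⁻¹) (b : T.I' t) :
    Ψ.map t⁻¹ (T.starU t a) * π (T.α t b) = Ψ.map t⁻¹ (T.starU t (cmul a (T.toInv t b))) := by
  have h1 : (T.α t b : C₀(X, 𝕜)) ∈ T.I' t⁻¹ := fun x hx =>
    (T.α t b).2 x (by rwa [T.source_inv] at hx)
  have h2 := Ψ.map_mul_pi hπ (T.starU t a) ⟨_, h1⟩
  refine h2.trans (congrArg _ (T.I_ext fun x hx => ?_))
  have hx' : x ∈ (T.h t).source := by rwa [T.target_inv] at hx
  rw [cmul_apply, T.α_apply _ hx, T.starU_apply, T.starU_apply, cmul_apply, T.coe_toInv]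
  change _ * (T.α t b : C₀(X, 𝕜)) _ = _
  rw [T.symm_inv_apply hx', T.α_apply _ ((T.h t).map_source hx'), (T.h t).left_inv hx']
  ring

end Adjoint

/-! ### The covariant representation on a Banach space defined by a graded representation -/

variable {E : Type*} [NormedAddCommGroup E] [NormedSpace 𝕜 E]

open Classical in
/-- The extension by zero of a map on an ideal of `C₀(X)`. -/
def zeroExtend {J : Submodule 𝕜 C₀(X, 𝕜)} {F : Type*} [Zero F] (R : J → F) (a : C₀(X, 𝕜)) : F :=
  if h : a ∈ J then R ⟨a, h⟩ else 0

theorem zeroExtend_of_mem {J : Submodule 𝕜 C₀(X, 𝕜)} {F : Type*} [Zero F] (R : J → F)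
    {a : C₀(X, 𝕜)} (h : a ∈ J) : zeroExtend R a = R ⟨a, h⟩ := dif_pos h

variable (T E) in
/-- Contractions on `E` indexed by suitable approximate units of the ideals `I_t` have weak
limits. -/
def HasWeakLimits : Prop := ∀ t : S, ∃ l, IsApproxUnit (T.I t) l ∧
  ∀ R : C₀(X, 𝕜) → E →L[𝕜] E, (∀ᶠ μ in l, ‖R μ‖ ≤ 1) →
    ∃ V : E →L[𝕜] E, ‖V‖ ≤ 1 ∧ WeakOpTendsto R l V

theorem hasWeakLimits_of_reflexive [LocallyCompactSpace X] (hE : IsReflexive 𝕜 E) :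
    HasWeakLimits T E := fun t => by
  obtain ⟨l, hl⟩ := exists_ultra_approxUnit (𝕜 := 𝕜) (T.h t).open_target
  exact ⟨l, hl, fun R hR => exists_weakOpLimit hE l hR⟩

/-- No compactness of balls of operators is needed: the constant net `1_{X_t}` is an approximate
unit, and every limit along it is a value. -/
theorem hasWeakLimits_of_compact [LocallyCompactSpace X] (hc : ∀ t, IsCompact (T.h t).target) :
    HasWeakLimits T E := fun t => by
  obtain ⟨q, hq, -⟩ := exists_unit (hc t)
  refine ⟨pure q, isApproxUnit_pure hq, fun R hR => ⟨R q, hR, WeakOpTendsto.of_tendsto ?_⟩⟩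
  rw [Filter.tendsto_pure_left]
  exact fun s hs => mem_of_mem_nhds hs

/-- All products of the limit operators with elements of the graded pieces are computed in this way:
the weak limit of `A R₀(μ) A'` is `A V A'`, and the same net, being `R₁(μ a)`, converges in norm to
`R₁(a)`. -/
theorem IsApproxUnit.weakLimit_eq {U : Set X} {l : Filter C₀(X, 𝕜)}
    (hl : IsApproxUnit (C0on 𝕜 U) l) {R₀ : C0on 𝕜 U → E →L[𝕜] E} {V : E →L[𝕜] E}
    (hV : WeakOpTendsto (zeroExtend R₀) l V) (A A' : E →L[𝕜] E)
    (R₁ : C0on 𝕜 U →ₗ[𝕜] E →L[𝕜] E) (hR₁ : ∀ a, ‖R₁ a‖ ≤ ‖a‖) (a : C0on 𝕜 U)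
    (h : ∀ μ : C0on 𝕜 U, A * R₀ μ * A' = R₁ (cmul μ a)) : A * V * A' = R₁ a := by
  have := hl.neBot
  refine ((hV.mul_left A).mul_right A').unique (WeakOpTendsto.congr' (WeakOpTendsto.of_tendsto
    (R := fun μ => R₁ (cmul μ a)) ?_) ?_)
  · rw [tendsto_iff_norm_sub_tendsto_zero]
    refine squeeze_zero (fun _ => norm_nonneg _) (fun μ => ?_)
      (tendsto_iff_norm_sub_tendsto_zero.1 (hl.tendsto a a.2))
    rw [← map_sub]
    exact hR₁ _
  · filter_upwards [hl.mem] with μ hμ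
    rw [zeroExtend_of_mem R₀ hμ.1, h ⟨μ, hμ.1⟩]

namespace GradedRep

variable (Ψ : GradedRep T (E →L[𝕜] E)) {π : BanachRep 𝕜 C₀(X, 𝕜) (E →L[𝕜] E)}

/-- `Ψ_t(a) ξ` is in the closed span of `π(I_t) E`. -/
theorem map_mem [LocallyCompactSpace X] (hπ : ∀ e, e * e = e → ∀ a : T.I e, π a = Ψ.map e a)
    {t : S} (a : T.I t) (ξ : E) : Ψ.map t a ξ ∈ essSubspace π (T.I t) := by
  obtain ⟨l, hl⟩ := exists_isApproxUnit (𝕜 := 𝕜) (T.h t).open_target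
  have := hl.neBot
  have h1 : Filter.Tendsto (fun μ => Ψ.map t (cmul μ a) ξ) l (𝓝 (Ψ.map t a ξ)) :=
    ((ContinuousLinearMap.apply 𝕜 E ξ).continuous.tendsto _).comp (Ψ.tendsto_map hl a)
  refine isClosed_essSubspace.mem_of_tendsto h1 ?_
  filter_upwards [hl.mem] with μ hμ
  have h2 := Ψ.pi_mul_map hπ ⟨μ, hμ.1⟩ a
  change _ ∈ essSubspace π (T.I t)
  rw [← show π μ * Ψ.map t a = Ψ.map t (cmul μ a) from h2]
  exact mem_essSubspace π hμ.1 _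

/-- A graded representation in `B(E)` is defined by a covariant representation on `E`, if `E` has
enough weak limits. -/
theorem exists_covRepOn [LocallyCompactSpace X] [CompleteSpace E] (hT : T.AbsorbsCompacts)
    (hE : HasWeakLimits T E) : ∃ q : CovRepOn T E, Ψ.Matches q.toCovRep := by
  obtain ⟨π, hπ⟩ := Ψ.exists_pi hT
  choose l hl hlim using hE
  have hne := fun t => (hl t).neBot
  have hlim' : ∀ t (R : T.I t → E →L[𝕜] E), (∀ a, ‖R a‖ ≤ ‖a‖) →
      ∃ V : E →L[𝕜] E, ‖V‖ ≤ 1 ∧ WeakOpTendsto (zeroExtend R) (l t) V := fun t R hR => by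
    refine hlim t _ ?_
    filter_upwards [(hl t).mem] with μ hμ
    rw [zeroExtend_of_mem R hμ.1]
    exact (hR _).trans hμ.2
  have hpi : ∀ t (a : T.I t), ‖(π.toHom : C₀(X, 𝕜) →ₗ[𝕜] E →L[𝕜] E).comp (T.I t).subtype a‖ ≤ ‖a‖ :=
    fun t a => π.contractive a
  -- `v t` is the weak limit of `Ψ_t(μ)`; below, `w t` is that of `Ψ_{t⁻¹}(μ u(t⁻¹, t)^*)`, the
  -- future generalised inverse of `v t`.
  choose v hv hvl using fun t => hlim' t (Ψ.map t) (Ψ.norm_le t)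
  have hstar : ∀ t (a : T.I t⁻¹), ‖(Ψ.map t⁻¹).comp (T.starU t) a‖ ≤ ‖a‖ := fun t a =>
    (Ψ.norm_le _ _).trans (T.norm_starU_le t a)
  choose w hw hwl using fun t => hlim' t⁻¹ ((Ψ.map t⁻¹).comp (T.starU t)) (hstar t)
  have hI' : ∀ t, T.I t⁻¹ = T.I' t := fun t => by
    change C0on 𝕜 _ = C0on 𝕜 _
    rw [T.target_inv]
  -- products of `v`, `w` with elements of the graded pieces
  have hpv : ∀ t (a : T.I t), π a * v t = Ψ.map t a := fun t a => by
    have h := (hl t).weakLimit_eq (hvl t) (π a) 1 (Ψ.map t) (Ψ.norm_le t) a fun μ => by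
      rw [mul_one, Ψ.pi_mul_map hπ]
      exact congrArg (fun z => Ψ.map t z) (Subtype.ext (mul_comm (a : C₀(X, 𝕜)) μ))
    rwa [mul_one] at h
  have hvs : ∀ t (b : T.I' t), v t * Ψ.map t⁻¹ (T.starU t (T.toInv t b)) = π (T.α t b) := by
    intro t b
    have h := (hl t).weakLimit_eq (hvl t) 1 (Ψ.map t⁻¹ (T.starU t (T.toInv t b)))
      ((π.toHom : C₀(X, 𝕜) →ₗ[𝕜] E →L[𝕜] E).comp (T.I t).subtype) (hpi t) (T.α t b) fun μ => by
        rw [one_mul, Ψ.map_mul_star hπ]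
        rfl
    rwa [one_mul] at h
  have hpw : ∀ t (b : T.I' t), π b * w t = Ψ.map t⁻¹ (T.starU t (T.toInv t b)) := by
    intro t b
    have h := (hl t⁻¹).weakLimit_eq (hwl t) (π b) 1 ((Ψ.map t⁻¹).comp (T.starU t)) (hstar t)
      (T.toInv t b) fun μ => by
        rw [mul_one]
        refine (Ψ.pi_mul_map hπ (T.toInv t b) (T.starU t μ)).trans ?_
        refine congrArg (fun z => Ψ.map t⁻¹ z) (Subtype.ext (ZeroAtInftyContinuousMap.ext fun x => ?_))
        simp only [cmul_apply, T.starU_apply, T.coe_toInv]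
        ring
    rwa [mul_one] at h
  have hws : ∀ t (b : T.I' t), w t * Ψ.map t (T.α t b) = π b := by
    intro t b
    have h := (hl t⁻¹).weakLimit_eq (hwl t) 1 (Ψ.map t (T.α t b))
      ((π.toHom : C₀(X, 𝕜) →ₗ[𝕜] E →L[𝕜] E).comp (T.I t⁻¹).subtype) (hpi t⁻¹) (T.toInv t b)
      fun μ => by
        rw [one_mul]
        exact Ψ.star_mul_map hπ μ b
    rwa [one_mul] at h
  have hwp : ∀ t (b : T.I' t), w t * π (T.α t b) = Ψ.map t⁻¹ (T.starU t (T.toInv t b)) := by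
    intro t b
    have h := (hl t⁻¹).weakLimit_eq (hwl t) 1 (π (T.α t b)) ((Ψ.map t⁻¹).comp (T.starU t)) (hstar t)
      (T.toInv t b) fun μ => by
        rw [one_mul]
        exact Ψ.star_mul_pi hπ μ b
    rwa [one_mul] at h
  have hvp : ∀ t (b : T.I' t), v t * π b = Ψ.map t (T.α t b) := by
    intro t b
    have h := (hl t).weakLimit_eq (hvl t) 1 (π b) (Ψ.map t) (Ψ.norm_le t) (T.α t b) fun μ => by
        rw [one_mul]
        exact Ψ.map_mul_pi hπ μ b
    rwa [one_mul] at h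
  -- ranges
  have hvm : ∀ t ξ, v t ξ ∈ essSubspace π (T.I t) := fun t ξ => by
    refine (hvl t).apply_mem isClosed_essSubspace ?_
    filter_upwards [(hl t).mem] with μ hμ
    rw [zeroExtend_of_mem _ hμ.1]
    exact Ψ.map_mem hπ _ ξ
  have hwm : ∀ t ξ, w t ξ ∈ essSubspace π (T.I' t) := fun t ξ => by
    rw [← hI' t]
    refine (hwl t).apply_mem isClosed_essSubspace ?_
    filter_upwards [(hl t⁻¹).mem] with μ hμ
    rw [zeroExtend_of_mem _ hμ.1]
    exact Ψ.map_mem hπ _ ξ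
  -- On the generating vectors, `v w π(α_t(b)) = v Ψ_{t⁻¹}(b u(t⁻¹, t)^*) = π(α_t(b))`, and `α_t` is
  -- onto `I_t`.
  have hvw : ∀ t, ∀ ζ ∈ essSubspace π (T.I t), v t (w t ζ) = ζ := fun t ζ hζ => by
    refine eq_on_essSubspace (A := v t * w t) (A' := ContinuousLinearMap.id 𝕜 E) ?_ hζ
    intro a ha x
    have h1 := T.α_αinv t ⟨a, ha⟩
    have h2 : v t * w t * π (T.α t (T.αinv t ⟨a, ha⟩)) = π (T.α t (T.αinv t ⟨a, ha⟩)) := by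
      rw [mul_assoc, hwp, hvs]
    rw [h1] at h2
    exact congrArg (fun z : E →L[𝕜] E => z x) h2
  have hwv : ∀ t, ∀ ζ ∈ essSubspace π (T.I' t), w t (v t ζ) = ζ := fun t ζ hζ => by
    refine eq_on_essSubspace (A := w t * v t) (A' := ContinuousLinearMap.id 𝕜 E) ?_ hζ
    intro a ha x
    have h2 : w t * v t * π a = π a := by
      rw [mul_assoc, hvp t ⟨a, ha⟩, hws]
    exact congrArg (fun z : E →L[𝕜] E => z x) h2
  have hmul : ∀ s t, ∃ M : essSubspace π (T.I (s * t)) →L[𝕜] essSubspace π (T.I (s * t)),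
      (∀ (a : T.I (s * t)) (x : E),
        (M ⟨π a x, mem_essSubspace π a.2 x⟩ : E) = π (T.mulU s t a) x) ∧
      ∀ ξ, ∃ hξ : v (s * t) ξ ∈ essSubspace π (T.I (s * t)),
        v s (v t ξ) = M ⟨v (s * t) ξ, hξ⟩ := by
    intro s t
    -- A multiplier `u(s, t)` of `I_{st}` acts as the weak limit `N` of `π(μ u(s, t))`. The required
    -- operator `M` is the restriction of `N` to the closed span of `π(I_{st}) E`.
    obtain ⟨N, -, hNl⟩ := hlim' (s * t) (fun a => π (T.mulU s t a)) fun a =>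
      (π.contractive _).trans (norm_mulUnit_le (T.h (s * t)).open_target (T.u s t)
        (T.continuousOn_u s t) (fun x hx => (T.norm_u s t x hx).le) a)
    have hmulU : ∀ a b : T.I (s * t),
        π (T.mulU s t a) * π b = π (T.mulU s t b) * π a := fun a b => by
      rw [← map_mul, ← map_mul]
      congr 1
      ext x
      simp only [ZeroAtInftyContinuousMap.mul_apply, T.mulU_apply]
      ring
    have hNp : ∀ a : T.I (s * t), N * π a = π (T.mulU s t a) := fun a => by
      have h := (hl (s * t)).weakLimit_eq hNl 1 (π a)
        ((π.toHom : C₀(X, 𝕜) →ₗ[𝕜] E →L[𝕜] E).comp (T.I (s * t)).subtype) (hpi _)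
        (T.mulU s t a) fun μ => by
          rw [one_mul, hmulU, ← map_mul, mul_comm]
          rfl
      rwa [one_mul] at h
    have hNm : ∀ ζ ∈ essSubspace π (T.I (s * t)), N ζ ∈ essSubspace π (T.I (s * t)) := by
      have h1 : essSubspace π (T.I (s * t))
          ≤ (essSubspace π (T.I (s * t))).comap N.toLinearMap :=
        essSubspace_le (isClosed_essSubspace.preimage N.continuous) fun a ha x => by
          have h2 := congrArg (fun z : E →L[𝕜] E => z x) (hNp ⟨a, ha⟩)
          change N (π a x) ∈ essSubspace π (T.I (s * t))
          rw [show N (π a x) = π (T.mulU s t ⟨a, ha⟩) x from h2]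
          exact mem_essSubspace π (T.mulU s t ⟨a, ha⟩).2 x
      exact h1
    -- `v_s v_t` is an iterated weak limit of `Ψ_s(μ) Ψ_t(ν)`, and these products take values in a
    -- closed subspace.
    have hvv : ∀ ξ, v s (v t ξ) ∈ essSubspace π (T.I (s * t)) := by
      intro ξ
      refine ((hvl t).mul_left (v s)).apply_mem isClosed_essSubspace (ξ := ξ) ?_
      filter_upwards [(hl t).mem] with ν hν
      rw [zeroExtend_of_mem _ hν.1]
      refine ((hvl s).mul_right _).apply_mem isClosed_essSubspace (ξ := ξ) ?_
      filter_upwards [(hl s).mem] with μ hμ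
      rw [zeroExtend_of_mem _ hμ.1, Ψ.mul]
      exact Ψ.map_mem hπ _ ξ
    refine ⟨(N.comp (essSubspace π (T.I (s * t))).subtypeL).codRestrict _ fun ζ => hNm _ ζ.2,
      fun a x => congrArg (fun z : E →L[𝕜] E => z x) (hNp a), fun ξ => ⟨hvm _ ξ, ?_⟩⟩
    change v s (v t ξ) = N (v (s * t) ξ)
    -- Both vectors lie in the closed span of `π(I_{st}) E`, so it suffices to compare them under
    -- `π(a)`, `a ∈ I_{st}`. That comparison is `map_arens`, read in `B(E)` through the embedding
    -- into its bidual.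
    refine essSubspace_ext (hl (s * t)) (hvv ξ) (hNm _ (hvm _ ξ)) fun a ha => ?_
    have h1 : (a : C₀(X, 𝕜)) ∈ T.I s := fun x hx => ha x fun hx' => hx (T.mem_target_mul.1 hx').1
    have h2 := Ψ.map_arens hπ ((norm_toBidual_le (𝕜 := 𝕜) (v t)).trans (hv t)) s t
      (fun a => by rw [arens_toBidual, hpv]) ⟨a, ha⟩ ⟨a, h1⟩ rfl
    rw [arens_toBidual] at h2
    have h3 : π a * v s * v t = π (T.mulU s t ⟨a, ha⟩) * v (s * t) := by
      rw [hpv s ⟨a, h1⟩, hpv (s * t)]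
      exact toBidual_injective (𝕜 := 𝕜) h2
    have h4 : π a (N (v (s * t) ξ)) = π (T.mulU s t ⟨a, ha⟩) (v (s * t) ξ) := by
      refine eq_on_essSubspace (A := π a * N) (fun b hb x => ?_) (hvm _ ξ)
      have h5 : π a * (N * π b) = π (T.mulU s t ⟨a, ha⟩) * π b := by
        rw [hNp ⟨b, hb⟩, hmulU ⟨a, ha⟩ ⟨b, hb⟩, ← map_mul, ← map_mul, mul_comm]
      exact congrArg (fun z : E →L[𝕜] E => z x) h5
    exact (congrArg (fun z : E →L[𝕜] E => z ξ) h3).trans h4.symm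
  have hcov : ∀ t, v t * w t * v t = v t ∧ w t * v t * w t = w t ∧
      (∀ a : T.I' t, v t * π a * w t = π (T.α t a)) ∧
      Set.range (v t) = essSubspace π (T.I t) ∧ Set.range (w t) = essSubspace π (T.I' t) := by
    intro t
    refine ⟨ContinuousLinearMap.ext fun ξ => hvw t _ (hvm t ξ),
      ContinuousLinearMap.ext fun ξ => hwv t _ (hwm t ξ), fun a => ?_, ?_, ?_⟩
    · rw [mul_assoc, hpw, hvs]
    · exact Set.Subset.antisymm (Set.range_subset_iff.2 (hvm t)) fun ζ hζ => ⟨_, hvw t ζ hζ⟩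
    · exact Set.Subset.antisymm (Set.range_subset_iff.2 (hwm t)) fun ζ hζ => ⟨_, hwv t ζ hζ⟩
  let q : CovRepOn T E :=
    { π := π
      v := v
      norm_v := hv
      cov := fun t => ⟨w t, hw t, hcov t⟩
      idem := fun e he a => by rw [hpv, hπ e he]
      mul := hmul }
  exact ⟨q, CovRepOn.matches_iff.2 hpv⟩

end GradedRep

/-- For the converse, the graded representation of `p` also comes from some `q` on `E`. Both `p` and
`q.toCovRep` are normalized since the `X_t` are compact, so they coincide by uniqueness. -/
theorem CovRepOn.exists_isCov_iff [LocallyCompactSpace X] [CompleteSpace E]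
    (hT : T.AbsorbsCompacts) (hc : ∀ t, IsCompact (T.h t).target) (p : CovRep T (E →L[𝕜] E)) :
    (∃ q : CovRepOn T E, q.IsCov p) ↔ p.IsUnitNormalized := by
  constructor
  · rintro ⟨q, hq⟩
    rw [hq.eq]
    exact isUnitNormalized hc
  · intro hp
    obtain ⟨Ψ, hΨ⟩ := p.exists_gradedRep
    obtain ⟨q, hq⟩ := Ψ.exists_covRepOn hT (hasWeakLimits_of_compact hc)
    refine ⟨q, ?_⟩
    rw [((CovRep.isNormalized_iff hc p).2 hp).unique hT
      ((CovRep.isNormalized_iff hc _).2 (isUnitNormalized hc)) hΨ hq]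
    exact q.isCov_toCovRep

end

section

/-! ### Crossed products -/

section Crossed

variable {𝕜 X S : Type*} [RCLike 𝕜] [TopologicalSpace X] [T2Space X] [InverseSemigroup S]
  {T : TwistedAction 𝕜 X S}

theorem crossedSeminorm_le (R : Set (SomeCovRep T)) (f : T.ell1) :
    (crossedSeminorm R).toSeminorm f ≤ ‖f‖ := by
  rw [crossedSeminorm_apply]
  refine Real.sSup_le ?_ (norm_nonneg f)
  rintro _ ⟨q, -, rfl⟩
  exact q.2.norm_integrate_le f

theorem le_crossedSeminorm {R : Set (SomeCovRep T)} {q : SomeCovRep T} (hq : q ∈ R) (f : T.ell1) :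
    ‖q.2.integrate f‖ ≤ (crossedSeminorm R).toSeminorm f := by
  rw [crossedSeminorm_apply]
  refine le_csSup ⟨‖f‖, ?_⟩ ⟨q, hq, rfl⟩
  rintro _ ⟨q, -, rfl⟩
  exact q.2.norm_integrate_le f

theorem crossedSeminorm_mono {R R' : Set (SomeCovRep T)}
    (h : ∀ q ∈ R, ∃ q' ∈ R', ∀ f, ‖q.2.integrate f‖ = ‖q'.2.integrate f‖) (f : T.ell1) :
    (crossedSeminorm R).toSeminorm f ≤ (crossedSeminorm R').toSeminorm f := by
  rw [crossedSeminorm_apply R]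
  refine Real.sSup_le ?_ (apply_nonneg _ _)
  rintro _ ⟨q, hq, rfl⟩
  obtain ⟨q', hq', h'⟩ := h q hq
  exact (h' f).trans_le (le_crossedSeminorm hq' f)

theorem CovRep.integrate_congr {B : Type*} [NonUnitalNormedRing B] [NormedSpace 𝕜 B]
    [IsScalarTower 𝕜 B B] [SMulCommClass 𝕜 B B] {p p' : CovRep T B} {Ψ : GradedRep T B}
    (h : Ψ.Matches p) (h' : Ψ.Matches p') (f : T.ell1) : p.integrate f = p'.integrate f :=
  tsum_congr fun t => (h t _).symm.trans (h' t _)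

/-- The graded representation `a ↦ a δ_t` in the crossed product. -/
def crossedRep (R : Set (SomeCovRep T)) : GradedRep T (CrossedProduct R) where
  map t := (crossedSeminorm R).toCompl.comp (T.gradedMul.single t)
  norm_le t a := by
    rw [LinearMap.comp_apply, AlgSeminorm.norm_toCompl]
    exact (crossedSeminorm_le R _).trans_eq (T.gradedMul.norm_single t a)
  restrict s t hst a b ha hb := by
    rw [LinearMap.comp_apply, LinearMap.comp_apply, ← sub_eq_zero, ← map_sub, ← norm_eq_zero,
      AlgSeminorm.norm_toCompl]
    refine le_antisymm ?_ (apply_nonneg _ _)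
    -- Every covariant representation in the class takes the same value at `a δ_t` and `b δ_s`, so
    -- their difference has seminorm zero, although it need not vanish in `ℓ¹(α, u)`.
    rw [crossedSeminorm_apply]
    refine Real.sSup_le ?_ le_rfl
    rintro _ ⟨q, -, rfl⟩
    obtain ⟨Ψ, hΨ⟩ := q.2.exists_gradedRep
    have h1 : q.2.integrateHom (T.gradedMul.single t a - T.gradedMul.single s b) = 0 := by
      rw [map_sub, sub_eq_zero]
      refine (q.2.integrate_single t a).trans (Eq.trans ?_ (q.2.integrate_single s b).symm)
      rw [← hΨ, ← hΨ, Ψ.restrict s t hst a b ha hb]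
    exact (norm_eq_zero.2 h1).le
  mul s t a b := by
    simp only [LinearMap.comp_apply]
    rw [← AlgSeminorm.toCompl_mul, T.gradedMul.single_mul_single]
    rfl

/-- The closure of `N` contains `a δ_t` for all `a ∈ I_t` by cutoff, then all of `ℓ¹(α, u)` by
summation of the series, and this has dense image. -/
theorem dense_crossedProduct [LocallyCompactSpace X] (R : Set (SomeCovRep T))
    (N : Submodule 𝕜 (CrossedProduct R))
    (hN : ∀ t (a : T.Ic t), (crossedSeminorm R).toCompl (T.gradedMul.single t a.1) ∈ N) :
    Dense (N : Set (CrossedProduct R)) := by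
  have h1 : ∀ t (a : T.I t),
      (crossedSeminorm R).toCompl (T.gradedMul.single t a) ∈ N.topologicalClosure := by
    intro t a
    refine Metric.mem_closure_iff.2 fun ε hε => ?_
    obtain ⟨b, hb, hba⟩ := exists_CcOn_approx (T.h t).open_target a (half_pos hε)
    refine ⟨_, hN t ⟨b, hb⟩, ?_⟩
    rw [dist_comm, dist_eq_norm]
    change ‖(crossedRep R).map t b - (crossedRep R).map t a‖ < ε
    rw [← map_sub]
    exact (((crossedRep R).norm_le t _).trans hba).trans_lt (half_lt_self hε)
  have h2 : ∀ f : T.ell1, (crossedSeminorm R).toCompl f ∈ N.topologicalClosure := by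
    intro f
    have hc : Continuous (crossedSeminorm R).toCompl :=
      AddMonoidHomClass.continuous_of_bound _ 1 fun f => by
        rw [one_mul, AlgSeminorm.norm_toCompl]; exact crossedSeminorm_le R f
    have h3 := (T.gradedMul.hasSum_single f).map (crossedSeminorm R).toCompl hc
    exact N.isClosed_topologicalClosure.mem_of_tendsto h3
      (Filter.Eventually.of_forall fun s => sum_mem fun t _ => h1 t _)
  have h3 := (crossedSeminorm R).denseRange_toCompl.mono (Set.range_subset_iff.2 h2)
  rw [dense_iff_closure_eq] at h3 ⊢
  rwa [N.isClosed_topologicalClosure.closure_eq] at h3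

theorem spaClass_subset_algClass (𝓔 : Set (BanachSp 𝕜)) : spaClass T 𝓔 ⊆ algClass T 𝓔 := by
  rintro _ ⟨E, hE, p, rfl, -⟩
  exact ⟨E, hE, p, rfl⟩

/-- The graded representation of a pair in `B(E)` also comes from a pair on `E`, and integrated
forms depend only on the graded representation. -/
theorem exists_spaClass [LocallyCompactSpace X] (hT : T.AbsorbsCompacts) {𝓔 : Set (BanachSp 𝕜)}
    (h𝓔 : ∀ E ∈ 𝓔, HasWeakLimits T E.carrier) {r : SomeCovRep T} (hr : r ∈ algClass T 𝓔) :
    ∃ r' ∈ spaClass T 𝓔, ∀ f, ‖r.2.integrate f‖ = ‖r'.2.integrate f‖ := by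
  obtain ⟨E, hE, p, rfl⟩ := hr
  obtain ⟨Ψ, hΨ⟩ := p.exists_gradedRep
  obtain ⟨q, hq⟩ := GradedRep.exists_covRepOn (E := E.carrier) Ψ hT (h𝓔 E hE)
  exact ⟨⟨E.operators, q.toCovRep⟩, ⟨E, hE, q.toCovRep, rfl, q, q.isCov_toCovRep⟩,
    fun f => congrArg norm (CovRep.integrate_congr hΨ hq f)⟩

/-- The representation of the crossed product for all covariant representations in `B(E)` in that
for the covariant representations on `E`, for `E ∈ 𝓔`. -/
theorem exists_algClass_to_spaClass [LocallyCompactSpace X] (hT : T.AbsorbsCompacts)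
    (𝓔 : Set (BanachSp 𝕜)) :
    ∃ Λ : BanachRep 𝕜 (CrossedProduct (algClass T 𝓔)) (CrossedProduct (spaClass T 𝓔)),
      DenseRange Λ ∧
      (∀ f : T.ell1, Λ ((crossedSeminorm (algClass T 𝓔)).toCompl f)
        = (crossedSeminorm (spaClass T 𝓔)).toCompl f) ∧
      ((∀ E ∈ 𝓔, HasWeakLimits T E.carrier) → ∀ f, ‖Λ f‖ = ‖f‖) := by
  have hle := crossedSeminorm_mono (T := T) (R := spaClass T 𝓔) (R' := algClass T 𝓔)
    fun q hq => ⟨q, spaClass_subset_algClass 𝓔 hq, fun _ => rfl⟩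
  obtain ⟨Λ, hΛ⟩ := (crossedSeminorm (algClass T 𝓔)).exists_rep
    (crossedSeminorm (spaClass T 𝓔)).toCompl (AlgSeminorm.toCompl_mul _) fun f => by
      rw [AlgSeminorm.norm_toCompl]; exact hle f
  refine ⟨Λ, (crossedSeminorm (spaClass T 𝓔)).denseRange_toCompl.mono ?_, hΛ,
    fun h => AlgSeminorm.norm_rep fun f => ?_⟩
  · rintro _ ⟨f, rfl⟩
    exact ⟨_, hΛ f⟩
  · rw [hΛ, AlgSeminorm.norm_toCompl]
    exact le_antisymm (hle f) (crossedSeminorm_mono (fun q hq => exists_spaClass hT h hq) f)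

end Crossed

/-! ### The integrated forms of covariant representations -/

namespace Models

universe v

open Bundle (TotalSpace)

variable {𝕜 X S Y G : Type*} [RCLike 𝕜] [TopologicalSpace X] [T2Space X]
  [InverseSemigroup S] [TopologicalSpace Y] [TopologicalSpace G] {T : TwistedAction 𝕜 X S}
  {𝓖 : EtaleGroupoid Y G} {L : G → Type*} [∀ γ, NormedAddCommGroup (L γ)]
  [∀ γ, NormedSpace 𝕜 (L γ)] [TopologicalSpace (TotalSpace 𝕜 L)] {𝓛 : Twist 𝕜 𝓖 L}
  (M : Models T 𝓛)
  [LocallyCompactSpace X] [T2Space Y] [LocallyCompactSpace Y]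

section Rep

variable {B : Type*} [NonUnitalNormedRing B] [NormedSpace 𝕜 B] [IsScalarTower 𝕜 B B]
  [SMulCommClass 𝕜 B B]

/-- `Integrates` tests only compactly supported `a`; the equality passes to all of `I_t` by density.
-/
theorem integrates_iff {Ψ : GradedRep T B} {ψ : BanachRep 𝕜 M.FS B}
    (h : ∀ t (a : T.Ic t), ψ (M.toFS (M.delta t a)) = Ψ.map t a) {p : CovRep T B} :
    M.Integrates p ψ ↔ Ψ.Matches p := by
  refine ⟨fun hp t a => ?_, fun hp t a => by rw [h, hp]⟩
  let g : C0on 𝕜 (T.h t).target →ₗ[𝕜] Bidual 𝕜 B :=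
    { toFun := fun a => p.elt t a
      map_add' := fun a b => p.elt_add t a b
      map_smul' := fun c a => p.elt_smul t c a }
  refine C0on_dense (C := 1) (T.h t).open_target (f := (toBidual 𝕜).comp (Ψ.map t)) (g := g)
    (fun a => ?_) (fun a => ?_) (fun a ha => ?_) a
  · rw [one_mul, LinearMap.comp_apply, norm_toBidual]
    exact Ψ.norm_le t a
  · rw [one_mul]
    exact p.norm_elt_le t a
  · have h1 := hp t ⟨a, ha⟩
    rw [h] at h1
    exact h1

variable [CompleteSpace B]

theorem existsUnique_integrates (p : CovRep T B) : ∃! ψ : BanachRep 𝕜 M.FS B, M.Integrates p ψ := by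
  obtain ⟨Ψ, hΨ⟩ := p.exists_gradedRep
  obtain ⟨ψ, hψ, huniq⟩ := M.existsUnique_rep Ψ
  refine ⟨ψ, (M.integrates_iff hψ).2 hΨ, fun ψ' hψ' => huniq ψ' fun t a => ?_⟩
  apply toBidual_injective (𝕜 := 𝕜)
  rw [hψ' t a, hΨ]

theorem exists_integrates_iff (ψ : BanachRep 𝕜 M.FS B) :
    ∃ Ψ : GradedRep T B, ∀ p : CovRep T B, M.Integrates p ψ ↔ Ψ.Matches p := by
  obtain ⟨Ψ, hΨ⟩ := M.exists_gradedRep ψ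
  exact ⟨Ψ, fun p => M.integrates_iff fun t a => (hΨ t a).symm⟩

theorem existsUnique_normalized (hT : T.AbsorbsCompacts) (ψ : BanachRep 𝕜 M.FS B) :
    ∃! p : CovRep T B, p.IsNormalized ∧ M.Integrates p ψ := by
  obtain ⟨Ψ, hΨ⟩ := M.exists_integrates_iff ψ
  simp only [hΨ]
  exact Ψ.existsUnique_normalized hT

theorem existsUnique_predualNormalized (hT : T.AbsorbsCompacts) {P : Type*}
    [NormedAddCommGroup P] [NormedSpace 𝕜 P] {e : StrongDual 𝕜 P ≃ₗᵢ[𝕜] B}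
    (he : IsDualBanachAlgebra e) (ψ : BanachRep 𝕜 M.FS B) :
    ∃! p : CovRep T B, p.IsPredualNormalized e ∧ M.Integrates p ψ := by
  obtain ⟨Ψ, hΨ⟩ := M.exists_integrates_iff ψ
  simp only [hΨ]
  exact Ψ.existsUnique_predualNormalized hT he

end Rep

/-- Weak limits are needed only for existence; uniqueness follows from the range conditions and
holds on every Banach space. -/
theorem existsUnique_covRepOn (hT : T.AbsorbsCompacts) {E : Type*} [NormedAddCommGroup E]
    [NormedSpace 𝕜 E] [CompleteSpace E] (hE : HasWeakLimits T E)
    (ψ : BanachRep 𝕜 M.FS (E →L[𝕜] E)) :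
    ∃! q : CovRepOn T E, ∃ p, q.IsCov p ∧ M.Integrates p ψ := by
  obtain ⟨Ψ, hΨ⟩ := M.exists_integrates_iff ψ
  obtain ⟨q, hq⟩ := Ψ.exists_covRepOn hT hE
  refine ⟨q, ⟨q.toCovRep, q.isCov_toCovRep, (hΨ _).2 hq⟩, ?_⟩
  rintro q' ⟨p, hp, hψ⟩
  rw [hp.eq, hΨ] at hψ
  exact CovRepOn.unique_of_matches hT hψ hq

/-- The homomorphism `a δ_t ↦ a δ_t` into a crossed product, and the integrated forms of covariant
representations at its values. -/
theorem exists_toCrossedProduct (R : Set (SomeCovRep T)) : ∃ J : 𝓛.Alg →ₗ[𝕜] CrossedProduct R,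
    (∀ t (a : T.Ic t),
      J (M.delta t a) = (crossedSeminorm R).toCompl (T.gradedMul.single t a.1)) ∧
    (∀ f g, J (f * g) = J f * J g) ∧
    (∀ f, ‖J f‖ ≤ (𝓛.maxNorm M.bisections).toSeminorm f) ∧
    ∀ f, ∃ k : T.ell1, J f = (crossedSeminorm R).toCompl k ∧
      ∀ (r : SomeCovRep T) (ψ : BanachRep 𝕜 M.FS r.1.carrier), M.Integrates r.2 ψ →
        ‖r.2.integrate k‖ = ‖ψ (M.toFS f)‖ := by
  obtain ⟨J, hJ, hle⟩ := M.exists_integrated (crossedRep R).toGradedFamily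
  refine ⟨J, hJ, M.integrated_mul (crossedRep R) hJ, hle, fun f => ?_⟩
  -- `k` is a lift of `f` to `ℓ¹(α, u)` obtained from some decomposition into elements `a δ_t`. The
  -- lift is not unique, but its image under an integrated form is determined by `f`.
  have key : ∃ k : T.ell1, J f = (crossedSeminorm R).toCompl k ∧
      ∀ (r : SomeCovRep T) (ψ : BanachRep 𝕜 M.FS r.1.carrier), M.Integrates r.2 ψ →
        r.2.integrate k = toBidual 𝕜 (ψ (M.toFS f)) := by
    refine M.alg_induction (P := fun f => ∃ k : T.ell1, J f = (crossedSeminorm R).toCompl k ∧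
      ∀ (r : SomeCovRep T) (ψ : BanachRep 𝕜 M.FS r.1.carrier), M.Integrates r.2 ψ →
        r.2.integrate k = toBidual 𝕜 (ψ (M.toFS f))) ?_ ?_ ?_ f
    · refine ⟨0, by rw [map_zero, map_zero], fun r ψ _ => ?_⟩
      rw [toFS, map_zero, map_zero, map_zero]
      exact map_zero r.2.integrateHom
    · rintro f g ⟨k, h1, h2⟩ ⟨k', h1', h2'⟩
      refine ⟨k + k', by rw [map_add, map_add, h1, h1'], fun r ψ hψ => ?_⟩
      rw [r.2.integrate_add, h2 r ψ hψ, h2' r ψ hψ, toFS, toFS, toFS, map_add, map_add, map_add]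
    · intro t a
      refine ⟨T.gradedMul.single t a.1, hJ t a, fun r ψ hψ => ?_⟩
      rw [hψ t a, r.2.integrate_single]
  obtain ⟨k, h1, h2⟩ := key
  exact ⟨k, h1, fun r ψ hψ => by rw [h2 r ψ hψ, norm_toBidual]⟩

/-- A seminorm on the algebra of sections that is induced from a crossed product gives a
completion that is isometrically isomorphic to the crossed product. -/
theorem exists_isometry (R : Set (SomeCovRep T)) (N : AlgSeminorm 𝕜 𝓛.Alg)
    {J : 𝓛.Alg →ₗ[𝕜] CrossedProduct R} (hJ : ∀ t (a : T.Ic t),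
      J (M.delta t a) = (crossedSeminorm R).toCompl (T.gradedMul.single t a.1))
    (hmul : ∀ f g, J (f * g) = J f * J g) (hN : ∀ f, ‖J f‖ = N.toSeminorm f) :
    ∃ Θ : N.Compl →ₙₐ[𝕜] CrossedProduct R, (∀ f, ‖Θ f‖ = ‖f‖) ∧ Function.Surjective Θ ∧
      ∀ t (a : T.Ic t), Θ (N.toCompl (M.delta t a))
        = (crossedSeminorm R).toCompl (T.gradedMul.single t a.1) := by
  obtain ⟨Θ, hΘ⟩ := N.exists_rep J hmul fun f => (hN f).le
  have hn : ∀ x, ‖Θ x‖ = ‖x‖ := AlgSeminorm.norm_rep fun f => by rw [hΘ, hN]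
  refine ⟨Θ.toHom, hn, AlgSeminorm.surjective_rep hn ?_, fun t a => (hΘ _).trans (hJ t a)⟩
  refine (dense_crossedProduct R (LinearMap.range J) fun t a => ⟨_, hJ t a⟩).mono ?_
  rintro _ ⟨f, rfl⟩
  exact ⟨_, hΘ f⟩

/-- Both seminorms are suprema of the same set of numbers: every covariant representation in `B(E)`
integrates to a representation of `F^S(G, L)` on `E`, and every such representation arises from a
normalized pair. -/
theorem exists_isometry_class (hT : T.AbsorbsCompacts) (𝓔 : Set (BanachSp 𝕜)) :
    ∃ Θ : 𝓛.FClass M.bisections 𝓔 →ₙₐ[𝕜] CrossedProduct (algClass T 𝓔),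
      (∀ f, ‖Θ f‖ = ‖f‖) ∧ Function.Surjective Θ ∧
      ∀ t (a : T.Ic t), Θ ((Twist.repSeminorm (𝓛.onClass M.bisections 𝓔)).toCompl (M.delta t a))
        = (crossedSeminorm (algClass T 𝓔)).toCompl (T.gradedMul.single t a.1) := by
  obtain ⟨J, hJ, hmul, -, hk⟩ := M.exists_toCrossedProduct (algClass T 𝓔)
  refine M.exists_isometry _ _ hJ hmul fun f => ?_
  obtain ⟨k, hJk, hk⟩ := hk f
  rw [hJk, AlgSeminorm.norm_toCompl, crossedSeminorm_apply]
  refine congrArg sSup (Set.Subset.antisymm ?_ ?_)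
  · rintro _ ⟨r, ⟨E, hE, p, rfl⟩, rfl⟩
    obtain ⟨ψ, hψ, -⟩ := M.existsUnique_integrates p
    exact ⟨⟨E.operators, ψ⟩, ⟨E, hE, ψ, rfl⟩, (hk ⟨E.operators, p⟩ ψ hψ).symm⟩
  · rintro _ ⟨_, ⟨E, hE, ψ, rfl⟩, rfl⟩
    obtain ⟨p, ⟨-, hp⟩, -⟩ := M.existsUnique_normalized hT ψ
    exact ⟨⟨E.operators, p⟩, ⟨E, hE, p, rfl⟩, hk ⟨E.operators, p⟩ ψ hp⟩

/-- If some Banach algebra in the given universe contains `F^S(G, L)` isometrically, then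
`F^S(G, L)` is the crossed product for all covariant representations in this universe. -/
theorem exists_isometry_univ (hT : T.AbsorbsCompacts) (B : BanachAlg.{_, v} 𝕜)
    (ι : BanachRep 𝕜 M.FS B.carrier) (hι : ∀ x, ‖ι x‖ = ‖x‖) :
    ∃ Θ : M.FS →ₙₐ[𝕜] CrossedProduct (Set.univ : Set (SomeCovRep.{v} T)),
      (∀ f, ‖Θ f‖ = ‖f‖) ∧ Function.Surjective Θ ∧
      ∀ t (a : T.Ic t), Θ (M.toFS (M.delta t a))
        = (crossedSeminorm Set.univ).toCompl (T.gradedMul.single t a.1) := by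
  obtain ⟨J, hJ, hmul, hle, hk⟩ := M.exists_toCrossedProduct Set.univ
  refine M.exists_isometry _ _ hJ hmul fun f => le_antisymm (hle f) ?_
  obtain ⟨k, hJk, hk⟩ := hk f
  -- The isometric representation is itself an integrated form, so the norm of `f` is among the
  -- numbers whose supremum is the crossed product seminorm.
  obtain ⟨p, ⟨-, hp⟩, -⟩ := M.existsUnique_normalized hT ι
  have h1 := le_crossedSeminorm (Set.mem_univ (⟨B, p⟩ : SomeCovRep T)) k
  rw [hk ⟨B, p⟩ ι hp, hι, toFS, AlgSeminorm.norm_toCompl] at h1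
  rwa [hJk, AlgSeminorm.norm_toCompl]

end Models

/-- A Banach algebra as a Banach algebra in a larger universe. -/
def BanachAlg.lift.{b', b, a} {𝕜 : Type a} [RCLike 𝕜] (B : Type b) [NonUnitalNormedRing B]
    [NormedSpace 𝕜 B] [IsScalarTower 𝕜 B B] [SMulCommClass 𝕜 B B] [CompleteSpace B] :
    BanachAlg.{a, max b b'} 𝕜 where
  carrier := ULift.{b'} B
  tower := ⟨fun c x y => ULift.ext _ _ (smul_mul_assoc c x.down y.down)⟩
  comm := ⟨fun c x y => ULift.ext _ _ (mul_smul_comm c x.down y.down).symm⟩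

/-- The identity as a representation of a Banach algebra in its copy in a larger universe. -/
def BanachAlg.up.{b', b, a} {𝕜 : Type a} [RCLike 𝕜] (B : Type b) [NonUnitalNormedRing B]
    [NormedSpace 𝕜 B] [IsScalarTower 𝕜 B B] [SMulCommClass 𝕜 B B] [CompleteSpace B] :
    BanachRep 𝕜 B (BanachAlg.lift.{b'} (𝕜 := 𝕜) B).carrier where
  toHom :=
    { toFun := fun x => (ULift.up x : ULift.{b'} B)
      map_smul' := fun _ _ => rfl
      map_zero' := rfl
      map_add' := fun _ _ => rfl
      map_mul' := fun _ _ => rfl }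
  contractive x := (ULift.norm_up.{b, b'} x).le

theorem BanachAlg.norm_up.{b', b, a} {𝕜 : Type a} [RCLike 𝕜] {B : Type b} [NonUnitalNormedRing B]
    [NormedSpace 𝕜 B] [IsScalarTower 𝕜 B B] [SMulCommClass 𝕜 B B] [CompleteSpace B] (x : B) :
    ‖BanachAlg.up.{b'} (𝕜 := 𝕜) B x‖ = ‖x‖ := ULift.norm_up.{b, b'} x

end

end TwistedGroupoid

end

/-! ### The theorem and its corollary. -/

theorem mainTheorem1 {𝕜 : Type u₁} [RCLike 𝕜] {X : Type u₂} [TopologicalSpace X] [T2Space X]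
    [LocallyCompactSpace X] {S : Type u₃} [InverseSemigroup S] (T : TwistedAction 𝕜 X S)
    (hT : T.AbsorbsCompacts)
    {Y : Type u₄} [TopologicalSpace Y] [T2Space Y] [LocallyCompactSpace Y]
    {G : Type u₅} [TopologicalSpace G] {𝓖 : EtaleGroupoid Y G}
    {L : G → Type u₆} [∀ γ, NormedAddCommGroup (L γ)] [∀ γ, NormedSpace 𝕜 (L γ)]
    [TopologicalSpace (Bundle.TotalSpace 𝕜 L)] {𝓛 : Twist 𝕜 𝓖 L} (M : Models T 𝓛) :
    -- representations in a Banach algebra `B`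
    (∀ (B : Type w) [NonUnitalNormedRing B] [NormedSpace 𝕜 B] [IsScalarTower 𝕜 B B]
        [SMulCommClass 𝕜 B B] [CompleteSpace B],
      -- every covariant representation has an integrated form `π ⋊ v`
      (∀ p : CovRep T B, ∃! ψ : BanachRep 𝕜 M.FS B, M.Integrates p ψ) ∧
      -- every representation is `π ⋊ v` for a unique `B'`-normalized pair `(π, v)`
      (∀ ψ : BanachRep 𝕜 M.FS B, ∃! p : CovRep T B, p.IsNormalized ∧ M.Integrates p ψ) ∧
      ((∀ t, IsCompact (T.h t).target) →
        ∀ p : CovRep T B, p.IsNormalized ↔ p.IsUnitNormalized) ∧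
      -- the same with a predual `P`, if `(B, P)` is a dual Banach algebra
      (∀ (P : Type w') [NormedAddCommGroup P] [NormedSpace 𝕜 P] [CompleteSpace P]
          (e : StrongDual 𝕜 P ≃ₗᵢ[𝕜] B), IsDualBanachAlgebra e →
        (∀ ψ : BanachRep 𝕜 M.FS B, ∃! p : CovRep T B, p.IsPredualNormalized e ∧ M.Integrates p ψ) ∧
        ((∀ t, IsCompact (T.h t).target) →
          ∀ p : CovRep T B, p.IsPredualNormalized e ↔ p.IsUnitNormalized))) ∧
    -- representations on a Banach space `E`
    (∀ (E : Type w) [NormedAddCommGroup E] [NormedSpace 𝕜 E] [CompleteSpace E],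
      (∀ q : CovRepOn T E, ∃ p : CovRep T (E →L[𝕜] E), q.IsCov p) ∧
      (IsReflexive 𝕜 E → ∀ ψ : BanachRep 𝕜 M.FS (E →L[𝕜] E),
        ∃! q : CovRepOn T E, ∃ p, q.IsCov p ∧ M.Integrates p ψ) ∧
      ((∀ t, IsCompact (T.h t).target) → ∀ p : CovRep T (E →L[𝕜] E),
        (∃ q : CovRepOn T E, q.IsCov p) ↔ p.IsUnitNormalized)) ∧
    -- the isometric isomorphism with the universal crossed product
    (∃ Θ : M.FS →ₙₐ[𝕜]
        CrossedProduct (Set.univ : Set (SomeCovRep.{max u₁ u₂ u₃ u₄ u₅ u₆ w} T)),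
      (∀ f, ‖Θ f‖ = ‖f‖) ∧ Function.Surjective Θ ∧
      ∀ t (a : T.Ic t), Θ (M.toFS (M.delta t a))
        = (crossedSeminorm Set.univ).toCompl (T.gradedMul.single t a.1)) ∧
    -- the algebras defined by a class of Banach spaces
    (∀ 𝓔 : Set (BanachSp.{u₁, w} 𝕜),
      (∃ Θ : 𝓛.FClass M.bisections 𝓔 →ₙₐ[𝕜] CrossedProduct (algClass T 𝓔),
        (∀ f, ‖Θ f‖ = ‖f‖) ∧ Function.Surjective Θ ∧
        ∀ t (a : T.Ic t), Θ ((Twist.repSeminorm (𝓛.onClass M.bisections 𝓔)).toCompl (M.delta t a))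
          = (crossedSeminorm (algClass T 𝓔)).toCompl (T.gradedMul.single t a.1)) ∧
      (∃ Λ : BanachRep 𝕜 (CrossedProduct (algClass T 𝓔)) (CrossedProduct (spaClass T 𝓔)),
        DenseRange Λ ∧
        (∀ f : T.ell1, Λ ((crossedSeminorm (algClass T 𝓔)).toCompl f)
          = (crossedSeminorm (spaClass T 𝓔)).toCompl f) ∧
        (((∀ E ∈ 𝓔, IsReflexive 𝕜 E.carrier) ∨ ∀ t, IsCompact (T.h t).target) →
          ∀ f, ‖Λ f‖ = ‖f‖))) := by
  refine ⟨fun B _ _ _ _ _ => ⟨M.existsUnique_integrates, M.existsUnique_normalized hT,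
      fun hc p => CovRep.isNormalized_iff hc p, fun P _ _ _ e he =>
      ⟨M.existsUnique_predualNormalized hT he, fun hc p => CovRep.isPredualNormalized_iff hc p⟩⟩,
    fun E _ _ _ => ⟨fun q => ⟨q.toCovRep, q.isCov_toCovRep⟩,
      fun hE => M.existsUnique_covRepOn hT (hasWeakLimits_of_reflexive hE),
      fun hc => CovRepOn.exists_isCov_iff hT hc⟩,
    -- The isometric target is a copy of `M.FS`, lifted to the universe over which the covariant
    -- representations range.
    M.exists_isometry_univ hT (BanachAlg.lift.{max u₁ u₂ u₃ u₄ u₅ u₆ w} M.FS)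
      (BanachAlg.up.{max u₁ u₂ u₃ u₄ u₅ u₆ w} M.FS) BanachAlg.norm_up,
    fun 𝓔 => ⟨M.exists_isometry_class hT 𝓔, ?_⟩⟩
  obtain ⟨Λ, hd, hΛ, hi⟩ := exists_algClass_to_spaClass hT 𝓔
  refine ⟨Λ, hd, hΛ, fun h => hi fun E hE => ?_⟩
  exact h.elim (fun h => hasWeakLimits_of_reflexive (h E hE)) hasWeakLimits_of_compact
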